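/- **Conventions.** A *manifold (with corners)* of dimension $m$ is a Hausdorff, second countable space $M$ with an atlas of charts onto relatively open subsets of the spaces $[0,\infty)^{\ell}\times\mathbb{R}^{m-\ell}$ with smooth transition maps, each of whose boundary hypersurfaces is embedded. Here a boundary hypersurface is the closure of a connected component of the part of the boundary of codimension one (the points having exactly one vanishing boundary coordinate), and it is embedded if near each of its points it is the zero set of a smooth function which is otherwise positive and has nonzero differential at the point. A subset $X\subset M$ is an *interior p-submanifold* if near each of its points it is given, in suitable coordinates of the above type, by the vanishing of some of the coordinates (the remaining ones then being coordinates on $X$), and no component of $X$ is contained in the boundary of $M$. Let $G$ be a compact Lie group acting smoothly on a manifold with corners $M$. The action is *boundary intersection free* if the set of boundary hypersurfaces of $M$ can be partitioned into collections, the elements of each of which are pairwise disjoint, such that every $g\in G$ maps each collection to itself. It has a *unique isotropy type* if all the isotropy groups $G_\zeta=\{g\in G: g\zeta=\zeta\}$, $\zeta\in M$, are conjugate in $G$. A quotient of a manifold is said to be a *smooth manifold with corners* if, with the quotient topology, it has a (necessarily unique) structure of manifold with corners for which the projection is smooth and has a smooth local section through each point. **Proposition (Borel).** Let $M$ be a manifold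 with corners with a smooth, boundary intersection free action of a compact Lie group $G$ with a unique isotropy type. Then the orbit space $G\backslash M$ is a smooth manifold with corners. Let $K=G_\zeta$, $\zeta \in M$, be any isotropy group, $N(K)$ its normalizer in $G$ and $M^K=\{x\in M: kx=x \text{ for all } k\in K\}$. Then $M^K$ is an interior p-submanifold of $M$, and so, with the induced structure, a manifold with corners; moreover: 1. the quotient $G\times_{N(K)}M^K$ of $G\times M^K$ by the action $n\cdot(g,x)=(gn^{-1},nx)$ of $N(K)$ is a smooth manifold with corners, and $[g,x]\mapsto gx$ is a $G$-equivariant diffeomorphism $G\times_{N(K)}M^K\to M$, where $h\cdot[g,x]=[hg,x]$; 2. the orbits of $N(K)$ and of $N(K)/K$ on $M^K$ are the same, the quotient $(N(K)/K)\backslash M^K=N(K)\backslash M^K$ is a smooth manifold with corners, and the inclusion $M^K\hookrightarrow M$ induces a diffeomorphism $$(N(K)/K)\backslash M^K=N(K)\backslash M^K\;\cong\; G\backslash M.$$ -/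

import Mathlib

open scoped Manifold ContDiff Topology

noncomputable section

/-! ### Manifolds with corners -/

section Corners

/-- The points of boundary depth exactly one: in the preferred chart, with values in the quadrant
`[0,∞)^m`, exactly one coordinate of the point vanishes. -/
def smoothBoundaryPart (m : ℕ) (M : Type*) [TopologicalSpace M]
    [ChartedSpace (EuclideanQuadrant m) M] : Set M :=
  {x | ∃! i : Fin m, (chartAt (EuclideanQuadrant m) x x).1 i = 0}

/-- A boundary hypersurface is the closure of a connected component of the part of the boundary of
smooth codimension one. -/
def IsBoundaryHypersurface (m : ℕ) {M : Type*} [TopologicalSpace M]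
    [ChartedSpace (EuclideanQuadrant m) M] (S : Set M) : Prop :=
  ∃ x ∈ smoothBoundaryPart m M, S = closure (connectedComponentIn (smoothBoundaryPart m M) x)

/-- A closed set `S` is an embedded hypersurface if near each of its points it is the zero set
of a smooth function which is otherwise positive and has nonzero differential at the point. -/
def IsEmbeddedHypersurface (m : ℕ) {M : Type*} [TopologicalSpace M]
    [ChartedSpace (EuclideanQuadrant m) M] (S : Set M) : Prop :=
  ∀ p ∈ S, ∃ (U : Set M) (f : M → ℝ), IsOpen U ∧ p ∈ U ∧
    ContMDiffOn (modelWithCornersEuclideanQuadrant m) 𝓘(ℝ, ℝ) ∞ f U ∧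
    (∀ q ∈ U, 0 ≤ f q) ∧ (∀ q ∈ U, q ∈ S ↔ f q = 0) ∧
    mfderiv (modelWithCornersEuclideanQuadrant m) 𝓘(ℝ, ℝ) f p ≠ 0

/-- `M`, with its atlas of charts in `[0,∞)^m`, is a smooth `m`-dimensional manifold with corners:
Hausdorff, second countable, with smooth transition maps and embedded boundary hypersurfaces.
(An open subset of `[0,∞)^l × ℝ^(m-l)` is locally diffeomorphic to an open subset of `[0,∞)^m`, so
the quadrant is a model for all types of corners.) -/
structure IsManifoldWithCorners (m : ℕ) (M : Type*) [TopologicalSpace M]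
    [ChartedSpace (EuclideanQuadrant m) M] : Prop where
  t2Space : T2Space M
  secondCountable : SecondCountableTopology M
  isManifold : IsManifold (modelWithCornersEuclideanQuadrant m) ∞ M
  embedded : ∀ S : Set M, IsBoundaryHypersurface m S → IsEmbeddedHypersurface m S

/-- The manifold structure given on the subset `X` of `M` makes it an interior p-submanifold of `M`
with its induced smooth structure. Around each point `p` of `X` there is a chart `φ` of `M` in which
`X` is given by fixing some of the coordinates (equal to their values at `p`), and the other
coordinates, restricted to `X`, form a chart `ψ` of `X`; moreover no component of `X` is contained
in the boundary of `M`. -/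
structure IsInteriorPSubmanifold (m d : ℕ) {M : Type*} [TopologicalSpace M]
    [ChartedSpace (EuclideanQuadrant m) M] (X : Set M)
    [ChartedSpace (EuclideanQuadrant d) X] : Prop where
  adapted : ∀ p : X,
    ∃ φ ∈ IsManifold.maximalAtlas (modelWithCornersEuclideanQuadrant m) ∞ M,
    ∃ ψ ∈ IsManifold.maximalAtlas (modelWithCornersEuclideanQuadrant d) ∞ X,
    ∃ e : Fin d ↪ Fin m,
      (p : M) ∈ φ.source ∧
      (∀ q : X, q ∈ ψ.source ↔ (q : M) ∈ φ.source) ∧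
      (∀ q ∈ ψ.source, ∀ j, (ψ q).1 j = (φ q).1 (e j)) ∧
      (∀ q ∈ φ.source, q ∈ X ↔ ∀ i ∉ Set.range e, (φ q).1 i = (φ p).1 i)
  interior : ∀ p ∈ X, ¬ connectedComponentIn X p ⊆
    (modelWithCornersEuclideanQuadrant m).boundary M

end Corners

/-- `π : X → Y` exhibits `Y` as a smooth quotient of `X`: it is a topological quotient map, it is
smooth, and through every point of `X` there is a smooth local section of `π` (so `π` is a
surjective submersion, and the smooth structure of `Y` is the only one with this property). -/
structure IsSmoothQuotientMap {E H E' H' X Y : Type*}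
    [NormedAddCommGroup E] [NormedSpace ℝ E] [TopologicalSpace H] (I : ModelWithCorners ℝ E H)
    [NormedAddCommGroup E'] [NormedSpace ℝ E'] [TopologicalSpace H'] (J : ModelWithCorners ℝ E' H')
    [TopologicalSpace X] [ChartedSpace H X] [TopologicalSpace Y] [ChartedSpace H' Y]
    (π : X → Y) : Prop where
  isQuotientMap : Topology.IsQuotientMap π
  contMDiff : ContMDiff I J ∞ π
  exists_section : ∀ x : X, ∃ (U : Set Y) (s : Y → X), IsOpen U ∧ π x ∈ U ∧
    ContMDiffOn J I ∞ s U ∧ s (π x) = x ∧ ∀ y ∈ U, π (s y) = y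

/-! ### Group actions -/

section Actions

/-- The action is boundary intersection free: the boundary hypersurfaces can be partitioned
into collections, the elements of each of which are disjoint, so that every group element maps each
collection to itself. -/
def IsBoundaryIntersectionFree (m : ℕ) (G M : Type*) [Group G] [TopologicalSpace M]
    [ChartedSpace (EuclideanQuadrant m) M] [MulAction G M] : Prop :=
  ∃ P : Set (Set (Set M)),
    ⋃₀ P = {S : Set M | IsBoundaryHypersurface m S} ∧
    P.PairwiseDisjoint id ∧
    (∀ B ∈ P, B.Pairwise Disjoint) ∧
    ∀ g : G, ∀ B ∈ P, ∀ S ∈ B, (fun x : M => g • x) '' S ∈ B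

/-- Any two isotropy groups of the action are conjugate. -/
def HasUniqueIsotropyType (G M : Type*) [Group G] [MulAction G M] : Prop :=
  ∀ x y : M, ∃ g : G,
    MulAction.stabilizer G y = (MulAction.stabilizer G x).map (MulAut.conj g).toMonoidHom

variable {G M : Type*} [Group G] [MulAction G M]

/-- The normalizer of `K` acts on the fixed points of `K`. -/
instance normalizerAction (K : Subgroup G) :
    MulAction (Subgroup.normalizer (K : Set G)) (MulAction.fixedPoints K M) where
  smul n x := ⟨(n : G) • (x : M), fun k => by
    have h : (n : G)⁻¹ * k * n ∈ K := by
      have := (Subgroup.mem_normalizer_iff.1 (inv_mem n.2) k).1 k.2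
      simpa using this
    have hx : ((n : G)⁻¹ * k * n) • (x : M) = x := x.2 ⟨_, h⟩
    change (k : G) • (n : G) • (x : M) = (n : G) • (x : M)
    conv_rhs => rw [← hx]
    simp [← mul_smul, mul_assoc]⟩
  one_smul x := Subtype.ext (one_smul G (x : M))
  mul_smul a b x := Subtype.ext (mul_smul (a : G) (b : G) (x : M))

theorem coe_normalizer_smul (K : Subgroup G) (n : Subgroup.normalizer (K : Set G))
    (x : MulAction.fixedPoints K M) : ((n • x : MulAction.fixedPoints K M) : M) = (n : G) • (x : M) :=
  rfl

/-- The group `N(K)/K`. -/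
abbrev WeylGroup (K : Subgroup G) : Type _ :=
  Subgroup.normalizer (K : Set G) ⧸ K.subgroupOf (Subgroup.normalizer (K : Set G))

/-- The action of `N(K)/K` on the fixed points of `K` induced by that of `N(K)`. -/
instance weylAction (K : Subgroup G) :
    MulAction (WeylGroup K) (MulAction.fixedPoints K M) :=
  MulAction.compHom (MulAction.fixedPoints K M)
    (QuotientGroup.lift (K.subgroupOf (Subgroup.normalizer (K : Set G)))
      (MulAction.toPermHom (Subgroup.normalizer (K : Set G)) (MulAction.fixedPoints K M))
      (fun n hn => Equiv.ext fun x => Subtype.ext (x.2 ⟨(n : G), Subgroup.mem_subgroupOf.1 hn⟩)))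

theorem weylGroup_mk_smul (K : Subgroup G) (n : Subgroup.normalizer (K : Set G))
    (x : MulAction.fixedPoints K M) : ((n : WeylGroup K) • x) = n • x :=
  rfl

/-- Two points of `G × X` are equivalent if they are in the same orbit of the
action `n · (g, x) = (g n⁻¹, n x)` of `N`. -/
def twistedSetoid (N : Subgroup G) (X : Type*) [MulAction N X] : Setoid (G × X) where
  r a b := ∃ n : N, b = (a.1 * (n : G)⁻¹, n • a.2)
  iseqv :=
    { refl := fun a => ⟨1, by simp⟩
      symm := by
        rintro a b ⟨n, rfl⟩
        exact ⟨n⁻¹, by simp⟩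
      trans := by
        rintro a b c ⟨n, rfl⟩ ⟨k, rfl⟩
        exact ⟨k * n, by simp [mul_assoc, mul_smul]⟩ }

/-- The twisted product `G ×_N X`, with the quotient topology of `G × X`. -/
abbrev TwistedProduct (N : Subgroup G) (X : Type*) [MulAction N X] : Type _ :=
  Quotient (twistedSetoid N X)

/-- The class of `(g, x)` in `G ×_N X`. -/
def TwistedProduct.mk (N : Subgroup G) (X : Type*) [MulAction N X] (a : G × X) :
    TwistedProduct N X :=
  Quotient.mk (twistedSetoid N X) a

/-- The left action of `G` on `G ×_N X`, `h · [g, x] = [h g, x]`. -/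
instance twistedProductAction (N : Subgroup G) (X : Type*) [MulAction N X] :
    MulAction G (TwistedProduct N X) where
  smul h := Quotient.map (fun a => (h * a.1, a.2)) (by
    rintro a b ⟨n, rfl⟩
    exact ⟨n, by simp [mul_assoc]⟩)
  one_smul := by
    rintro ⟨a⟩
    exact congrArg (Quotient.mk _) (by simp)
  mul_smul := by
    rintro h k ⟨a⟩
    exact congrArg (Quotient.mk _) (by simp [mul_assoc])

/-- The projection of a `G`-space onto its orbit space `G\M`. -/
def orbitMk (G : Type*) {M : Type*} [Group G] [MulAction G M] (x : M) :
    MulAction.orbitRel.Quotient G M :=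
  Quotient.mk (MulAction.orbitRel G M) x

end Actions

end

/-! The whole statement rests on a slice at each point ζ, with stabilizer K. Boundary intersection
freeness forces K to preserve every boundary hypersurface through ζ. Hence the isotropy
representation of K is trivial on the coordinates vanishing at ζ: on each of them it is a continuous
nonnegative character of a compact group (`isotropyRep_apply_of_zero`). Averaging a chart over K
therefore respects the quadrant and its boundary, and yields a chart in which K acts by affine maps
(`exists_isLinearChart`).

The orbit of ζ is tangent to all faces through ζ and its tangent space is K-invariant. Pushing a
K-invariant complement along the orbit is a local change of coordinates, by an inverse function
theorem on closed convex sets (`exists_inverse_on_convex`, `exists_sliceMap_openPartialHomeomorph`).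
Near ζ only elements of K move a slice point to a slice point, so stabilizers of slice points lie in
K. A closed subgroup of a compact group contains no proper conjugate of itself, so the unique
isotropy type makes them equal to K. Thus K fixes the slice pointwise and nearby orbits meet it
exactly once: slice coordinates are charts of the orbit space (`exists_isSlice`,
`IsSlice.exists_isOrbitChart`).

In a linear chart the fixed point set of K is an affine subspace, straightened to a coordinate
subspace (`exists_isFixedChart`). Its dimension is the same at all points, because it can be
computed from the kernel of the derivative of the orbit map, which depends on the stabilizer only
(`finrank_isotropyFixed_add`, `ker_orbitDeriv_le`).

Embeddedness of hypersurfaces is handled through the equivalent condition `NoSelfIntersectionAt`: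
locally, different coordinate hyperplanes belong to different boundary components. It passes to
fixed point sets at once and to the orbit space by boundary intersection freeness.

For the global statements, every point of the fixed set has stabilizer exactly K, so an element
moving one such point to another normalizes K. Hence the fibres of (g, x) ↦ gx and of the map from
the fixed set to the orbit space are the orbits of N(K). Both maps have smooth local sections, read
off from slices, and a topological quotient with the same fibres as a smooth quotient inherits its
structure (`exists_chartedSpace_of_isSmoothQuotientMap`). No smooth structure on N(K) is needed. -/

section

open Set Filter

local notation "𝓒" => modelWithCornersEuclideanQuadrant
local notation:max "𝔼" k:max => EuclideanSpace ℝ (Fin k)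

/-! ### Inverse function theorem on closed convex sets. -/

section ConvexInverse

variable {E : Type*} [NormedAddCommGroup E] [NormedSpace ℝ E] [FiniteDimensional ℝ E]

/-- A continuous local right inverse of a smooth map with invertible derivatives is smooth, on
sets with unique derivatives. -/
theorem contDiffOn_of_rightInverse {S T : Set E} (hS : UniqueDiffOn ℝ S) (hT : UniqueDiffOn ℝ T)
    {Θ Ψ : E → E} (hΘ : ContDiffOn ℝ ∞ Θ S) (hm : MapsTo Ψ T S) (hc : ContinuousOn Ψ T)
    (hr : ∀ y ∈ T, Θ (Ψ y) = y)
    (hinv : ∀ x ∈ S, fderivWithin ℝ Θ S x ∈ range ((↑) : (E ≃L[ℝ] E) → E →L[ℝ] E)) :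
    ContDiffOn ℝ ∞ Ψ T := by
  have hd : ∀ y ∈ T, HasFDerivWithinAt Ψ
      (ContinuousLinearMap.inverse (fderivWithin ℝ Θ S (Ψ y))) T y := by
    intro y hy
    obtain ⟨B, hB⟩ := hinv _ (hm hy)
    rw [← hB, ContinuousLinearMap.inverse_equiv]
    have h1 : HasFDerivWithinAt Θ (B : E →L[ℝ] E) S (Ψ y) := by
      rw [hB]
      exact ((hΘ.differentiableOn (by simp)) _ (hm hy)).hasFDerivWithinAt
    refine HasFDerivWithinAt.of_local_left_inverse ?_ h1 hy ?_
    · exact tendsto_nhdsWithin_iff.2 ⟨hc y hy, eventually_mem_nhdsWithin.mono fun z hz => hm hz⟩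
    · exact eventually_mem_nhdsWithin.mono fun z hz => hr z hz
  -- Bootstrapping: the derivative of `Ψ` is the derivative of `Θ` composed with `Ψ` and then with
  -- inversion of operators, so it is as smooth as `Ψ`, and `Ψ` gains one order.
  rw [contDiffOn_infty]
  intro n
  induction n with
  | zero => exact contDiffOn_zero.2 hc
  | succ n ih =>
    push_cast
    rw [contDiffOn_succ_iff_hasFDerivWithinAt_of_uniqueDiffOn hT]
    refine ⟨by simp, _, ?_, hd⟩
    have h1 : ContDiffOn ℝ n (fderivWithin ℝ Θ S) S :=
      hΘ.fderivWithin hS (by exact_mod_cast le_top)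
    intro y hy
    obtain ⟨B, hB⟩ := hinv _ (hm hy)
    refine ContDiffAt.comp_contDiffWithinAt (g := ContinuousLinearMap.inverse) y ?_
      ((h1.comp ih hm) y hy)
    rw [← hB]
    exact contDiffAt_map_inverse B

/-- Close to `p` the map is a small Lipschitz perturbation of `A` on a convex set, so it extends to
a homeomorphism of the whole space. What remains is that the inverse returns points of `Q` to `Q`.
This is where mapping the frontier to the frontier enters, through a connectedness argument. -/
theorem exists_inverse_on_convex {Q : Set E} (hQ : Convex ℝ Q) (hQc : IsClosed Q)
    (hQi : (interior Q).Nonempty) {O : Set E} (hO : IsOpen O) {p : E} (hpQ : p ∈ Q) (hpO : p ∈ O)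
    {Θ : E → E} (hΘ : ContDiffOn ℝ ∞ Θ (Q ∩ O)) (hm : MapsTo Θ (Q ∩ O) Q)
    (hb : MapsTo Θ (frontier Q ∩ O) (frontier Q)) {A : E ≃L[ℝ] E}
    (hA : HasFDerivWithinAt Θ (A : E →L[ℝ] E) Q p) :
    ∃ (Ω Ω' : Set E) (Ψ : E → E), IsOpen Ω ∧ IsOpen Ω' ∧ p ∈ Ω ∧ Ω ⊆ O ∧
      MapsTo Θ (Q ∩ Ω) (Q ∩ Ω') ∧ MapsTo Ψ (Q ∩ Ω') (Q ∩ Ω) ∧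
      (∀ x ∈ Q ∩ Ω, Ψ (Θ x) = x) ∧ (∀ y ∈ Q ∩ Ω', Θ (Ψ y) = y) ∧
      ContDiffOn ℝ ∞ Ψ (Q ∩ Ω') := by
  have hu : UniqueDiffOn ℝ (Q ∩ O) := (uniqueDiffOn_convex hQ hQi).inter hO
  have hpS : p ∈ Q ∩ O := ⟨hpQ, hpO⟩
  have hAS : fderivWithin ℝ Θ (Q ∩ O) p = A :=
    (hA.mono inter_subset_left).fderivWithin (hu p hpS)
  have hcont : ContinuousOn (fderivWithin ℝ Θ (Q ∩ O)) (Q ∩ O) :=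
    hΘ.continuousOn_fderivWithin hu (by simp)
  -- a constant small enough for the extension theorem
  obtain ⟨c, hc0, hc⟩ : ∃ c : NNReal, 0 < c ∧
      (Subsingleton E ∨ lipschitzExtensionConstant E * c < ‖(A.symm : E →L[ℝ] E)‖₊⁻¹) := by
    rcases subsingleton_or_nontrivial E with h | h
    · exact ⟨1, one_pos, Or.inl h⟩
    · have hN : 0 < ‖(A.symm : E →L[ℝ] E)‖₊⁻¹ := by
        have := A.symm.norm_pos
        exact inv_pos.2 this
      have hl := lipschitzExtensionConstant_pos E
      obtain ⟨c, hc0, hc⟩ := exists_between (div_pos hN hl)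
      refine ⟨c, hc0, Or.inr ?_⟩
      rw [mul_comm]
      exact (lt_div_iff₀ hl).1 hc
  have hev : ∀ᶠ x in 𝓝[Q ∩ O] p, fderivWithin ℝ Θ (Q ∩ O) x ∈
      Metric.closedBall (A : E →L[ℝ] E) c ∩ range ((↑) : (E ≃L[ℝ] E) → E →L[ℝ] E) := by
    have := hcont p hpS
    rw [ContinuousWithinAt, hAS] at this
    exact this (inter_mem (Metric.closedBall_mem_nhds _ (by exact_mod_cast hc0)) A.nhds)
  obtain ⟨ε, hε, hεO, hεd⟩ : ∃ ε > 0, Metric.ball p ε ⊆ O ∧ ∀ x ∈ Q ∩ Metric.ball p ε,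
      fderivWithin ℝ Θ (Q ∩ O) x ∈
      Metric.closedBall (A : E →L[ℝ] E) c ∩ range ((↑) : (E ≃L[ℝ] E) → E →L[ℝ] E) := by
    obtain ⟨ε₁, h1, h1'⟩ := Metric.mem_nhdsWithin_iff.1 hev
    obtain ⟨ε₂, h2, h2'⟩ := Metric.isOpen_iff.1 hO p hpO
    refine ⟨min ε₁ ε₂, lt_min h1 h2, (Metric.ball_subset_ball (min_le_right _ _)).trans h2', ?_⟩
    rintro x ⟨hxQ, hx⟩
    exact h1' ⟨Metric.ball_subset_ball (min_le_left _ _) hx, hxQ,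
      h2' (Metric.ball_subset_ball (min_le_right _ _) hx)⟩
  set B := Metric.ball p ε with hBdef
  have hsub : Q ∩ B ⊆ Q ∩ O := inter_subset_inter_right _ hεO
  have hder : ∀ x ∈ Q ∩ B, HasFDerivWithinAt Θ (fderivWithin ℝ Θ (Q ∩ O) x) (Q ∩ B) x :=
    fun x hx => ((hΘ.differentiableOn (by simp)) x (hsub hx)).hasFDerivWithinAt.mono hsub
  -- The mean value inequality needs a convex domain, hence the intersection of `Q` with a ball.
  have happ : ApproximatesLinearOn Θ (A : E →L[ℝ] E) (Q ∩ B) c := by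
    intro x hx y hy
    refine (hQ.inter (convex_ball p ε)).norm_image_sub_le_of_norm_hasFDerivWithin_le'
      hder (fun z hz => ?_) hy hx
    simpa [dist_eq_norm] using (hεd z hz).1
  obtain ⟨g, hg'⟩ := happ.exists_homeomorph_extension hc
  have hg : ∀ {x}, x ∈ Q ∩ B → g x = Θ x := fun hx => (hg' hx).symm
  have hpB : p ∈ B := Metric.mem_ball_self hε
  have hgB : IsOpen (g '' B) := g.isOpenMap _ Metric.isOpen_ball
  -- The target neighbourhood is a ball so that its intersection with the interior of `Q` is convex,
  -- hence connected.
  obtain ⟨δ, hδ, hδB⟩ := Metric.isOpen_iff.1 hgB (g p) (mem_image_of_mem g hpB)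
  set Ω' := Metric.ball (g p) δ with hΩ'
  have hsymm : ∀ y ∈ Ω', g.symm y ∈ B := by
    intro y hy
    obtain ⟨x, hx, rfl⟩ := hδB hy
    simpa using hx
  -- the interior is mapped to the interior
  have hint : ∀ x ∈ interior Q ∩ B, g x ∈ interior Q := by
    have h1 : g '' (interior Q ∩ B) ⊆ interior Q := by
      refine interior_maximal ?_ (g.isOpenMap _ (isOpen_interior.inter Metric.isOpen_ball))
      rintro _ ⟨x, ⟨hx, hxB⟩, rfl⟩
      rw [hg ⟨interior_subset hx, hxB⟩]
      exact hm (hsub ⟨interior_subset hx, hxB⟩)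
    exact fun x hx => h1 (mem_image_of_mem g hx)
  have hfr : ∀ x ∈ frontier Q ∩ B, g x ∈ frontier Q := by
    rintro x ⟨hx, hxB⟩
    rw [hg ⟨hQc.frontier_subset hx, hxB⟩]
    exact hb ⟨hx, hεO hxB⟩
  -- preimages of interior points near `g p` are interior
  have hkey : interior Q ∩ Ω' ⊆ g.symm ⁻¹' (interior Q) := by
    have hpre : IsPreconnected (interior Q ∩ Ω') :=
      (hQ.interior.inter (convex_ball _ _)).isPreconnected
    -- A preimage on the frontier would have its image on the frontier, so the preimage of an
    -- interior point is either interior or outside `Q`. These are two disjoint open conditions on a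
    -- connected set, and the first one does occur.
    have hcov : interior Q ∩ Ω' ⊆ g.symm ⁻¹' (interior Q) ∪ g.symm ⁻¹' (Qᶜ) := by
      rintro y ⟨hy, hyΩ⟩
      by_contra hcon
      rw [mem_union, not_or] at hcon
      have h1 : g.symm y ∈ Q := by simpa using hcon.2
      have h2 : g.symm y ∈ frontier Q := by
        rw [hQc.frontier_eq]; exact ⟨h1, hcon.1⟩
      have h3 := hfr _ ⟨h2, hsymm y hyΩ⟩
      rw [g.apply_symm_apply, hQc.frontier_eq] at h3
      exact h3.2 hy
    have hdisj : Disjoint (g.symm ⁻¹' (interior Q)) (g.symm ⁻¹' (Qᶜ)) := by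
      rw [Set.disjoint_left]
      intro y hy hy'
      exact hy' (interior_subset hy)
    refine IsPreconnected.subset_left_of_subset_union
      (isOpen_interior.preimage g.symm.continuous)
      (hQc.isOpen_compl.preimage g.symm.continuous) hdisj hcov ?_ hpre
    have hcl : p ∈ closure (interior Q) := by
      rw [hQ.closure_interior_eq_closure_of_nonempty_interior hQi]
      exact subset_closure hpQ
    have hN : B ∩ g ⁻¹' Ω' ∈ 𝓝 p :=
      inter_mem (Metric.ball_mem_nhds _ hε)
        (g.continuous.continuousAt.preimage_mem_nhds (Metric.ball_mem_nhds _ hδ))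
    obtain ⟨x, ⟨hxB, hxΩ⟩, hxi⟩ := mem_closure_iff_nhds.1 hcl _ hN
    exact ⟨g x, ⟨hint x ⟨hxi, hxB⟩, hxΩ⟩, by simpa using hxi⟩
  -- Points of `Q` are limits of interior points and `Q` is closed.
  have hkeyQ : ∀ y ∈ Q ∩ Ω', g.symm y ∈ Q := by
    rintro y ⟨hyQ, hyΩ⟩
    have hcl : y ∈ closure (interior Q ∩ Ω') := by
      have : y ∈ closure (interior Q) := by
        rw [hQ.closure_interior_eq_closure_of_nonempty_interior hQi]
        exact subset_closure hyQ
      rw [inter_comm]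
      exact Metric.isOpen_ball.inter_closure ⟨hyΩ, this⟩
    have h1 : closure (interior Q ∩ Ω') ⊆ g.symm ⁻¹' Q :=
      closure_minimal (hkey.trans (preimage_mono interior_subset))
        (hQc.preimage g.symm.continuous)
    exact h1 hcl
  refine ⟨B ∩ g ⁻¹' Ω', Ω', g.symm, Metric.isOpen_ball.inter (Metric.isOpen_ball.preimage
    g.continuous), Metric.isOpen_ball, ⟨hpB, Metric.mem_ball_self hδ⟩,
    inter_subset_left.trans hεO, ?_, ?_, ?_, ?_, ?_⟩
  · rintro x ⟨hxQ, hxB, hxΩ⟩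
    have := hg ⟨hxQ, hxB⟩
    exact ⟨hm ⟨hxQ, hεO hxB⟩, by rw [← this]; exact hxΩ⟩
  · rintro y hy
    exact ⟨hkeyQ y hy, hsymm y hy.2, by simpa using hy.2⟩
  · rintro x ⟨hxQ, hxB, hxΩ⟩
    rw [← hg ⟨hxQ, hxB⟩]; simp
  · intro y hy
    rw [← hg ⟨hkeyQ y hy, hsymm y hy.2⟩]; simp
  · have huB : UniqueDiffOn ℝ (Q ∩ B) := (uniqueDiffOn_convex hQ hQi).inter Metric.isOpen_ball
    refine contDiffOn_of_rightInverse (S := Q ∩ B) (Θ := Θ) huB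
      ((uniqueDiffOn_convex hQ hQi).inter Metric.isOpen_ball) (hΘ.mono hsub)
      (fun y hy => ⟨hkeyQ y hy, hsymm y hy.2⟩) g.symm.continuous.continuousOn ?_ ?_
    · intro y hy
      rw [← hg ⟨hkeyQ y hy, hsymm y hy.2⟩]; simp
    · intro x hx
      rw [(hder x hx).fderivWithin (huB x hx)]
      exact (hεd x hx).2

end ConvexInverse

/-! ### Smooth dependence of integrals over a compact space of parameters. -/

section ParametricIntegral

set_option linter.unusedSectionVars false

open MeasureTheory

variable {E F : Type*} [NormedAddCommGroup E] [NormedSpace ℝ E]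
  [NormedAddCommGroup F] [NormedSpace ℝ F]

theorem integrable_of_continuous_compactSpace {X : Type*} [TopologicalSpace X] [CompactSpace X]
    [MeasurableSpace X] [BorelSpace X] (μ : Measure X) [IsProbabilityMeasure μ]
    [SecondCountableTopology F] {f : X → F} (hf : Continuous f) : Integrable f μ :=
  hf.integrable_of_hasCompactSupport (HasCompactSupport.of_compactSpace f)

theorem continuous_section_of_continuousOn {X : Type*} [TopologicalSpace X] {s : Set E}
    {h : X → E → F} (hh : ContinuousOn (Function.uncurry h) (univ ×ˢ s)) {y : E} (hy : y ∈ s) :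
    Continuous fun k => h k y :=
  hh.comp_continuous (f := fun k => (k, y)) (by fun_prop) (fun k => ⟨mem_univ _, hy⟩)

/-- Compactness of `X` makes the first order approximation uniform in the parameter, so it can be
integrated. -/
theorem hasFDerivWithinAt_integral_of_continuousOn {X : Type*} [TopologicalSpace X] [CompactSpace X]
    [MeasurableSpace X] [BorelSpace X] (μ : Measure X) [IsProbabilityMeasure μ]
    [FiniteDimensional ℝ E] [FiniteDimensional ℝ F] {s : Set E} (hs : Convex ℝ s)
    {h : X → E → F} {h' : X → E → E →L[ℝ] F}
    (hd : ∀ k, ∀ y ∈ s, HasFDerivWithinAt (h k) (h' k y) s y)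
    (hh : ContinuousOn (Function.uncurry h) (univ ×ˢ s))
    (hh' : ContinuousOn (Function.uncurry h') (univ ×ˢ s)) {y : E} (hy : y ∈ s) :
    HasFDerivWithinAt (fun z => ∫ k, h k z ∂μ) (∫ k, h' k y ∂μ) s y := by
  have : SecondCountableTopology F := by
    have := FiniteDimensional.proper ℝ F
    infer_instance
  have : SecondCountableTopology (E →L[ℝ] F) := by
    have := FiniteDimensional.proper ℝ (E →L[ℝ] F)
    infer_instance
  refine HasFDerivWithinAt.of_isLittleO ?_
  rw [Asymptotics.isLittleO_iff]
  intro ε hε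
  -- Tube argument: continuity of `h'` at each `(k, y)` and compactness give one neighbourhood of
  -- `y` that serves all `k`.
  have h1 : ∀ᶠ z in 𝓝 y, ∀ k ∈ (univ : Set X), z ∈ s → ‖h' k z - h' k y‖ < ε := by
    refine IsCompact.eventually_forall_of_forall_eventually
      (P := fun z k => z ∈ s → ‖h' k z - h' k y‖ < ε) isCompact_univ ?_
    intro k _
    have hc : ContinuousOn (fun q : E × X => h' q.2 q.1 - h' q.2 y) (s ×ˢ univ) := by
      refine ContinuousOn.sub (hh'.comp (f := fun q : E × X => (q.2, q.1)) (by fun_prop) ?_)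
        (hh'.comp (f := fun q : E × X => (q.2, y)) (by fun_prop) ?_)
      · rintro q ⟨hq, -⟩; exact ⟨mem_univ _, hq⟩
      · rintro q ⟨hq, -⟩; exact ⟨mem_univ _, hy⟩
    have h2 := hc (y, k) ⟨hy, mem_univ _⟩
    have h3 : ∀ᶠ q in 𝓝[s ×ˢ univ] (y, k), ‖h' q.2 q.1 - h' q.2 y‖ < ε := by
      have h4 := h2.norm
      rw [ContinuousWithinAt] at h4
      refine h4.eventually_lt_const ?_
      simpa using hε
    rw [eventually_nhdsWithin_iff] at h3
    exact h3.mono fun q hq hqs => hq ⟨hqs, mem_univ _⟩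
  obtain ⟨δ, hδ, hδb⟩ := Metric.eventually_nhds_iff_ball.1 h1
  have h5 : s ∩ Metric.ball y δ ∈ 𝓝[s] y :=
    inter_mem self_mem_nhdsWithin (mem_nhdsWithin_of_mem_nhds (Metric.ball_mem_nhds _ hδ))
  filter_upwards [h5] with z hz
  have hyb : y ∈ s ∩ Metric.ball y δ := ⟨hy, Metric.mem_ball_self hδ⟩
  have h6 : ∀ k, ‖h k z - h k y - h' k y (z - y)‖ ≤ ε * ‖z - y‖ := by
    intro k
    refine (hs.inter (convex_ball y δ)).norm_image_sub_le_of_norm_hasFDerivWithin_le'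
      (f' := fun w => h' k w) (fun w hw => (hd k w hw.1).mono inter_subset_left)
      (fun w hw => (hδb w hw.2 k (mem_univ _) hw.1).le) hyb hz
  have i1 := integrable_of_continuous_compactSpace μ (continuous_section_of_continuousOn hh hz.1)
  have i2 := integrable_of_continuous_compactSpace μ (continuous_section_of_continuousOn hh hy)
  have i3 := integrable_of_continuous_compactSpace μ (continuous_section_of_continuousOn hh' hy)
  have e1 : (∫ k, h k z ∂μ) - (∫ k, h k y ∂μ) - (∫ k, h' k y ∂μ) (z - y) =
      ∫ k, (h k z - h k y - h' k y (z - y)) ∂μ := by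
    rw [ContinuousLinearMap.integral_apply i3, ← integral_sub i1 i2]
    exact (integral_sub (i1.sub i2) (i3.apply_continuousLinearMap _)).symm
  rw [e1]
  refine (norm_integral_le_of_norm_le_const (Eventually.of_forall h6)).trans ?_
  simp

variable {EG HG G : Type*} [NormedAddCommGroup EG] [NormedSpace ℝ EG] [TopologicalSpace HG]
  {J : ModelWithCorners ℝ EG HG} [TopologicalSpace G] [ChartedSpace HG G] [IsManifold J ∞ G]

/-- The derivative in the vector variable is that of a family parametrized by the pair `(g, y)` and
evaluated at `y`. The result has the same form as the hypothesis, so it can be iterated. -/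
theorem contMDiffOn_fderivWithin_of_prod {Ω : Set G} {s : Set E} (hs : UniqueDiffOn ℝ s)
    {h : G → E → F}
    (hh : ContMDiffOn (J.prod 𝓘(ℝ, E)) 𝓘(ℝ, F) ∞ (Function.uncurry h) (Ω ×ˢ s)) :
    ContMDiffOn (J.prod 𝓘(ℝ, E)) 𝓘(ℝ, E →L[ℝ] F) ∞
      (Function.uncurry fun g y => fderivWithin ℝ (h g) s y) (Ω ×ˢ s) := by
  intro q hq
  have h1 := ContMDiffWithinAt.mfderivWithin (J := J.prod 𝓘(ℝ, E)) (I := 𝓘(ℝ, E))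
    (I' := 𝓘(ℝ, F)) (m := ∞) (n := ∞) (t := Ω ×ˢ s) (u := s) (x₀ := q)
    (f := fun q : G × E => h q.1) (g := fun q : G × E => q.2) ?_ ?_ hq (fun q hq => hq.2)
    (by simp) hs.uniqueMDiffOn
  · simp only [inTangentCoordinates_model_space, mfderivWithin_eq_fderivWithin] at h1
    exact h1
  · refine (hh q hq).comp (f := fun z : (G × E) × E => (z.1.1, z.2)) (s := (Ω ×ˢ s) ×ˢ s) (q, q.2) ?_ ?_
    · exact contMDiffWithinAt_fst.fst.prodMk contMDiffWithinAt_snd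
    · rintro z ⟨hz1, hz2⟩
      exact ⟨hz1.1, hz2⟩
  · exact contMDiffWithinAt_snd

/-- The derivative of the integral is an integral of the same kind with values in `E →L[ℝ] F`, so
the induction quantifies over `F`. The parameter space enters through a continuous map `ι` into a
manifold: it will be a stabilizer, on which no smooth structure is used. -/
theorem contDiffOn_integral_of_contMDiffOn {X : Type*} [TopologicalSpace X] [CompactSpace X]
    [MeasurableSpace X] [BorelSpace X] (μ : Measure X) [IsProbabilityMeasure μ]
    {E : Type} [NormedAddCommGroup E] [NormedSpace ℝ E] [FiniteDimensional ℝ E]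
    {Ω : Set G} {s : Set E} (hs : UniqueDiffOn ℝ s) (hc : Convex ℝ s)
    {ι : X → G} (hι : Continuous ι) (hιΩ : ∀ k, ι k ∈ Ω) (n : ℕ) :
    ∀ {F : Type} [NormedAddCommGroup F] [NormedSpace ℝ F] [FiniteDimensional ℝ F] {h : G → E → F},
      ContMDiffOn (J.prod 𝓘(ℝ, E)) 𝓘(ℝ, F) ∞ (Function.uncurry h) (Ω ×ˢ s) →
      ContDiffOn ℝ n (fun y => ∫ k, h (ι k) y ∂μ) s := by
  induction n with
  | zero =>
    intro F _ _ _ h hh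
    have hd := contMDiffOn_fderivWithin_of_prod hs hh
    have hcont : ∀ {F : Type} [NormedAddCommGroup F] [NormedSpace ℝ F] {h : G → E → F},
        ContMDiffOn (J.prod 𝓘(ℝ, E)) 𝓘(ℝ, F) ∞ (Function.uncurry h) (Ω ×ˢ s) →
        ContinuousOn (Function.uncurry fun k => h (ι k)) (univ ×ˢ s) := by
      intro F _ _ h hh
      refine hh.continuousOn.comp (f := fun q : X × E => (ι q.1, q.2)) (by fun_prop) ?_
      rintro q ⟨-, hq⟩
      exact ⟨hιΩ _, hq⟩
    refine contDiffOn_zero.2 fun y hy => ?_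
    refine (hasFDerivWithinAt_integral_of_continuousOn μ hc (h := fun k => h (ι k))
      (h' := fun k y => fderivWithin ℝ (h (ι k)) s y) ?_ (hcont hh) (hcont hd)
      hy).continuousWithinAt
    intro k y hy
    have h1 : ContMDiffWithinAt 𝓘(ℝ, E) 𝓘(ℝ, F) ∞ (h (ι k)) s y :=
      (hh (ι k, y) ⟨hιΩ k, hy⟩).comp (f := fun y => (ι k, y)) y
        (contMDiffWithinAt_const.prodMk contMDiffWithinAt_id) (fun y hy => ⟨hιΩ k, hy⟩)
    exact (h1.contDiffWithinAt.differentiableWithinAt (by simp)).hasFDerivWithinAt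
  | succ n ih =>
    intro F _ _ _ h hh
    have hd := contMDiffOn_fderivWithin_of_prod hs hh
    have hcont : ∀ {F : Type} [NormedAddCommGroup F] [NormedSpace ℝ F] {h : G → E → F},
        ContMDiffOn (J.prod 𝓘(ℝ, E)) 𝓘(ℝ, F) ∞ (Function.uncurry h) (Ω ×ˢ s) →
        ContinuousOn (Function.uncurry fun k => h (ι k)) (univ ×ˢ s) := by
      intro F _ _ h hh
      refine hh.continuousOn.comp (f := fun q : X × E => (ι q.1, q.2)) (by fun_prop) ?_
      rintro q ⟨-, hq⟩
      exact ⟨hιΩ _, hq⟩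
    push_cast
    rw [contDiffOn_succ_iff_hasFDerivWithinAt_of_uniqueDiffOn hs]
    refine ⟨by simp, fun y => ∫ k, fderivWithin ℝ (h (ι k)) s y ∂μ, ih hd, fun y hy => ?_⟩
    refine hasFDerivWithinAt_integral_of_continuousOn μ hc (h := fun k => h (ι k))
      (h' := fun k y => fderivWithin ℝ (h (ι k)) s y) ?_ (hcont hh) (hcont hd) hy
    intro k y hy
    have h1 : ContMDiffWithinAt 𝓘(ℝ, E) 𝓘(ℝ, F) ∞ (h (ι k)) s y :=
      (hh (ι k, y) ⟨hιΩ k, hy⟩).comp (f := fun y => (ι k, y)) y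
        (contMDiffWithinAt_const.prodMk contMDiffWithinAt_id) (fun y hy => ⟨hιΩ k, hy⟩)
    exact (h1.contDiffWithinAt.differentiableWithinAt (by simp)).hasFDerivWithinAt

end ParametricIntegral

/-! ### A constant rank theorem. -/

section ConstantRank

variable {X E : Type*} [NormedAddCommGroup X] [NormedSpace ℝ X] [FiniteDimensional ℝ X]
  [NormedAddCommGroup E] [NormedSpace ℝ E] [FiniteDimensional ℝ E]

/-- The range of `D` maps onto `V` and its dimension is at most that of `V`, so `P` is injective on
it. -/
theorem injOn_range_of_surjective_comp {V : Submodule ℝ E} (P : E →ₗ[ℝ] V) (D : X →ₗ[ℝ] E)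
    (hs : Function.Surjective (P ∘ₗ D))
    (hr : Module.finrank ℝ (LinearMap.range D) ≤ Module.finrank ℝ V) (x : X)
    (hx : P (D x) = 0) : D x = 0 := by
  have h1 : Function.Surjective (P.domRestrict (LinearMap.range D)) := by
    intro v
    obtain ⟨x, hx⟩ := hs v
    exact ⟨⟨D x, x, rfl⟩, hx⟩
  have h2 : Module.finrank ℝ (LinearMap.range D) = Module.finrank ℝ V :=
    le_antisymm hr (LinearMap.finrank_le_finrank_of_surjective h1)
  have h3 : Function.Injective (P.domRestrict (LinearMap.range D)) :=
    (LinearMap.injective_iff_surjective_of_finrank_eq_finrank h2).2 h1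
  have h4 : (⟨D x, x, rfl⟩ : LinearMap.range D) = 0 := h3 (by simpa using hx)
  exact congrArg Subtype.val h4

/-- A map of constant rank locally factors through the projection of its values to the range of
its derivative. -/
theorem exists_factorization_of_finrank_le {ψ : X → E} {u₀ : X} {O : Set X} (hO : IsOpen O)
    (hu₀ : u₀ ∈ O) (hψ : ContDiffOn ℝ ∞ ψ O)
    {V : Submodule ℝ E} (hV : LinearMap.range (fderiv ℝ ψ u₀ : X →ₗ[ℝ] E) = V)
    (hr : ∀ u ∈ O, Module.finrank ℝ (LinearMap.range (fderiv ℝ ψ u : X →ₗ[ℝ] E)) ≤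
      Module.finrank ℝ V)
    (P : E →L[ℝ] V) (hP : ∀ v : V, P v = v) :
    ∃ (B : Set V) (c : V → X),
      IsOpen B ∧ P (ψ u₀) ∈ B ∧ ContDiffOn ℝ ∞ c B ∧ c (P (ψ u₀)) = u₀ ∧ MapsTo c B O ∧
      (∀ v ∈ B, P (ψ (c v)) = v) ∧ ∀ᶠ u in 𝓝 u₀, P (ψ u) ∈ B ∧ ψ u = ψ (c (P (ψ u))) := by
  set D := fderiv ℝ ψ u₀ with hD
  have hdiff : ∀ u ∈ O, ContDiffAt ℝ ∞ ψ u := fun u hu => hψ.contDiffAt (hO.mem_nhds hu)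
  have hder : ∀ u ∈ O, HasFDerivAt ψ (fderiv ℝ ψ u) u := fun u hu =>
    ((hdiff u hu).differentiableAt (by simp)).hasFDerivAt
  obtain ⟨π, hπ⟩ := D.ker_closedComplemented_of_finiteDimensional_range
  -- Coordinates adapted to the fibres: `P ∘ ψ` records the part seen by the derivative at `u₀`, and
  -- `π`, a projection to the kernel of that derivative, records the rest.
  let χ : X → V × LinearMap.ker (D : X →ₗ[ℝ] E) := fun u => (P (ψ u), π (u - u₀))
  have hχ : ContDiffOn ℝ ∞ χ O :=
    (P.contDiff.comp_contDiffOn hψ).prodMk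
      (π.contDiff.comp_contDiffOn (contDiffOn_id.sub contDiffOn_const))
  have hχd : ∀ u ∈ O, HasFDerivAt χ ((P.comp (fderiv ℝ ψ u)).prod π) u := by
    intro u hu
    have h1 : HasFDerivAt (fun u => π (u - u₀)) π u :=
      π.hasFDerivAt.comp u ((hasFDerivAt_id u).sub_const u₀)
    exact ((P.hasFDerivAt.comp u (hder u hu))).prodMk h1
  have hinj : Function.Injective ((P.comp D).prod π : X →ₗ[ℝ] V × LinearMap.ker (D : X →ₗ[ℝ] E)) := by
    rw [← LinearMap.ker_eq_bot, LinearMap.ker_eq_bot']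
    intro x hx
    have h1 : P (D x) = 0 := congrArg Prod.fst hx
    have h2 : π x = 0 := congrArg Prod.snd hx
    have h3 : D x = 0 := by
      have := hP ⟨D x, hV ▸ ⟨x, rfl⟩⟩
      rw [h1] at this
      exact (congrArg Subtype.val this).symm
    have h4 := hπ ⟨x, h3⟩
    rw [h2] at h4
    exact (congrArg Subtype.val h4).symm
  have hfr : Module.finrank ℝ X = Module.finrank ℝ (V × LinearMap.ker (D : X →ₗ[ℝ] E)) := by
    rw [Module.finrank_prod, ← hV]
    exact (LinearMap.finrank_range_add_finrank_ker (D : X →ₗ[ℝ] E)).symm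
  let T : X ≃L[ℝ] V × LinearMap.ker (D : X →ₗ[ℝ] E) :=
    (LinearMap.linearEquivOfInjective _ hinj hfr).toContinuousLinearEquiv
  have hT : (T : X →L[ℝ] V × LinearMap.ker (D : X →ₗ[ℝ] E)) = (P.comp D).prod π := by
    ext x <;> rfl
  have hχ₀ : HasFDerivAt χ (T : X →L[ℝ] V × LinearMap.ker (D : X →ₗ[ℝ] E)) u₀ := by
    rw [hT]; exact hχd u₀ hu₀
  let e := (hχ.contDiffAt (hO.mem_nhds hu₀)).toOpenPartialHomeomorph χ hχ₀ (by simp)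
  have heχ : ∀ u, e u = χ u := fun u => rfl
  have hu₀e : u₀ ∈ e.source := ContDiffAt.mem_toOpenPartialHomeomorph_source _ hχ₀ (by simp)
  have hχu₀ : e u₀ = (P (ψ u₀), 0) := by rw [heχ]; simp [χ]
  -- a neighbourhood on which the derivative of `χ` stays invertible
  have hev : ∀ᶠ u in 𝓝 u₀, u ∈ O ∧ (P.comp (fderiv ℝ ψ u)).prod π ∈
      range ((↑) : (X ≃L[ℝ] V × LinearMap.ker (D : X →ₗ[ℝ] E)) → _) := by
    refine (show ∀ᶠ u in 𝓝 u₀, u ∈ O from hO.mem_nhds hu₀).and ?_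
    have hc : ContinuousAt (fun u => (P.comp (fderiv ℝ ψ u)).prod π) u₀ := by
      have h1 : ContinuousAt (fderiv ℝ ψ) u₀ :=
        ((hψ.continuousOn_fderiv_of_isOpen hO (by simp))).continuousAt (hO.mem_nhds hu₀)
      have h2 : ContinuousAt (fun u => P.comp (fderiv ℝ ψ u)) u₀ := by fun_prop
      exact (ContinuousLinearMap.prodₗᵢ ℝ (𝕜 := ℝ) (E := X) (F := V)
        (G := LinearMap.ker (D : X →ₗ[ℝ] E))).continuous.continuousAt.comp
        (f := fun u => (P.comp (fderiv ℝ ψ u), π)) (h2.prodMk continuousAt_const)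
    have h3 := T.nhds
    rw [hT] at h3
    exact hc h3
  have hev' : ∀ᶠ z in 𝓝 (P (ψ u₀), (0 : LinearMap.ker (D : X →ₗ[ℝ] E))), z ∈ e.target ∧
      e.symm z ∈ O ∧ (P.comp (fderiv ℝ ψ (e.symm z))).prod π ∈
      range ((↑) : (X ≃L[ℝ] V × LinearMap.ker (D : X →ₗ[ℝ] E)) → _) := by
    rw [← hχu₀]
    refine (show ∀ᶠ z in 𝓝 (e u₀), z ∈ e.target from
      e.open_target.mem_nhds (e.map_source hu₀e)).and ?_
    have h1 := e.symm.continuousAt (e.map_source hu₀e)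
    have h2 : e.symm (e u₀) = u₀ := e.left_inv hu₀e
    rw [ContinuousAt, h2] at h1
    exact h1.eventually hev
  obtain ⟨r, hr0, hrb⟩ := Metric.eventually_nhds_iff_ball.1 hev'
  rw [← ball_prod_same] at hrb
  have hsm : ∀ z ∈ Metric.ball (P (ψ u₀)) r ×ˢ Metric.ball (0 : LinearMap.ker (D : X →ₗ[ℝ] E)) r,
      ContDiffAt ℝ ∞ e.symm z := by
    intro z hz
    obtain ⟨h1, h2, S, h3⟩ := hrb z hz
    refine e.contDiffAt_symm (f₀' := S) h1 ?_ (hχ.contDiffAt (hO.mem_nhds h2))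
    rw [h3]
    exact hχd _ h2
  have hright : ∀ z ∈ Metric.ball (P (ψ u₀)) r ×ˢ
      Metric.ball (0 : LinearMap.ker (D : X →ₗ[ℝ] E)) r, P (ψ (e.symm z)) = z.1 := fun z hz =>
    congrArg Prod.fst (e.right_inv (hrb z hz).1)
  have hconst : ∀ v ∈ Metric.ball (P (ψ u₀)) r,
      ∀ κ ∈ Metric.ball (0 : LinearMap.ker (D : X →ₗ[ℝ] E)) r,
      ψ (e.symm (v, κ)) = ψ (e.symm (v, 0)) := by
    intro v hv κ hκ
    have hd : ∀ κ ∈ Metric.ball (0 : LinearMap.ker (D : X →ₗ[ℝ] E)) r,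
        HasFDerivAt (fun κ => ψ (e.symm (v, κ))) (0 : LinearMap.ker (D : X →ₗ[ℝ] E) →L[ℝ] E) κ := by
      intro κ hκ
      have hz : (v, κ) ∈ Metric.ball (P (ψ u₀)) r ×ˢ
        Metric.ball (0 : LinearMap.ker (D : X →ₗ[ℝ] E)) r := ⟨hv, hκ⟩
      have hO' := (hrb _ hz).2.1
      have he := ((hsm _ hz).differentiableAt (by simp)).hasFDerivAt
      set L := fderiv ℝ (e.symm) (v, κ)
      have hψe : HasFDerivAt (fun z => ψ (e.symm z)) ((fderiv ℝ ψ (e.symm (v, κ))).comp L) (v, κ) :=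
        (hder _ hO').comp (v, κ) he
      have hPe : P.comp ((fderiv ℝ ψ (e.symm (v, κ))).comp L) =
          ContinuousLinearMap.fst ℝ V (LinearMap.ker (D : X →ₗ[ℝ] E)) := by
        have h1 : HasFDerivAt (fun z => P (ψ (e.symm z))) _ (v, κ) := P.hasFDerivAt.comp (v, κ) hψe
        have h2 : HasFDerivAt (fun z => P (ψ (e.symm z)))
            (ContinuousLinearMap.fst ℝ V (LinearMap.ker (D : X →ₗ[ℝ] E))) (v, κ) := by
          refine (ContinuousLinearMap.fst ℝ V
            (LinearMap.ker (D : X →ₗ[ℝ] E))).hasFDerivAt.congr_of_eventuallyEq ?_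
          filter_upwards [(Metric.isOpen_ball.prod Metric.isOpen_ball).mem_nhds hz] with z hz
          exact hright z hz
        exact h1.unique h2
      have hκd := hψe.comp (f := fun κ => (v, κ)) κ (hasFDerivAt_prodMk_right v κ)
      -- In the coordinates `(v, κ)` the map `P ∘ ψ` is the first projection, so `P` kills
      -- derivatives in the `κ` direction. By the rank bound, `P` is injective on the range of the
      -- derivative, so these derivatives vanish.
      have hzero : ((fderiv ℝ ψ (e.symm (v, κ))).comp L).comp
          (ContinuousLinearMap.inr ℝ V (LinearMap.ker (D : X →ₗ[ℝ] E))) = 0 := by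
        ext k
        simp only [ContinuousLinearMap.comp_apply, zero_apply]
        refine injOn_range_of_surjective_comp (P : E →ₗ[ℝ] V)
          (fderiv ℝ ψ (e.symm (v, κ)) : X →ₗ[ℝ] E) ?_ (hr _ hO') _ ?_
        · intro w
          exact ⟨L (w, 0), DFunLike.congr_fun hPe (w, 0)⟩
        · exact DFunLike.congr_fun hPe (0, k)
      rw [hzero] at hκd
      exact hκd
    exact Metric.isOpen_ball.is_const_of_fderiv_eq_zero (convex_ball _ _).isPreconnected
      (fun κ hκ => (hd κ hκ).differentiableAt.differentiableWithinAt)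
      (fun κ hκ => (hd κ hκ).fderiv) hκ (Metric.mem_ball_self hr0)
  refine ⟨Metric.ball (P (ψ u₀)) r, fun v => e.symm (v, 0), Metric.isOpen_ball,
    Metric.mem_ball_self (x := P (ψ u₀)) hr0, ?_, ?_, ?_, ?_, ?_⟩
  · intro v hv
    exact ((hsm (v, 0) ⟨hv, Metric.mem_ball_self hr0⟩).comp v
      (contDiffAt_id.prodMk contDiffAt_const)).contDiffWithinAt
  · change e.symm (P (ψ u₀), 0) = u₀
    rw [← hχu₀]; exact e.left_inv hu₀e
  · intro v hv
    exact (hrb (v, 0) ⟨hv, Metric.mem_ball_self hr0⟩).2.1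
  · intro v hv
    exact hright (v, 0) ⟨hv, Metric.mem_ball_self hr0⟩
  · have h1 : ∀ᶠ u in 𝓝 u₀, u ∈ e.source := e.open_source.mem_nhds hu₀e
    have h2 : ∀ᶠ u in 𝓝 u₀, e u ∈ Metric.ball (P (ψ u₀)) r ×ˢ
        Metric.ball (0 : LinearMap.ker (D : X →ₗ[ℝ] E)) r := by
      refine (e.continuousAt hu₀e).eventually ?_
      rw [hχu₀]
      exact prod_mem_nhds (Metric.ball_mem_nhds _ hr0) (Metric.ball_mem_nhds _ hr0)
    filter_upwards [h1, h2] with u hu hub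
    refine ⟨hub.1, ?_⟩
    have h3 := hconst _ hub.1 _ hub.2
    rw [Prod.mk.eta, e.left_inv hu] at h3
    exact h3

end ConstantRank

/-! ### Calculus on the model quadrant. -/

section Quadrant

variable {m : ℕ}

theorem mem_range_quadrant {y : EuclideanSpace ℝ (Fin m)} : y ∈ range (𝓒 m) ↔ ∀ i, 0 ≤ y i := by
  change y ∈ range (Subtype.val : EuclideanQuadrant m → _) ↔ _
  rw [range_euclideanQuadrant]; rfl

theorem mem_interior_range_quadrant {y : EuclideanSpace ℝ (Fin m)} :
    y ∈ interior (range (𝓒 m)) ↔ ∀ i, 0 < y i := by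
  change y ∈ interior (range (Subtype.val : EuclideanQuadrant m → _)) ↔ _
  rw [range_euclideanQuadrant, interior_euclideanQuadrant]; rfl

theorem mem_frontier_range_quadrant {y : EuclideanSpace ℝ (Fin m)} :
    y ∈ frontier (range (𝓒 m)) ↔ (∀ i, 0 ≤ y i) ∧ ∃ i, y i = 0 := by
  rw [(𝓒 m).isClosed_range.frontier_eq, Set.mem_sdiff, mem_range_quadrant,
    mem_interior_range_quadrant]
  constructor
  · rintro ⟨h1, h2⟩
    push Not at h2
    obtain ⟨i, hi⟩ := h2
    exact ⟨h1, i, le_antisymm hi (h1 i)⟩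
  · rintro ⟨h1, i, hi⟩
    exact ⟨h1, fun h => (h i).ne' hi⟩

theorem val_symm_quadrant {y : EuclideanSpace ℝ (Fin m)} (hy : ∀ i, 0 ≤ y i) :
    ((𝓒 m).symm y).1 = y :=
  (𝓒 m).right_inv (mem_range_quadrant.2 hy)

theorem symm_val_quadrant (y : EuclideanQuadrant m) : (𝓒 m).symm y.1 = y :=
  (𝓒 m).left_inv y

theorem val_mem_range_quadrant (y : EuclideanQuadrant m) : y.1 ∈ range (𝓒 m) := ⟨y, rfl⟩

/-- Moving from a point of the quadrant in a direction which is nonnegative in the vanishing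
coordinates stays in the quadrant for a short time. -/
theorem eventually_add_smul_mem_quadrant {a v : EuclideanSpace ℝ (Fin m)} (ha : ∀ i, 0 ≤ a i)
    (hv : ∀ i, a i = 0 → 0 ≤ v i) : ∀ᶠ t in 𝓝[≥] (0 : ℝ), a + t • v ∈ range (𝓒 m) := by
  simp only [mem_range_quadrant, eventually_all]
  intro i
  rcases (ha i).eq_or_lt with h | h
  · filter_upwards [self_mem_nhdsWithin] with t ht
    simp only [PiLp.add_apply, PiLp.smul_apply, smul_eq_mul, ← h, zero_add]
    exact mul_nonneg ht (hv i h.symm)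
  · have hc : ContinuousAt (fun t : ℝ => (a + t • v) i) 0 := by
      simp only [PiLp.add_apply, PiLp.smul_apply, smul_eq_mul]
      fun_prop
    have h1 : ∀ᶠ t in 𝓝 (0 : ℝ), 0 < (a + t • v) i := hc.eventually_const_lt (by simpa using h)
    exact (h1.filter_mono nhdsWithin_le_nhds).mono fun t ht => ht.le

theorem eventually_add_smul_mem_quadrant_of_eq_zero {a v : EuclideanSpace ℝ (Fin m)}
    (ha : ∀ i, 0 ≤ a i) (hv : ∀ i, a i = 0 → v i = 0) :
    ∀ᶠ t in 𝓝 (0 : ℝ), a + t • v ∈ range (𝓒 m) := by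
  simp only [mem_range_quadrant, eventually_all]
  intro i
  rcases (ha i).eq_or_lt with h | h
  · refine Eventually.of_forall fun t => ?_
    simp [← h, hv i h.symm]
  · have hc : ContinuousAt (fun t : ℝ => (a + t • v) i) 0 := by
      simp only [PiLp.add_apply, PiLp.smul_apply, smul_eq_mul]
      fun_prop
    have h1 : ∀ᶠ t in 𝓝 (0 : ℝ), 0 < (a + t • v) i := hc.eventually_const_lt (by simpa using h)
    exact h1.mono fun t ht => ht.le

/-- The derivative of a map of quadrants maps directions tangent to a face to directions tangent
to the corresponding face. -/
theorem apply_eq_zero_of_hasFDerivWithinAt_quadrant {k : ℕ}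
    {f : EuclideanSpace ℝ (Fin m) → EuclideanSpace ℝ (Fin k)}
    {A : EuclideanSpace ℝ (Fin m) →L[ℝ] EuclideanSpace ℝ (Fin k)} {a : EuclideanSpace ℝ (Fin m)}
    (ha : ∀ i, 0 ≤ a i) (hA : HasFDerivWithinAt f A (range (𝓒 m)) a)
    {j : Fin k} (hf : ∀ᶠ y in 𝓝[range (𝓒 m)] a, 0 ≤ f y j)
    (hj : f a j = 0) {v : EuclideanSpace ℝ (Fin m)} (hv : ∀ i, a i = 0 → v i = 0) :
    A v j = 0 := by
  have hev := eventually_add_smul_mem_quadrant_of_eq_zero ha hv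
  have hline : HasDerivAt (fun t : ℝ => a + t • v) v 0 := by
    simpa using ((hasDerivAt_id (0 : ℝ)).smul_const v).const_add a
  have h1 : HasDerivAt (fun t : ℝ => f (a + t • v)) (A v) 0 := by
    have h2 : HasDerivWithinAt (fun t : ℝ => f (a + t • v)) (A v)
        ((fun t : ℝ => a + t • v) ⁻¹' range (𝓒 m)) 0 := by
      refine HasFDerivWithinAt.comp_hasDerivWithinAt (t := range (𝓒 m)) (0 : ℝ) ?_
        hline.hasDerivWithinAt (mapsTo_preimage _ _)
      simpa using hA
    exact h2.hasDerivAt hev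
  have h3 : HasDerivAt (fun t : ℝ => f (a + t • v) j) (A v j) 0 :=
    (EuclideanSpace.proj (𝕜 := ℝ) j).hasFDerivAt.comp_hasDerivAt (0 : ℝ) h1
  -- Along the line, which stays in the quadrant for small times of both signs, the `j`-th
  -- coordinate is nonnegative and vanishes at time zero.
  refine IsLocalMin.hasDerivAt_eq_zero ?_ h3
  have hc : Tendsto (fun t : ℝ => a + t • v) (𝓝 0) (𝓝[range (𝓒 m)] a) := by
    refine tendsto_nhdsWithin_iff.2 ⟨?_, hev⟩
    simpa using hline.continuousAt.tendsto
  filter_upwards [hc.eventually hf] with t ht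
  simpa [hj] using ht

/-- Vectors tangent to the face of `a` are sent to vectors tangent to the face of `f a`. Hence `A`
induces a map from the vectors on the vanishing coordinates of `a` to those on the vanishing
coordinates of `f a`, and surjectivity is inherited. -/
theorem card_zeros_le_of_hasFDerivWithinAt
    {f : EuclideanSpace ℝ (Fin m) → EuclideanSpace ℝ (Fin m)}
    {A : EuclideanSpace ℝ (Fin m) →L[ℝ] EuclideanSpace ℝ (Fin m)} {a : EuclideanSpace ℝ (Fin m)}
    (ha : ∀ i, 0 ≤ a i) (hA : HasFDerivWithinAt f A (range (𝓒 m)) a)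
    (hf : ∀ᶠ y in 𝓝[range (𝓒 m)] a, f y ∈ range (𝓒 m)) (hs : Function.Surjective A) :
    Fintype.card {j // f a j = 0} ≤ Fintype.card {i // a i = 0} := by
  classical
  let ext : ({i // a i = 0} → ℝ) →ₗ[ℝ] EuclideanSpace ℝ (Fin m) :=
    { toFun := fun w => WithLp.toLp 2 fun i => if h : a i = 0 then w ⟨i, h⟩ else 0
      map_add' := by intro x y; ext i; by_cases h : a i = 0 <;> simp [h]
      map_smul' := by intro c x; ext i; by_cases h : a i = 0 <;> simp [h] }
  let T : ({i // a i = 0} → ℝ) →ₗ[ℝ] ({j // f a j = 0} → ℝ) :=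
    { toFun := fun w j => A (ext w) j
      map_add' := by intro x y; ext j; simp
      map_smul' := by intro c x; ext j; simp }
  have hT : Function.Surjective T := by
    intro w
    obtain ⟨v, hv⟩ := hs (WithLp.toLp 2 fun j => if h : f a j = 0 then w ⟨j, h⟩ else 0)
    refine ⟨fun i => v i, ?_⟩
    ext j
    have h1 : A (v - ext fun i => v i) j = 0 := by
      refine apply_eq_zero_of_hasFDerivWithinAt_quadrant ha hA
        (hf.mono fun y hy => mem_range_quadrant.1 hy _) j.2 ?_
      intro i hi
      simp [ext, hi]
    have h2 : A v j = w j := by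
      rw [hv]; simp [j.2]
    change A (ext fun i => v i) j = w j
    rw [map_sub, PiLp.sub_apply, sub_eq_zero] at h1
    rw [← h1, h2]
  simpa using LinearMap.finrank_le_finrank_of_surjective hT

/-- This is the tool for every change of chart below (averaged, affine and slice coordinates). Only
preservation of the quadrant and of its frontier, and an invertible derivative at one point, have to
be checked. -/
theorem exists_quadrant_openPartialHomeomorph {O : Set (EuclideanSpace ℝ (Fin m))} (hO : IsOpen O)
    {p : EuclideanQuadrant m} (hp : p.1 ∈ O)
    {Θ : EuclideanSpace ℝ (Fin m) → EuclideanSpace ℝ (Fin m)}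
    (hΘ : ContDiffOn ℝ ∞ Θ (range (𝓒 m) ∩ O)) (hm : MapsTo Θ (range (𝓒 m) ∩ O) (range (𝓒 m)))
    (hb : MapsTo Θ (frontier (range (𝓒 m)) ∩ O) (frontier (range (𝓒 m))))
    {A : EuclideanSpace ℝ (Fin m) ≃L[ℝ] EuclideanSpace ℝ (Fin m)}
    (hA : HasFDerivWithinAt Θ (A : EuclideanSpace ℝ (Fin m) →L[ℝ] EuclideanSpace ℝ (Fin m))
      (range (𝓒 m)) p.1) :
    ∃ θ : OpenPartialHomeomorph (EuclideanQuadrant m) (EuclideanQuadrant m),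
      ContMDiffOn (𝓒 m) (𝓒 m) ∞ θ θ.source ∧ ContMDiffOn (𝓒 m) (𝓒 m) ∞ θ.symm θ.target ∧
      p ∈ θ.source ∧ ∀ y ∈ θ.source, y.1 ∈ O ∧ (θ y).1 = Θ y.1 := by
  obtain ⟨Ω, Ω', Ψ, hΩ, hΩ', hpΩ, hΩO, h1, h2, h3, h4, h5⟩ := exists_inverse_on_convex
    (𝓒 m).convex_range (𝓒 m).isClosed_range (𝓒 m).nonempty_interior hO
    (val_mem_range_quadrant p) hp hΘ hm hb hA
  have hval : Continuous (Subtype.val : EuclideanQuadrant m → EuclideanSpace ℝ (Fin m)) :=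
    continuous_subtype_val
  have hv1 : ∀ {y : EuclideanQuadrant m}, y.1 ∈ Ω → ((𝓒 m).symm (Θ y.1)).1 = Θ y.1 := fun {y} hy =>
    (𝓒 m).right_inv (h1 ⟨val_mem_range_quadrant y, hy⟩).1
  have hv2 : ∀ {y : EuclideanQuadrant m}, y.1 ∈ Ω' → ((𝓒 m).symm (Ψ y.1)).1 = Ψ y.1 :=
    fun {y} hy => (𝓒 m).right_inv (h2 ⟨val_mem_range_quadrant y, hy⟩).1
  have hs1 : ContMDiffOn (𝓒 m) (𝓒 m) ∞ (fun y => (𝓒 m).symm (Θ y.1))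
      (Subtype.val ⁻¹' Ω : Set (EuclideanQuadrant m)) := by
    refine (𝓒 m).contMDiffOn_symm.comp (t := range (𝓒 m)) ?_
      (fun y hy => (h1 ⟨val_mem_range_quadrant y, hy⟩).1)
    exact (hΘ.contMDiffOn).comp (f := (𝓒 m)) (𝓒 m).contMDiff.contMDiffOn
      (fun y hy => ⟨val_mem_range_quadrant y, hΩO hy⟩)
  have hs2 : ContMDiffOn (𝓒 m) (𝓒 m) ∞ (fun y => (𝓒 m).symm (Ψ y.1))
      (Subtype.val ⁻¹' Ω' : Set (EuclideanQuadrant m)) := by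
    refine (𝓒 m).contMDiffOn_symm.comp (t := range (𝓒 m)) ?_
      (fun y hy => (h2 ⟨val_mem_range_quadrant y, hy⟩).1)
    exact (h5.contMDiffOn).comp (f := (𝓒 m)) (𝓒 m).contMDiff.contMDiffOn
      (fun y hy => ⟨val_mem_range_quadrant y, hy⟩)
  refine ⟨{ toFun := fun y => (𝓒 m).symm (Θ y.1)
            invFun := fun y => (𝓒 m).symm (Ψ y.1)
            source := Subtype.val ⁻¹' Ω
            target := Subtype.val ⁻¹' Ω'
            map_source' := ?_
            map_target' := ?_
            left_inv' := ?_
            right_inv' := ?_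
            open_source := hΩ.preimage hval
            open_target := hΩ'.preimage hval
            continuousOn_toFun := hs1.continuousOn
            continuousOn_invFun := hs2.continuousOn }, hs1, hs2, hpΩ, ?_⟩
  · intro y hy
    change ((𝓒 m).symm (Θ y.1)).1 ∈ Ω'
    rw [hv1 hy]
    exact (h1 ⟨val_mem_range_quadrant y, hy⟩).2
  · intro y hy
    change ((𝓒 m).symm (Ψ y.1)).1 ∈ Ω
    rw [hv2 hy]
    exact (h2 ⟨val_mem_range_quadrant y, hy⟩).2
  · intro y hy
    rw [hv1 hy, h3 _ ⟨val_mem_range_quadrant y, hy⟩]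
    exact symm_val_quadrant y
  · intro y hy
    rw [hv2 hy, h4 _ ⟨val_mem_range_quadrant y, hy⟩]
    exact symm_val_quadrant y
  · intro y hy
    exact ⟨hΩO hy, hv1 hy⟩

variable {M : Type*} [TopologicalSpace M] [ChartedSpace (EuclideanQuadrant m) M]
  [IsManifold (𝓒 m) ∞ M]

theorem trans_mem_maximalAtlas {φ : OpenPartialHomeomorph M (EuclideanQuadrant m)}
    (hφ : φ ∈ IsManifold.maximalAtlas (𝓒 m) ∞ M)
    {θ : OpenPartialHomeomorph (EuclideanQuadrant m) (EuclideanQuadrant m)}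
    (h1 : ContMDiffOn (𝓒 m) (𝓒 m) ∞ θ θ.source)
    (h2 : ContMDiffOn (𝓒 m) (𝓒 m) ∞ θ.symm θ.target) :
    φ.trans θ ∈ IsManifold.maximalAtlas (𝓒 m) ∞ M := by
  refine (φ.trans θ).mem_maximalAtlas_of_contMDiffOn ?_ ?_
  · refine h1.comp ((contMDiffOn_of_mem_maximalAtlas hφ).mono ?_) ?_
    · intro x hx; rw [φ.trans_source] at hx; exact hx.1
    · intro x hx; rw [φ.trans_source] at hx; exact hx.2
  · refine (contMDiffOn_symm_of_mem_maximalAtlas hφ).comp (h2.mono ?_) ?_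
    · intro x hx; rw [φ.trans_target] at hx; exact hx.1
    · intro x hx; rw [φ.trans_target] at hx; exact hx.2

end Quadrant

/-! ### Boundary depth in arbitrary charts. -/

section Charts

set_option linter.unusedSectionVars false

variable {m : ℕ} {M : Type*} [TopologicalSpace M] [ChartedSpace (EuclideanQuadrant m) M]
  [IsManifold (𝓒 m) ∞ M] {φ φ' : OpenPartialHomeomorph M (EuclideanQuadrant m)}

theorem restr_mem_maximalAtlas_quadrant
    (hφ : φ ∈ IsManifold.maximalAtlas (𝓒 m) ∞ M) {s : Set M} (hs : IsOpen s) :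
    φ.restr s ∈ IsManifold.maximalAtlas (𝓒 m) ∞ M :=
  restr_mem_maximalAtlas _ hφ hs

theorem contMDiffOn_val_chart (hφ : φ ∈ IsManifold.maximalAtlas (𝓒 m) ∞ M) :
    ContMDiffOn (𝓒 m) 𝓘(ℝ, EuclideanSpace ℝ (Fin m)) ∞ (fun x => (φ x).1) φ.source :=
  (𝓒 m).contMDiff.comp_contMDiffOn (contMDiffOn_of_mem_maximalAtlas hφ)

theorem contMDiffOn_val_chart_symm (hφ : φ ∈ IsManifold.maximalAtlas (𝓒 m) ∞ M) :
    ContMDiffOn 𝓘(ℝ, EuclideanSpace ℝ (Fin m)) (𝓒 m) ∞ (fun y => φ.symm ((𝓒 m).symm y))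
      {y | y ∈ range (𝓒 m) ∧ (𝓒 m).symm y ∈ φ.target} :=
  (contMDiffOn_symm_of_mem_maximalAtlas hφ).comp ((𝓒 m).contMDiffOn_symm.mono fun _ hy => hy.1)
    fun _ hy => hy.2

theorem continuousOn_val_chart : ContinuousOn (fun x => (φ x).1) φ.source :=
  continuous_subtype_val.comp_continuousOn φ.continuousOn

theorem continuousOn_chart_symm :
    ContinuousOn (fun y => φ.symm ((𝓒 m).symm y)) {y | (𝓒 m).symm y ∈ φ.target} :=
  φ.continuousOn_symm.comp (𝓒 m).continuous_symm.continuousOn fun _ hy => hy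

theorem chart_symm_val {x : M} (hx : x ∈ φ.source) : φ.symm ((𝓒 m).symm (φ x).1) = x := by
  rw [symm_val_quadrant, φ.left_inv hx]

theorem val_chart_symm {y : EuclideanSpace ℝ (Fin m)} (hy : y ∈ range (𝓒 m))
    (hy' : (𝓒 m).symm y ∈ φ.target) : (φ (φ.symm ((𝓒 m).symm y))).1 = y := by
  rw [φ.right_inv hy']; exact (𝓒 m).right_inv hy

theorem isOpen_symm_preimage_target : IsOpen {y | (𝓒 m).symm y ∈ φ.target} :=
  φ.open_target.preimage (𝓒 m).continuous_symm

/-- The number of vanishing coordinates of a point does not depend on the chart. -/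
theorem card_zeros_chart_le (hφ : φ ∈ IsManifold.maximalAtlas (𝓒 m) ∞ M)
    (hφ' : φ' ∈ IsManifold.maximalAtlas (𝓒 m) ∞ M) {x : M} (hx : x ∈ φ.source)
    (hx' : x ∈ φ'.source) :
    Fintype.card {j // (φ' x).1 j = 0} ≤ Fintype.card {i // (φ x).1 i = 0} := by
  set f := (𝓒 m).extendCoordChange φ φ' with hf
  have hxf : (φ x).1 ∈ f.source := by
    rw [hf]
    have : (φ.extend (𝓒 m)) x ∈ ((𝓒 m).extendCoordChange φ φ').source := by simp [hx, hx']
    exact this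
  have hfx : f (φ x).1 = (φ' x).1 := by
    change (φ' (φ.symm ((𝓒 m).symm (φ x).1))).1 = _
    rw [chart_symm_val hx]
  have hinv := (𝓒 m).isInvertible_fderivWithin_extendCoordChange (n := ∞) (by simp) hφ hφ' hxf
  have hnhds : f.source ∈ 𝓝[range (𝓒 m)] (φ x).1 :=
    (𝓒 m).extendCoordChange_source_mem_nhdsWithin hxf
  have hsub : f.source ⊆ range (𝓒 m) := by
    intro y hy
    rw [hf, ModelWithCorners.extendCoordChange, PartialEquiv.trans_source,
      PartialEquiv.symm_source] at hy
    exact φ.extend_target_subset_range hy.1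
  have hd : HasFDerivWithinAt f (fderivWithin ℝ f f.source (φ x).1) f.source (φ x).1 :=
    ((ModelWithCorners.contDiffOn_extendCoordChange hφ hφ').differentiableOn (by simp) _ hxf).hasFDerivWithinAt
  have hd' : HasFDerivWithinAt f (fderivWithin ℝ f f.source (φ x).1) (range (𝓒 m)) (φ x).1 :=
    hd.mono_of_mem_nhdsWithin hnhds
  have := card_zeros_le_of_hasFDerivWithinAt (φ x).2 hd'
    (Eventually.of_forall fun y => val_mem_range_quadrant _) hinv.surjective
  rwa [hfx] at this

theorem card_zeros_chart_eq (hφ : φ ∈ IsManifold.maximalAtlas (𝓒 m) ∞ M)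
    (hφ' : φ' ∈ IsManifold.maximalAtlas (𝓒 m) ∞ M) {x : M} (hx : x ∈ φ.source)
    (hx' : x ∈ φ'.source) :
    Fintype.card {j // (φ' x).1 j = 0} = Fintype.card {i // (φ x).1 i = 0} :=
  le_antisymm (card_zeros_chart_le hφ hφ' hx hx') (card_zeros_chart_le hφ' hφ hx' hx)

theorem existsUnique_zero_iff_card {y : EuclideanSpace ℝ (Fin m)} :
    (∃! i, y i = 0) ↔ Fintype.card {i // y i = 0} = 1 := by
  rw [Fintype.card_eq_one_iff]
  constructor
  · rintro ⟨i, hi, h⟩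
    exact ⟨⟨i, hi⟩, fun j => Subtype.ext (h j j.2)⟩
  · rintro ⟨i, h⟩
    exact ⟨i, i.2, fun j hj => congrArg Subtype.val (h ⟨j, hj⟩)⟩

/-- The definition refers to the preferred chart at each point; invariance of the number of
vanishing coordinates frees it from that choice. -/
theorem mem_smoothBoundaryPart_iff (hφ : φ ∈ IsManifold.maximalAtlas (𝓒 m) ∞ M) {x : M}
    (hx : x ∈ φ.source) : x ∈ smoothBoundaryPart m M ↔ ∃! i, (φ x).1 i = 0 := by
  change (∃! i, (chartAt (EuclideanQuadrant m) x x).1 i = 0) ↔ _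
  rw [existsUnique_zero_iff_card, existsUnique_zero_iff_card,
    card_zeros_chart_eq hφ (IsManifold.chart_mem_maximalAtlas x) hx (mem_chart_source _ x)]

theorem mem_boundary_iff_chart (hφ : φ ∈ IsManifold.maximalAtlas (𝓒 m) ∞ M) {x : M}
    (hx : x ∈ φ.source) : x ∈ (𝓒 m).boundary M ↔ ∃ i, (φ x).1 i = 0 := by
  change (chartAt (EuclideanQuadrant m) x x).1 ∈ frontier (range (𝓒 m)) ↔ _
  rw [mem_frontier_range_quadrant, and_iff_right (chartAt (EuclideanQuadrant m) x x).2]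
  have := card_zeros_chart_eq hφ (IsManifold.chart_mem_maximalAtlas x) hx (mem_chart_source _ x)
  rw [← nonempty_subtype, ← nonempty_subtype, ← Fintype.card_pos_iff, ← Fintype.card_pos_iff, this]

end Charts

/-! ### Embedded hypersurfaces and the absence of self-intersections. -/

section Faces

set_option linter.unusedSectionVars false

variable {m : ℕ} {M : Type*} [TopologicalSpace M] [ChartedSpace (EuclideanQuadrant m) M]
  [IsManifold (𝓒 m) ∞ M] {φ : OpenPartialHomeomorph M (EuclideanQuadrant m)} {p : M}

/-- Near `p`, two points on different coordinate hyperplanes of the chart `φ` lie in different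
components of the smooth boundary part. -/
def NoSelfIntersectionAt (φ : OpenPartialHomeomorph M (EuclideanQuadrant m)) (p : M) : Prop :=
  ∃ U ∈ 𝓝 p, ∀ x ∈ U, ∀ y ∈ U, ∀ i j, (φ x).1 i = 0 → (φ y).1 j = 0 →
    y ∈ connectedComponentIn (smoothBoundaryPart m M) x → i = j

/-- A ball in the chart `φ` around `p`, contained in `W`, on which the nonvanishing coordinates of
`p` stay positive. -/
structure IsCornerBox (φ : OpenPartialHomeomorph M (EuclideanQuadrant m)) (p : M) (W : Set M)
    (ε : ℝ) : Prop where
  pos : 0 < ε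
  target : ∀ y ∈ range (𝓒 m), y ∈ Metric.ball (φ p).1 ε → (𝓒 m).symm y ∈ φ.target
  mem : ∀ y ∈ range (𝓒 m), y ∈ Metric.ball (φ p).1 ε → φ.symm ((𝓒 m).symm y) ∈ W
  coord : ∀ y ∈ Metric.ball (φ p).1 ε, ∀ i, (φ p).1 i ≠ 0 → 0 < y i

theorem exists_isCornerBox (hp : p ∈ φ.source) {W : Set M} (hW : W ∈ 𝓝 p) :
    ∃ ε, IsCornerBox φ p W ε := by
  have hsymm : (𝓒 m).symm (φ p).1 = φ p := symm_val_quadrant _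
  have h1 : ∀ᶠ y in 𝓝 (φ p).1, (𝓒 m).symm y ∈ φ.target :=
    isOpen_symm_preimage_target.mem_nhds (by simpa [hsymm] using φ.map_source hp)
  have h2 : ∀ᶠ y in 𝓝 (φ p).1, φ.symm ((𝓒 m).symm y) ∈ W := by
    have hc : ContinuousAt (fun y => φ.symm ((𝓒 m).symm y)) (φ p).1 :=
      continuousOn_chart_symm.continuousAt h1
    refine hc ?_
    change W ∈ 𝓝 (φ.symm ((𝓒 m).symm (φ p).1))
    rwa [chart_symm_val hp]
  have h3 : ∀ᶠ y in 𝓝 (φ p).1, ∀ i, (φ p).1 i ≠ 0 → 0 < y i := by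
    simp only [eventually_all]
    intro i hi
    have hc : ContinuousAt (fun y : EuclideanSpace ℝ (Fin m) => y i) (φ p).1 := by fun_prop
    exact hc.eventually_const_lt (lt_of_le_of_ne ((φ p).2 i) (Ne.symm hi))
  obtain ⟨ε, hε, h⟩ := Metric.eventually_nhds_iff_ball.1 (h1.and (h2.and h3))
  exact ⟨ε, hε, fun y _ hy => (h y hy).1, fun y _ hy => (h y hy).2.1, fun y hy => (h y hy).2.2⟩

/-- The open face of a corner box where only the `i`-th coordinate vanishes. -/
def boxFace (φ : OpenPartialHomeomorph M (EuclideanQuadrant m)) (p : M) (ε : ℝ) (i : Fin m) :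
    Set M :=
  (fun y => φ.symm ((𝓒 m).symm y)) ''
    {y | y ∈ Metric.ball (φ p).1 ε ∧ y i = 0 ∧ ∀ j, j ≠ i → 0 < y j}

theorem range_of_face {y : EuclideanSpace ℝ (Fin m)} {i : Fin m} (hi : y i = 0)
    (hj : ∀ j, j ≠ i → 0 < y j) : y ∈ range (𝓒 m) := by
  rw [mem_range_quadrant]
  intro j
  by_cases h : j = i
  · rw [h, hi]
  · exact (hj j h).le

variable {W : Set M} {ε : ℝ}

theorem IsCornerBox.isPreconnected_boxFace (h : IsCornerBox φ p W ε) (i : Fin m) :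
    IsPreconnected (boxFace φ p ε i) := by
  refine IsPreconnected.image ?_ _ (continuousOn_chart_symm.mono ?_)
  · refine Convex.isPreconnected ?_
    refine (convex_ball _ _).inter (Convex.inter
      (s := {y : EuclideanSpace ℝ (Fin m) | y i = 0})
      (t := {y : EuclideanSpace ℝ (Fin m) | ∀ j, j ≠ i → 0 < y j}) ?_ ?_)
    · intro x hx y hy a b _ _ _
      simp only [mem_ofPred_eq] at hx hy ⊢
      simp [hx, hy]
    · intro x hx y hy a b ha hb hab j hj
      have h1 := hx j hj
      have h2 := hy j hj
      simp only [PiLp.add_apply, PiLp.smul_apply, smul_eq_mul]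
      rcases ha.eq_or_lt with h | h
      · have : b = 1 := by linarith
        simp [← h, this, h2]
      · have := mul_pos h h1
        have := mul_nonneg hb h2.le
        linarith
  · rintro y ⟨hy, hi, hj⟩
    exact h.target y (range_of_face hi hj) hy

theorem mem_boxFace_of_existsUnique {x : M} (hxs : x ∈ φ.source)
    (hxb : (φ x).1 ∈ Metric.ball (φ p).1 ε) {i : Fin m} (hi : (φ x).1 i = 0)
    (hu : ∃! i, (φ x).1 i = 0) : x ∈ boxFace φ p ε i := by
  refine ⟨(φ x).1, ⟨hxb, hi, fun j hj => lt_of_le_of_ne ((φ x).2 j) fun h0 => hj ?_⟩,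
    chart_symm_val hxs⟩
  exact hu.unique h0.symm hi

theorem IsCornerBox.boxFace_subset (h : IsCornerBox φ p W ε)
    (hφ : φ ∈ IsManifold.maximalAtlas (𝓒 m) ∞ M) (i : Fin m) :
    boxFace φ p ε i ⊆ smoothBoundaryPart m M := by
  rintro _ ⟨y, ⟨hy, hi, hj⟩, rfl⟩
  have hr := range_of_face hi hj
  have ht := h.target y hr hy
  rw [mem_smoothBoundaryPart_iff hφ (φ.map_target ht), val_chart_symm hr ht]
  refine ⟨i, hi, fun j hj0 => ?_⟩
  by_contra hne
  exact (hj j hne).ne' hj0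

/-- Points of the box on the hyperplane `x_i = 0` are limits of points of the open face. -/
theorem IsCornerBox.mem_closure_boxFace (h : IsCornerBox φ p W ε) {y : EuclideanSpace ℝ (Fin m)}
    (hy : y ∈ range (𝓒 m)) (hyb : y ∈ Metric.ball (φ p).1 ε) {i : Fin m} (hi : y i = 0) :
    φ.symm ((𝓒 m).symm y) ∈ closure (boxFace φ p ε i) := by
  classical
  set v : EuclideanSpace ℝ (Fin m) := WithLp.toLp 2 fun j => if j = i then 0 else 1 with hv
  have hc : ContinuousAt (fun t : ℝ => y + t • v) 0 := by fun_prop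
  have hc0 : (fun t : ℝ => y + t • v) 0 = y := by simp
  have h1 : ∀ᶠ t in 𝓝[>] (0 : ℝ), y + t • v ∈ Metric.ball (φ p).1 ε := by
    refine nhdsWithin_le_nhds ?_
    refine hc ?_
    rw [hc0]
    exact Metric.isOpen_ball.mem_nhds hyb
  have ht := h.target y hy hyb
  have hc2 : ContinuousAt (fun t : ℝ => φ.symm ((𝓒 m).symm (y + t • v))) 0 := by
    refine ContinuousAt.comp (g := fun y => φ.symm ((𝓒 m).symm y)) ?_ hc
    rw [zero_smul, add_zero]
    exact continuousOn_chart_symm.continuousAt (isOpen_symm_preimage_target.mem_nhds ht)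
  have hc3 : Tendsto (fun t : ℝ => φ.symm ((𝓒 m).symm (y + t • v))) (𝓝[>] 0)
      (𝓝 (φ.symm ((𝓒 m).symm y))) := by
    have := hc2.tendsto
    simp only [zero_smul, add_zero] at this
    exact this.mono_left nhdsWithin_le_nhds
  refine mem_closure_of_tendsto hc3 ?_
  filter_upwards [h1, self_mem_nhdsWithin] with t htb htp
  refine ⟨_, ⟨htb, by simp [hi, hv], fun j hj => ?_⟩, rfl⟩
  have := mem_range_quadrant.1 hy j
  have htp' : (0 : ℝ) < t := htp
  simp only [hv, PiLp.add_apply, PiLp.smul_apply, smul_eq_mul, if_neg hj, mul_one]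
  linarith

/-- The open set of the points of the chart domain with values in the box. -/
theorem isOpen_box (φ : OpenPartialHomeomorph M (EuclideanQuadrant m)) (a : EuclideanSpace ℝ (Fin m))
    (ε : ℝ) : IsOpen (φ.source ∩ (fun x => (φ x).1) ⁻¹' Metric.ball a ε) :=
  continuousOn_val_chart.isOpen_inter_preimage φ.open_source Metric.isOpen_ball

/-- In a box each open face is connected, so it lies in one component of the smooth boundary part,
and by hypothesis that component meets no other face of the box. Hence its closure is a coordinate
hyperplane there. The last clause provides a hypersurface for every coordinate vanishing at `p`. -/
theorem NoSelfIntersectionAt.exists_local_structure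
    (hφ : φ ∈ IsManifold.maximalAtlas (𝓒 m) ∞ M) (hp : p ∈ φ.source)
    (h : NoSelfIntersectionAt φ p) :
    ∃ U : Set M, IsOpen U ∧ p ∈ U ∧ U ⊆ φ.source ∧
      (∀ x ∈ U, ∀ i, (φ x).1 i = 0 → (φ p).1 i = 0) ∧
      (∀ x ∈ U, x ∈ smoothBoundaryPart m M → ∀ i, (φ x).1 i = 0 → ∀ z ∈ U,
        (z ∈ closure (connectedComponentIn (smoothBoundaryPart m M) x) ↔ (φ z).1 i = 0)) ∧
      ∀ i, (φ p).1 i = 0 → ∃ x ∈ U, x ∈ smoothBoundaryPart m M ∧ (φ x).1 i = 0 := by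
  obtain ⟨W, hW, hns⟩ := h
  obtain ⟨ε, hbox⟩ := exists_isCornerBox hp hW
  have hUW : ∀ x ∈ φ.source ∩ (fun x => (φ x).1) ⁻¹' Metric.ball (φ p).1 ε, x ∈ W := by
    intro x hx
    have := hbox.mem _ (val_mem_range_quadrant (φ x)) hx.2
    rwa [chart_symm_val hx.1] at this
  refine ⟨φ.source ∩ (fun x => (φ x).1) ⁻¹' Metric.ball (φ p).1 ε, isOpen_box φ _ ε,
    ⟨hp, Metric.mem_ball_self hbox.pos⟩, inter_subset_left, ?_, ?_, ?_⟩
  · intro x hx i hi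
    by_contra h0
    exact (hbox.coord _ hx.2 i h0).ne' hi
  · intro x hx hxs i hi z hz
    have hxu := (mem_smoothBoundaryPart_iff hφ hx.1).1 hxs
    have hxf := mem_boxFace_of_existsUnique hx.1 hx.2 hi hxu
    constructor
    · intro hzc
      by_contra h0
      -- Near a point of the closure with positive `i`-th coordinate there would be a point of the
      -- component on another face.
      have hopen : IsOpen ((φ.source ∩ (fun x => (φ x).1) ⁻¹' Metric.ball (φ p).1 ε) ∩
          (φ.source ∩ (fun x => (φ x).1) ⁻¹' {y | 0 < y i})) :=
        (isOpen_box φ _ ε).inter (continuousOn_val_chart.isOpen_inter_preimage φ.open_source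
          (isOpen_lt (by fun_prop) (by fun_prop)))
      obtain ⟨y, ⟨hy1, hy2⟩, hyc⟩ := mem_closure_iff.1 hzc _ hopen
        ⟨hz, hz.1, lt_of_le_of_ne ((φ z).2 i) (Ne.symm h0)⟩
      obtain ⟨j, hj, -⟩ := (mem_smoothBoundaryPart_iff hφ hy1.1).1
        (connectedComponentIn_subset _ _ hyc)
      have hij := hns x (hUW x hx) y (hUW y hy1) i j hi hj hyc
      subst hij
      exact (ne_of_gt (show 0 < (φ y).1 i from hy2.2)) hj
    · intro h0
      refine closure_mono ((hbox.isPreconnected_boxFace i).subset_connectedComponentIn hxf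
        (hbox.boxFace_subset hφ i)) ?_
      have := hbox.mem_closure_boxFace (val_mem_range_quadrant (φ z)) hz.2 h0
      rwa [chart_symm_val hz.1] at this
  · intro i hi
    have := hbox.mem_closure_boxFace (val_mem_range_quadrant (φ p))
      (Metric.mem_ball_self hbox.pos) hi
    obtain ⟨x, hx⟩ := (closure_nonempty_iff.1 ⟨_, this⟩)
    refine ⟨x, ?_, hbox.boxFace_subset hφ i hx, ?_⟩
    · obtain ⟨y, ⟨hy, hi, hj⟩, rfl⟩ := hx
      have hr := range_of_face hi hj
      have ht := hbox.target y hr hy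
      refine ⟨φ.map_target ht, ?_⟩
      change (φ (φ.symm ((𝓒 m).symm y))).1 ∈ Metric.ball (φ p).1 ε
      rwa [val_chart_symm hr ht]
    · obtain ⟨y, ⟨hy, hi, hj⟩, rfl⟩ := hx
      have hr := range_of_face hi hj
      have ht := hbox.target y hr hy
      change (φ (φ.symm ((𝓒 m).symm y))).1 i = 0
      rwa [val_chart_symm hr ht]

theorem single_direction_mem {a : EuclideanSpace ℝ (Fin m)} (ha : ∀ i, 0 ≤ a i) (k : Fin m) :
    ∀ᶠ t in 𝓝[≥] (0 : ℝ), a + t • EuclideanSpace.single k (1 : ℝ) ∈ range (𝓒 m) :=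
  eventually_add_smul_mem_quadrant ha fun i _ => by
    by_cases h : i = k <;> simp [h]

/-- A function on the quadrant which vanishes in the direction of the `k`-th coordinate has
vanishing `k`-th partial derivative. -/
theorem apply_single_of_hasFDerivWithinAt {f : EuclideanSpace ℝ (Fin m) → ℝ}
    {L : EuclideanSpace ℝ (Fin m) →L[ℝ] ℝ} {a : EuclideanSpace ℝ (Fin m)} (ha : ∀ i, 0 ≤ a i)
    (hL : HasFDerivWithinAt f L (range (𝓒 m)) a) (k : Fin m) {c : ℝ}
    (hf : ∀ᶠ t in 𝓝[≥] (0 : ℝ), f (a + t • EuclideanSpace.single k (1 : ℝ)) = f a + c * t) :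
    L (EuclideanSpace.single k (1 : ℝ)) = c := by
  set v : EuclideanSpace ℝ (Fin m) := EuclideanSpace.single k (1 : ℝ)
  have hline : HasDerivAt (fun t : ℝ => a + t • v) v 0 := by
    simpa using ((hasDerivAt_id (0 : ℝ)).smul_const v).const_add a
  have h1 : HasDerivWithinAt (fun t : ℝ => f (a + t • v)) (L v) (Ici 0) 0 := by
    have h2 : HasDerivWithinAt (fun t : ℝ => f (a + t • v)) (L v)
        ((fun t : ℝ => a + t • v) ⁻¹' range (𝓒 m)) 0 := by
      refine HasFDerivWithinAt.comp_hasDerivWithinAt (t := range (𝓒 m)) (0 : ℝ) ?_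
        hline.hasDerivWithinAt (mapsTo_preimage _ _)
      simpa using hL
    exact h2.mono_of_mem_nhdsWithin (single_direction_mem ha k)
  have h3 : HasDerivWithinAt (fun t : ℝ => f (a + t • v)) c (Ici 0) 0 := by
    have h4 : HasDerivWithinAt (fun t : ℝ => f a + c * t) c (Ici 0) 0 := by
      simpa using (((hasDerivAt_id (0 : ℝ)).const_mul c).const_add (f a)).hasDerivWithinAt
    exact h4.congr_of_eventuallyEq hf (by simp)
  exact (uniqueDiffWithinAt_Ici (0 : ℝ)).eq_deriv _ h1 h3

/-- Together with the following lemma this trades the vanishing of the manifold derivative for that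
of the derivative on the quadrant, where directional derivatives are available. -/
theorem hasFDerivWithinAt_comp_chart_symm (hφ : φ ∈ IsManifold.maximalAtlas (𝓒 m) ∞ M)
    (hp : p ∈ φ.source) {f : M → ℝ}
    (hf : MDifferentiableAt (𝓒 m) 𝓘(ℝ, ℝ) f p) :
    ∃ L : EuclideanSpace ℝ (Fin m) →L[ℝ] ℝ,
      HasFDerivWithinAt (fun y => f (φ.symm ((𝓒 m).symm y))) L (range (𝓒 m)) (φ p).1 ∧
      (mfderiv (𝓒 m) 𝓘(ℝ, ℝ) f p = 0 → L = 0) := by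
  have ht : (𝓒 m).symm (φ p).1 ∈ φ.target := by
    rw [symm_val_quadrant]; exact φ.map_source hp
  have hs : φ.symm ((𝓒 m).symm (φ p).1) = p := chart_symm_val hp
  have h1 : MDifferentiableWithinAt 𝓘(ℝ, EuclideanSpace ℝ (Fin m)) (𝓒 m)
      (fun y => φ.symm ((𝓒 m).symm y)) (range (𝓒 m)) (φ p).1 := by
    have h2 := (contMDiffOn_val_chart_symm hφ _ ⟨val_mem_range_quadrant (φ p), ht⟩).mdifferentiableWithinAt
      (by simp)
    exact h2.mono_of_mem_nhdsWithin (inter_mem self_mem_nhdsWithin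
      (mem_nhdsWithin_of_mem_nhds (isOpen_symm_preimage_target.mem_nhds ht)))
  have hf' := hf
  rw [← hs] at hf
  have h3 := HasMFDerivAt.comp_hasMFDerivWithinAt (φ p).1 hf.hasMFDerivAt h1.hasMFDerivWithinAt
  refine ⟨_, h3.hasFDerivWithinAt, fun h0 => ?_⟩
  have h5 : ∀ q, q = p → mfderiv (𝓒 m) 𝓘(ℝ, ℝ) f q = 0 := by
    rintro _ rfl; exact h0
  rw [h5 _ hs]
  exact ContinuousLinearMap.zero_comp _

theorem mfderiv_eq_zero_of_comp_chart_symm (hφ : φ ∈ IsManifold.maximalAtlas (𝓒 m) ∞ M)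
    (hp : p ∈ φ.source) {f : M → ℝ}
    (hf : HasFDerivWithinAt (fun y => f (φ.symm ((𝓒 m).symm y)))
        (0 : EuclideanSpace ℝ (Fin m) →L[ℝ] ℝ) (range (𝓒 m)) (φ p).1) :
    mfderiv (𝓒 m) 𝓘(ℝ, ℝ) f p = 0 := by
  have h1 : MDifferentiableAt (𝓒 m) 𝓘(ℝ, EuclideanSpace ℝ (Fin m)) (fun x => (φ x).1) p :=
    ((contMDiffOn_val_chart hφ).contMDiffAt (φ.open_source.mem_nhds hp)).mdifferentiableAt (by simp)
  have h2 := (hf.hasMFDerivWithinAt).comp (u := range (𝓒 m)) (f := fun x => (φ x).1) (s := univ) p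
    h1.hasMFDerivAt.hasMFDerivWithinAt (fun x _ => val_mem_range_quadrant (φ x))
  rw [hasMFDerivWithinAt_univ] at h2
  have h3 : HasMFDerivAt (𝓒 m) 𝓘(ℝ, ℝ) f p _ := h2.congr_of_eventuallyEq (by
    filter_upwards [φ.open_source.mem_nhds hp] with x hx
    exact (congrArg f (chart_symm_val hx)).symm)
  rw [h3.mfderiv]
  exact ContinuousLinearMap.zero_comp _

/-- If a component contained two faces of a box, a defining function of its closure would vanish on
two coordinate hyperplanes through `p`. Every coordinate direction is tangent to one of them, so its
differential at `p` would be zero. -/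
theorem noSelfIntersectionAt_of_embedded
    (hemb : ∀ S : Set M, IsBoundaryHypersurface m S → IsEmbeddedHypersurface m S)
    (hφ : φ ∈ IsManifold.maximalAtlas (𝓒 m) ∞ M) (hp : p ∈ φ.source) :
    NoSelfIntersectionAt φ p := by
  obtain ⟨ε, hbox⟩ := exists_isCornerBox hp univ_mem
  refine ⟨φ.source ∩ (fun x => (φ x).1) ⁻¹' Metric.ball (φ p).1 ε, (isOpen_box φ _ ε).mem_nhds
    ⟨hp, Metric.mem_ball_self hbox.pos⟩, ?_⟩
  intro x hx y hy i j hi hj hyx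
  by_contra hij
  have hne : (connectedComponentIn (smoothBoundaryPart m M) x).Nonempty := ⟨y, hyx⟩
  have hxs : x ∈ smoothBoundaryPart m M := connectedComponentIn_nonempty_iff.1 hne
  have hys : y ∈ smoothBoundaryPart m M := connectedComponentIn_subset _ _ hyx
  have hfi : boxFace φ p ε i ⊆ connectedComponentIn (smoothBoundaryPart m M) x :=
    (hbox.isPreconnected_boxFace i).subset_connectedComponentIn
      (mem_boxFace_of_existsUnique hx.1 hx.2 hi
        ((mem_smoothBoundaryPart_iff hφ hx.1).1 hxs)) (hbox.boxFace_subset hφ i)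
  have hfj : boxFace φ p ε j ⊆ connectedComponentIn (smoothBoundaryPart m M) x := by
    rw [connectedComponentIn_eq hyx]
    exact (hbox.isPreconnected_boxFace j).subset_connectedComponentIn
      (mem_boxFace_of_existsUnique hy.1 hy.2 hj
        ((mem_smoothBoundaryPart_iff hφ hy.1).1 hys)) (hbox.boxFace_subset hφ j)
  set S := closure (connectedComponentIn (smoothBoundaryPart m M) x) with hS
  have hi0 : (φ p).1 i = 0 := by
    by_contra h0
    exact (hbox.coord _ hx.2 i h0).ne' hi
  have hj0 : (φ p).1 j = 0 := by
    by_contra h0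
    exact (hbox.coord _ hy.2 j h0).ne' hj
  have hface : ∀ y ∈ range (𝓒 m), y ∈ Metric.ball (φ p).1 ε → (y i = 0 ∨ y j = 0) →
      φ.symm ((𝓒 m).symm y) ∈ S := by
    rintro y hy hyb (h0 | h0)
    · exact closure_mono hfi (hbox.mem_closure_boxFace hy hyb h0)
    · exact closure_mono hfj (hbox.mem_closure_boxFace hy hyb h0)
  have hsymm : φ.symm ((𝓒 m).symm (φ p).1) = p := chart_symm_val hp
  have hpS : p ∈ S := by
    have := hface (φ p).1 (val_mem_range_quadrant _) (Metric.mem_ball_self hbox.pos) (Or.inl hi0)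
    rwa [hsymm] at this
  obtain ⟨U, f, hU, hpU, hf, -, hfS, hdf⟩ := hemb S ⟨x, hxs, rfl⟩ p hpS
  have hfd : MDifferentiableAt (𝓒 m) 𝓘(ℝ, ℝ) f p :=
    (hf.contMDiffAt (hU.mem_nhds hpU)).mdifferentiableAt (by simp)
  obtain ⟨L, hB, -⟩ := hasFDerivWithinAt_comp_chart_symm hφ hp hfd
  refine hdf (mfderiv_eq_zero_of_comp_chart_symm hφ hp ?_)
  suffices hL : L = 0 by rwa [hL] at hB
  have hLk : ∀ k, L (EuclideanSpace.single k (1 : ℝ)) = 0 := by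
    intro k
    refine apply_single_of_hasFDerivWithinAt (φ p).2 hB k (c := 0) ?_
    have hc : ContinuousAt (fun t : ℝ => (φ p).1 + t • EuclideanSpace.single k (1 : ℝ)) 0 := by
      fun_prop
    have hc0 : (fun t : ℝ => (φ p).1 + t • EuclideanSpace.single k (1 : ℝ)) 0 = (φ p).1 := by simp
    have e1 : ∀ᶠ t in 𝓝[≥] (0 : ℝ), (φ p).1 + t • EuclideanSpace.single k (1 : ℝ) ∈
        Metric.ball (φ p).1 ε := by
      refine nhdsWithin_le_nhds (hc ?_)
      rw [hc0]; exact Metric.ball_mem_nhds _ hbox.pos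
    have e2 : ∀ᶠ t in 𝓝[≥] (0 : ℝ), φ.symm ((𝓒 m).symm ((φ p).1 +
        t • EuclideanSpace.single k (1 : ℝ))) ∈ U := by
      have ht : (𝓒 m).symm (φ p).1 ∈ φ.target :=
        hbox.target _ (val_mem_range_quadrant _) (Metric.mem_ball_self hbox.pos)
      have hc2 : ContinuousAt (fun t : ℝ => φ.symm ((𝓒 m).symm ((φ p).1 +
          t • EuclideanSpace.single k (1 : ℝ)))) 0 := by
        refine ContinuousAt.comp (g := fun y => φ.symm ((𝓒 m).symm y)) ?_ hc
        rw [zero_smul, add_zero]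
        exact continuousOn_chart_symm.continuousAt (isOpen_symm_preimage_target.mem_nhds ht)
      refine nhdsWithin_le_nhds (hc2 (hU.mem_nhds ?_))
      simpa [hsymm] using hpU
    filter_upwards [e1, e2, single_direction_mem (φ p).2 k] with t h1 h2 h3
    have hz : f p = 0 := (hfS p hpU).1 hpS
    rw [hsymm, hz, (hfS _ h2).1 (hface _ h3 h1 ?_)]
    · simp
    -- Moving along the `k`-th axis stays in the `i`-th hyperplane unless `k = i`, and then it stays
    -- in the `j`-th.
    · by_cases hk : k = i
      · right
        have : j ≠ k := by rintro rfl; exact hij hk.symm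
        simp [hj0, this]
      · left
        simp [hi0, Ne.symm hk]
  ext v
  have hv : v = ∑ k, v k • EuclideanSpace.single k (1 : ℝ) := by
    ext l
    simp [Pi.single_apply]
  rw [hv, map_sum]
  simp [hLk]

/-- The coordinate `φ_i` of the local hyperplane is itself a defining function, with derivative 1 in
its own direction. -/
theorem embedded_of_noSelfIntersectionAt
    (h : ∀ p : M, ∃ φ ∈ IsManifold.maximalAtlas (𝓒 m) ∞ M, p ∈ φ.source ∧
      NoSelfIntersectionAt φ p) (S : Set M) (hS : IsBoundaryHypersurface m S) :
    IsEmbeddedHypersurface m S := by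
  obtain ⟨x₀, hx₀, rfl⟩ := hS
  intro p hpS
  obtain ⟨φ, hφ, hp, hns⟩ := h p
  obtain ⟨U, hU, hpU, hUs, hU0, hU1, -⟩ := hns.exists_local_structure hφ hp
  obtain ⟨x, hxU, hxc⟩ := mem_closure_iff.1 hpS U hU hpU
  have hxs := connectedComponentIn_subset _ _ hxc
  obtain ⟨i, hi, -⟩ := (mem_smoothBoundaryPart_iff hφ (hUs hxU)).1 hxs
  have hcomp := connectedComponentIn_eq hxc
  have hiff := hU1 x hxU hxs i hi
  rw [← hcomp] at hiff
  have hsm : ContMDiffOn (𝓒 m) 𝓘(ℝ, ℝ) ∞ (fun z => (φ z).1 i) φ.source :=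
    ((EuclideanSpace.proj (𝕜 := ℝ) i).contMDiff).comp_contMDiffOn (contMDiffOn_val_chart hφ)
  refine ⟨U, fun z => (φ z).1 i, hU, hpU, hsm.mono hUs, fun q _ => (φ q).2 i, hiff, fun h0 => ?_⟩
  obtain ⟨L, hB, hL0⟩ := hasFDerivWithinAt_comp_chart_symm hφ hp
    ((hsm.contMDiffAt (φ.open_source.mem_nhds hp)).mdifferentiableAt (by simp))
  rw [hL0 h0] at hB
  have ht : ∀ᶠ t in 𝓝[≥] (0 : ℝ), (𝓒 m).symm ((φ p).1 + t • EuclideanSpace.single i (1 : ℝ)) ∈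
      φ.target := by
    have hc : ContinuousAt (fun t : ℝ => (φ p).1 + t • EuclideanSpace.single i (1 : ℝ)) 0 := by
      fun_prop
    refine nhdsWithin_le_nhds (hc (isOpen_symm_preimage_target.mem_nhds ?_))
    simpa [symm_val_quadrant] using φ.map_source hp
  have h1 := apply_single_of_hasFDerivWithinAt (φ p).2 hB i (c := 1) (by
    filter_upwards [ht, single_direction_mem (φ p).2 i] with t h1 h2
    rw [val_chart_symm h2 h1, chart_symm_val hp]
    simp)
  simp at h1

end Faces

/-! ### Stabilizers and neighbourhoods for actions of compact groups. -/

section CompactActions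

open scoped Pointwise

set_option linter.unusedSectionVars false

variable {G M : Type*} [TopologicalSpace G] [Group G] [IsTopologicalGroup G] [CompactSpace G]
  [TopologicalSpace M] [T2Space M] [MulAction G M] [ContinuousSMul G M]

/-- A closed subgroup of a compact group containing a conjugate of itself is equal to it. -/
theorem map_conj_eq_of_le {K : Subgroup G} (hK : IsClosed (K : Set G)) {g : G}
    (h : K.map (MulAut.conj g).toMonoidHom ≤ K) : K.map (MulAut.conj g).toMonoidHom = K := by
  refine le_antisymm h fun k hk => ?_
  have h1 : ∀ g', (∀ k ∈ K, g' * k * g'⁻¹ ∈ K) → ∀ n : ℕ, ∀ k ∈ K, g' ^ n * k * (g' ^ n)⁻¹ ∈ K := by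
    intro g' hg' n
    induction n with
    | zero => intro k hk; simpa using hk
    | succ n ih =>
      intro k hk
      have := ih _ (hg' k hk)
      simpa [pow_succ, mul_assoc] using this
  have hg : ∀ k ∈ K, g * k * g⁻¹ ∈ K := fun k hk => h ⟨k, hk, rfl⟩
  have hcl : IsClosed {g' : G | g' * k * g'⁻¹ ∈ K} := hK.preimage (by fun_prop)
  -- In a compact group the inverse is a limit of positive powers, so conjugation by `g⁻¹` also maps
  -- the closed subgroup `K` into itself.
  have h2 : g⁻¹ ∈ closure (range (g ^ · : ℕ → G)) := by
    refine ((mapClusterPt_atTop_pow_tfae g⁻¹ g).out 0 2).1 ?_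
    simpa using mapClusterPt_self_zpow_atTop_pow g (-1)
  have h3 : g⁻¹ * k * g⁻¹⁻¹ ∈ K :=
    closure_minimal (s := range (g ^ · : ℕ → G)) (t := {g' : G | g' * k * g'⁻¹ ∈ K})
      (range_subset_iff.2 fun n => h1 g hg n k hk) hcl h2
  refine ⟨_, h3, ?_⟩
  simp [mul_assoc]

theorem isClosed_stabilizer (x : M) : IsClosed (MulAction.stabilizer G x : Set G) :=
  isClosed_eq (f := fun g : G => g • x) (g := fun _ => x) (by fun_prop) continuous_const

/-- An inclusion of conjugate closed subgroups of a compact group is an equality. This turns every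
upper bound for a stabilizer below into its exact value. -/
theorem stabilizer_eq_of_le (hiso : HasUniqueIsotropyType G M) {x y : M}
    (h : MulAction.stabilizer G y ≤ MulAction.stabilizer G x) :
    MulAction.stabilizer G y = MulAction.stabilizer G x := by
  obtain ⟨g, hg⟩ := hiso x y
  rw [hg] at h ⊢
  exact map_conj_eq_of_le (isClosed_stabilizer x) h

theorem stabilizer_eq_of_mem_fixedPoints (hiso : HasUniqueIsotropyType G M) {x y : M}
    (hy : y ∈ MulAction.fixedPoints (MulAction.stabilizer G x) M) :
    MulAction.stabilizer G y = MulAction.stabilizer G x :=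
  (stabilizer_eq_of_le hiso (x := y) (y := x) fun k hk => hy ⟨k, hk⟩).symm

/-- Group elements moving a point near `ζ` to a point near `ζ` are close to the stabilizer. -/
theorem exists_nhds_mem_mul_stabilizer (ζ : M) {O : Set G} (hO : O ∈ 𝓝 (1 : G)) :
    ∃ U ∈ 𝓝 ζ, ∀ x ∈ U, ∀ h : G, h • x ∈ U →
      ∃ o ∈ O, ∃ k ∈ MulAction.stabilizer G ζ, h = o * k := by
  obtain ⟨O', hO', hO'o, h1⟩ := mem_nhds_iff.1 hO
  -- Elements outside `O' * K` form a compact set, none of them fixes `ζ`, and this persists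
  -- uniformly for pairs of points near `(ζ, ζ)`.
  set C : Set G := (O' * (MulAction.stabilizer G ζ : Set G))ᶜ with hC
  have hCc : IsCompact C := (hO'o.mul_right).isClosed_compl.isCompact
  have hev : ∀ᶠ q in 𝓝 (ζ, ζ), ∀ h ∈ C, h • (q.1 : M) ≠ q.2 := by
    refine IsCompact.eventually_forall_of_forall_eventually
      (P := fun (q : M × M) (h : G) => h • q.1 ≠ q.2) hCc fun h hh => ?_
    have hne : h • ζ ≠ ζ := by
      intro h0
      exact hh ⟨1, h1, h, h0, one_mul h⟩
    have hop : IsOpen {z : (M × M) × G | z.2 • z.1.1 ≠ z.1.2} :=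
      isOpen_ne_fun (by fun_prop) (by fun_prop)
    exact hop.mem_nhds hne
  rw [nhds_prod_eq] at hev
  obtain ⟨U, hU, hUb⟩ :=
    (eventually_prod_self_iff (r := fun x y => ∀ h ∈ C, h • x ≠ y)).1 hev
  refine ⟨_, hU, fun x hx h hhx => ?_⟩
  by_contra hcon
  refine hUb x hx _ hhx h ?_ rfl
  rintro ⟨o, ho, k, hk, hok⟩
  exact hcon ⟨o, hO' ho, k, hk, hok.symm⟩

/-- Arbitrarily small invariant neighbourhoods of a point under its stabilizer. -/
theorem exists_invariant_nhds {ζ : M} {W : Set M} (hW : W ∈ 𝓝 ζ) :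
    ∃ U, IsOpen U ∧ ζ ∈ U ∧ U ⊆ W ∧
      ∀ k ∈ MulAction.stabilizer G ζ, ∀ x ∈ U, k • x ∈ U := by
  obtain ⟨W', hW', hW'o, hζ⟩ := mem_nhds_iff.1 hW
  -- The points whose whole orbit under the compact stabilizer stays in `W'`; this set is invariant
  -- by construction and open by compactness.
  refine ⟨{x | ∀ k ∈ (MulAction.stabilizer G ζ : Set G), k • x ∈ W'}, ?_, ?_, ?_, ?_⟩
  · rw [isOpen_iff_mem_nhds]
    intro x hx
    refine IsCompact.eventually_forall_of_forall_eventually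
      (P := fun (x : M) (k : G) => k • x ∈ W') (isClosed_stabilizer ζ).isCompact fun k hk => ?_
    have hc : ContinuousAt (fun z : M × G => z.2 • z.1) (x, k) := by fun_prop
    exact hc (hW'o.mem_nhds (hx k hk))
  · intro k hk
    have h0 : k • ζ = ζ := hk
    rwa [h0]
  · intro x hx
    have := hx 1 (one_mem _)
    rw [one_smul] at this
    exact hW' this
  · intro k hk x hx k' hk'
    rw [smul_smul]
    exact hx _ (mul_mem hk' hk)

end CompactActions

/-! ### Translates of charts and of boundary hypersurfaces. -/

section SmoothActions

set_option linter.unusedSectionVars false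

variable {n m : ℕ} {G : Type*} [TopologicalSpace G] [ChartedSpace (EuclideanSpace ℝ (Fin n)) G]
  [Group G] [LieGroup (𝓡 n) ∞ G]
  {M : Type*} [TopologicalSpace M] [ChartedSpace (EuclideanQuadrant m) M]
  [IsManifold (𝓒 m) ∞ M] [MulAction G M] [ContMDiffSMul (𝓡 n) (𝓒 m) ∞ G M]
  [ContinuousSMul G M]

/-- The translate of a chart by a group element. -/
noncomputable def translateChart (g : G) (φ : OpenPartialHomeomorph M (EuclideanQuadrant m)) :
    OpenPartialHomeomorph M (EuclideanQuadrant m) :=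
  (Homeomorph.smul g).toOpenPartialHomeomorph.trans φ

theorem translateChart_apply (g : G) (φ : OpenPartialHomeomorph M (EuclideanQuadrant m)) (x : M) :
    translateChart g φ x = φ (g • x) := rfl

theorem mem_translateChart_source {g : G} {φ : OpenPartialHomeomorph M (EuclideanQuadrant m)}
    {x : M} : x ∈ (translateChart g φ).source ↔ g • x ∈ φ.source := by
  rw [translateChart, OpenPartialHomeomorph.trans_source]
  simp

theorem translateChart_mem_maximalAtlas (n) [ChartedSpace (EuclideanSpace ℝ (Fin n)) G]
    [LieGroup (𝓡 n) ∞ G] [ContMDiffSMul (𝓡 n) (𝓒 m) ∞ G M] (g : G)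
    {φ : OpenPartialHomeomorph M (EuclideanQuadrant m)}
    (hφ : φ ∈ IsManifold.maximalAtlas (𝓒 m) ∞ M) :
    translateChart g φ ∈ IsManifold.maximalAtlas (𝓒 m) ∞ M := by
  refine (translateChart g φ).mem_maximalAtlas_of_contMDiffOn ?_ ?_
  · exact (contMDiffOn_of_mem_maximalAtlas hφ).comp (f := fun x : M => g • x)
      (ContMDiffSMul.contMDiff_const_smul (I := 𝓡 n) g).contMDiffOn
      (fun x hx => mem_translateChart_source.1 hx)
  · refine ((ContMDiffSMul.contMDiff_const_smul (I := 𝓡 n) (I' := 𝓒 m) (M := M)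
      (n := ∞) g⁻¹).contMDiffOn (s := univ)).comp
      ((contMDiffOn_symm_of_mem_maximalAtlas hφ).mono ?_) (fun _ _ => mem_univ _)
    intro y hy
    rw [translateChart, OpenPartialHomeomorph.trans_target] at hy
    exact hy.1

theorem smul_mem_smoothBoundaryPart_iff (n) [ChartedSpace (EuclideanSpace ℝ (Fin n)) G]
    [LieGroup (𝓡 n) ∞ G] [ContMDiffSMul (𝓡 n) (𝓒 m) ∞ G M] (g : G) {x : M} :
    g • x ∈ smoothBoundaryPart m M ↔ x ∈ smoothBoundaryPart m M := by
  have h := IsManifold.chart_mem_maximalAtlas (I := 𝓒 m) (n := ∞) (g • x)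
  rw [mem_smoothBoundaryPart_iff h (mem_chart_source _ _),
    mem_smoothBoundaryPart_iff (translateChart_mem_maximalAtlas n g h)
      (mem_translateChart_source.2 (mem_chart_source _ _))]
  rfl

theorem smul_mem_boundary_iff (n) [ChartedSpace (EuclideanSpace ℝ (Fin n)) G]
    [LieGroup (𝓡 n) ∞ G] [ContMDiffSMul (𝓡 n) (𝓒 m) ∞ G M] (g : G) {x : M} :
    g • x ∈ (𝓒 m).boundary M ↔ x ∈ (𝓒 m).boundary M := by
  have h := IsManifold.chart_mem_maximalAtlas (I := 𝓒 m) (n := ∞) (g • x)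
  rw [mem_boundary_iff_chart h (mem_chart_source _ _),
    mem_boundary_iff_chart (translateChart_mem_maximalAtlas n g h)
      (mem_translateChart_source.2 (mem_chart_source _ _))]
  rfl

/-- `S` and its translate belong to the same collection of the partition, whose distinct members are
disjoint. This is how boundary intersection freeness is used throughout. -/
theorem image_smul_eq_of_nonempty_inter (hbif : IsBoundaryIntersectionFree m G M) {S : Set M}
    (hS : IsBoundaryHypersurface m S) {g : G} {x : M} (hx : x ∈ S)
    (hgx : x ∈ (fun y : M => g • y) '' S) : (fun y : M => g • y) '' S = S := by
  obtain ⟨P, hP, -, hdisj, hinv⟩ := hbif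
  have h1 : S ∈ ⋃₀ P := by rw [hP]; exact hS
  obtain ⟨B, hB, hSB⟩ := h1
  by_contra hne
  exact Set.disjoint_left.1 (hdisj B hB (hinv g B hB S hSB) hSB hne) hgx hx

/-- Elements of the stabilizer preserve the boundary faces through the point. -/
theorem exists_nhds_zero_iff_smul (hM : IsManifoldWithCorners m M)
    (hbif : IsBoundaryIntersectionFree m G M)
    {φ : OpenPartialHomeomorph M (EuclideanQuadrant m)}
    (hφ : φ ∈ IsManifold.maximalAtlas (𝓒 m) ∞ M) {ζ : M} (hζ : ζ ∈ φ.source) :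
    ∃ U : Set M, IsOpen U ∧ ζ ∈ U ∧ U ⊆ φ.source ∧ ∀ i, (φ ζ).1 i = 0 →
      ∀ k ∈ MulAction.stabilizer G ζ, ∀ x ∈ U, k • x ∈ U → ((φ (k • x)).1 i = 0 ↔ (φ x).1 i = 0) := by
  obtain ⟨U, hU, hζU, hUs, hU0, hU1, hU2⟩ :=
    (noSelfIntersectionAt_of_embedded hM.embedded hφ hζ).exists_local_structure hφ hζ
  refine ⟨U, hU, hζU, hUs, fun i hi k hk x hx hkx => ?_⟩
  obtain ⟨z, hzU, hzs, hz0⟩ := hU2 i hi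
  set S := closure (connectedComponentIn (smoothBoundaryPart m M) z) with hS
  have hSh : IsBoundaryHypersurface m S := ⟨z, hzs, rfl⟩
  have hζS : ζ ∈ S := (hU1 z hzU hzs i hz0 ζ hζU).2 hi
  have hk0 : k • ζ = ζ := hk
  -- Since `k` fixes `ζ`, the hypersurface and its translate share the point `ζ`, so they coincide.
  have heq := image_smul_eq_of_nonempty_inter hbif hSh (g := k) hζS ⟨ζ, hζS, hk0⟩
  rw [← hU1 z hzU hzs i hz0 x hx, ← hU1 z hzU hzs i hz0 _ hkx]
  constructor
  · intro h
    change k • x ∈ S at h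
    rw [← heq] at h
    obtain ⟨y, hy, hyx⟩ := h
    have : y = x := MulAction.injective k hyx
    rwa [← this]
  · intro h
    change k • x ∈ S
    rw [← heq]
    exact ⟨x, h, rfl⟩

end SmoothActions

/-! ### The isotropy representation in a chart. -/

section IsotropyRepresentation

set_option linter.unusedSectionVars false

variable {n m : ℕ} {G : Type*} [TopologicalSpace G] [ChartedSpace (EuclideanSpace ℝ (Fin n)) G]
  [Group G] [LieGroup (𝓡 n) ∞ G] [IsTopologicalGroup G] [CompactSpace G]
  {M : Type*} [TopologicalSpace M] [T2Space M] [ChartedSpace (EuclideanQuadrant m) M]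
  [IsManifold (𝓒 m) ∞ M] [MulAction G M] [ContMDiffSMul (𝓡 n) (𝓒 m) ∞ G M]
  [ContinuousSMul G M] {φ : OpenPartialHomeomorph M (EuclideanQuadrant m)} {ζ : M}

/-- The action of a group element, read in a chart. -/
noncomputable def actionInChart (φ : OpenPartialHomeomorph M (EuclideanQuadrant m)) (g : G)
    (y : EuclideanSpace ℝ (Fin m)) : EuclideanSpace ℝ (Fin m) :=
  (φ (g • φ.symm ((𝓒 m).symm y))).1

theorem actionInChart_val (φ : OpenPartialHomeomorph M (EuclideanQuadrant m)) (g : G) {x : M}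
    (hx : x ∈ φ.source) : actionInChart φ g (φ x).1 = (φ (g • x)).1 := by
  rw [actionInChart, chart_symm_val hx]

theorem contMDiffOn_actionInChart (hφ : φ ∈ IsManifold.maximalAtlas (𝓒 m) ∞ M) :
    ContMDiffOn ((𝓡 n).prod 𝓘(ℝ, EuclideanSpace ℝ (Fin m))) 𝓘(ℝ, EuclideanSpace ℝ (Fin m)) ∞
      (Function.uncurry (actionInChart (G := G) φ))
      {q | (q.2 ∈ range (𝓒 m) ∧ (𝓒 m).symm q.2 ∈ φ.target) ∧
        q.1 • φ.symm ((𝓒 m).symm q.2) ∈ φ.source} := by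
  refine (contMDiffOn_val_chart hφ).comp (f := fun q : G × EuclideanSpace ℝ (Fin m) =>
    q.1 • φ.symm ((𝓒 m).symm q.2)) ?_ (fun q hq => hq.2)
  exact (contMDiffOn_fst (I := 𝓡 n)).smul (I' := 𝓒 m)
    ((contMDiffOn_val_chart_symm hφ).comp contMDiffOn_snd fun q hq => hq.1)

/-- A product neighbourhood of the stabilizer and the base point on which the action is smooth in
the chart. -/
theorem exists_smooth_tube (hφ : φ ∈ IsManifold.maximalAtlas (𝓒 m) ∞ M) (hζ : ζ ∈ φ.source)
    {W : Set M} (hW : W ∈ 𝓝 ζ) :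
    ∃ (Ω : Set G) (ε : ℝ), IsOpen Ω ∧ (∀ k ∈ MulAction.stabilizer G ζ, k ∈ Ω) ∧
      (∀ g ∈ Ω, g⁻¹ ∈ Ω) ∧ IsCornerBox φ ζ W ε ∧
      (∀ g ∈ Ω, ∀ y ∈ range (𝓒 m) ∩ Metric.ball (φ ζ).1 ε,
        g • φ.symm ((𝓒 m).symm y) ∈ φ.source ∩ W) ∧
      ContMDiffOn ((𝓡 n).prod 𝓘(ℝ, EuclideanSpace ℝ (Fin m))) 𝓘(ℝ, EuclideanSpace ℝ (Fin m)) ∞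
        (Function.uncurry (actionInChart (G := G) φ))
        (Ω ×ˢ (range (𝓒 m) ∩ Metric.ball (φ ζ).1 ε)) := by
  obtain ⟨W', hW', hW'o, hζW'⟩ := mem_nhds_iff.1 hW
  have hop : IsOpen {q : G × M | q.1 • q.2 ∈ φ.source ∩ W'} :=
    (φ.open_source.inter hW'o).preimage (by fun_prop)
  -- The tube lemma around the compact set `K × {ζ}`, which the action maps to `ζ`.
  obtain ⟨Ω₁, V, hΩ₁, hV, hKΩ, hζV, hsub⟩ := generalized_tube_lemma
    (isClosed_stabilizer (G := G) ζ).isCompact (isCompact_singleton (x := ζ)) hop (by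
      rintro ⟨k, x⟩ ⟨hk, rfl⟩
      have hk0 : k • x = x := hk
      change k • x ∈ φ.source ∩ W'
      rw [hk0]
      exact ⟨hζ, hζW'⟩)
  obtain ⟨ε, hbox⟩ := exists_isCornerBox hζ
    (inter_mem hW (inter_mem (hV.mem_nhds (hζV rfl)) (φ.open_source.mem_nhds hζ)))
  have hact : ∀ g ∈ Ω₁ ∩ Ω₁⁻¹, ∀ y ∈ range (𝓒 m) ∩ Metric.ball (φ ζ).1 ε,
        g • φ.symm ((𝓒 m).symm y) ∈ φ.source ∩ W := by
    rintro g hg y ⟨hy, hyb⟩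
    have := hsub (show (g, φ.symm ((𝓒 m).symm y)) ∈ Ω₁ ×ˢ V from
      ⟨hg.1, (hbox.mem y hy hyb).2.1⟩)
    exact ⟨this.1, hW' this.2⟩
  -- The intersection with the inverses makes `Ω` symmetric, because the averaging integrand
  -- involves both `k` and `k⁻¹`.
  refine ⟨Ω₁ ∩ Ω₁⁻¹, ε, hΩ₁.inter hΩ₁.inv, fun k hk => ⟨hKΩ hk, hKΩ (inv_mem hk)⟩, ?_,
    ⟨hbox.pos, hbox.target, fun y h1 h2 => (hbox.mem y h1 h2).1, hbox.coord⟩, hact,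
    (contMDiffOn_actionInChart hφ).mono ?_⟩
  · rintro g ⟨hg, hg'⟩
    exact ⟨hg', by simpa using hg⟩
  · rintro ⟨g, y⟩ ⟨hg, hy⟩
    exact ⟨⟨hy.1, hbox.target y hy.1 hy.2⟩, (hact g hg y hy).1⟩

/-- The derivative at `ζ` of the action of a group element, read in a chart. -/
noncomputable def isotropyRep (φ : OpenPartialHomeomorph M (EuclideanQuadrant m)) (ζ : M) (g : G) :
    EuclideanSpace ℝ (Fin m) →L[ℝ] EuclideanSpace ℝ (Fin m) :=
  fderivWithin ℝ (actionInChart φ g) (range (𝓒 m)) (φ ζ).1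

theorem uniqueDiffWithinAt_quadrant (x : M) :
    UniqueDiffWithinAt ℝ (range (𝓒 m)) (φ x).1 :=
  (𝓒 m).uniqueDiffWithinAt_image

theorem hasFDerivWithinAt_actionInChart (n) [ChartedSpace (EuclideanSpace ℝ (Fin n)) G]
    [LieGroup (𝓡 n) ∞ G] [ContMDiffSMul (𝓡 n) (𝓒 m) ∞ G M]
    (hφ : φ ∈ IsManifold.maximalAtlas (𝓒 m) ∞ M) {x : M} (hx : x ∈ φ.source) {g : G}
    (hg : g • x ∈ φ.source) :
    HasFDerivWithinAt (actionInChart φ g) (isotropyRep φ x g) (range (𝓒 m)) (φ x).1 := by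
  refine DifferentiableWithinAt.hasFDerivWithinAt ?_
  have ht : (𝓒 m).symm (φ x).1 ∈ φ.target := by
    rw [symm_val_quadrant]; exact φ.map_source hx
  have h1 : ContMDiffWithinAt 𝓘(ℝ, EuclideanSpace ℝ (Fin m)) 𝓘(ℝ, EuclideanSpace ℝ (Fin m)) ∞
      (actionInChart φ g) {y | (y ∈ range (𝓒 m) ∧ (𝓒 m).symm y ∈ φ.target) ∧
        g • φ.symm ((𝓒 m).symm y) ∈ φ.source} (φ x).1 :=
    (contMDiffOn_actionInChart (n := n) hφ (g, (φ x).1)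
      ⟨⟨val_mem_range_quadrant _, ht⟩, by rwa [chart_symm_val hx]⟩).comp
      (f := fun y => (g, y)) _ (contMDiffWithinAt_const.prodMk contMDiffWithinAt_id)
      (fun y hy => hy)
  refine (h1.contDiffWithinAt.differentiableWithinAt (by simp)).mono_of_mem_nhdsWithin ?_
  have e1 : ∀ᶠ y in 𝓝 (φ x).1, (𝓒 m).symm y ∈ φ.target := isOpen_symm_preimage_target.mem_nhds ht
  have e2 : ∀ᶠ y in 𝓝 (φ x).1, g • φ.symm ((𝓒 m).symm y) ∈ φ.source := by
    have hc : ContinuousAt (fun y => g • φ.symm ((𝓒 m).symm y)) (φ x).1 :=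
      (continuousOn_chart_symm.continuousAt e1).const_smul g
    refine hc (φ.open_source.mem_nhds ?_)
    simpa [chart_symm_val hx] using hg
  filter_upwards [self_mem_nhdsWithin, nhdsWithin_le_nhds e1, nhdsWithin_le_nhds e2] with y h1 h2 h3
  exact ⟨⟨h1, h2⟩, h3⟩

/-- The chain rule at `ζ`, which both elements fix. Because derivatives are taken within the
quadrant, the composition formula is only needed near `ζ`. -/
theorem isotropyRep_mul (n) [ChartedSpace (EuclideanSpace ℝ (Fin n)) G]
    [LieGroup (𝓡 n) ∞ G] [ContMDiffSMul (𝓡 n) (𝓒 m) ∞ G M]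
    (hφ : φ ∈ IsManifold.maximalAtlas (𝓒 m) ∞ M) (hζ : ζ ∈ φ.source) {k l : G}
    (hk : k ∈ MulAction.stabilizer G ζ) (hl : l ∈ MulAction.stabilizer G ζ) :
    isotropyRep φ ζ (k * l) = (isotropyRep φ ζ k).comp (isotropyRep φ ζ l) := by
  have hk0 : k • ζ = ζ := hk
  have hl0 : l • ζ = ζ := hl
  have h1 := hasFDerivWithinAt_actionInChart n hφ hζ (g := k) (by rwa [hk0])
  have h2 := hasFDerivWithinAt_actionInChart n hφ hζ (g := l) (by rwa [hl0])
  have e : actionInChart φ l (φ ζ).1 = (φ ζ).1 := by rw [actionInChart_val _ _ hζ, hl0]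
  rw [← e] at h1
  have h3 := h1.comp (φ ζ).1 h2 (fun y _ => val_mem_range_quadrant _)
  refine HasFDerivWithinAt.fderivWithin ?_ (uniqueDiffWithinAt_quadrant ζ)
  refine HasFDerivWithinAt.congr_of_eventuallyEq h3 ?_ ?_
  rotate_left
  · change (φ (_ • _)).1 = (φ (k • φ.symm ((𝓒 m).symm (φ (l • φ.symm ((𝓒 m).symm (φ ζ).1))).1))).1
    rw [chart_symm_val hζ, hl0, chart_symm_val hζ, hk0, mul_smul, hl0, hk0]
  have ht : (𝓒 m).symm (φ ζ).1 ∈ φ.target := by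
    rw [symm_val_quadrant]; exact φ.map_source hζ
  have hc : ContinuousAt (fun y => l • φ.symm ((𝓒 m).symm y)) (φ ζ).1 :=
    (continuousOn_chart_symm.continuousAt (isOpen_symm_preimage_target.mem_nhds ht)).const_smul l
  have e2 : ∀ᶠ y in 𝓝 (φ ζ).1, l • φ.symm ((𝓒 m).symm y) ∈ φ.source := by
    refine hc (φ.open_source.mem_nhds ?_)
    simpa [chart_symm_val hζ, hl0] using hζ
  filter_upwards [nhdsWithin_le_nhds e2] with y hy
  change _ = (φ (k • φ.symm ((𝓒 m).symm (φ (l • φ.symm ((𝓒 m).symm y))).1))).1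
  rw [chart_symm_val hy, smul_smul]
  rfl

theorem isotropyRep_one (hζ : ζ ∈ φ.source) :
    isotropyRep φ ζ (1 : G) = ContinuousLinearMap.id ℝ _ := by
  refine HasFDerivWithinAt.fderivWithin ?_ (uniqueDiffWithinAt_quadrant ζ)
  refine (hasFDerivWithinAt_id _ _).congr_of_eventuallyEq ?_
    (by rw [actionInChart_val _ _ hζ, one_smul]; rfl)
  have ht : (𝓒 m).symm (φ ζ).1 ∈ φ.target := by
    rw [symm_val_quadrant]; exact φ.map_source hζ
  have e1 : ∀ᶠ y in 𝓝 (φ ζ).1, (𝓒 m).symm y ∈ φ.target := isOpen_symm_preimage_target.mem_nhds ht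
  filter_upwards [self_mem_nhdsWithin, nhdsWithin_le_nhds e1] with y h1 h2
  rw [actionInChart, one_smul, val_chart_symm h1 h2]
  rfl

theorem fderivWithin_inter_ball {ε : ℝ} (hε : 0 < ε)
    {f : EuclideanSpace ℝ (Fin m) → EuclideanSpace ℝ (Fin m)} {a : EuclideanSpace ℝ (Fin m)} :
    fderivWithin ℝ f (range (𝓒 m) ∩ Metric.ball a ε) a = fderivWithin ℝ f (range (𝓒 m)) a :=
  fderivWithin_inter (Metric.ball_mem_nhds a hε)

theorem uniqueDiffOn_quadrant_ball (a : EuclideanSpace ℝ (Fin m)) (ε : ℝ) :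
    UniqueDiffOn ℝ (range (𝓒 m) ∩ Metric.ball a ε) :=
  (𝓒 m).uniqueDiffOn.inter Metric.isOpen_ball

theorem contMDiffOn_isotropyRep {Ω : Set G} {ε : ℝ} (hε : 0 < ε)
    (h : ContMDiffOn ((𝓡 n).prod 𝓘(ℝ, EuclideanSpace ℝ (Fin m)))
      𝓘(ℝ, EuclideanSpace ℝ (Fin m)) ∞ (Function.uncurry (actionInChart (G := G) φ))
        (Ω ×ˢ (range (𝓒 m) ∩ Metric.ball (φ ζ).1 ε))) :
    ContMDiffOn (𝓡 n) 𝓘(ℝ, EuclideanSpace ℝ (Fin m) →L[ℝ] EuclideanSpace ℝ (Fin m)) ∞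
      (fun g : G => isotropyRep φ ζ g) Ω := by
  have h1 := contMDiffOn_fderivWithin_of_prod (uniqueDiffOn_quadrant_ball _ _) h
  have h2 := h1.comp (f := fun g : G => (g, (φ ζ).1)) (s := Ω)
    (contMDiffOn_id.prodMk contMDiffOn_const)
    (fun g hg => ⟨hg, val_mem_range_quadrant _, Metric.mem_ball_self hε⟩)
  refine h2.congr fun g _ => ?_
  exact (fderivWithin_inter_ball hε).symm

theorem continuous_isotropyRep (hφ : φ ∈ IsManifold.maximalAtlas (𝓒 m) ∞ M)
    (n) [ChartedSpace (EuclideanSpace ℝ (Fin n)) G]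
    [LieGroup (𝓡 n) ∞ G] [ContMDiffSMul (𝓡 n) (𝓒 m) ∞ G M] (hζ : ζ ∈ φ.source) :
    Continuous fun k : MulAction.stabilizer G ζ => isotropyRep φ ζ (k : G) := by
  obtain ⟨Ω, ε, -, hK, -, hbox, -, hsm⟩ := exists_smooth_tube (n := n) (G := G) hφ hζ univ_mem
  exact (contMDiffOn_isotropyRep hbox.pos hsm).continuousOn.comp_continuous continuous_subtype_val
    fun k => hK k k.2

/-- A continuous multiplicative nonnegative function on a compact group is trivial. -/
theorem eq_one_of_compact {K : Type*} [Group K] [TopologicalSpace K] [CompactSpace K] {a : K → ℝ}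
    (ha : Continuous a) (h1 : a 1 = 1) (hmul : ∀ k l, a (k * l) = a k * a l)
    (h0 : ∀ k, 0 ≤ a k) (k : K) : a k = 1 := by
  obtain ⟨C, hC⟩ := (isCompact_range ha).bddAbove
  have hle : ∀ k, a k ≤ 1 := by
    intro k
    by_contra hk
    rw [not_le] at hk
    obtain ⟨N, hN⟩ := pow_unbounded_of_one_lt C hk
    have hp : ∀ N : ℕ, a (k ^ N) = a k ^ N := by
      intro N
      induction N with
      | zero => simpa using h1
      | succ N ih => rw [pow_succ, hmul, ih, pow_succ]
    have := hC ⟨k ^ N, rfl⟩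
    rw [hp] at this
    linarith
  -- Both factors are at most 1 and their product is 1.
  have h2 : a k * a k⁻¹ = 1 := by rw [← hmul, mul_inv_cancel, h1]
  nlinarith [hle k, hle k⁻¹, h0 k, h0 k⁻¹]

/-- The isotropy representation is trivial on the coordinates vanishing at the point. -/
theorem isotropyRep_apply_of_zero (n) [ChartedSpace (EuclideanSpace ℝ (Fin n)) G]
    [LieGroup (𝓡 n) ∞ G] [ContMDiffSMul (𝓡 n) (𝓒 m) ∞ G M] (hM : IsManifoldWithCorners m M)
    (hbif : IsBoundaryIntersectionFree m G M)
    (hφ : φ ∈ IsManifold.maximalAtlas (𝓒 m) ∞ M) (hζ : ζ ∈ φ.source) {k : G}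
    (hk : k ∈ MulAction.stabilizer G ζ) {i : Fin m} (hi : (φ ζ).1 i = 0)
    (v : EuclideanSpace ℝ (Fin m)) : isotropyRep φ ζ k v i = v i := by
  obtain ⟨U, hU, hζU, hUs, hface⟩ := exists_nhds_zero_iff_smul hM hbif hφ hζ
  -- off-diagonal entries vanish
  have hoff : ∀ k ∈ MulAction.stabilizer G ζ, ∀ j, j ≠ i →
      isotropyRep φ ζ k (EuclideanSpace.single j (1 : ℝ)) i = 0 := by
    intro k hk j hj
    have hk0 : k • ζ = ζ := hk
    have hd := hasFDerivWithinAt_actionInChart n hφ hζ (g := k) (by rwa [hk0])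
    have hdi : HasFDerivWithinAt (fun y => actionInChart φ k y i)
        ((EuclideanSpace.proj (𝕜 := ℝ) i).comp (isotropyRep φ ζ k)) (range (𝓒 m)) (φ ζ).1 :=
      (EuclideanSpace.proj (𝕜 := ℝ) i).hasFDerivAt.comp_hasFDerivWithinAt _ hd
    -- For `j ≠ i` the `j`-th axis through `ζ` lies in the hyperplane of the `i`-th coordinate,
    -- which `k` preserves near `ζ`.
    refine apply_single_of_hasFDerivWithinAt (φ ζ).2 hdi j (c := 0) ?_
    have hc : ContinuousAt (fun t : ℝ => (φ ζ).1 + t • EuclideanSpace.single j (1 : ℝ)) 0 := by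
      fun_prop
    have ht : (𝓒 m).symm (φ ζ).1 ∈ φ.target := by
      rw [symm_val_quadrant]; exact φ.map_source hζ
    have hc2 : ContinuousAt (fun t : ℝ => φ.symm ((𝓒 m).symm ((φ ζ).1 +
        t • EuclideanSpace.single j (1 : ℝ)))) 0 := by
      refine ContinuousAt.comp (g := fun y => φ.symm ((𝓒 m).symm y)) ?_ hc
      rw [zero_smul, add_zero]
      exact continuousOn_chart_symm.continuousAt (isOpen_symm_preimage_target.mem_nhds ht)
    have e1 : ∀ᶠ t in 𝓝[≥] (0 : ℝ), φ.symm ((𝓒 m).symm ((φ ζ).1 +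
          t • EuclideanSpace.single j (1 : ℝ))) ∈ U := by
      refine nhdsWithin_le_nhds (hc2 (hU.mem_nhds ?_))
      simpa [chart_symm_val hζ] using hζU
    have e2 : ∀ᶠ t in 𝓝[≥] (0 : ℝ), k • φ.symm ((𝓒 m).symm ((φ ζ).1 +
          t • EuclideanSpace.single j (1 : ℝ))) ∈ U := by
      refine nhdsWithin_le_nhds ((hc2.const_smul k) (hU.mem_nhds ?_))
      simpa [chart_symm_val hζ, hk0] using hζU
    have e3 : ∀ᶠ t in 𝓝[≥] (0 : ℝ), (𝓒 m).symm ((φ ζ).1 +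
          t • EuclideanSpace.single j (1 : ℝ)) ∈ φ.target := by
      refine nhdsWithin_le_nhds (hc (isOpen_symm_preimage_target.mem_nhds ?_))
      simpa using ht
    filter_upwards [e1, e2, e3, single_direction_mem (φ ζ).2 j] with t h1 h2 h3 h4
    rw [actionInChart_val _ _ hζ, hk0, hi, actionInChart, (hface i hi k hk _ h1 h2).2]
    · simp
    · rw [val_chart_symm h4 h3]
      simp [hi, Ne.symm hj]
  have hdiag : ∀ k ∈ MulAction.stabilizer G ζ, ∀ v : EuclideanSpace ℝ (Fin m),
      isotropyRep φ ζ k v i = v i * isotropyRep φ ζ k (EuclideanSpace.single i (1 : ℝ)) i := by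
    intro k hk v
    have hv : v = ∑ j, v j • EuclideanSpace.single j (1 : ℝ) := by
      ext l
      simp [Pi.single_apply]
    conv_lhs => rw [hv]
    rw [map_sum, WithLp.ofLp_sum, Finset.sum_apply]
    simp only [map_smul, PiLp.smul_apply, smul_eq_mul]
    rw [Finset.sum_eq_single i]
    · intro j _ hj
      rw [hoff k hk j hj, mul_zero]
    · simp
  -- The `i`-th coordinate of the image starts at 0 and cannot become negative along the inward
  -- axis, so its difference quotients are nonnegative.
  have hnonneg : ∀ k ∈ MulAction.stabilizer G ζ,
      0 ≤ isotropyRep φ ζ k (EuclideanSpace.single i (1 : ℝ)) i := by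
    intro k hk
    have hk0 : k • ζ = ζ := hk
    have hd := hasFDerivWithinAt_actionInChart n hφ hζ (g := k) (by rwa [hk0])
    have hdi : HasFDerivWithinAt (fun y => actionInChart φ k y i)
        ((EuclideanSpace.proj (𝕜 := ℝ) i).comp (isotropyRep φ ζ k)) (range (𝓒 m)) (φ ζ).1 :=
      (EuclideanSpace.proj (𝕜 := ℝ) i).hasFDerivAt.comp_hasFDerivWithinAt _ hd
    set v : EuclideanSpace ℝ (Fin m) := EuclideanSpace.single i (1 : ℝ)
    have hline : HasDerivAt (fun t : ℝ => (φ ζ).1 + t • v) v 0 := by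
      simpa using ((hasDerivAt_id (0 : ℝ)).smul_const v).const_add (φ ζ).1
    have h2 : HasDerivWithinAt (fun t : ℝ => actionInChart φ k ((φ ζ).1 + t • v) i)
        (isotropyRep φ ζ k v i) ((fun t : ℝ => (φ ζ).1 + t • v) ⁻¹' range (𝓒 m)) 0 := by
      have hdi' : HasFDerivWithinAt (fun y => actionInChart φ k y i)
          ((EuclideanSpace.proj (𝕜 := ℝ) i).comp (isotropyRep φ ζ k)) (range (𝓒 m))
          ((fun t : ℝ => (φ ζ).1 + t • v) 0) := by simpa using hdi
      exact hdi'.comp_hasDerivWithinAt (0 : ℝ) hline.hasDerivWithinAt (mapsTo_preimage _ _)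
    have h3 : HasDerivWithinAt (fun t : ℝ => actionInChart φ k ((φ ζ).1 + t • v) i)
        (isotropyRep φ ζ k v i) (Ici 0) 0 :=
      h2.mono_of_mem_nhdsWithin (single_direction_mem (φ ζ).2 i)
    have h4 := (hasDerivWithinAt_iff_tendsto_slope' (by simp)).1 (h3.Ioi_of_Ici)
    refine ge_of_tendsto h4 ?_
    filter_upwards [self_mem_nhdsWithin] with t ht
    rw [slope_def_field]
    have e0 : actionInChart φ k ((φ ζ).1 + (0 : ℝ) • v) i = 0 := by
      rw [zero_smul, add_zero, actionInChart_val _ _ hζ, hk0, hi]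
    rw [e0]
    have ht' : (0 : ℝ) < t := ht
    have := (φ (k • φ.symm ((𝓒 m).symm ((φ ζ).1 + t • v)))).2 i
    have : 0 ≤ actionInChart φ k ((φ ζ).1 + t • v) i := this
    simp only [sub_zero]
    positivity
  have : CompactSpace (MulAction.stabilizer G ζ) :=
    isCompact_iff_compactSpace.1 (isClosed_stabilizer ζ).isCompact
  -- With the off-diagonal entries gone, the diagonal entry is a continuous nonnegative character of
  -- the compact stabilizer, hence constantly 1.
  have hone := eq_one_of_compact
    (K := MulAction.stabilizer G ζ) (a := fun k => isotropyRep φ ζ (k : G)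
      (EuclideanSpace.single i (1 : ℝ)) i) ?_ ?_ ?_ (fun k => hnonneg k k.2) ⟨k, hk⟩
  · rw [hdiag k hk, hone, mul_one]
  · have := continuous_isotropyRep (G := G) hφ n hζ
    fun_prop
  · simp [isotropyRep_one hζ]
  · intro k l
    rw [Subgroup.coe_mul, isotropyRep_mul n hφ hζ k.2 l.2, ContinuousLinearMap.comp_apply,
      hdiag k k.2, mul_comm]

end IsotropyRepresentation

/-! ### Averaging a chart over the stabilizer. -/

section Linearization

open MeasureTheory

set_option linter.unusedSectionVars false

variable {n m : ℕ} {G : Type*} [TopologicalSpace G] [ChartedSpace (EuclideanSpace ℝ (Fin n)) G]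
  [Group G] [LieGroup (𝓡 n) ∞ G] [IsTopologicalGroup G] [CompactSpace G]
  {M : Type*} [TopologicalSpace M] [T2Space M] [ChartedSpace (EuclideanQuadrant m) M]
  [IsManifold (𝓒 m) ∞ M] [MulAction G M] [ContMDiffSMul (𝓡 n) (𝓒 m) ∞ G M]
  [ContinuousSMul G M] {φ : OpenPartialHomeomorph M (EuclideanQuadrant m)} {ζ : M}

/-- The chart `φ`, averaged over the stabilizer of `ζ`. -/
noncomputable def averagedChart [MeasurableSpace (MulAction.stabilizer G ζ)]
    (φ : OpenPartialHomeomorph M (EuclideanQuadrant m))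
    (μ : Measure (MulAction.stabilizer G ζ)) (y : EuclideanSpace ℝ (Fin m)) :
    EuclideanSpace ℝ (Fin m) :=
  (φ ζ).1 + ∫ k, isotropyRep φ ζ (k : G) (actionInChart φ (k : G)⁻¹ y - (φ ζ).1) ∂μ

variable [MeasurableSpace (MulAction.stabilizer G ζ)] [BorelSpace (MulAction.stabilizer G ζ)]
  (μ : Measure (MulAction.stabilizer G ζ)) [IsProbabilityMeasure μ]

/-- Smoothness is stated for group elements in a subset of `G` and not on the stabilizer, so that
the smooth structure of `G` is the only one involved. -/
theorem contMDiffOn_averagedIntegrand {Ω : Set G} {ε : ℝ} (hε : 0 < ε) (hΩ' : ∀ g ∈ Ω, g⁻¹ ∈ Ω)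
    (h : ContMDiffOn ((𝓡 n).prod 𝓘(ℝ, EuclideanSpace ℝ (Fin m)))
      𝓘(ℝ, EuclideanSpace ℝ (Fin m)) ∞ (Function.uncurry (actionInChart (G := G) φ))
        (Ω ×ˢ (range (𝓒 m) ∩ Metric.ball (φ ζ).1 ε))) :
    ContMDiffOn ((𝓡 n).prod 𝓘(ℝ, EuclideanSpace ℝ (Fin m)))
      𝓘(ℝ, EuclideanSpace ℝ (Fin m)) ∞ (Function.uncurry fun (g : G) y =>
        isotropyRep φ ζ g (actionInChart φ g⁻¹ y - (φ ζ).1))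
        (Ω ×ˢ (range (𝓒 m) ∩ Metric.ball (φ ζ).1 ε)) := by
  have h1 : ContMDiffOn ((𝓡 n).prod 𝓘(ℝ, EuclideanSpace ℝ (Fin m)))
      𝓘(ℝ, EuclideanSpace ℝ (Fin m) →L[ℝ] EuclideanSpace ℝ (Fin m)) ∞
      (fun q : G × EuclideanSpace ℝ (Fin m) => isotropyRep φ ζ q.1)
        (Ω ×ˢ (range (𝓒 m) ∩ Metric.ball (φ ζ).1 ε)) :=
    (contMDiffOn_isotropyRep hε h).comp contMDiffOn_fst fun q hq => hq.1
  have h2 : ContMDiffOn ((𝓡 n).prod 𝓘(ℝ, EuclideanSpace ℝ (Fin m)))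
      𝓘(ℝ, EuclideanSpace ℝ (Fin m)) ∞
      (fun q : G × EuclideanSpace ℝ (Fin m) => actionInChart φ q.1⁻¹ q.2)
        (Ω ×ˢ (range (𝓒 m) ∩ Metric.ball (φ ζ).1 ε)) := by
    refine h.comp (f := fun q : G × EuclideanSpace ℝ (Fin m) => (q.1⁻¹, q.2)) ?_
      fun q hq => ⟨hΩ' _ hq.1, hq.2⟩
    exact (contMDiffOn_fst.inv).prodMk contMDiffOn_snd
  exact h1.clm_apply (h2.sub contMDiffOn_const)

theorem contDiffOn_averagedChart {Ω : Set G} {ε : ℝ} (hε : 0 < ε)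
    (hK : ∀ k ∈ MulAction.stabilizer G ζ, k ∈ Ω) (hΩ' : ∀ g ∈ Ω, g⁻¹ ∈ Ω)
    (h : ContMDiffOn ((𝓡 n).prod 𝓘(ℝ, EuclideanSpace ℝ (Fin m)))
      𝓘(ℝ, EuclideanSpace ℝ (Fin m)) ∞ (Function.uncurry (actionInChart (G := G) φ))
        (Ω ×ˢ (range (𝓒 m) ∩ Metric.ball (φ ζ).1 ε))) :
    ContDiffOn ℝ ∞ (averagedChart φ μ) (range (𝓒 m) ∩ Metric.ball (φ ζ).1 ε) := by
  have : CompactSpace (MulAction.stabilizer G ζ) :=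
    isCompact_iff_compactSpace.1 (isClosed_stabilizer ζ).isCompact
  have : IsManifold (𝓡 n) ∞ G := LieGroup.toContMDiffMul.toIsManifold
  refine contDiffOn_const.add (contDiffOn_infty.2 fun N => ?_)
  exact contDiffOn_integral_of_contMDiffOn μ (uniqueDiffOn_quadrant_ball _ _)
    ((𝓒 m).convex_range.inter (convex_ball _ _)) continuous_subtype_val (fun k => hK k k.2) N
    (contMDiffOn_averagedIntegrand hε hΩ' h)

theorem continuous_averagedIntegrand {Ω : Set G} {ε : ℝ} (hε : 0 < ε)
    (hK : ∀ k ∈ MulAction.stabilizer G ζ, k ∈ Ω) (hΩ' : ∀ g ∈ Ω, g⁻¹ ∈ Ω)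
    (h : ContMDiffOn ((𝓡 n).prod 𝓘(ℝ, EuclideanSpace ℝ (Fin m)))
      𝓘(ℝ, EuclideanSpace ℝ (Fin m)) ∞ (Function.uncurry (actionInChart (G := G) φ))
        (Ω ×ˢ (range (𝓒 m) ∩ Metric.ball (φ ζ).1 ε))) {y : EuclideanSpace ℝ (Fin m)}
    (hy : y ∈ range (𝓒 m) ∩ Metric.ball (φ ζ).1 ε) :
    Continuous fun k : MulAction.stabilizer G ζ =>
      isotropyRep φ ζ (k : G) (actionInChart φ (k : G)⁻¹ y - (φ ζ).1) :=
  (contMDiffOn_averagedIntegrand hε hΩ' h).continuousOn.comp_continuous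
    (f := fun k : MulAction.stabilizer G ζ => ((k : G), y)) (by fun_prop)
    fun k => ⟨hK k k.2, hy⟩

theorem averagedChart_self (hζ : ζ ∈ φ.source) : averagedChart φ μ (φ ζ).1 = (φ ζ).1 := by
  rw [averagedChart]
  have : ∀ k : MulAction.stabilizer G ζ, isotropyRep φ ζ (k : G)
      (actionInChart φ (k : G)⁻¹ (φ ζ).1 - (φ ζ).1) = 0 := by
    intro k
    have hk : (k : G)⁻¹ • ζ = ζ := (inv_mem k.2 : (k : G)⁻¹ ∈ MulAction.stabilizer G ζ)
    rw [actionInChart_val _ _ hζ, hk, sub_self, map_zero]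
  simp [this]

/-- The integrand for `k` has derivative `ρ(k) ρ(k⁻¹) = 1` at the base point, where `ρ` is the
isotropy representation, and a probability measure averages the identity to itself. -/
theorem hasFDerivWithinAt_averagedChart (hφ : φ ∈ IsManifold.maximalAtlas (𝓒 m) ∞ M)
    (hζ : ζ ∈ φ.source) {Ω : Set G} {ε : ℝ} (hε : 0 < ε)
    (hK : ∀ k ∈ MulAction.stabilizer G ζ, k ∈ Ω) (hΩ' : ∀ g ∈ Ω, g⁻¹ ∈ Ω)
    (h : ContMDiffOn ((𝓡 n).prod 𝓘(ℝ, EuclideanSpace ℝ (Fin m)))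
      𝓘(ℝ, EuclideanSpace ℝ (Fin m)) ∞ (Function.uncurry (actionInChart (G := G) φ))
        (Ω ×ˢ (range (𝓒 m) ∩ Metric.ball (φ ζ).1 ε))) :
    HasFDerivWithinAt (averagedChart φ μ) (ContinuousLinearMap.id ℝ _) (range (𝓒 m))
      (φ ζ).1 := by
  have : CompactSpace (MulAction.stabilizer G ζ) :=
    isCompact_iff_compactSpace.1 (isClosed_stabilizer ζ).isCompact
  have : IsManifold (𝓡 n) ∞ G := LieGroup.toContMDiffMul.toIsManifold
  have hs := contMDiffOn_averagedIntegrand hε hΩ' h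
  have hs' := contMDiffOn_fderivWithin_of_prod (uniqueDiffOn_quadrant_ball _ _) hs
  have hpm : (φ ζ).1 ∈ range (𝓒 m) ∩ Metric.ball (φ ζ).1 ε :=
    ⟨val_mem_range_quadrant _, Metric.mem_ball_self hε⟩
  have hmaps : MapsTo (fun q : MulAction.stabilizer G ζ × EuclideanSpace ℝ (Fin m) =>
      ((q.1 : G), q.2)) (univ ×ˢ (range (𝓒 m) ∩ Metric.ball (φ ζ).1 ε))
      (Ω ×ˢ (range (𝓒 m) ∩ Metric.ball (φ ζ).1 ε)) := fun q hq => ⟨hK _ q.1.2, hq.2⟩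
  have hcts : ContinuousOn (fun q : MulAction.stabilizer G ζ × EuclideanSpace ℝ (Fin m) =>
      ((q.1 : G), q.2)) (univ ×ˢ (range (𝓒 m) ∩ Metric.ball (φ ζ).1 ε)) := by fun_prop
  have key := hasFDerivWithinAt_integral_of_continuousOn μ
    (s := range (𝓒 m) ∩ Metric.ball (φ ζ).1 ε)
    (h := fun k : MulAction.stabilizer G ζ => fun y =>
      isotropyRep φ ζ (k : G) (actionInChart φ (k : G)⁻¹ y - (φ ζ).1))
    (h' := fun k : MulAction.stabilizer G ζ => fun y => fderivWithin ℝ (fun y =>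
      isotropyRep φ ζ (k : G) (actionInChart φ (k : G)⁻¹ y - (φ ζ).1))
      (range (𝓒 m) ∩ Metric.ball (φ ζ).1 ε) y)
    ((𝓒 m).convex_range.inter (convex_ball _ _)) ?_ (hs.continuousOn.comp hcts hmaps)
    (hs'.continuousOn.comp hcts hmaps) hpm
  · have hid : ∀ k : MulAction.stabilizer G ζ, fderivWithin ℝ (fun y =>
      isotropyRep φ ζ (k : G) (actionInChart φ (k : G)⁻¹ y - (φ ζ).1))
      (range (𝓒 m) ∩ Metric.ball (φ ζ).1 ε) (φ ζ).1 = ContinuousLinearMap.id ℝ _ := by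
      intro k
      have hk0 : (k : G)⁻¹ • ζ = ζ := (inv_mem k.2 : (k : G)⁻¹ ∈ MulAction.stabilizer G ζ)
      rw [fderivWithin_inter_ball hε]
      refine HasFDerivWithinAt.fderivWithin ?_ (uniqueDiffWithinAt_quadrant ζ)
      have h1 := (hasFDerivWithinAt_actionInChart n hφ hζ (g := (k : G)⁻¹)
        (by rwa [hk0])).sub_const (φ ζ).1
      have h2 := (isotropyRep φ ζ (k : G)).hasFDerivAt.comp_hasFDerivWithinAt _ h1
      rwa [← isotropyRep_mul n hφ hζ k.2 (inv_mem k.2), mul_inv_cancel, isotropyRep_one hζ] at h2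
    simp only [hid, integral_const, probReal_univ, one_smul] at key
    have key2 := key.mono_of_mem_nhdsWithin
      (inter_mem_nhdsWithin (range (𝓒 m)) (Metric.ball_mem_nhds (φ ζ).1 hε))
    exact key2.const_add _
  · intro k y hy
    have h1 : ContMDiffWithinAt 𝓘(ℝ, EuclideanSpace ℝ (Fin m)) 𝓘(ℝ, EuclideanSpace ℝ (Fin m)) ∞
        (fun y => isotropyRep φ ζ (k : G) (actionInChart φ (k : G)⁻¹ y - (φ ζ).1))
        (range (𝓒 m) ∩ Metric.ball (φ ζ).1 ε) y :=
      (hs ((k : G), y) ⟨hK k k.2, hy⟩).comp (f := fun y => ((k : G), y)) _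
        (contMDiffWithinAt_const.prodMk contMDiffWithinAt_id) (fun y hy => ⟨hK k k.2, hy⟩)
    exact (h1.contDiffWithinAt.differentiableWithinAt (by simp)).hasFDerivWithinAt

/-- A chart around `ζ` in which the stabilizer of `ζ` acts by affine maps. -/
def IsLinearChart (G : Type*) {M : Type*} [TopologicalSpace M] [Group G] [MulAction G M]
    (φ : OpenPartialHomeomorph M (EuclideanQuadrant m)) (ζ : M) : Prop :=
  ζ ∈ φ.source ∧ ∀ k ∈ MulAction.stabilizer G ζ, ∀ x ∈ φ.source, k • x ∈ φ.source ∧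
    (φ (k • x)).1 = (φ ζ).1 + isotropyRep φ ζ k ((φ x).1 - (φ ζ).1)

/-- Replacing `k` by `l k` in the integral turns `k⁻¹ l` into `k⁻¹` and releases a factor `ρ(l)`;
left invariance of the measure is what allows it. -/
theorem averagedChart_smul [μ.IsMulLeftInvariant]
    (hφ : φ ∈ IsManifold.maximalAtlas (𝓒 m) ∞ M)
    (hζ : ζ ∈ φ.source) {Ω : Set G} {ε : ℝ} (hε : 0 < ε)
    (hK : ∀ k ∈ MulAction.stabilizer G ζ, k ∈ Ω) (hΩ' : ∀ g ∈ Ω, g⁻¹ ∈ Ω)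
    (h : ContMDiffOn ((𝓡 n).prod 𝓘(ℝ, EuclideanSpace ℝ (Fin m)))
      𝓘(ℝ, EuclideanSpace ℝ (Fin m)) ∞ (Function.uncurry (actionInChart (G := G) φ))
        (Ω ×ˢ (range (𝓒 m) ∩ Metric.ball (φ ζ).1 ε))) {x : M} (hx : x ∈ φ.source)
    (hxb : (φ x).1 ∈ Metric.ball (φ ζ).1 ε) {l : G} (hl : l ∈ MulAction.stabilizer G ζ)
    (hlx : l • x ∈ φ.source) :
    averagedChart φ μ (φ (l • x)).1 =
      (φ ζ).1 + isotropyRep φ ζ l (averagedChart φ μ (φ x).1 - (φ ζ).1) := by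
  have : CompactSpace (MulAction.stabilizer G ζ) :=
    isCompact_iff_compactSpace.1 (isClosed_stabilizer ζ).isCompact
  rw [averagedChart, averagedChart, add_sub_cancel_left, ← ContinuousLinearMap.integral_comp_comm,
    ← integral_mul_left_eq_self _ (⟨l, hl⟩ : MulAction.stabilizer G ζ)]
  · congr 2
    ext1 k
    rw [actionInChart_val _ _ hlx, actionInChart_val _ _ hx, Subgroup.coe_mul,
      isotropyRep_mul n hφ hζ hl k.2]
    simp [smul_smul]
  · exact integrable_of_continuous_compactSpace μ
      (continuous_averagedIntegrand hε hK hΩ' h ⟨val_mem_range_quadrant _, hxb⟩)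

/-- On a coordinate vanishing at `ζ` the representation is trivial, so averaging reduces to the
plain mean of the translated coordinate. This is why nonnegativity and zeros survive. -/
theorem averagedChart_apply_of_zero (hM : IsManifoldWithCorners m M)
    (hbif : IsBoundaryIntersectionFree m G M) (hφ : φ ∈ IsManifold.maximalAtlas (𝓒 m) ∞ M)
    (hζ : ζ ∈ φ.source) {Ω : Set G} {ε : ℝ} (hε : 0 < ε)
    (hK : ∀ k ∈ MulAction.stabilizer G ζ, k ∈ Ω) (hΩ' : ∀ g ∈ Ω, g⁻¹ ∈ Ω)
    (h : ContMDiffOn ((𝓡 n).prod 𝓘(ℝ, EuclideanSpace ℝ (Fin m)))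
      𝓘(ℝ, EuclideanSpace ℝ (Fin m)) ∞ (Function.uncurry (actionInChart (G := G) φ))
        (Ω ×ˢ (range (𝓒 m) ∩ Metric.ball (φ ζ).1 ε))) {y : EuclideanSpace ℝ (Fin m)}
    (hy : y ∈ range (𝓒 m) ∩ Metric.ball (φ ζ).1 ε) {i : Fin m} (hi : (φ ζ).1 i = 0) :
    averagedChart φ μ y i =
      ∫ k : MulAction.stabilizer G ζ, actionInChart φ (k : G)⁻¹ y i ∂μ := by
  have : CompactSpace (MulAction.stabilizer G ζ) :=
    isCompact_iff_compactSpace.1 (isClosed_stabilizer ζ).isCompact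
  rw [averagedChart, PiLp.add_apply, hi, zero_add]
  change EuclideanSpace.proj (𝕜 := ℝ) i (∫ k, _ ∂μ) = _
  rw [← ContinuousLinearMap.integral_comp_comm]
  · congr 1
    ext1 k
    change isotropyRep φ ζ (k : G) (actionInChart φ (k : G)⁻¹ y - (φ ζ).1) i = _
    rw [isotropyRep_apply_of_zero n hM hbif hφ hζ k.2 hi, PiLp.sub_apply, hi, sub_zero]
  · exact integrable_of_continuous_compactSpace μ (continuous_averagedIntegrand hε hK hΩ' h hy)

end Linearization

/-! ### Existence of linear charts. -/

section LinearChart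

open MeasureTheory

set_option linter.unusedSectionVars false

variable {n m : ℕ} {G : Type*} [TopologicalSpace G] [ChartedSpace (EuclideanSpace ℝ (Fin n)) G]
  [Group G] [LieGroup (𝓡 n) ∞ G] [IsTopologicalGroup G] [CompactSpace G]
  {M : Type*} [TopologicalSpace M] [T2Space M] [ChartedSpace (EuclideanQuadrant m) M]
  [IsManifold (𝓒 m) ∞ M] [MulAction G M] [ContMDiffSMul (𝓡 n) (𝓒 m) ∞ G M]
  [ContinuousSMul G M]

/-- The averaged chart intertwines the action with its linearization and has derivative the identity
at the base point. Means of nonnegative coordinates keep it in the quadrant, so it is an admissible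
change of coordinates; restricting to a neighbourhood invariant under the stabilizer makes the
formula hold on the whole domain. -/
theorem exists_isLinearChart (n) [ChartedSpace (EuclideanSpace ℝ (Fin n)) G]
    [LieGroup (𝓡 n) ∞ G] [ContMDiffSMul (𝓡 n) (𝓒 m) ∞ G M] (hM : IsManifoldWithCorners m M)
    (hbif : IsBoundaryIntersectionFree m G M) (ζ : M) :
    ∃ φ ∈ IsManifold.maximalAtlas (𝓒 m) ∞ M, IsLinearChart G φ ζ := by
  set φ := chartAt (EuclideanQuadrant m) ζ with hφdef
  have hφ : φ ∈ IsManifold.maximalAtlas (𝓒 m) ∞ M := IsManifold.chart_mem_maximalAtlas _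
  have hζ : ζ ∈ φ.source := mem_chart_source _ _
  obtain ⟨U, hU, hζU, hUs, hface⟩ := exists_nhds_zero_iff_smul hM hbif hφ hζ
  obtain ⟨Ω, ε, hΩo, hK, hΩ', hbox, hact, hsm⟩ :=
    exists_smooth_tube (n := n) (G := G) hφ hζ (hU.mem_nhds hζU)
  have hε := hbox.pos
  have : CompactSpace (MulAction.stabilizer G ζ) :=
    isCompact_iff_compactSpace.1 (isClosed_stabilizer ζ).isCompact
  let _ : MeasurableSpace (MulAction.stabilizer G ζ) := borel _
  have : BorelSpace (MulAction.stabilizer G ζ) := ⟨rfl⟩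
  let μ : Measure (MulAction.stabilizer G ζ) := Measure.haarMeasure ⊤
  have : IsProbabilityMeasure μ := ⟨Measure.haarMeasure_self⟩
  set Θ := averagedChart φ μ with hΘ
  have hsmooth : ContDiffOn ℝ ∞ Θ _ := contDiffOn_averagedChart μ hε hK hΩ' hsm
  have hder := hasFDerivWithinAt_averagedChart μ hφ hζ hε hK hΩ' hsm
  have hself : Θ (φ ζ).1 = (φ ζ).1 := averagedChart_self μ hζ
  have hzero : ∀ {y}, y ∈ range (𝓒 m) ∩ Metric.ball (φ ζ).1 ε → ∀ {i}, (φ ζ).1 i = 0 →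
      Θ y i = ∫ k : MulAction.stabilizer G ζ, actionInChart φ (k : G)⁻¹ y i ∂μ :=
    fun hy _ hi => averagedChart_apply_of_zero μ hM hbif hφ hζ hε hK hΩ' hsm hy hi
  -- positivity of the remaining coordinates
  obtain ⟨δ, hδ, hδpos⟩ : ∃ δ > 0, ∀ y ∈ range (𝓒 m) ∩ Metric.ball (φ ζ).1 δ,
      ∀ i, (φ ζ).1 i ≠ 0 → 0 < Θ y i := by
    have : ∀ᶠ y in 𝓝[range (𝓒 m)] (φ ζ).1, ∀ i, (φ ζ).1 i ≠ 0 → 0 < Θ y i := by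
      simp only [eventually_all]
      intro i hi
      have hc : ContinuousWithinAt (fun y => Θ y i) (range (𝓒 m)) (φ ζ).1 :=
        (EuclideanSpace.proj (𝕜 := ℝ) i).continuous.continuousAt.comp_continuousWithinAt
          hder.continuousWithinAt
      refine hc.eventually_const_lt ?_
      change 0 < Θ (φ ζ).1 i
      rw [hself]
      exact lt_of_le_of_ne ((φ ζ).2 i) (Ne.symm hi)
    obtain ⟨δ, hδ, h⟩ := Metric.mem_nhdsWithin_iff.1 this
    exact ⟨δ, hδ, fun y hy => h ⟨hy.2, hy.1⟩⟩
  set O := Metric.ball (φ ζ).1 (min δ ε) with hO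
  have hOε : O ⊆ Metric.ball (φ ζ).1 ε := Metric.ball_subset_ball (min_le_right _ _)
  have hOδ : O ⊆ Metric.ball (φ ζ).1 δ := Metric.ball_subset_ball (min_le_left _ _)
  have hm : MapsTo Θ (range (𝓒 m) ∩ O) (range (𝓒 m)) := by
    rintro y ⟨hy, hyO⟩
    rw [mem_range_quadrant]
    intro i
    by_cases hi : (φ ζ).1 i = 0
    · rw [hzero ⟨hy, hOε hyO⟩ hi]
      exact integral_nonneg fun k => (φ ((k : G)⁻¹ • φ.symm ((𝓒 m).symm y))).2 i
    · exact (hδpos y ⟨hy, hOδ hyO⟩ i hi).le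
  have hb : MapsTo Θ (frontier (range (𝓒 m)) ∩ O) (frontier (range (𝓒 m))) := by
    rintro y ⟨hy, hyO⟩
    have hyr : y ∈ range (𝓒 m) := (𝓒 m).isClosed_range.frontier_subset hy
    rw [mem_frontier_range_quadrant] at hy ⊢
    refine ⟨mem_range_quadrant.1 (hm ⟨hyr, hyO⟩), ?_⟩
    obtain ⟨-, i, hi⟩ := hy
    have hi0 : (φ ζ).1 i = 0 := by
      by_contra hne
      exact (hbox.coord y (hOε hyO) i hne).ne' hi
    refine ⟨i, ?_⟩
    rw [hzero ⟨hyr, hOε hyO⟩ hi0]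
    -- The stabilizer preserves the face, so every translate of a point on it still has vanishing
    -- `i`-th coordinate and the mean is 0.
    have : ∀ k : MulAction.stabilizer G ζ, actionInChart φ (k : G)⁻¹ y i = 0 := by
      intro k
      refine (hface i hi0 _ (inv_mem k.2) _ (hbox.mem y hyr (hOε hyO))
        (hact _ (hK _ (inv_mem k.2)) y ⟨hyr, hOε hyO⟩).2).2 ?_
      rw [val_chart_symm hyr (hbox.target y hyr (hOε hyO)), hi]
    simp [this]
  obtain ⟨θ, hθ1, hθ2, hθp, hθ⟩ := exists_quadrant_openPartialHomeomorph Metric.isOpen_ball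
    (p := φ ζ) (Metric.mem_ball_self (lt_min hδ hε)) (hsmooth.mono fun y hy => ⟨hy.1, hOε hy.2⟩)
    hm hb (A := ContinuousLinearEquiv.refl ℝ _) hder
  have hφ' := trans_mem_maximalAtlas hφ hθ1 hθ2
  have hζ' : ζ ∈ (φ.trans θ).source := by
    rw [OpenPartialHomeomorph.trans_source]
    exact ⟨hζ, hθp⟩
  obtain ⟨V, hVo, hζV, hVs, hVinv⟩ := exists_invariant_nhds (G := G)
    ((φ.trans θ).open_source.mem_nhds hζ')
  have hsrc : ((φ.trans θ).restr V).source = V := by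
    rw [OpenPartialHomeomorph.restr_source, hVo.interior_eq, inter_eq_right.2 hVs]
  have hval : ∀ x ∈ V, ((φ.trans θ).restr V x).1 = Θ (φ x).1 := by
    intro x hx
    have := hVs hx
    rw [OpenPartialHomeomorph.trans_source] at this
    exact (hθ _ this.2).2
  have hxs : ∀ x ∈ V, x ∈ φ.source ∧ (φ x).1 ∈ O := by
    intro x hx
    have := hVs hx
    rw [OpenPartialHomeomorph.trans_source] at this
    exact ⟨this.1, (hθ _ this.2).1⟩
  set φ₁ := (φ.trans θ).restr V with hφ₁
  have hφ₁m : φ₁ ∈ IsManifold.maximalAtlas (𝓒 m) ∞ M := restr_mem_maximalAtlas_quadrant hφ' hVo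
  have hp₁ : (φ₁ ζ).1 = (φ ζ).1 := by rw [hval ζ hζV, hself]
  have heq : ∀ k ∈ MulAction.stabilizer G ζ, ∀ x ∈ V, (φ₁ (k • x)).1 =
      (φ₁ ζ).1 + isotropyRep φ ζ k ((φ₁ x).1 - (φ₁ ζ).1) := by
    intro k hk x hx
    rw [hval _ (hVinv k hk x hx), hval x hx, hp₁]
    exact averagedChart_smul μ hφ hζ hε hK hΩ' hsm (hxs x hx).1 (hOε (hxs x hx).2) hk
      (hxs _ (hVinv k hk x hx)).1
  refine ⟨φ₁, hφ₁m, by rwa [hsrc], fun k hk x hx => ?_⟩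
  rw [hsrc] at hx
  refine ⟨by rw [hsrc]; exact hVinv k hk x hx, ?_⟩
  rw [heq k hk x hx]
  -- `IsLinearChart` refers to the representation computed in the new chart; it agrees with the old
  -- one because the action is now affine with that linear part.
  suffices hrep : isotropyRep φ₁ ζ k = isotropyRep φ ζ k by rw [hrep]
  refine HasFDerivWithinAt.fderivWithin ?_ (uniqueDiffWithinAt_quadrant ζ)
  have hk0 : k • ζ = ζ := hk
  have h1 : HasFDerivWithinAt (fun y => (φ₁ ζ).1 + isotropyRep φ ζ k (y - (φ₁ ζ).1))
      (isotropyRep φ ζ k) (range (𝓒 m)) (φ₁ ζ).1 := by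
    have h0 : HasFDerivWithinAt (fun y => y - (φ₁ ζ).1) (ContinuousLinearMap.id ℝ _)
        (range (𝓒 m)) (φ₁ ζ).1 := (hasFDerivWithinAt_id _ _).sub_const _
    have h1 := (isotropyRep φ ζ k).hasFDerivAt.comp_hasFDerivWithinAt (φ₁ ζ).1 h0
    exact h1.const_add (φ₁ ζ).1
  have hζ₁ : ζ ∈ φ₁.source := by rwa [hsrc]
  refine h1.congr_of_eventuallyEq ?_ ?_
  · have ht : (𝓒 m).symm (φ₁ ζ).1 ∈ φ₁.target := by
      rw [symm_val_quadrant]; exact φ₁.map_source hζ₁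
    filter_upwards [self_mem_nhdsWithin,
      nhdsWithin_le_nhds ((isOpen_symm_preimage_target (φ := φ₁)).mem_nhds ht)] with y h1 h2
    have hs : φ₁.symm ((𝓒 m).symm y) ∈ V := by
      rw [← hsrc]; exact φ₁.map_target h2
    rw [actionInChart, heq k hk _ hs, val_chart_symm h1 h2]
  · rw [actionInChart_val _ _ hζ₁, hk0]
    simp

end LinearChart

/-! ### The orbit map and its derivative. -/

section OrbitMap

set_option linter.unusedSectionVars false

variable {n m : ℕ} {G : Type*} [TopologicalSpace G] [ChartedSpace (EuclideanSpace ℝ (Fin n)) G]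
  [Group G] [LieGroup (𝓡 n) ∞ G] [IsTopologicalGroup G] [CompactSpace G]
  {M : Type*} [TopologicalSpace M] [T2Space M] [ChartedSpace (EuclideanQuadrant m) M]
  [IsManifold (𝓒 m) ∞ M] [MulAction G M] [ContMDiffSMul (𝓡 n) (𝓒 m) ∞ G M]
  [ContinuousSMul G M] {φ φ' : OpenPartialHomeomorph M (EuclideanQuadrant m)} {ζ ζ' : M}

theorem contMDiffOn_orbit (hφ : φ ∈ IsManifold.maximalAtlas (𝓒 m) ∞ M) (ζ : M) :
    ContMDiffOn (𝓡 n) 𝓘(ℝ, 𝔼 m) ∞ (fun g : G => (φ (g • ζ)).1) {g | g • ζ ∈ φ.source} := by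
  refine (contMDiffOn_val_chart hφ).comp (f := fun g : G => g • ζ) ?_ (fun g hg => hg)
  exact (contMDiffOn_id (I := 𝓡 n)).smul (I' := 𝓒 m) contMDiffOn_const

/-- The derivative at the identity of the orbit map of a point, in a chart. -/
noncomputable def orbitDeriv (n : ℕ) {m : ℕ} (G : Type*) [TopologicalSpace G]
    [ChartedSpace (EuclideanSpace ℝ (Fin n)) G] [Group G] {M : Type*} [TopologicalSpace M]
    [MulAction G M] (φ : OpenPartialHomeomorph M (EuclideanQuadrant m)) (ζ : M) :
    𝔼 n →L[ℝ] 𝔼 m :=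
  mfderiv (𝓡 n) 𝓘(ℝ, 𝔼 m) (fun g : G => (φ (g • ζ)).1) 1

theorem hasMFDerivAt_orbit (hφ : φ ∈ IsManifold.maximalAtlas (𝓒 m) ∞ M) (hζ : ζ ∈ φ.source) :
    HasMFDerivAt (𝓡 n) 𝓘(ℝ, 𝔼 m) (fun g : G => (φ (g • ζ)).1) 1 (orbitDeriv n G φ ζ) := by
  have hop : IsOpen {g : G | g • ζ ∈ φ.source} := φ.open_source.preimage (by fun_prop)
  have := (contMDiffOn_orbit (n := n) (G := G) hφ ζ).contMDiffAt (x := 1)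
    (hop.mem_nhds (by simpa using hζ))
  exact (this.mdifferentiableAt (by simp)).hasMFDerivAt

section Chain

variable {EX HX X F : Type*} [NormedAddCommGroup EX] [NormedSpace ℝ EX] [TopologicalSpace HX]
  {J : ModelWithCorners ℝ EX HX} [TopologicalSpace X] [ChartedSpace HX X]
  [NormedAddCommGroup F] [NormedSpace ℝ F]

/-- The chain rule in the form used below: curves of group elements through 1 act on `ζ`, and `h`
need only be differentiable within the quadrant. -/
theorem hasMFDerivAt_comp_orbit (hφ : φ ∈ IsManifold.maximalAtlas (𝓒 m) ∞ M) (hζ : ζ ∈ φ.source)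
    {f : X → G} {x₀ : X} (hf0 : f x₀ = 1) {f' : EX →L[ℝ] 𝔼 n}
    (hf : HasMFDerivAt J (𝓡 n) f x₀ f') {h : 𝔼 m → F} {h' : 𝔼 m →L[ℝ] F}
    (hh : HasFDerivWithinAt h h' (range (𝓒 m)) (φ ζ).1) :
    HasMFDerivAt J 𝓘(ℝ, F) (fun x => h (φ (f x • ζ)).1) x₀
      (h'.comp ((orbitDeriv n G φ ζ).comp f')) := by
  have h1 : HasMFDerivAt (𝓡 n) 𝓘(ℝ, 𝔼 m) (fun g : G => (φ (g • ζ)).1) (f x₀)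
      (orbitDeriv n G φ ζ) := by
    rw [hf0]; exact hasMFDerivAt_orbit hφ hζ
  have h2 := h1.comp x₀ hf
  have h3 : HasMFDerivWithinAt 𝓘(ℝ, 𝔼 m) 𝓘(ℝ, F) h (range (𝓒 m)) (φ (f x₀ • ζ)).1 h' := by
    rw [hf0, one_smul]
    exact hh.hasMFDerivWithinAt
  exact hasMFDerivWithinAt_univ.1 (HasMFDerivWithinAt.comp (u := range (𝓒 m)) x₀ h3
    (hasMFDerivWithinAt_univ.2 h2) (fun x _ => val_mem_range_quadrant _))

theorem hasFDerivAt_comp_orbit (hφ : φ ∈ IsManifold.maximalAtlas (𝓒 m) ∞ M) (hζ : ζ ∈ φ.source)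
    {f : EX → G} {x₀ : EX} (hf0 : f x₀ = 1) {f' : EX →L[ℝ] 𝔼 n}
    (hf : HasMFDerivAt 𝓘(ℝ, EX) (𝓡 n) f x₀ f') {h : 𝔼 m → F} {h' : 𝔼 m →L[ℝ] F}
    (hh : HasFDerivWithinAt h h' (range (𝓒 m)) (φ ζ).1) :
    HasFDerivAt (fun x => h (φ (f x • ζ)).1) (h'.comp ((orbitDeriv n G φ ζ).comp f')) x₀ :=
  (hasMFDerivAt_comp_orbit hφ hζ hf0 hf hh).hasFDerivAt

end Chain

theorem hasMFDerivAt_extChartAt_symm_self {EX HX X : Type*} [NormedAddCommGroup EX]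
    [NormedSpace ℝ EX] [TopologicalSpace HX] {J : ModelWithCorners ℝ EX HX} [J.Boundaryless]
    [TopologicalSpace X] [ChartedSpace HX X] (x : X) :
    HasMFDerivAt 𝓘(ℝ, EX) J (extChartAt J x).symm (extChartAt J x x)
      (ContinuousLinearMap.id ℝ EX) := by
  refine ⟨continuousAt_extChartAt_symm x, ?_⟩
  have e : writtenInExtChartAt 𝓘(ℝ, EX) J (extChartAt J x x) (extChartAt J x).symm =
      extChartAt J x ∘ (extChartAt J x).symm := by
    rw [writtenInExtChartAt, extChartAt_to_inv]
    rfl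
  rw [e]
  change HasFDerivWithinAt _ _ _ (extChartAt J x x)
  refine (hasFDerivWithinAt_id _ _).congr_of_eventuallyEq (nhdsWithin_le_nhds ?_) (by simp)
  filter_upwards [(isOpen_extChartAt_target (I := J) x).mem_nhds
    (mem_extChartAt_target (I := J) x)] with y hy
  exact (extChartAt J x).right_inv hy

/-- Along the orbit the `i`-th coordinate is nonnegative near `ζ` and vanishes there, and `G` has no
boundary: a local minimum. So orbits are tangent to every face they touch. -/
theorem orbitDeriv_apply_of_zero (hφ : φ ∈ IsManifold.maximalAtlas (𝓒 m) ∞ M) (hζ : ζ ∈ φ.source)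
    {i : Fin m} (hi : (φ ζ).1 i = 0) (v : 𝔼 n) : orbitDeriv n G φ ζ v i = 0 := by
  set κ := extChartAt (𝓡 n) (1 : G)
  have hκ : HasMFDerivAt 𝓘(ℝ, 𝔼 n) (𝓡 n) κ.symm (κ 1) (ContinuousLinearMap.id ℝ (𝔼 n)) :=
    hasMFDerivAt_extChartAt_symm_self 1
  have h1 := (hasMFDerivAt_comp_orbit (G := G) hφ hζ (by simp [κ]) hκ
    (EuclideanSpace.proj (𝕜 := ℝ) i).hasFDerivWithinAt).hasFDerivAt
  have hmin : IsLocalMin (fun u => EuclideanSpace.proj (𝕜 := ℝ) i (φ (κ.symm u • ζ)).1) (κ 1) := by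
    refine Eventually.of_forall fun u => ?_
    have e : (φ (κ.symm (κ 1) • ζ)).1 i = 0 := by simp [κ, hi]
    change (φ (κ.symm (κ 1) • ζ)).1 i ≤ _
    rw [e]
    exact (φ (κ.symm u • ζ)).2 i
  have h2 := hmin.hasFDerivAt_eq_zero h1
  exact congrArg (fun L => L v) h2

/-- The derivative at the identity of conjugation by a group element. -/
noncomputable def conjDeriv (n : ℕ) {G : Type*} [TopologicalSpace G]
    [ChartedSpace (EuclideanSpace ℝ (Fin n)) G] [Group G] (k : G) : 𝔼 n →L[ℝ] 𝔼 n :=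
  mfderiv (𝓡 n) (𝓡 n) (fun g : G => k * g * k⁻¹) 1

theorem hasMFDerivAt_conj (k : G) :
    HasMFDerivAt (𝓡 n) (𝓡 n) (fun g : G => k * g * k⁻¹) 1 (conjDeriv n k) := by
  have : ContMDiff (𝓡 n) (𝓡 n) ∞ (fun g : G => k * g * k⁻¹) :=
    (contMDiff_const.mul contMDiff_id).mul contMDiff_const
  exact ((this 1).mdifferentiableAt (by simp)).hasMFDerivAt

theorem eventually_smul_mem_source (hζ : ζ ∈ φ.source) : ∀ᶠ g in 𝓝 (1 : G), g • ζ ∈ φ.source := by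
  have hop : IsOpen {g : G | g • ζ ∈ φ.source} := φ.open_source.preimage (by fun_prop)
  exact hop.mem_nhds (by simpa using hζ)

/-- Differentiate `k g ζ = (k g k⁻¹) ζ` at `g = 1`. In particular the tangent space of the orbit is
invariant. -/
theorem isotropyRep_comp_orbitDeriv (hφ : φ ∈ IsManifold.maximalAtlas (𝓒 m) ∞ M)
    (hζ : ζ ∈ φ.source) {k : G} (hk : k ∈ MulAction.stabilizer G ζ) :
    (isotropyRep φ ζ k).comp (orbitDeriv n G φ ζ) = (orbitDeriv n G φ ζ).comp (conjDeriv n k) := by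
  have hk0 : k • ζ = ζ := hk
  have hk1 : k⁻¹ • ζ = ζ := (inv_mem hk : k⁻¹ ∈ MulAction.stabilizer G ζ)
  have h1 := hasMFDerivAt_comp_orbit (n := n) hφ hζ (f := fun g : G => g) rfl
    (hasMFDerivAt_id (I := 𝓡 n) (1 : G))
    (hasFDerivWithinAt_actionInChart n hφ hζ (g := k) (by rwa [hk0]))
  have h2 := hasMFDerivAt_comp_orbit (n := n) hφ hζ (f := fun g : G => k * g * k⁻¹) (by simp)
    (hasMFDerivAt_conj k) (h := id) (hasFDerivWithinAt_id _ _)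
  have h3 := h2.congr_of_eventuallyEq (f₁ := fun g : G => actionInChart φ k (φ (g • ζ)).1) ?_
  · exact hasMFDerivAt_unique h1 h3
  · filter_upwards [eventually_smul_mem_source hζ] with g hg
    rw [actionInChart_val _ _ hg, mul_smul, mul_smul, hk1]
    rfl

theorem finrank_range_comp_le {E₁ E₂ E₃ E₄ : Type*} [AddCommGroup E₁] [Module ℝ E₁]
    [AddCommGroup E₂] [Module ℝ E₂] [AddCommGroup E₃] [Module ℝ E₃]
    [FiniteDimensional ℝ E₃] [AddCommGroup E₄] [Module ℝ E₄] (A : E₃ →ₗ[ℝ] E₄)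
    (D : E₂ →ₗ[ℝ] E₃) (B : E₁ →ₗ[ℝ] E₂) :
    Module.finrank ℝ (LinearMap.range (A ∘ₗ D ∘ₗ B)) ≤ Module.finrank ℝ (LinearMap.range D) := by
  have h1 : LinearMap.range (A ∘ₗ D ∘ₗ B) ≤ (LinearMap.range D).map A := by
    rintro _ ⟨x, rfl⟩
    exact ⟨D (B x), ⟨B x, rfl⟩, rfl⟩
  exact (Submodule.finrank_mono h1).trans (Submodule.finrank_map_le _ _)

/-- An orbit is locally the image of a smooth map defined on the tangent space of the orbit. -/
theorem exists_orbit_factorization (hφ : φ ∈ IsManifold.maximalAtlas (𝓒 m) ∞ M)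
    (hζ : ζ ∈ φ.source) {V : Submodule ℝ (𝔼 m)}
    (hV : LinearMap.range (orbitDeriv n G φ ζ : 𝔼 n →ₗ[ℝ] 𝔼 m) = V) (P : 𝔼 m →L[ℝ] V)
    (hP : ∀ v : V, P v = v) :
    ∃ (B : Set V) (c : V → G), IsOpen B ∧ 0 ∈ B ∧ ContMDiffOn 𝓘(ℝ, V) (𝓡 n) ∞ c B ∧ c 0 = 1 ∧
      (∀ v ∈ B, c v • ζ ∈ φ.source ∧ P ((φ (c v • ζ)).1 - (φ ζ).1) = v) ∧
      ∀ᶠ g in 𝓝 (1 : G), P ((φ (g • ζ)).1 - (φ ζ).1) ∈ B ∧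
        g • ζ = c (P ((φ (g • ζ)).1 - (φ ζ).1)) • ζ := by
  have : IsManifold (𝓡 n) ∞ G := LieGroup.toContMDiffMul.toIsManifold
  set κ := extChartAt (𝓡 n) (1 : G) with hκ
  set ψ : 𝔼 n → 𝔼 m := fun u => (φ (κ.symm u • ζ)).1 with hψdef
  set O : Set (𝔼 n) := κ.target ∩ κ.symm ⁻¹' {g : G | g • ζ ∈ φ.source} with hOdef
  have hop : IsOpen {g : G | g • ζ ∈ φ.source} := φ.open_source.preimage (by fun_prop)
  have hO : IsOpen O := (continuousOn_extChartAt_symm (I := 𝓡 n) (1 : G)).isOpen_inter_preimage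
    (isOpen_extChartAt_target _) hop
  have hκ1 : κ.symm (κ 1) = 1 := extChartAt_to_inv _
  have hu₀ : κ 1 ∈ O := by
    refine ⟨mem_extChartAt_target _, ?_⟩
    change κ.symm (κ 1) • ζ ∈ φ.source
    rwa [hκ1, one_smul]
  have hψ : ContDiffOn ℝ ∞ ψ O := by
    refine ContMDiffOn.contDiffOn ?_
    exact (contMDiffOn_orbit hφ ζ).comp ((contMDiffOn_extChartAt_symm (1 : G)).mono
      inter_subset_left) (fun u hu => hu.2)
  have hψ0 : ψ (κ 1) = (φ ζ).1 := by simp only [hψdef, hκ1, one_smul]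
  have hκd : HasMFDerivAt 𝓘(ℝ, 𝔼 n) (𝓡 n) κ.symm (κ 1) (ContinuousLinearMap.id ℝ (𝔼 n)) :=
    hasMFDerivAt_extChartAt_symm_self 1
  have hD : fderiv ℝ ψ (κ 1) = orbitDeriv n G φ ζ := by
    have h0 := hasFDerivAt_comp_orbit (G := G) hφ hζ hκ1 hκd (h := id) (hasFDerivWithinAt_id _ _)
    exact h0.fderiv
  -- The rank cannot exceed its value at the identity, by homogeneity: near `g` the orbit map is
  -- translation by `g` after the orbit map of `g⁻¹ g'`, so its derivative factors through
  -- `orbitDeriv`.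
  have hr : ∀ u ∈ O, Module.finrank ℝ (LinearMap.range (fderiv ℝ ψ u : 𝔼 n →ₗ[ℝ] 𝔼 m)) ≤
      Module.finrank ℝ V := by
    intro u hu
    set g := κ.symm u with hg
    have hgζ : g • ζ ∈ φ.source := hu.2
    have hf : ContMDiffOn 𝓘(ℝ, 𝔼 n) (𝓡 n) ∞ (fun u => g⁻¹ * κ.symm u) κ.target :=
      contMDiffOn_const.mul (contMDiffOn_extChartAt_symm (1 : G))
    obtain ⟨f', hf'⟩ : ∃ f' : 𝔼 n →L[ℝ] 𝔼 n,
        HasMFDerivAt 𝓘(ℝ, 𝔼 n) (𝓡 n) (fun u => g⁻¹ * κ.symm u) u f' :=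
      ⟨_, ((hf.contMDiffAt ((isOpen_extChartAt_target _).mem_nhds hu.1)).mdifferentiableAt
      (by simp)).hasMFDerivAt⟩
    have h1 := (hasFDerivAt_comp_orbit (G := G) (f := fun u => g⁻¹ * κ.symm u) hφ hζ
      (inv_mul_cancel g) hf'
      (hasFDerivWithinAt_actionInChart n hφ hζ hgζ))
    have h2 : HasFDerivAt ψ _ u := h1.congr_of_eventuallyEq (f₁ := ψ) (by
      have hc : ContinuousAt (fun u => (g⁻¹ * κ.symm u) • ζ) u :=
        ContinuousAt.smul (continuousAt_const.mul ((continuousOn_extChartAt_symm (1 : G)).continuousAt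
          ((isOpen_extChartAt_target _).mem_nhds hu.1))) continuousAt_const
      have : ∀ᶠ w in 𝓝 u, (g⁻¹ * κ.symm w) • ζ ∈ φ.source :=
        hc (φ.open_source.mem_nhds (by simpa [← hg] using hζ))
      filter_upwards [this] with w hw
      rw [actionInChart_val _ _ hw, smul_smul, mul_inv_cancel_left])
    rw [h2.fderiv, ← hV]
    exact finrank_range_comp_le _ _ _
  obtain ⟨B, c, hB, hB0, hc, hc0, hcO, hPc, hev⟩ := exists_factorization_of_finrank_le hO hu₀ hψ
    (by rw [hD, hV]) hr P hP
  rw [hψ0] at hB0 hc0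
  have hsub : ∀ y : 𝔼 m, P (y - (φ ζ).1) + P (φ ζ).1 = P y := fun y => by
    rw [map_sub, sub_add_cancel]
  refine ⟨(fun v => v + P (φ ζ).1) ⁻¹' B, fun v => κ.symm (c (v + P (φ ζ).1)),
    hB.preimage (by fun_prop), by simpa using hB0, ?_, by simp [hc0, hκ1], ?_, ?_⟩
  · refine (contMDiffOn_extChartAt_symm (1 : G)).comp (t := κ.target) ?_ (fun v hv => (hcO hv).1)
    refine ContDiffOn.contMDiffOn ?_
    exact hc.comp (by fun_prop) (fun v hv => hv)
  · intro v hv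
    refine ⟨(hcO hv).2, ?_⟩
    rw [map_sub, hPc _ hv, add_sub_cancel_right]
  · have hκc : ContinuousAt κ 1 := continuousAt_extChartAt _
    filter_upwards [hκc.eventually hev, (isOpen_extChartAt_source (I := 𝓡 n) (1 : G)).mem_nhds
      (mem_extChartAt_source (I := 𝓡 n) (1 : G)), eventually_smul_mem_source hζ] with g hg hgs hgζ
    have hgg : κ.symm (κ g) = g := κ.left_inv hgs
    have e : ψ (κ g) = (φ (g • ζ)).1 := by simp only [hψdef, hgg]
    rw [e] at hg
    refine ⟨by simpa only [mem_preimage, hsub] using hg.1, ?_⟩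
    rw [hsub]
    refine φ.injOn hgζ (hcO hg.1).2 (Subtype.ext hg.2)

theorem exists_projection (V : Submodule ℝ (𝔼 m)) : ∃ P : 𝔼 m →L[ℝ] V, ∀ v : V, P v = v :=
  ⟨V.orthogonalProjectionOnto, fun v => Submodule.orthogonalProjectionOnto_mem_subspace_eq_self v⟩

/-- Near 1 one has `g ζ = c(v) ζ` with `v` a smooth function of `g ζ`. Then `c(v)⁻¹ g` fixes `ζ`,
hence also `ζ'`, so `g ζ' = c(v) ζ'` depends smoothly on `g ζ` and its derivative factors through
that of `g ζ`. Thus the kernel depends only on the stabilizer. -/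
theorem ker_orbitDeriv_le (hφ : φ ∈ IsManifold.maximalAtlas (𝓒 m) ∞ M) (hζ : ζ ∈ φ.source)
    (hφ' : φ' ∈ IsManifold.maximalAtlas (𝓒 m) ∞ M) (hζ' : ζ' ∈ φ'.source)
    (h : MulAction.stabilizer G ζ ≤ MulAction.stabilizer G ζ') {v : 𝔼 n}
    (hv : orbitDeriv n G φ ζ v = 0) : orbitDeriv n G φ' ζ' v = 0 := by
  set V := LinearMap.range (orbitDeriv n G φ ζ : 𝔼 n →ₗ[ℝ] 𝔼 m) with hV
  obtain ⟨P, hP⟩ := exists_projection V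
  obtain ⟨B, c, hB, hB0, hc, hc0, -, hev⟩ := exists_orbit_factorization hφ hζ hV.symm P hP
  have hcd := (((hc.contMDiffAt (hB.mem_nhds hB0)).mdifferentiableAt (by simp))).hasMFDerivAt
  have h1 := (hasMFDerivAt_comp_orbit (G := G) hφ' hζ' hc0 hcd
      (h := id) (hasFDerivWithinAt_id _ _)).hasFDerivAt
  have h0 : P ((φ ζ).1 - (φ ζ).1) = 0 := by simp
  have h2 : HasFDerivAt (fun y : 𝔼 m => P (y - (φ ζ).1)) P (φ ζ).1 :=
    P.hasFDerivAt.comp _ ((hasFDerivAt_id _).sub_const _)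
  rw [← h0] at h1
  have h3 := (h1.comp (φ ζ).1 h2).hasFDerivWithinAt (s := range (𝓒 m))
  have h4 := hasMFDerivAt_comp_orbit (n := n) hφ hζ (f := fun g : G => g) rfl
    (hasMFDerivAt_id (I := 𝓡 n) (1 : G)) h3
  have h5 := h4.congr_of_eventuallyEq (f₁ := fun g : G => (φ' (g • ζ')).1) (by
    filter_upwards [hev] with g hg
    have h6 : (c (P ((φ (g • ζ)).1 - (φ ζ).1)))⁻¹ * g ∈ MulAction.stabilizer G ζ := by
      rw [MulAction.mem_stabilizer_iff, mul_smul, inv_smul_eq_iff]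
      exact hg.2
    have h7 := h h6
    rw [MulAction.mem_stabilizer_iff, mul_smul, inv_smul_eq_iff] at h7
    change (φ' (g • ζ')).1 = (φ' (c (P ((φ (g • ζ)).1 - (φ ζ).1)) • ζ')).1
    rw [← h7])
  have h8 := hasMFDerivAt_unique (hasMFDerivAt_orbit hφ' hζ') h5
  have h9 : P (orbitDeriv n G φ ζ v) = 0 := by rw [hv, map_zero]
  have h10 := congrArg (fun L => L v) h8
  have h11 : ∀ L : V →L[ℝ] 𝔼 n, orbitDeriv n G φ' ζ' (L (P (orbitDeriv n G φ ζ v))) = 0 :=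
    fun L => by rw [h9, map_zero, map_zero]
  exact h10.trans (h11 _)

end OrbitMap

/-! ### Straightening a subspace to a coordinate subspace. -/

section LinearAlgebra

theorem finrank_map_add_finrank_inf_ker {E F : Type*} [AddCommGroup E] [Module ℝ E]
    [FiniteDimensional ℝ E] [AddCommGroup F] [Module ℝ F] (f : E →ₗ[ℝ] F) (S : Submodule ℝ E) :
    Module.finrank ℝ (S.map f) + Module.finrank ℝ (S ⊓ LinearMap.ker f : Submodule ℝ E) =
      Module.finrank ℝ S := by
  have h := LinearMap.finrank_range_add_finrank_ker (f.domRestrict S)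
  rw [LinearMap.range_domRestrict] at h
  rw [← h]
  congr 1
  have e : (LinearMap.ker (f.domRestrict S)).map S.subtype = S ⊓ LinearMap.ker f := by
    ext x
    simp only [Submodule.mem_map, LinearMap.mem_ker, LinearMap.domRestrict_apply,
      Submodule.subtype_apply, Subtype.exists, Submodule.mem_inf]
    exact ⟨fun ⟨a, ha, h0, hx⟩ => hx ▸ ⟨ha, h0⟩, fun h => ⟨x, h.1, h.2, rfl⟩⟩
  rw [← e]
  exact (Submodule.equivMapOfInjective S.subtype S.injective_subtype
    (LinearMap.ker (f.domRestrict S))).finrank_eq.symm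

/-- A subspace of a coordinate space that projects onto the coordinates in `Z` is the graph of a
linear map over the coordinates in a set containing `Z`. -/
theorem exists_coordinate_straightening {m : ℕ} (X : Submodule ℝ (𝔼 m)) (Z : Set (Fin m))
    (hX : ∀ v : 𝔼 m, ∃ x ∈ X, ∀ i ∈ Z, x i = v i) {d : ℕ} (hd : Module.finrank ℝ X = d) :
    ∃ (e : Fin d ↪ Fin m) (B : 𝔼 m ≃L[ℝ] 𝔼 m), Z ⊆ range e ∧
      (∀ v, ∀ i ∈ range e, B v i = v i) ∧ ∀ v, v ∈ X ↔ ∀ i ∉ range e, B v i = 0 := by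
  classical
  let ε : Fin m → Module.Dual ℝ X := fun i =>
    (EuclideanSpace.proj (𝕜 := ℝ) i : 𝔼 m →L[ℝ] ℝ).toLinearMap ∘ₗ X.subtype
  have hε : ∀ i (x : X), ε i x = (x : 𝔼 m) i := fun i x => rfl
  -- Independence of the coordinate functionals in `Z` on `X` restates that `X` projects onto these
  -- coordinates.
  have hZ : LinearIndepOn ℝ ε Z := by
    rw [linearIndepOn_iff']
    intro t g ht h0 i hi
    obtain ⟨x, hx, hxi⟩ := hX (EuclideanSpace.single i 1)
    have := congrArg (fun L => L ⟨x, hx⟩) h0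
    simp only [LinearMap.coe_sum, Finset.sum_apply, LinearMap.smul_apply, hε, smul_eq_mul,
      LinearMap.zero_apply] at this
    rw [Finset.sum_eq_single i] at this
    · simpa [hxi i (ht hi)] using this
    · intro j hj hji
      simp [hxi j (ht hj), hji]
    · exact fun h => absurd hi h
  -- Extend to a maximal independent family of coordinates: on `X` they form a basis of the dual, so
  -- `X` is a graph over the coordinates in `J`.
  obtain ⟨J, -, hZJ, hspan, hJ⟩ := exists_linearIndepOn_extension hZ (subset_univ Z)
  have hinj : ∀ x : X, (∀ j ∈ J, (x : 𝔼 m) j = 0) → x = 0 := by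
    intro x hx
    have h1 : Submodule.span ℝ (ε '' J) ≤
        LinearMap.ker (Module.Dual.eval ℝ X x) := by
      rw [Submodule.span_le]
      rintro _ ⟨j, hj, rfl⟩
      exact hx j hj
    ext i
    exact h1 (hspan ⟨i, mem_univ i, rfl⟩)
  let ρ : X →ₗ[ℝ] (J → ℝ) := LinearMap.pi fun j => ε j
  have hρ : ∀ x j, ρ x j = (x : 𝔼 m) j := fun x j => rfl
  have hρi : Function.Injective ρ := by
    rw [injective_iff_map_eq_zero]
    intro x hx
    exact hinj x fun j hj => by rw [← hρ x ⟨j, hj⟩, hx]; rfl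
  have hcard : Fintype.card J = d := by
    have h1 : Module.finrank ℝ X ≤ Fintype.card J := by
      have := LinearMap.finrank_le_finrank_of_injective hρi
      rwa [Module.finrank_fintype_fun_eq_card] at this
    have h2 : Fintype.card J ≤ Module.finrank ℝ (Module.Dual ℝ X) :=
      LinearIndependent.fintype_card_le_finrank hJ
    rw [Subspace.dual_finrank_eq] at h2
    omega
  let ρe : X ≃ₗ[ℝ] (J → ℝ) := LinearEquiv.ofInjectiveOfFinrankEq ρ hρi (by
    rw [Module.finrank_fintype_fun_eq_card, hcard, hd])
  have hρe : ∀ x j, ρe x j = (x : 𝔼 m) j := fun x j => rfl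
  let σ : 𝔼 m →ₗ[ℝ] (J → ℝ) :=
    LinearMap.pi fun j => (EuclideanSpace.proj (𝕜 := ℝ) (j : Fin m) : 𝔼 m →L[ℝ] ℝ).toLinearMap
  have hσ : ∀ v j, σ v j = v (j : Fin m) := fun v j => rfl
  let S : 𝔼 m →ₗ[ℝ] 𝔼 m := X.subtype ∘ₗ ρe.symm.toLinearMap ∘ₗ σ
  have hSX : ∀ v, S v ∈ X := fun v => (ρe.symm (σ v)).2
  have hSJ : ∀ v, ∀ j ∈ J, S v j = v j := by
    intro v j hj
    change (ρe.symm (σ v) : 𝔼 m) j = v j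
    rw [← hρe _ ⟨j, hj⟩, LinearEquiv.apply_symm_apply, hσ]
  have hS : ∀ v w, (∀ j ∈ J, v j = w j) → S v = S w := by
    intro v w h
    have : σ v = σ w := funext fun j => h j j.2
    change ((ρe.symm (σ v) : X) : 𝔼 m) = (ρe.symm (σ w) : X)
    rw [this]
  have hSx : ∀ x ∈ X, S x = x := by
    intro x hx
    have : σ x = ρe ⟨x, hx⟩ := rfl
    change ((ρe.symm (σ x) : X) : 𝔼 m) = x
    rw [this, LinearEquiv.symm_apply_apply]
  let R : 𝔼 m →ₗ[ℝ] 𝔼 m :=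
    { toFun := fun v => WithLp.toLp 2 fun i => if i ∈ J then v i else 0
      map_add' := fun v w => by ext i; by_cases h : i ∈ J <;> simp [h]
      map_smul' := fun c v => by ext i; by_cases h : i ∈ J <;> simp [h] }
  have hR1 : ∀ v, ∀ i ∈ J, R v i = v i := fun v i hi => if_pos hi
  have hR0 : ∀ v, ∀ i ∉ J, R v i = 0 := fun v i hi => if_neg hi
  have hR : ∀ v w, (∀ j ∈ J, v j = w j) → R v = R w := by
    intro v w h
    ext i
    by_cases hi : i ∈ J
    · rw [hR1 _ _ hi, hR1 _ _ hi, h i hi]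
    · rw [hR0 _ _ hi, hR0 _ _ hi]
  -- A shear: `S v` is the point of `X` over the `J`-coordinates of `v` and `R v` the point over
  -- them with all other coordinates zero. Replacing `S v` by `R v` keeps the `J`-coordinates and
  -- flattens the graph; `Cl` undoes it because `S` and `R` see only these coordinates.
  let Bl : 𝔼 m →ₗ[ℝ] 𝔼 m := LinearMap.id - S + R
  let Cl : 𝔼 m →ₗ[ℝ] 𝔼 m := LinearMap.id + S - R
  have hB : ∀ v, Bl v = v - S v + R v := fun v => rfl
  have hC : ∀ v, Cl v = v + S v - R v := fun v => rfl
  have hBJ : ∀ v, ∀ j ∈ J, Bl v j = v j := by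
    intro v j hj
    rw [hB, PiLp.add_apply, PiLp.sub_apply, hSJ v j hj, hR1 v j hj]
    ring
  have hCJ : ∀ v, ∀ j ∈ J, Cl v j = v j := by
    intro v j hj
    rw [hC, PiLp.sub_apply, PiLp.add_apply, hSJ v j hj, hR1 v j hj]
    ring
  let B : 𝔼 m ≃ₗ[ℝ] 𝔼 m :=
    { Bl with
      invFun := Cl
      left_inv := fun v => by
        change Cl (Bl v) = v
        rw [hC, hS _ _ (hBJ v), hR _ _ (hBJ v), hB]
        abel
      right_inv := fun v => by
        change Bl (Cl v) = v
        rw [hB, hS _ _ (hCJ v), hR _ _ (hCJ v), hC]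
        abel }
  let e : Fin d ↪ Fin m :=
    ((Fintype.equivFinOfCardEq hcard).symm.toEmbedding).trans (Function.Embedding.subtype _)
  have he : range e = J := by
    ext i
    constructor
    · rintro ⟨j, rfl⟩
      exact ((Fintype.equivFinOfCardEq hcard).symm j).2
    · intro hi
      exact ⟨Fintype.equivFinOfCardEq hcard ⟨i, hi⟩, by simp [e]⟩
  refine ⟨e, B.toContinuousLinearEquiv, he ▸ hZJ, fun v i hi => hBJ v i (he ▸ hi), fun v => ?_⟩
  rw [he]
  change _ ↔ ∀ i ∉ J, Bl v i = 0
  constructor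
  · intro hv i hi
    rw [hB, hSx v hv, sub_self, zero_add, hR0 v i hi]
  · intro h
    suffices S v = v by rw [← this]; exact hSX v
    ext i
    by_cases hi : i ∈ J
    · exact hSJ v i hi
    · have := h i hi
      rw [hB, PiLp.add_apply, PiLp.sub_apply, hR0 v i hi] at this
      linarith

end LinearAlgebra

universe u

/-! ### Averaging vectors and projections over a compact group. -/

section InvariantProjection

open MeasureTheory

variable {K : Type*} [Group K] [TopologicalSpace K] [IsTopologicalGroup K] [CompactSpace K]
  {E : Type u} [NormedAddCommGroup E] [NormedSpace ℝ E] [FiniteDimensional ℝ E]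
  {A : K → E →L[ℝ] E}

/-- Averaging a vector over a compact group. -/
theorem exists_average (hA : Continuous A) (hmul : ∀ k l, A (k * l) = (A k).comp (A l)) (v : E) :
    ∃ w : E, (∀ k, A k w = w) ∧
      ∀ (F : Type u) [NormedAddCommGroup F] [NormedSpace ℝ F] [CompleteSpace F] (f : E →L[ℝ] F)
        (c : F), (∀ k, f (A k v) = c) → f w = c := by
  let _ : MeasurableSpace K := borel K
  have : BorelSpace K := ⟨rfl⟩
  let μ : Measure K := Measure.haarMeasure ⊤
  have : IsProbabilityMeasure μ := ⟨Measure.haarMeasure_self⟩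
  have : SecondCountableTopology E := by
    have := FiniteDimensional.proper ℝ E
    infer_instance
  have hi : Integrable (fun k => A k v) μ :=
    integrable_of_continuous_compactSpace μ (by fun_prop)
  refine ⟨∫ k, A k v ∂μ, fun k => ?_, fun F _ _ _ f c hf => ?_⟩
  · rw [← ContinuousLinearMap.integral_comp_comm _ hi]
    conv_rhs => rw [← integral_mul_left_eq_self _ k]
    simp only [hmul, ContinuousLinearMap.comp_apply]
  · rw [← ContinuousLinearMap.integral_comp_comm _ hi]
    simp [hf]

/-- Averaging a projection over a compact group. -/
theorem exists_invariant_projection (hA : Continuous A)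
    (hmul : ∀ k l, A (k * l) = (A k).comp (A l)) (hone : A 1 = ContinuousLinearMap.id ℝ E)
    {V : Submodule ℝ E} (hV : ∀ k, ∀ v ∈ V, A k v ∈ V) {P₀ : E →L[ℝ] V} (hP₀ : ∀ v : V, P₀ v = v) :
    ∃ P : E →L[ℝ] V, (∀ v : V, P v = v) ∧ ∀ k x, (P (A k x) : E) = A k (P x) := by
  -- The conjugation action on operators. Being the identity on `V` and having values in `V` are
  -- linear conditions satisfied by every conjugate of `P₀`, hence by the average.
  let C : K → (E →L[ℝ] E) →L[ℝ] (E →L[ℝ] E) := fun k =>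
    (ContinuousLinearMap.compL ℝ E E E (A k)).comp
      ((ContinuousLinearMap.compL ℝ E E E).flip (A k⁻¹))
  have hC : ∀ k L, C k L = (A k).comp (L.comp (A k⁻¹)) := fun k L => rfl
  have hCc : Continuous C := by
    refine Continuous.clm_comp ?_ ?_
    · exact (ContinuousLinearMap.compL ℝ E E E).continuous.comp hA
    · exact ((ContinuousLinearMap.compL ℝ E E E).flip).continuous.comp (hA.comp continuous_inv)
  have hCm : ∀ k l, C (k * l) = (C k).comp (C l) := by
    intro k l
    ext L x
    simp only [hC, ContinuousLinearMap.comp_apply, hmul, mul_inv_rev]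
  obtain ⟨Q, hQ, hf⟩ := exists_average hCc hCm (V.subtypeL.comp P₀)
  have hinv : ∀ k x, A k (A k⁻¹ x) = x := by
    intro k x
    rw [← ContinuousLinearMap.comp_apply, ← hmul, mul_inv_cancel, hone]
    rfl
  have hinv' : ∀ k x, A k⁻¹ (A k x) = x := by
    intro k x
    rw [← ContinuousLinearMap.comp_apply, ← hmul, inv_mul_cancel, hone]
    rfl
  have hcompl : CompleteSpace E := FiniteDimensional.complete ℝ E
  have hf' : ∀ (N : E →L[ℝ] E) (x y : E), (∀ k, N (A k (P₀ (A k⁻¹ x))) = y) → N (Q x) = y :=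
    fun N x y h => hf E (N.comp (ContinuousLinearMap.apply ℝ E x)) y h
  have hmem : ∀ x, Q x ∈ V := by
    intro x
    have := hf' (ContinuousLinearMap.id ℝ E - V.subtypeL.comp P₀) x 0 fun k => by
      have h1 := hP₀ ⟨_, hV k _ (P₀ (A k⁻¹ x)).2⟩
      simpa [sub_eq_zero] using (congrArg Subtype.val h1).symm
    have h2 : Q x = P₀ (Q x) := by simpa [sub_eq_zero] using this
    rw [h2]
    exact (P₀ (Q x)).2
  refine ⟨Q.codRestrict V hmem, fun v => Subtype.ext ?_, fun k x => ?_⟩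
  · refine hf' (ContinuousLinearMap.id ℝ E) v v fun k => ?_
    have h1 := hP₀ ⟨_, hV k⁻¹ _ v.2⟩
    rw [ContinuousLinearMap.id_apply, h1]
    exact hinv k v
  · have h1 := congrArg (fun L : E →L[ℝ] E => L (A k x)) (hQ k)
    simp only [hC, ContinuousLinearMap.comp_apply, hinv'] at h1
    exact h1.symm

end InvariantProjection

/-! ### Dimensions of orbits and of fixed spaces. -/

section IsotropyLinearAlgebra

set_option linter.unusedSectionVars false

variable {n m : ℕ} {G : Type*} [TopologicalSpace G] [ChartedSpace (EuclideanSpace ℝ (Fin n)) G]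
  [Group G] [LieGroup (𝓡 n) ∞ G] [IsTopologicalGroup G] [CompactSpace G]
  {M : Type*} [TopologicalSpace M] [T2Space M] [ChartedSpace (EuclideanQuadrant m) M]
  [IsManifold (𝓒 m) ∞ M] [MulAction G M] [ContMDiffSMul (𝓡 n) (𝓒 m) ∞ G M]
  [ContinuousSMul G M] {φ φ' : OpenPartialHomeomorph M (EuclideanQuadrant m)} {ζ ζ' : M}

/-- The vectors fixed by the isotropy representation. -/
noncomputable def isotropyFixed (G : Type*) {M : Type*} [TopologicalSpace M] [Group G]
    [MulAction G M] (φ : OpenPartialHomeomorph M (EuclideanQuadrant m)) (ζ : M) :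
    Submodule ℝ (𝔼 m) where
  carrier := {v | ∀ k ∈ MulAction.stabilizer G ζ, isotropyRep φ ζ k v = v}
  add_mem' := fun ha hb k hk => by rw [map_add, ha k hk, hb k hk]
  zero_mem' := fun k _ => map_zero _
  smul_mem' := fun c v hv k hk => by rw [map_smul, hv k hk]

/-- The tangent space of the orbit of `ζ`, in a chart. -/
noncomputable abbrev orbitTangent (n : ℕ) (G : Type*) [TopologicalSpace G]
    [ChartedSpace (EuclideanSpace ℝ (Fin n)) G] [Group G] {M : Type*} [TopologicalSpace M]
    [MulAction G M] (φ : OpenPartialHomeomorph M (EuclideanQuadrant m)) (ζ : M) :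
    Submodule ℝ (𝔼 m) :=
  LinearMap.range (orbitDeriv n G φ ζ : 𝔼 n →ₗ[ℝ] 𝔼 m)

theorem apply_of_mem_orbitTangent (hφ : φ ∈ IsManifold.maximalAtlas (𝓒 m) ∞ M)
    (hζ : ζ ∈ φ.source) {v : 𝔼 m} (hv : v ∈ orbitTangent n G φ ζ) {i : Fin m}
    (hi : (φ ζ).1 i = 0) : v i = 0 := by
  obtain ⟨u, rfl⟩ := hv
  exact orbitDeriv_apply_of_zero hφ hζ hi u

/-- Average `v`: the coordinates vanishing at `ζ` are untouched since the representation is trivial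
on them. This is the projection property needed to straighten the fixed space while keeping these
coordinates. -/
theorem exists_mem_isotropyFixed (n) [ChartedSpace (EuclideanSpace ℝ (Fin n)) G]
    [LieGroup (𝓡 n) ∞ G] [ContMDiffSMul (𝓡 n) (𝓒 m) ∞ G M] (hM : IsManifoldWithCorners m M)
    (hbif : IsBoundaryIntersectionFree m G M)
    (hφ : φ ∈ IsManifold.maximalAtlas (𝓒 m) ∞ M) (hζ : ζ ∈ φ.source) (v : 𝔼 m) :
    ∃ w ∈ isotropyFixed G φ ζ, ∀ i ∈ {i | (φ ζ).1 i = 0}, w i = v i := by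
  have : CompactSpace (MulAction.stabilizer G ζ) :=
    isCompact_iff_compactSpace.1 (isClosed_stabilizer ζ).isCompact
  obtain ⟨w, hw, hf⟩ := exists_average (continuous_isotropyRep (G := G) hφ n hζ)
    (fun k l => isotropyRep_mul n hφ hζ k.2 l.2) v
  exact ⟨w, fun k hk => hw ⟨k, hk⟩, fun i hi => hf ℝ (EuclideanSpace.proj (𝕜 := ℝ) i) (v i)
    fun k => isotropyRep_apply_of_zero n hM hbif hφ hζ k.2 hi v⟩

/-- An invariant projection onto the tangent space of the orbit. -/
theorem exists_orbitTangent_projection (hφ : φ ∈ IsManifold.maximalAtlas (𝓒 m) ∞ M)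
    (hζ : ζ ∈ φ.source) :
    ∃ P : 𝔼 m →L[ℝ] orbitTangent n G φ ζ, (∀ v : orbitTangent n G φ ζ, P v = v) ∧
      ∀ k ∈ MulAction.stabilizer G ζ, ∀ x,
        (P (isotropyRep φ ζ k x) : 𝔼 m) = isotropyRep φ ζ k (P x) := by
  have : CompactSpace (MulAction.stabilizer G ζ) :=
    isCompact_iff_compactSpace.1 (isClosed_stabilizer ζ).isCompact
  obtain ⟨P₀, hP₀⟩ := exists_projection (orbitTangent n G φ ζ)
  obtain ⟨P, hP, hPk⟩ := exists_invariant_projection (continuous_isotropyRep (G := G) hφ n hζ)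
    (fun k l => isotropyRep_mul n hφ hζ k.2 l.2) (isotropyRep_one hζ)
    (V := orbitTangent n G φ ζ) (fun k v hv => by
      obtain ⟨u, rfl⟩ := hv
      have := congrArg (fun L => L u) (isotropyRep_comp_orbitDeriv (n := n) hφ hζ k.2)
      exact ⟨conjDeriv n (k : G) u, this.symm⟩) hP₀
  exact ⟨P, hP, fun k hk x => hPk ⟨k, hk⟩ x⟩

/-- The orbit map of `g ζ` in the translated chart is that of `ζ` precomposed with conjugation by
`g⁻¹`. -/
theorem orbitTangent_translateChart (hφ : φ ∈ IsManifold.maximalAtlas (𝓒 m) ∞ M)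
    (hζ : ζ ∈ φ.source) (g : G) :
    orbitTangent n G (translateChart g⁻¹ φ) (g • ζ) ≤ orbitTangent n G φ ζ := by
  rintro _ ⟨u, rfl⟩
  have hs : g • ζ ∈ (translateChart g⁻¹ φ).source := by
    rw [mem_translateChart_source, inv_smul_smul]; exact hζ
  have h1 := hasMFDerivAt_orbit (n := n) (G := G) (translateChart_mem_maximalAtlas n g⁻¹ hφ) hs
  have h2 := hasMFDerivAt_comp_orbit (n := n) hφ hζ (f := fun h : G => g⁻¹ * h * g⁻¹⁻¹) (by simp)
    (hasMFDerivAt_conj g⁻¹) (h := id) (hasFDerivWithinAt_id _ _)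
  have e : (fun h : G => (translateChart g⁻¹ φ (h • g • ζ)).1) =
      fun h : G => id (φ ((g⁻¹ * h * g⁻¹⁻¹) • ζ)).1 := by
    ext1 h
    rw [translateChart_apply, inv_inv, mul_smul, mul_smul]
    rfl
  rw [e] at h1
  have h3 := congrArg (fun L => L u) (hasMFDerivAt_unique h1 h2)
  exact ⟨conjDeriv n g⁻¹ u, h3.symm⟩

/-- By the unique isotropy type some translate of `ζ` has the same stabilizer as `ζ'`, so kernels
compare by `ker_orbitDeriv_le`; rank and nullity do the rest. -/
theorem finrank_orbitTangent_le (hiso : HasUniqueIsotropyType G M)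
    (hφ : φ ∈ IsManifold.maximalAtlas (𝓒 m) ∞ M) (hζ : ζ ∈ φ.source)
    (hφ' : φ' ∈ IsManifold.maximalAtlas (𝓒 m) ∞ M) (hζ' : ζ' ∈ φ'.source) :
    Module.finrank ℝ (orbitTangent n G φ' ζ') ≤ Module.finrank ℝ (orbitTangent n G φ ζ) := by
  obtain ⟨g, hg⟩ := hiso ζ ζ'
  have hst : MulAction.stabilizer G (g • ζ) = MulAction.stabilizer G ζ' := by
    rw [hg, MulAction.stabilizer_smul_eq_stabilizer_map_conj]
  have hs : g • ζ ∈ (translateChart g⁻¹ φ).source := by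
    rw [mem_translateChart_source, inv_smul_smul]; exact hζ
  have h1 := LinearMap.finrank_range_add_finrank_ker (orbitDeriv n G φ' ζ' : 𝔼 n →ₗ[ℝ] 𝔼 m)
  have h2 := LinearMap.finrank_range_add_finrank_ker
    (orbitDeriv n G (translateChart g⁻¹ φ) (g • ζ) : 𝔼 n →ₗ[ℝ] 𝔼 m)
  have h3 := Submodule.finrank_mono (orbitTangent_translateChart (n := n) hφ hζ g)
  have h4 : LinearMap.ker (orbitDeriv n G (translateChart g⁻¹ φ) (g • ζ) : 𝔼 n →ₗ[ℝ] 𝔼 m) ≤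
      LinearMap.ker (orbitDeriv n G φ' ζ' : 𝔼 n →ₗ[ℝ] 𝔼 m) := fun v hv =>
    ker_orbitDeriv_le (translateChart_mem_maximalAtlas n g⁻¹ hφ) hs hφ' hζ' hst.le hv
  have h5 := Submodule.finrank_mono h4
  unfold orbitTangent at h3 ⊢
  omega

theorem finrank_orbitTangent_eq (hiso : HasUniqueIsotropyType G M)
    (hφ : φ ∈ IsManifold.maximalAtlas (𝓒 m) ∞ M) (hζ : ζ ∈ φ.source)
    (hφ' : φ' ∈ IsManifold.maximalAtlas (𝓒 m) ∞ M) (hζ' : ζ' ∈ φ'.source) :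
    Module.finrank ℝ (orbitTangent n G φ' ζ') = Module.finrank ℝ (orbitTangent n G φ ζ) :=
  le_antisymm (finrank_orbitTangent_le hiso hφ hζ hφ' hζ')
    (finrank_orbitTangent_le hiso hφ' hζ' hφ hζ)

/-- The vectors moved by the adjoint action of the stabilizer only along its Lie algebra. -/
noncomputable def orbitFixed (n : ℕ) (G : Type*) [TopologicalSpace G]
    [ChartedSpace (EuclideanSpace ℝ (Fin n)) G] [Group G] {M : Type*} [TopologicalSpace M]
    [MulAction G M] (φ : OpenPartialHomeomorph M (EuclideanQuadrant m)) (ζ : M) :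
    Submodule ℝ (𝔼 n) where
  carrier := {v | ∀ k ∈ MulAction.stabilizer G ζ, orbitDeriv n G φ ζ (conjDeriv n k v - v) = 0}
  add_mem' := fun {a b} ha hb k hk => by
    rw [map_add, add_sub_add_comm, map_add, ha k hk, hb k hk, add_zero]
  zero_mem' := fun k _ => by simp
  smul_mem' := fun c v hv k hk => by rw [map_smul, ← smul_sub, map_smul, hv k hk, smul_zero]

theorem mem_orbitFixed_iff (hφ : φ ∈ IsManifold.maximalAtlas (𝓒 m) ∞ M)
    (hζ : ζ ∈ φ.source) {v : 𝔼 n} :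
    v ∈ orbitFixed n G φ ζ ↔ orbitDeriv n G φ ζ v ∈ isotropyFixed G φ ζ := by
  refine forall₂_congr fun k hk => ?_
  have := congrArg (fun L => L v) (isotropyRep_comp_orbitDeriv (n := n) hφ hζ hk)
  simp only [ContinuousLinearMap.comp_apply] at this
  rw [this, map_sub, sub_eq_zero]

/-- The invariant projection splits the fixed vectors into the kernel of `P`, all of which is fixed,
and the fixed vectors tangent to the orbit, which are the image of `orbitFixed`. The point of the
formula is that its right-hand side depends on the stabilizer and not on the point. -/
theorem finrank_isotropyFixed_add {P : 𝔼 m →L[ℝ] orbitTangent n G φ ζ}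
    (hφ : φ ∈ IsManifold.maximalAtlas (𝓒 m) ∞ M) (hζ : ζ ∈ φ.source)
    (hP : ∀ v : orbitTangent n G φ ζ, P v = v)
    (hPk : ∀ k ∈ MulAction.stabilizer G ζ, ∀ x,
        (P (isotropyRep φ ζ k x) : 𝔼 m) = isotropyRep φ ζ k (P x))
    (hW : ∀ w, P w = 0 → w ∈ isotropyFixed G φ ζ) :
    Module.finrank ℝ (isotropyFixed G φ ζ) + n = m + Module.finrank ℝ (orbitFixed n G φ ζ) := by
  set D : 𝔼 n →ₗ[ℝ] 𝔼 m := (orbitDeriv n G φ ζ : 𝔼 n →ₗ[ℝ] 𝔼 m) with hD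
  set Q : 𝔼 m →ₗ[ℝ] 𝔼 m := 
    (((orbitTangent n G φ ζ).subtypeL.comp P : 𝔼 m →L[ℝ] 𝔼 m) : 𝔼 m →ₗ[ℝ] 𝔼 m) with hQ
  have hQv : ∀ v ∈ LinearMap.range D, Q v = v := fun v hv => congrArg Subtype.val (hP ⟨v, hv⟩)
  have hQm : ∀ v, Q v ∈ LinearMap.range D := fun v => (P v).2
  have hQ0 : ∀ w, Q w = 0 ↔ P w = 0 := fun w => by
    change ((P w : orbitTangent n G φ ζ) : 𝔼 m) = 0 ↔ _
    simp
  have hrQ : LinearMap.range Q = LinearMap.range D := by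
    refine le_antisymm ?_ fun v hv => ⟨v, hQv v hv⟩
    rintro _ ⟨v, rfl⟩
    exact hQm v
  have hkQ : isotropyFixed G φ ζ ⊓ LinearMap.ker Q = LinearMap.ker Q :=
    inf_eq_right.2 fun w hw => hW w ((hQ0 w).1 hw)
  have hkD : orbitFixed n G φ ζ ⊓ LinearMap.ker D = LinearMap.ker D := by
    refine inf_eq_right.2 fun v hv => ?_
    rw [mem_orbitFixed_iff hφ hζ]
    have : orbitDeriv n G φ ζ v = 0 := hv
    rw [this]
    exact zero_mem _
  have hmap : (isotropyFixed G φ ζ).map Q = (orbitFixed n G φ ζ).map D := by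
    ext v
    constructor
    · rintro ⟨w, hw, rfl⟩
      obtain ⟨u, hu⟩ := hQm w
      refine ⟨u, ?_, hu⟩
      refine (mem_orbitFixed_iff hφ hζ).2 ?_
      have hu' : orbitDeriv n G φ ζ u = Q w := hu
      rw [hu']
      intro k hk
      change isotropyRep φ ζ k (P w) = P w
      rw [← hPk k hk, hw k hk]
    · rintro ⟨u, hu, rfl⟩
      exact ⟨D u, (mem_orbitFixed_iff hφ hζ).1 hu, hQv _ ⟨u, rfl⟩⟩
  have h1 := finrank_map_add_finrank_inf_ker Q (isotropyFixed G φ ζ)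
  have h2 := finrank_map_add_finrank_inf_ker D (orbitFixed n G φ ζ)
  have h3 := LinearMap.finrank_range_add_finrank_ker Q
  have h4 := LinearMap.finrank_range_add_finrank_ker D
  rw [hkQ, hmap] at h1
  rw [hkD] at h2
  rw [hrQ, finrank_euclideanSpace_fin] at h3
  rw [finrank_euclideanSpace_fin] at h4
  omega

/-- The definition involves only the stabilizer and the kernel of `orbitDeriv`, and the former
determines the latter. -/
theorem orbitFixed_eq_of_stabilizer_eq (hφ : φ ∈ IsManifold.maximalAtlas (𝓒 m) ∞ M)
    (hζ : ζ ∈ φ.source) (hφ' : φ' ∈ IsManifold.maximalAtlas (𝓒 m) ∞ M) (hζ' : ζ' ∈ φ'.source)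
    (h : MulAction.stabilizer G ζ = MulAction.stabilizer G ζ') :
    orbitFixed n G φ ζ = orbitFixed n G φ' ζ' := by
  ext v
  constructor
  · exact fun hv k hk => ker_orbitDeriv_le hφ hζ hφ' hζ' h.le (hv k (h ▸ hk))
  · exact fun hv k hk => ker_orbitDeriv_le hφ' hζ' hφ hζ h.ge (hv k (h ▸ hk))

end IsotropyLinearAlgebra

/-! ### Pushing a transversal along the orbit. -/

section Slice

set_option linter.unusedSectionVars false

variable {n m : ℕ} {G : Type*} [TopologicalSpace G] [ChartedSpace (EuclideanSpace ℝ (Fin n)) G]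
  [Group G] [LieGroup (𝓡 n) ∞ G] [IsTopologicalGroup G] [CompactSpace G]
  {M : Type*} [TopologicalSpace M] [T2Space M] [ChartedSpace (EuclideanQuadrant m) M]
  [IsManifold (𝓒 m) ∞ M] [MulAction G M] [ContMDiffSMul (𝓡 n) (𝓒 m) ∞ G M]
  [ContinuousSMul G M] {φ φ' : OpenPartialHomeomorph M (EuclideanQuadrant m)} {ζ ζ' : M}

theorem eventually_symm_mem_target (hζ : ζ ∈ φ.source) :
    ∀ᶠ y in 𝓝 (φ ζ).1, (𝓒 m).symm y ∈ φ.target :=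
  isOpen_symm_preimage_target.mem_nhds (by
    change (𝓒 m).symm (φ ζ).1 ∈ φ.target
    rw [symm_val_quadrant]; exact φ.map_source hζ)

theorem continuousAt_chart_symm_val (hζ : ζ ∈ φ.source) :
    ContinuousAt (fun y => φ.symm ((𝓒 m).symm y)) (φ ζ).1 :=
  continuousOn_chart_symm.continuousAt (eventually_symm_mem_target hζ)

theorem eventually_pos_of_ne_zero (p : EuclideanQuadrant m) :
    ∀ᶠ y in 𝓝 p.1, ∀ i, p.1 i ≠ 0 → 0 < y i := by
  simp only [eventually_all]
  intro i hi
  have hc : ContinuousAt (fun y : 𝔼 m => y i) p.1 := by fun_prop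
  exact hc.eventually_const_lt (lt_of_le_of_ne (p.2 i) (Ne.symm hi))

/-- An affine change of coordinates that does not change the coordinates vanishing at the base
point. -/
theorem exists_affine_recoordinate (hφ : φ ∈ IsManifold.maximalAtlas (𝓒 m) ∞ M)
    (hζ : ζ ∈ φ.source) (B : 𝔼 m ≃L[ℝ] 𝔼 m) (hB : ∀ i, (φ ζ).1 i = 0 → ∀ v, B v i = v i) :
    ∃ φ₂ ∈ IsManifold.maximalAtlas (𝓒 m) ∞ M, ζ ∈ φ₂.source ∧ φ₂.source ⊆ φ.source ∧
      ∀ x ∈ φ₂.source, (φ₂ x).1 = (φ ζ).1 + B ((φ x).1 - (φ ζ).1) := by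
  set p := (φ ζ).1 with hp
  let Θ : 𝔼 m → 𝔼 m := fun y => p + B (y - p)
  have hΘp : Θ p = p := by simp [Θ]
  have hΘ : ContDiff ℝ ∞ Θ := contDiff_const.add (B.contDiff.comp (contDiff_id.sub contDiff_const))
  have hΘ0 : ∀ i, p i = 0 → ∀ y, Θ y i = y i := by
    intro i hi y
    simp [Θ, hB i hi, hi]
  have ev : ∀ᶠ y in 𝓝 p, (∀ i, p i ≠ 0 → 0 < y i) ∧ ∀ i, p i ≠ 0 → 0 < Θ y i := by
    refine (eventually_pos_of_ne_zero (φ ζ)).and ?_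
    have := hΘ.continuous.continuousAt (x := p)
    rw [ContinuousAt, hΘp] at this
    exact this.eventually (eventually_pos_of_ne_zero (φ ζ))
  obtain ⟨O, hO, hOo, hpO⟩ := mem_nhds_iff.1 ev
  obtain ⟨θ, h1, h2, h3, h4⟩ := exists_quadrant_openPartialHomeomorph hOo (p := φ ζ) hpO
    hΘ.contDiffOn
    (fun y hy => by
      rw [mem_range_quadrant]
      intro i
      by_cases hi : p i = 0
      · rw [hΘ0 i hi]
        exact mem_range_quadrant.1 hy.1 i
      · exact ((hO hy.2).2 i hi).le)
    (fun y hy => by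
      have hyf := mem_frontier_range_quadrant.1 hy.1
      obtain ⟨j, hj⟩ := hyf.2
      have hpj : p j = 0 := by
        by_contra hne
        exact ((hO hy.2).1 j hne).ne' hj
      rw [mem_frontier_range_quadrant]
      refine ⟨fun i => ?_, j, by rw [hΘ0 j hpj, hj]⟩
      by_cases hi : p i = 0
      · rw [hΘ0 i hi]
        exact hyf.1 i
      · exact ((hO hy.2).2 i hi).le)
    (A := B) (by
      have h0 : HasFDerivWithinAt (fun y => y - p) (ContinuousLinearMap.id ℝ _)
        (range (𝓒 m)) p := (hasFDerivWithinAt_id _ _).sub_const _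
      have h1 := (B : 𝔼 m →L[ℝ] 𝔼 m).hasFDerivAt.comp_hasFDerivWithinAt p h0
      exact h1.const_add p)
  refine ⟨φ.trans θ, trans_mem_maximalAtlas hφ h1 h2, ?_, ?_, ?_⟩
  · rw [OpenPartialHomeomorph.trans_source]; exact ⟨hζ, h3⟩
  · rw [OpenPartialHomeomorph.trans_source]; exact inter_subset_left
  · intro x hx
    rw [OpenPartialHomeomorph.trans_source] at hx
    exact (h4 _ hx.2).2

/-- The map sending a pair of a vector along the orbit and a transversal vector to the
corresponding translate, in a chart. -/
noncomputable def sliceMap (φ : OpenPartialHomeomorph M (EuclideanQuadrant m)) (ζ : M)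
    {V : Submodule ℝ (𝔼 m)} (P : 𝔼 m →L[ℝ] V) (c : V → G) (y : 𝔼 m) : 𝔼 m :=
  (φ (c (P (y - (φ ζ).1)) • φ.symm ((𝓒 m).symm (y - P (y - (φ ζ).1))))).1

variable {V : Submodule ℝ (𝔼 m)} {P : 𝔼 m →L[ℝ] V} {B : Set V} {c : V → G}

theorem sub_proj_mem_range (hφ : φ ∈ IsManifold.maximalAtlas (𝓒 m) ∞ M)
    (hζ : ζ ∈ φ.source) {y : 𝔼 m} (hy : y ∈ range (𝓒 m)) {v : 𝔼 m} (hV : V = orbitTangent n G φ ζ) (hv : v ∈ V)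
    (hpos : ∀ i, (φ ζ).1 i ≠ 0 → 0 < (y - v) i) : y - v ∈ range (𝓒 m) := by
  rw [mem_range_quadrant]
  intro i
  by_cases hi : (φ ζ).1 i = 0
  · rw [PiLp.sub_apply, apply_of_mem_orbitTangent hφ hζ (hV.le hv) hi, sub_zero]
    exact mem_range_quadrant.1 hy i
  · exact (hpos i hi).le

/-- The map is `(v, y) ↦ c(v) y` after splitting a vector by `P`. Its derivative is the identity on
each summand: in `y` because `c 0 = 1`, and in `v` because the derivative lands in the tangent space
`V`, where `P` identifies it with `v`. -/
theorem hasFDerivWithinAt_sliceMap (hφ : φ ∈ IsManifold.maximalAtlas (𝓒 m) ∞ M)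
    (hζ : ζ ∈ φ.source) (hV : V = orbitTangent n G φ ζ) (hP : ∀ v : V, P v = v) (hB : IsOpen B) (hB0 : 0 ∈ B)
    (hc : ContMDiffOn 𝓘(ℝ, V) (𝓡 n) ∞ c B) (hc0 : c 0 = 1)
    (hcP : ∀ v ∈ B, c v • ζ ∈ φ.source ∧ P ((φ (c v • ζ)).1 - (φ ζ).1) = v) :
    HasFDerivWithinAt (sliceMap φ ζ P c) (ContinuousLinearMap.id ℝ _) (range (𝓒 m)) (φ ζ).1 := by
  set p := (φ ζ).1 with hp
  let F : V × 𝔼 m → 𝔼 m := fun q => (φ (c q.1 • φ.symm ((𝓒 m).symm q.2))).1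
  have ht := eventually_symm_mem_target hζ
  have hFs : ContMDiffOn 𝓘(ℝ, V × 𝔼 m) 𝓘(ℝ, 𝔼 m) ∞ F
      {q | (q.1 ∈ B ∧ (q.2 ∈ range (𝓒 m) ∧ (𝓒 m).symm q.2 ∈ φ.target)) ∧
        c q.1 • φ.symm ((𝓒 m).symm q.2) ∈ φ.source} := by
    refine (contMDiffOn_val_chart hφ).comp
      (f := fun q : V × 𝔼 m => c q.1 • φ.symm ((𝓒 m).symm q.2)) ?_ (fun q hq => hq.2)
    refine ContMDiffOn.smul (I := 𝓡 n) (I' := 𝓒 m) ?_ ?_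
    · exact hc.comp (contDiff_fst.contMDiff.contMDiffOn) fun q hq => hq.1.1
    · exact (contMDiffOn_val_chart_symm hφ).comp (contDiff_snd.contMDiff.contMDiffOn)
        fun q hq => hq.1.2
  have hcc : ContinuousAt c 0 := hc.continuousOn.continuousAt (hB.mem_nhds hB0)
  have hcont : ContinuousAt (fun q : V × 𝔼 m => c q.1 • φ.symm ((𝓒 m).symm q.2)) (0, p) :=
    ContinuousAt.smul (ContinuousAt.comp (x := ((0 : V), p)) (g := c) (f := Prod.fst) hcc
      continuousAt_fst) (ContinuousAt.comp (x := ((0 : V), p))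
        (g := fun y => φ.symm ((𝓒 m).symm y)) (f := Prod.snd)
        (continuousAt_chart_symm_val hζ) continuousAt_snd)
  have hev : ∀ᶠ q in 𝓝 ((0 : V), p), (q.1 ∈ B ∧ (𝓒 m).symm q.2 ∈ φ.target) ∧
      c q.1 • φ.symm ((𝓒 m).symm q.2) ∈ φ.source := by
    refine (Eventually.and ?_ ?_).and ?_
    · exact (continuousAt_fst (p := ((0 : V), p))).eventually (p := fun v => v ∈ B)
        (hB.mem_nhds hB0)
    · exact (continuousAt_snd (p := ((0 : V), p))).eventually
        (p := fun y => (𝓒 m).symm y ∈ φ.target) ht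
    · refine hcont (φ.open_source.mem_nhds ?_)
      change c 0 • φ.symm ((𝓒 m).symm p) ∈ φ.source
      rwa [hc0, hp, chart_symm_val hζ, one_smul]
  have hF : DifferentiableWithinAt ℝ F (univ ×ˢ range (𝓒 m)) (0, p) := by
    refine ((hFs (0, p) ?_).contDiffWithinAt.differentiableWithinAt
      (by simp)).mono_of_mem_nhdsWithin ?_
    · have := hev.self_of_nhds
      exact ⟨⟨this.1.1, val_mem_range_quadrant _, this.1.2⟩, this.2⟩
    · filter_upwards [self_mem_nhdsWithin, nhdsWithin_le_nhds hev] with q h1 h2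
      exact ⟨⟨h2.1.1, h1.2, h2.1.2⟩, h2.2⟩
  obtain ⟨F', hF'⟩ := hF
  -- the derivative in the transversal direction
  have hsnd : ∀ w, F' (0, w) = w := by
    have h1 : HasFDerivWithinAt (fun y : 𝔼 m => ((0 : V), y)) (ContinuousLinearMap.inr ℝ V (𝔼 m))
        (range (𝓒 m)) p := (hasFDerivAt_prodMk_right (𝕜 := ℝ) (0 : V) p).hasFDerivWithinAt
    have h2 := hF'.comp p h1 (fun y hy => ⟨mem_univ _, hy⟩)
    have h3 : HasFDerivWithinAt (F ∘ fun y : 𝔼 m => ((0 : V), y))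
        (ContinuousLinearMap.id ℝ (𝔼 m)) (range (𝓒 m)) p := by
      refine (hasFDerivWithinAt_id _ _).congr_of_eventuallyEq ?_ ?_
      · filter_upwards [self_mem_nhdsWithin, nhdsWithin_le_nhds ht] with y hy1 hy2
        change (φ (c 0 • φ.symm ((𝓒 m).symm y))).1 = y
        rw [hc0, one_smul, val_chart_symm hy1 hy2]
      · change (φ (c 0 • φ.symm ((𝓒 m).symm p))).1 = p
        rw [hc0, one_smul, hp, chart_symm_val hζ]
    have h4 := (uniqueDiffWithinAt_quadrant ζ).eq h2 h3
    intro w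
    exact congrArg (fun L => L w) h4
  -- the derivative along the orbit
  have hfst : ∀ v : V, F' (v, 0) = v := by
    have h1 : HasFDerivAt (fun v : V => (v, p)) (ContinuousLinearMap.inl ℝ V (𝔼 m)) 0 :=
      hasFDerivAt_prodMk_left (𝕜 := ℝ) (0 : V) p
    have h2 : HasFDerivAt (fun v : V => F (v, p)) (F'.comp (ContinuousLinearMap.inl ℝ V (𝔼 m))) 0 :=
      hasFDerivWithinAt_univ.1 (HasFDerivWithinAt.comp (0 : V) hF' h1.hasFDerivWithinAt
        (fun v _ => (⟨mem_univ v, val_mem_range_quadrant (φ ζ)⟩ :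
          (v, p) ∈ (univ : Set V) ×ˢ range (𝓒 m))))
    have e : (fun v : V => F (v, p)) = fun v => id (φ (c v • ζ)).1 := by
      ext1 v
      change (φ (c v • φ.symm ((𝓒 m).symm p))).1 = _
      rw [hp, chart_symm_val hζ]
      rfl
    obtain ⟨c', hc'⟩ : ∃ c' : V →L[ℝ] 𝔼 n, HasMFDerivAt 𝓘(ℝ, V) (𝓡 n) c 0 c' :=
      ⟨_, ((hc.contMDiffAt (hB.mem_nhds hB0)).mdifferentiableAt (by simp)).hasMFDerivAt⟩
    have h3 := hasFDerivAt_comp_orbit (G := G) hφ hζ hc0 hc' (h := id) (hasFDerivWithinAt_id _ _)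
    rw [← e] at h3
    have h4 := h2.unique h3
    have h5 : HasFDerivAt (fun v : V => P (F (v, p) - p))
        (P.comp (F'.comp (ContinuousLinearMap.inl ℝ V (𝔼 m)))) 0 :=
      P.hasFDerivAt.comp (0 : V) (h2.sub_const p)
    have h6 : HasFDerivAt (fun v : V => P (F (v, p) - p)) (ContinuousLinearMap.id ℝ V) 0 := by
      refine (hasFDerivAt_id _).congr_of_eventuallyEq ?_
      filter_upwards [hB.mem_nhds hB0] with v hv
      have := congrFun e v
      simp only at this
      rw [this]
      exact (hcP v hv).2
    have h7 := h5.unique h6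
    intro v
    have h8 : F' (v, 0) ∈ V := by
      have := congrArg (fun L => L v) h4
      change F' (v, 0) = orbitDeriv n G φ ζ (c' v) at this
      rw [this]
      exact hV.ge ⟨c' v, rfl⟩
    have h9 : P (F' (v, 0)) = v := congrArg (fun L => L v) h7
    have h10 := hP ⟨_, h8⟩
    rw [h9] at h10
    exact (congrArg Subtype.val h10).symm
  have hL : HasFDerivWithinAt (fun y : 𝔼 m => (P (y - p), y - (P (y - p) : 𝔼 m)))
      (P.prod (ContinuousLinearMap.id ℝ _ - V.subtypeL.comp P)) (range (𝓒 m)) p := by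
    have h0 : HasFDerivWithinAt (fun y => y - p) (ContinuousLinearMap.id ℝ _)
        (range (𝓒 m)) p := (hasFDerivWithinAt_id _ _).sub_const _
    have h1 : HasFDerivWithinAt (fun y => P (y - p)) P (range (𝓒 m)) p :=
      P.hasFDerivAt.comp_hasFDerivWithinAt p h0
    have h2 : HasFDerivWithinAt (fun y => (P (y - p) : 𝔼 m)) (V.subtypeL.comp P)
        (range (𝓒 m)) p := V.subtypeL.hasFDerivAt.comp_hasFDerivWithinAt p h1
    exact h1.prodMk ((hasFDerivWithinAt_id _ _).sub h2)
  have hpos : ∀ᶠ y in 𝓝 p, ∀ i, p i ≠ 0 → 0 < (y - (P (y - p) : 𝔼 m)) i := by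
    have hcp : ContinuousAt (fun y : 𝔼 m => y - (P (y - p) : 𝔼 m)) p := by fun_prop
    rw [ContinuousAt] at hcp
    simp only [sub_self, map_zero, ZeroMemClass.coe_zero, sub_zero] at hcp
    exact hcp.eventually (eventually_pos_of_ne_zero (φ ζ))
  have hL' := hL.mono (inter_subset_left (s := range (𝓒 m))
    (t := {y | ∀ i, p i ≠ 0 → 0 < (y - (P (y - p) : 𝔼 m)) i}))
  have hpp : (P (p - p), p - (P (p - p) : 𝔼 m)) = ((0 : V), p) := by simp
  rw [← hpp] at hF'
  have h5 := HasFDerivWithinAt.comp (t := univ ×ˢ range (𝓒 m)) p hF' hL'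
    (fun y hy => ⟨mem_univ _, sub_proj_mem_range hφ hζ hy.1 hV (P (y - p)).2 hy.2⟩)
  have h6 := h5.mono_of_mem_nhdsWithin (inter_mem_nhdsWithin (range (𝓒 m)) hpos)
  have hid : F'.comp (P.prod (ContinuousLinearMap.id ℝ _ - V.subtypeL.comp P)) =
      ContinuousLinearMap.id ℝ (𝔼 m) := by
    ext1 w
    change F' (P w, w - (P w : 𝔼 m)) = w
    have : (P w, w - (P w : 𝔼 m)) = (P w, (0 : 𝔼 m)) + ((0 : V), w - (P w : 𝔼 m)) := by simp
    rw [this, map_add, hfst, hsnd]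
    abel
  rw [hid] at h6
  exact h6

/-- The slice map is a local change of coordinates. -/
theorem exists_sliceMap_openPartialHomeomorph (hφ : φ ∈ IsManifold.maximalAtlas (𝓒 m) ∞ M)
    (hζ : ζ ∈ φ.source) (hV : V = orbitTangent n G φ ζ) (hP : ∀ v : V, P v = v) (hB : IsOpen B) (hB0 : 0 ∈ B)
    (hc : ContMDiffOn 𝓘(ℝ, V) (𝓡 n) ∞ c B) (hc0 : c 0 = 1)
    (hcP : ∀ v ∈ B, c v • ζ ∈ φ.source ∧ P ((φ (c v • ζ)).1 - (φ ζ).1) = v) :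
    ∃ θ : OpenPartialHomeomorph (EuclideanQuadrant m) (EuclideanQuadrant m),
      ContMDiffOn (𝓒 m) (𝓒 m) ∞ θ θ.source ∧ ContMDiffOn (𝓒 m) (𝓒 m) ∞ θ.symm θ.target ∧
      φ ζ ∈ θ.source ∧ θ (φ ζ) = φ ζ ∧ ∀ y ∈ θ.source, (θ y).1 = sliceMap φ ζ P c y.1 ∧
        P (y.1 - (φ ζ).1) ∈ B ∧ y.1 - P (y.1 - (φ ζ).1) ∈ range (𝓒 m) ∧
        (𝓒 m).symm (y.1 - P (y.1 - (φ ζ).1)) ∈ φ.target ∧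
        c (P (y.1 - (φ ζ).1)) • φ.symm ((𝓒 m).symm (y.1 - P (y.1 - (φ ζ).1))) ∈ φ.source := by
  set p := (φ ζ).1 with hp
  have hcp1 : ContinuousAt (fun y : 𝔼 m => P (y - p)) p := by fun_prop
  have hcp2 : ContinuousAt (fun y : 𝔼 m => y - (P (y - p) : 𝔼 m)) p := by fun_prop
  rw [ContinuousAt] at hcp1 hcp2
  simp only [sub_self, map_zero, ZeroMemClass.coe_zero, sub_zero] at hcp1 hcp2
  have hev : ∀ᶠ y in 𝓝 p, ((∀ i, p i ≠ 0 → 0 < y i) ∧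
      (∀ i, p i ≠ 0 → 0 < (y - (P (y - p) : 𝔼 m)) i)) ∧ P (y - p) ∈ B ∧
      (𝓒 m).symm (y - P (y - p)) ∈ φ.target ∧
      c (P (y - p)) • φ.symm ((𝓒 m).symm (y - P (y - p))) ∈ φ.source := by
    refine ((eventually_pos_of_ne_zero (φ ζ)).and
      (hcp2.eventually (eventually_pos_of_ne_zero (φ ζ)))).and
      ((hcp1.eventually (p := fun v => v ∈ B) (hB.mem_nhds hB0)).and ((hcp2.eventually (eventually_symm_mem_target hζ)).and ?_))
    have h1 : Tendsto (fun y => c (P (y - p))) (𝓝 p) (𝓝 (1 : G)) := by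
      rw [← hc0]
      exact (hc.continuousOn.continuousAt (hB.mem_nhds hB0)).tendsto.comp hcp1
    have h2 : Tendsto (fun y => φ.symm ((𝓒 m).symm (y - P (y - p)))) (𝓝 p) (𝓝 ζ) := by
      have := (continuousAt_chart_symm_val hζ).tendsto.comp hcp2
      rwa [chart_symm_val hζ] at this
    have h3 := h1.smul h2
    rw [one_smul] at h3
    exact h3 (φ.open_source.mem_nhds hζ)
  obtain ⟨O, hO, hOo, hpO⟩ := mem_nhds_iff.1 hev
  have hmem : ∀ y ∈ range (𝓒 m) ∩ O, y - (P (y - p) : 𝔼 m) ∈ range (𝓒 m) := fun y hy =>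
    sub_proj_mem_range hφ hζ hy.1 hV (P (y - p)).2 (hO hy.2).1.2
  have hsm : ContDiffOn ℝ ∞ (sliceMap φ ζ P c) (range (𝓒 m) ∩ O) := by
    refine ContMDiffOn.contDiffOn ?_
    refine (contMDiffOn_val_chart hφ).comp (f := fun y : 𝔼 m =>
      c (P (y - (φ ζ).1)) • φ.symm ((𝓒 m).symm (y - P (y - (φ ζ).1)))) ?_
      (fun y hy => (hO hy.2).2.2.2)
    have hPs : ContDiff ℝ ∞ (fun y : 𝔼 m => P (y - (φ ζ).1)) :=
      P.contDiff.comp (contDiff_id.sub contDiff_const)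
    refine ContMDiffOn.smul (I := 𝓡 n) (I' := 𝓒 m) ?_ ?_
    · exact hc.comp hPs.contMDiff.contMDiffOn fun y hy => (hO hy.2).2.1
    · have h1 : ContDiff ℝ ∞ (fun y : 𝔼 m => y - (P (y - (φ ζ).1) : 𝔼 m)) :=
        contDiff_id.sub (V.subtypeL.contDiff.comp hPs)
      exact (contMDiffOn_val_chart_symm hφ).comp h1.contMDiff.contMDiffOn
        fun y hy => ⟨hmem y hy, (hO hy.2).2.2.1⟩
  have hself : sliceMap φ ζ P c p = p := by
    have h0 : P (p - (φ ζ).1) = 0 := by simp [hp]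
    rw [sliceMap, h0, hc0, one_smul, ZeroMemClass.coe_zero, sub_zero, hp, chart_symm_val hζ]
  obtain ⟨θ, h1, h2, h3, h4⟩ := exists_quadrant_openPartialHomeomorph hOo (p := φ ζ) hpO hsm
    (fun y _ => val_mem_range_quadrant _)
    (fun y hy => by
      have hyr := (𝓒 m).isClosed_range.frontier_subset hy.1
      obtain ⟨-, j, hj⟩ := mem_frontier_range_quadrant.1 hy.1
      have hpj : p j = 0 := by
        by_contra hne
        exact ((hO hy.2).1.1 j hne).ne' hj
      -- Subtracting a vector tangent to the orbit does not change coordinates vanishing at `ζ`, so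
      -- the slice point lies on the boundary, and group elements preserve the boundary.
      have hb : φ.symm ((𝓒 m).symm (y - P (y - p))) ∈ (𝓒 m).boundary M := by
        rw [mem_boundary_iff_chart hφ (φ.map_target (hO hy.2).2.2.1)]
        refine ⟨j, ?_⟩
        rw [val_chart_symm (hmem y ⟨hyr, hy.2⟩) (hO hy.2).2.2.1, PiLp.sub_apply,
          apply_of_mem_orbitTangent hφ hζ (hV.le (P (y - p)).2) hpj, hj, sub_zero]
      rw [← smul_mem_boundary_iff n (c (P (y - p))),
        mem_boundary_iff_chart hφ (hO hy.2).2.2.2] at hb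
      rw [mem_frontier_range_quadrant]
      exact ⟨mem_range_quadrant.1 (val_mem_range_quadrant _), hb⟩)
    (A := ContinuousLinearEquiv.refl ℝ _)
    (hasFDerivWithinAt_sliceMap hφ hζ hV hP hB hB0 hc hc0 hcP)
  refine ⟨θ, h1, h2, h3, Subtype.ext ?_, fun y hy => ?_⟩
  · rw [(h4 _ h3).2, ← hp, hself]
  · have := hO (h4 y hy).1
    exact ⟨(h4 y hy).2, this.2.1, hmem y.1 ⟨val_mem_range_quadrant _, (h4 y hy).1⟩, this.2.2.1,
      this.2.2.2⟩

end Slice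

/-! ### Isotropy groups along the slice. -/

section SliceTheorem

set_option linter.unusedSectionVars false

variable {n m : ℕ} {G : Type*} [TopologicalSpace G] [ChartedSpace (EuclideanSpace ℝ (Fin n)) G]
  [Group G] [LieGroup (𝓡 n) ∞ G] [IsTopologicalGroup G] [CompactSpace G]
  {M : Type*} [TopologicalSpace M] [T2Space M] [ChartedSpace (EuclideanQuadrant m) M]
  [IsManifold (𝓒 m) ∞ M] [MulAction G M] [ContMDiffSMul (𝓡 n) (𝓒 m) ∞ G M]
  [ContinuousSMul G M] {φ φ' : OpenPartialHomeomorph M (EuclideanQuadrant m)} {ζ ζ' : M}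

/-- A linear chart at `ζ`, an invariant projection `P` to the tangent space of the orbit, a local
parametrization `c` of the orbit, and the local change of coordinates given by the slice map. -/
structure IsSliceSystem (n : ℕ) {m : ℕ} (G : Type*) [TopologicalSpace G]
    [ChartedSpace (EuclideanSpace ℝ (Fin n)) G] [Group G] {M : Type*} [TopologicalSpace M]
    [ChartedSpace (EuclideanQuadrant m) M] [IsManifold (𝓒 m) ∞ M]
    [MulAction G M] (φ : OpenPartialHomeomorph M (EuclideanQuadrant m)) (ζ : M)
    {V : Submodule ℝ (𝔼 m)} (P : 𝔼 m →L[ℝ] V) (c : V → G)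
    (θ : OpenPartialHomeomorph (EuclideanQuadrant m) (EuclideanQuadrant m)) : Prop where
  mem_atlas : φ ∈ IsManifold.maximalAtlas (𝓒 m) ∞ M
  linear : IsLinearChart G φ ζ
  tangent : V = orbitTangent n G φ ζ
  proj : ∀ v : V, P v = v
  equivariant : ∀ k ∈ MulAction.stabilizer G ζ, ∀ x,
    (P (isotropyRep φ ζ k x) : 𝔼 m) = isotropyRep φ ζ k (P x)
  c_zero : c 0 = 1
  contMDiffOn_c : ContMDiffOn 𝓘(ℝ, 𝔼 m) (𝓡 n) ∞ (fun y => c (P (y - (φ ζ).1)))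
    {y | y ∈ range (𝓒 m) ∧ (𝓒 m).symm y ∈ θ.source}
  orbit : Tendsto (fun g : G => P ((φ (g • ζ)).1 - (φ ζ).1)) (𝓝 1) (𝓝 0)
  factor : ∀ᶠ g in 𝓝 (1 : G), g • ζ = c (P ((φ (g • ζ)).1 - (φ ζ).1)) • ζ
  contMDiffOn : ContMDiffOn (𝓒 m) (𝓒 m) ∞ θ θ.source
  contMDiffOn_symm : ContMDiffOn (𝓒 m) (𝓒 m) ∞ θ.symm θ.target
  mem_source : φ ζ ∈ θ.source
  map_eq : ∀ y ∈ θ.source, (θ y).1 = sliceMap φ ζ P c y.1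
  mem_range : ∀ y ∈ θ.source, y.1 - P (y.1 - (φ ζ).1) ∈ range (𝓒 m)
  mem_target : ∀ y ∈ θ.source, (𝓒 m).symm (y.1 - P (y.1 - (φ ζ).1)) ∈ φ.target
  smul_mem : ∀ y ∈ θ.source,
    c (P (y.1 - (φ ζ).1)) • φ.symm ((𝓒 m).symm (y.1 - P (y.1 - (φ ζ).1))) ∈ φ.source

theorem exists_isSliceSystem (n) [ChartedSpace (EuclideanSpace ℝ (Fin n)) G]
    [LieGroup (𝓡 n) ∞ G] [ContMDiffSMul (𝓡 n) (𝓒 m) ∞ G M]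
    (hφ : φ ∈ IsManifold.maximalAtlas (𝓒 m) ∞ M) (hlin : IsLinearChart G φ ζ) :
    ∃ (P : 𝔼 m →L[ℝ] orbitTangent n G φ ζ) (c : orbitTangent n G φ ζ → G)
      (θ : OpenPartialHomeomorph (EuclideanQuadrant m) (EuclideanQuadrant m)),
      IsSliceSystem n G φ ζ P c θ := by
  have hζ := hlin.1
  obtain ⟨P, hP, hPk⟩ := exists_orbitTangent_projection (n := n) (G := G) hφ hζ
  obtain ⟨B, c, hB, hB0, hc, hc0, hcP, hev⟩ := exists_orbit_factorization hφ hζ rfl P hP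
  obtain ⟨θ, h1, h2, h3, -, h5⟩ :=
    exists_sliceMap_openPartialHomeomorph hφ hζ rfl hP hB hB0 hc hc0 hcP
  refine ⟨P, c, θ, hφ, hlin, rfl, hP, hPk, hc0, ?_, ?_, hev.mono fun g hg => hg.2, h1, h2, h3,
    fun y hy => (h5 y hy).1, fun y hy => (h5 y hy).2.2.1, fun y hy => (h5 y hy).2.2.2.1,
    fun y hy => (h5 y hy).2.2.2.2⟩
  · have hPs : ContDiff ℝ ∞ (fun y : 𝔼 m => P (y - (φ ζ).1)) :=
      P.contDiff.comp (contDiff_id.sub contDiff_const)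
    refine hc.comp hPs.contMDiff.contMDiffOn ?_
    rintro y ⟨hy, hys⟩
    have := (h5 _ hys).2.1
    rwa [val_symm_quadrant (mem_range_quadrant.1 hy)] at this
  · have h6 := (contMDiffOn_orbit (n := n) (G := G) hφ ζ).continuousOn.continuousAt
      (eventually_smul_mem_source (G := G) hζ)
    have h7 : ContinuousAt (fun g : G => P ((φ (g • ζ)).1 - (φ ζ).1)) 1 :=
      P.continuous.continuousAt.comp (h6.sub continuousAt_const)
    rw [ContinuousAt] at h7
    simpa using h7

namespace IsSliceSystem

variable {V : Submodule ℝ (𝔼 m)} {P : 𝔼 m →L[ℝ] V} {c : V → G}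
  {θ : OpenPartialHomeomorph (EuclideanQuadrant m) (EuclideanQuadrant m)}

theorem mem_chart_source (h : IsSliceSystem n G φ ζ P c θ) : ζ ∈ φ.source := h.linear.1

/-- Points of the slice near `ζ` are moved to such points only by the stabilizer of `ζ`. -/
theorem exists_nhds_mem_stabilizer (h : IsSliceSystem n G φ ζ P c θ) :
    ∃ N : Set M, IsOpen N ∧ ζ ∈ N ∧ N ⊆ φ.source ∧ (∀ x ∈ N, φ x ∈ θ.source) ∧
      ∀ x ∈ N, ∀ g : G, g • x ∈ N → P ((φ x).1 - (φ ζ).1) = 0 →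
        P ((φ (g • x)).1 - (φ ζ).1) = 0 → g ∈ MulAction.stabilizer G ζ := by
  have hζ := h.mem_chart_source
  set p := (φ ζ).1 with hp
  have hVz : ∀ v : V, ∀ i, p i = 0 → (v : 𝔼 m) i = 0 := fun v i hi =>
    apply_of_mem_orbitTangent h.mem_atlas hζ (h.tangent.le v.2) hi
  -- a ball on which everything is defined
  have hθs : ∀ᶠ y in 𝓝 p, (𝓒 m).symm y ∈ θ.source ∧ ∀ i, p i ≠ 0 → 0 < y i := by
    refine Eventually.and ?_ (eventually_pos_of_ne_zero (φ ζ))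
    refine (𝓒 m).continuous_symm.continuousAt.eventually (p := fun y => y ∈ θ.source)
      (θ.open_source.mem_nhds ?_)
    rw [hp, symm_val_quadrant]
    exact h.mem_source
  obtain ⟨r, hr, hball⟩ := Metric.eventually_nhds_iff_ball.1 hθs
  -- Group elements so close to 1 that they move `ζ` like `c v` with `v` small. Halving `r` leaves
  -- room to add `v` to a slice point and stay in the domain of `θ`.
  have hO : {g : G | ‖P ((φ (g • ζ)).1 - p)‖ < r / 2 ∧
      g • ζ = c (P ((φ (g • ζ)).1 - p)) • ζ} ∈ 𝓝 (1 : G) := by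
    refine Eventually.and ?_ h.factor
    have := h.orbit.eventually (Metric.ball_mem_nhds (0 : V) (half_pos hr))
    simpa [mem_ball_zero_iff] using this
  obtain ⟨U, hU, hUO⟩ := exists_nhds_mem_mul_stabilizer ζ hO
  have hW : {x | x ∈ φ.source ∧ (φ x).1 ∈ Metric.ball p (r / 2)} ∈ 𝓝 ζ := by
    refine inter_mem (φ.open_source.mem_nhds hζ) ?_
    have hc1 : ContinuousAt (fun x => (φ x).1) ζ :=
      (contMDiffOn_val_chart h.mem_atlas).continuousOn.continuousAt (φ.open_source.mem_nhds hζ)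
    exact hc1 (Metric.ball_mem_nhds p (half_pos hr))
  obtain ⟨U₂, hU₂, hζU₂, hU₂W, hinv⟩ := exists_invariant_nhds (G := G) hW
  obtain ⟨U', hU'U, hU', hζU'⟩ := mem_nhds_iff.1 hU
  have hθm : ∀ x ∈ U₂, φ x ∈ θ.source := by
    intro x hx
    have := (hball _ (Metric.ball_subset_ball (half_le_self hr.le) (hU₂W hx).2)).1
    rwa [symm_val_quadrant] at this
  refine ⟨U' ∩ U₂, hU'.inter hU₂, ⟨hζU', hζU₂⟩, fun x hx => (hU₂W hx.2).1,
    fun x hx => hθm x hx.2, fun x hx g hgx hPx hPgx => ?_⟩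
  obtain ⟨o, ⟨ho1, ho2⟩, k, hk, rfl⟩ := hUO x (hU'U hx.1) g (hU'U hgx.1)
  set v := P ((φ (o • ζ)).1 - p) with hv
  -- `o` differs from `c v` by an element of the stabilizer
  have hk' : (c v)⁻¹ * o ∈ MulAction.stabilizer G ζ := by
    rw [MulAction.mem_stabilizer_iff, mul_smul, inv_smul_eq_iff]
    exact ho2
  set l := (c v)⁻¹ * o * k with hl
  have hlK : l ∈ MulAction.stabilizer G ζ := mul_mem hk' hk
  have hgl : (o * k) • x = c v • l • x := by
    rw [smul_smul, hl]
    simp [mul_assoc]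
  set x' := l • x with hx'
  have hx'U : x' ∈ U₂ := hinv l hlK x hx.2
  have hPx' : P ((φ x').1 - p) = 0 := by
    have h1 := (h.linear.2 l hlK x (hU₂W hx.2).1).2
    rw [hx', h1, add_sub_cancel_left]
    refine Subtype.ext ?_
    rw [h.equivariant l hlK, hPx, ZeroMemClass.coe_zero, map_zero]
  -- compare the two preimages under the slice map
  set y : 𝔼 m := (φ x').1 + v with hy
  have hyb : y ∈ Metric.ball p r := by
    have h1 := (hU₂W hx'U).2
    rw [Metric.mem_ball, dist_eq_norm] at h1 ⊢
    calc ‖(φ x').1 + v - p‖ = ‖((φ x').1 - p) + v‖ := by congr 1; abel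
      _ ≤ ‖(φ x').1 - p‖ + ‖(v : 𝔼 m)‖ := norm_add_le _ _
      _ < r / 2 + r / 2 := add_lt_add h1 ho1
      _ = r := add_halves r
  have hyr : y ∈ range (𝓒 m) := by
    rw [mem_range_quadrant]
    intro i
    by_cases hi : p i = 0
    · rw [hy, PiLp.add_apply, hVz v i hi, add_zero]
      exact (φ x').2 i
    · exact ((hball y hyb).2 i hi).le
  have hPy : P (y - p) = v := by
    have : y - p = ((φ x').1 - p) + v := by rw [hy]; abel
    rw [this, map_add, hPx', zero_add, h.proj]
  have e1 : θ ((𝓒 m).symm y) = φ ((o * k) • x) := by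
    refine Subtype.ext ?_
    rw [h.map_eq _ (hball y hyb).1, val_symm_quadrant (mem_range_quadrant.1 hyr), sliceMap, hPy]
    have : y - (v : 𝔼 m) = (φ x').1 := by rw [hy, add_sub_cancel_right]
    rw [this, chart_symm_val (hU₂W hx'U).1, hgl]
  have e2 : θ (φ ((o * k) • x)) = φ ((o * k) • x) := by
    refine Subtype.ext ?_
    rw [h.map_eq _ (hθm _ hgx.2), sliceMap, hPgx, ZeroMemClass.coe_zero, sub_zero, h.c_zero,
      one_smul, chart_symm_val (hU₂W hgx.2).1]
  have e3 := θ.injOn (hball y hyb).1 (hθm _ hgx.2) (e1.trans e2.symm)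
  -- The slice map sends both `φ x' + v` and the slice point `φ (g x)` to `φ (g x)`. By injectivity
  -- they coincide, and applying `P` gives `v = 0`, so `g = l` stabilizes `ζ`.
  have hv0 : v = 0 := by
    rw [← hPy, ← hPgx, ← e3, val_symm_quadrant (mem_range_quadrant.1 hyr)]
  have : o * k = c v * l := by rw [hl]; simp [mul_assoc]
  rw [this, hv0, h.c_zero, one_mul]
  exact hlK

/-- Slice points near `ζ` have stabilizer inside, hence equal to, that of `ζ`. So the stabilizer
fixes the slice pointwise, and its representation fixes the slice directions. Only directions
pointing into the quadrant are realized by points; the others are differences of such. -/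
theorem mem_isotropyFixed_of_proj_eq_zero (hiso : HasUniqueIsotropyType G M)
    (h : IsSliceSystem n G φ ζ P c θ) {w : 𝔼 m} (hw : P w = 0) : w ∈ isotropyFixed G φ ζ := by
  have hζ := h.mem_chart_source
  obtain ⟨N, hN, hζN, hNs, -, hNst⟩ := h.exists_nhds_mem_stabilizer
  set p := (φ ζ).1 with hp
  -- vectors pointing into the quadrant
  have key : ∀ w : 𝔼 m, P w = 0 → (∀ i, p i = 0 → 0 ≤ w i) → w ∈ isotropyFixed G φ ζ := by
    intro w hw hw0
    have hline : ContinuousAt (fun t : ℝ => p + t • w) 0 := by fun_prop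
    rw [ContinuousAt, zero_smul, add_zero] at hline
    have h1 : ∀ᶠ y in 𝓝 p, φ.symm ((𝓒 m).symm y) ∈ N := by
      refine (continuousAt_chart_symm_val hζ) (hN.mem_nhds ?_)
      change φ.symm ((𝓒 m).symm (φ ζ).1) ∈ N
      rwa [chart_symm_val hζ]
    have h2 := hline.eventually ((h1.and (eventually_symm_mem_target hζ)).and
      (eventually_pos_of_ne_zero (φ ζ)))
    obtain ⟨t, ⟨⟨ht1, ht2⟩, ht3⟩, ht0⟩ :=
      ((h2.filter_mono (nhdsWithin_le_nhds (s := Ioi (0 : ℝ)))).and self_mem_nhdsWithin).exists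
    have ht0' : (0 : ℝ) < t := ht0
    have hr : p + t • w ∈ range (𝓒 m) := by
      rw [mem_range_quadrant]
      intro i
      by_cases hi : p i = 0
      · rw [PiLp.add_apply, hi, zero_add, PiLp.smul_apply, smul_eq_mul]
        exact mul_nonneg ht0'.le (hw0 i hi)
      · exact (ht3 i hi).le
    set x := φ.symm ((𝓒 m).symm (p + t • w)) with hx
    have hφx : (φ x).1 = p + t • w := val_chart_symm hr ht2
    have hPx : P ((φ x).1 - p) = 0 := by
      rw [hφx, add_sub_cancel_left, map_smul, hw, smul_zero]
    have hst : MulAction.stabilizer G x = MulAction.stabilizer G ζ := by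
      refine stabilizer_eq_of_le hiso fun g hg => ?_
      have hgx : g • x = x := hg
      exact hNst x ht1 g (by rwa [hgx]) hPx (by rwa [hgx])
    intro k hk
    have hkx : k • x = x := by
      have : k ∈ MulAction.stabilizer G x := hst ▸ hk
      exact this
    have h3 := (h.linear.2 k hk x (hNs ht1)).2
    rw [hkx, hφx, add_sub_cancel_left, ← hp, map_smul] at h3
    have h4 := add_left_cancel h3
    exact (smul_right_injective _ ht0'.ne' h4).symm
  -- A slice direction pointing strictly inward at every face through `ζ`: project the all-ones
  -- vector, which leaves the vanishing coordinates equal to 1.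
  obtain ⟨w₀, hw₀, hw₀p⟩ : ∃ w₀ : 𝔼 m, P w₀ = 0 ∧ ∀ i, p i = 0 → w₀ i = 1 := by
    let u : 𝔼 m := WithLp.toLp 2 fun _ => 1
    refine ⟨u - P u, by rw [map_sub, h.proj, sub_self], fun i hi => ?_⟩
    rw [PiLp.sub_apply, apply_of_mem_orbitTangent h.mem_atlas hζ (h.tangent.le (P u).2) hi]
    simp [u]
  have h1 := key w₀ hw₀ fun i hi => by rw [hw₀p i hi]; exact zero_le_one
  -- The multiple of `w₀` bounds every negative coordinate of `w` from below, so the sum points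
  -- inward.
  have h2 := key (w + (∑ i, |w i|) • w₀) (by rw [map_add, map_smul, hw, hw₀]; simp) fun i hi => by
    rw [PiLp.add_apply, PiLp.smul_apply, hw₀p i hi, smul_eq_mul, mul_one]
    have := Finset.single_le_sum (f := fun i => |w i|) (fun i _ => abs_nonneg (w i))
      (Finset.mem_univ i)
    have := neg_abs_le (w i)
    simp only at *
    linarith
  have h3 := sub_mem h2 (Submodule.smul_mem _ (∑ i, |w i|) h1)
  rwa [add_sub_cancel_right] at h3

end IsSliceSystem

end SliceTheorem

/-! ### Slices and fixed point sets in coordinates. -/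

section CoordinateSlice

set_option linter.unusedSectionVars false

variable {n m q : ℕ} {G : Type*} [TopologicalSpace G] [ChartedSpace (EuclideanSpace ℝ (Fin n)) G]
  [Group G] [LieGroup (𝓡 n) ∞ G] [IsTopologicalGroup G] [CompactSpace G]
  {M : Type*} [TopologicalSpace M] [T2Space M] [ChartedSpace (EuclideanQuadrant m) M]
  [IsManifold (𝓒 m) ∞ M] [MulAction G M] [ContMDiffSMul (𝓡 n) (𝓒 m) ∞ G M]
  [ContinuousSMul G M] {φ φ' : OpenPartialHomeomorph M (EuclideanQuadrant m)} {ζ ζ' : M}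

/-- A slice at `ζ` given by fixing the coordinates outside the range of `e` in the chart `φ`. Each
point `x` of the neighbourhood `N` is the translate by `σ x` of the point `sl x` of the slice, which
is the only point of the slice in the orbit of `x`. -/
structure IsSlice (n : ℕ) {m q : ℕ} {G : Type*} [TopologicalSpace G]
    [ChartedSpace (EuclideanSpace ℝ (Fin n)) G] [Group G] {M : Type*} [TopologicalSpace M]
    [ChartedSpace (EuclideanQuadrant m) M] [IsManifold (𝓒 m) ∞ M]
    [MulAction G M] (φ : OpenPartialHomeomorph M (EuclideanQuadrant m)) (e : Fin q ↪ Fin m) (ζ : M)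
    (N : Set M) (σ : M → G) (sl : M → M) : Prop where
  mem_atlas : φ ∈ IsManifold.maximalAtlas (𝓒 m) ∞ M
  isOpen : IsOpen N
  mem : ζ ∈ N
  subset_source : N ⊆ φ.source
  mem_range_of_zero : ∀ i, (φ ζ).1 i = 0 → i ∈ range e
  contMDiffOn_translate : ContMDiffOn (𝓒 m) (𝓡 n) ∞ σ N
  contMDiffOn_slice : ContMDiffOn (𝓒 m) (𝓒 m) ∞ sl N
  translate_self : σ ζ = 1
  slice_self : sl ζ = ζ
  mapsTo : ∀ x ∈ N, sl x ∈ N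
  smul_slice : ∀ x ∈ N, σ x • sl x = x
  stabilizer_slice : ∀ x ∈ N, MulAction.stabilizer G (sl x) = MulAction.stabilizer G ζ
  coord_slice : ∀ x ∈ N, ∀ i ∉ range e, (φ (sl x)).1 i = (φ ζ).1 i
  slice_eq_self : ∀ x ∈ N, (∀ i ∉ range e, (φ x).1 i = (φ ζ).1 i) → sl x = x
  slice_smul : ∀ x ∈ N, ∀ g : G, g • x ∈ N → sl (g • x) = sl x

/-- Two charts are involved. `φ₂` straightens the slice to a coordinate subspace, while `φ'`, which
is `φ` followed by the inverse of the slice map, separates a point into its orbit part, giving `σ`,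
and its slice part, giving `sl`. -/
theorem exists_isSlice (n) [ChartedSpace (EuclideanSpace ℝ (Fin n)) G]
    [LieGroup (𝓡 n) ∞ G] [ContMDiffSMul (𝓡 n) (𝓒 m) ∞ G M] (hM : IsManifoldWithCorners m M)
    (hbif : IsBoundaryIntersectionFree m G M) (hiso : HasUniqueIsotropyType G M) (ζ : M)
    (hq : ∀ φ ∈ IsManifold.maximalAtlas (𝓒 m) ∞ M, ζ ∈ φ.source →
      Module.finrank ℝ (orbitTangent n G φ ζ) + q = m) :
    ∃ (φ : OpenPartialHomeomorph M (EuclideanQuadrant m)) (e : Fin q ↪ Fin m) (N : Set M)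
      (σ : M → G) (sl : M → M), IsSlice n φ e ζ N σ sl := by
  obtain ⟨φ, hφ, hlin⟩ := exists_isLinearChart (G := G) n hM hbif ζ
  have hζ := hlin.1
  obtain ⟨P, c, θ, hs⟩ := exists_isSliceSystem n hφ hlin
  set p := (φ ζ).1 with hp
  have hker : Module.finrank ℝ (LinearMap.ker (P : 𝔼 m →ₗ[ℝ] orbitTangent n G φ ζ)) = q := by
    have h1 := LinearMap.finrank_range_add_finrank_ker (P : 𝔼 m →ₗ[ℝ] orbitTangent n G φ ζ)
    have h2 : LinearMap.range (P : 𝔼 m →ₗ[ℝ] orbitTangent n G φ ζ) = ⊤ :=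
      LinearMap.range_eq_top.2 fun v => ⟨v, hs.proj v⟩
    rw [h2, finrank_top, finrank_euclideanSpace_fin] at h1
    have h3 := hq φ hφ hζ
    omega
  obtain ⟨e, B, hZe, hBe, hBX⟩ := exists_coordinate_straightening
    (LinearMap.ker (P : 𝔼 m →ₗ[ℝ] orbitTangent n G φ ζ)) {i | p i = 0} (fun v => by
      refine ⟨v - P v, ?_, fun i hi => ?_⟩
      · rw [LinearMap.mem_ker]
        change P (v - P v) = 0
        rw [map_sub, hs.proj, sub_self]
      · rw [PiLp.sub_apply, apply_of_mem_orbitTangent hφ hζ (P v).2 hi, sub_zero]) hker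
  obtain ⟨φ₂, hφ₂, hζ₂, hφ₂s, hφ₂v⟩ := exists_affine_recoordinate hφ hζ B
    (fun i hi v => hBe v i (hZe hi))
  have hp₂ : (φ₂ ζ).1 = p := by rw [hφ₂v ζ hζ₂, sub_self, map_zero, add_zero]
  have hslice : ∀ x ∈ φ₂.source, (P ((φ x).1 - p) = 0 ↔ ∀ i ∉ range e, (φ₂ x).1 i = (φ₂ ζ).1 i) := by
    intro x hx
    refine (hBX ((φ x).1 - p)).trans (forall₂_congr fun i _ => ?_)
    rw [hp₂, hφ₂v x hx, PiLp.add_apply, add_eq_left]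
  obtain ⟨N₂, hN₂, hζN₂, hN₂s, hN₂θ, hN₂st⟩ := hs.exists_nhds_mem_stabilizer
  -- the chart in which the action along the orbit is straightened
  set φ' := φ.trans θ.symm with hφ'
  have hφ'm : φ' ∈ IsManifold.maximalAtlas (𝓒 m) ∞ M :=
    trans_mem_maximalAtlas hφ hs.contMDiffOn_symm (by simpa using hs.contMDiffOn)
  have hsrc : ∀ x, x ∈ φ'.source ↔ x ∈ φ.source ∧ φ x ∈ θ.target := fun x => by
    rw [hφ', OpenPartialHomeomorph.trans_source]; rfl
  have hmem : ∀ x ∈ φ'.source, φ' x ∈ θ.source := fun x hx => θ.map_target ((hsrc x).1 hx).2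
  have hθφ : ∀ x ∈ φ'.source, θ (φ' x) = φ x := fun x hx => θ.right_inv ((hsrc x).1 hx).2
  let σ : M → G := fun x => c (P ((φ' x).1 - p))
  let sl : M → M := fun x => φ.symm ((𝓒 m).symm ((φ' x).1 - P ((φ' x).1 - p)))
  have hslv : ∀ x ∈ φ'.source, (φ (sl x)).1 = (φ' x).1 - P ((φ' x).1 - p) := fun x hx =>
    val_chart_symm (hs.mem_range _ (hmem x hx)) (hs.mem_target _ (hmem x hx))
  have hslP : ∀ x ∈ φ'.source, P ((φ (sl x)).1 - p) = 0 := fun x hx => by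
    rw [hslv x hx, sub_right_comm, map_sub, hs.proj, sub_self]
  have hσsl : ∀ x ∈ φ'.source, σ x • sl x = x := fun x hx => by
    refine φ.injOn (hs.smul_mem _ (hmem x hx)) ((hsrc x).1 hx).1 (Subtype.ext ?_)
    rw [← hθφ x hx, hs.map_eq _ (hmem x hx)]
    rfl
  -- The slice map is the identity on the slice, since `c 0 = 1`; hence so is the retraction `sl`.
  have hfix : ∀ x ∈ N₂, P ((φ x).1 - p) = 0 → x ∈ φ'.source ∧ φ' x = φ x ∧ sl x = x := by
    intro x hx hPx
    have h1 : θ (φ x) = φ x := by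
      refine Subtype.ext ?_
      rw [hs.map_eq _ (hN₂θ x hx), sliceMap, hPx, ZeroMemClass.coe_zero, sub_zero, hs.c_zero,
        one_smul, chart_symm_val (hN₂s hx)]
    have h2 : φ x ∈ θ.target := h1 ▸ θ.map_source (hN₂θ x hx)
    have h3 : φ' x = φ x := by
      change θ.symm (φ x) = φ x
      conv_lhs => rw [← h1]
      exact θ.left_inv (hN₂θ x hx)
    refine ⟨(hsrc x).2 ⟨hN₂s hx, h2⟩, h3, ?_⟩
    change φ.symm ((𝓒 m).symm ((φ' x).1 - P ((φ' x).1 - p))) = x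
    rw [h3, hPx, ZeroMemClass.coe_zero, sub_zero, chart_symm_val (hN₂s hx)]
  have hval : ContMDiffOn (𝓒 m) 𝓘(ℝ, 𝔼 m) ∞ (fun x => (φ' x).1) φ'.source :=
    contMDiffOn_val_chart hφ'm
  have hσs : ContMDiffOn (𝓒 m) (𝓡 n) ∞ σ φ'.source :=
    hs.contMDiffOn_c.comp hval fun x hx => ⟨val_mem_range_quadrant _, by
      rw [symm_val_quadrant]; exact hmem x hx⟩
  have hsls : ContMDiffOn (𝓒 m) (𝓒 m) ∞ sl φ'.source := by
    refine (contMDiffOn_val_chart_symm hφ).comp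
      (f := fun x => (φ' x).1 - (P ((φ' x).1 - p) : 𝔼 m)) ?_
      (fun x hx => ⟨hs.mem_range _ (hmem x hx), hs.mem_target _ (hmem x hx)⟩)
    have h1 : ContDiff ℝ ∞ (fun y : 𝔼 m => y - (P (y - p) : 𝔼 m)) :=
      contDiff_id.sub ((orbitTangent n G φ ζ).subtypeL.contDiff.comp
        (P.contDiff.comp (contDiff_id.sub contDiff_const)))
    exact h1.contMDiff.comp_contMDiffOn hval
  have hζP : P ((φ ζ).1 - p) = 0 := by rw [hp, sub_self, map_zero]
  obtain ⟨hζ', hφ'ζ, hslζ⟩ := hfix ζ hζN₂ hζP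
  set N₀ : Set M := φ'.source ∩ (N₂ ∩ φ₂.source) with hN₀
  have hN₀o : IsOpen N₀ := φ'.open_source.inter (hN₂.inter φ₂.open_source)
  -- Requiring the slice part to be in `N₀` as well makes `N` stable under `sl`, which is
  -- idempotent.
  set N : Set M := N₀ ∩ sl ⁻¹' N₀ with hN
  have hslst : ∀ x ∈ N, MulAction.stabilizer G (sl x) = MulAction.stabilizer G ζ := by
    intro x hx
    refine stabilizer_eq_of_le hiso fun g hg => ?_
    have hgx : g • sl x = sl x := hg
    exact hN₂st _ hx.2.2.1 g (by rw [hgx]; exact hx.2.2.1) (hslP x hx.1.1)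
      (by rw [hgx]; exact hslP x hx.1.1)
  refine ⟨φ₂, e, N, σ, sl, hφ₂, (hsls.continuousOn.mono inter_subset_left).isOpen_inter_preimage
    hN₀o hN₀o, ⟨⟨hζ', hζN₂, hζ₂⟩, ?_⟩, fun x hx => hx.1.2.2, fun i hi => hZe ?_,
    hσs.mono fun x hx => hx.1.1, hsls.mono fun x hx => hx.1.1, ?_, hslζ, fun x hx => ⟨hx.2, ?_⟩,
    fun x hx => hσsl x hx.1.1, hslst, fun x hx => ?_, fun x hx hxs => ?_, fun x hx g hgx => ?_⟩
  · change sl ζ ∈ N₀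
    rw [hslζ]
    exact ⟨hζ', hζN₂, hζ₂⟩
  · rwa [hp₂] at hi
  · change c (P ((φ' ζ).1 - p)) = 1
    rw [hφ'ζ, hζP, hs.c_zero]
  · change sl (sl x) ∈ N₀
    rw [(hfix _ hx.2.2.1 (hslP x hx.1.1)).2.2]
    exact hx.2
  · exact (hslice _ hx.2.2.2).1 (hslP x hx.1.1)
  · exact (hfix x hx.1.2.1 ((hslice x hx.1.2.2).2 hxs)).2.2
  -- This element carries one slice point to the other, so it stabilizes `ζ`. But the first slice
  -- point has the same stabilizer, so the two points are equal.
  · have h1 : ((σ (g • x))⁻¹ * g * σ x) • sl x = sl (g • x) := by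
      rw [mul_smul, mul_smul, hσsl x hx.1.1, inv_smul_eq_iff, hσsl _ hgx.1.1]
    have h2 := hN₂st _ hx.2.2.1 _ (by rw [h1]; exact hgx.2.2.1) (hslP x hx.1.1)
      (by rw [h1]; exact hslP _ hgx.1.1)
    rw [← hslst x hx] at h2
    have h3 : ((σ (g • x))⁻¹ * g * σ x) • sl x = sl x := h2
    rw [← h1, h3]

/-- A chart of `M` around `ζ` in which the fixed points of the stabilizer of `ζ` are given by fixing
coordinates. -/
structure IsFixedChart {m d : ℕ} (G : Type*) [Group G] {M : Type*} [TopologicalSpace M]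
    [ChartedSpace (EuclideanQuadrant m) M] [IsManifold (𝓒 m) ∞ M]
    [MulAction G M] (φ : OpenPartialHomeomorph M (EuclideanQuadrant m)) (e : Fin d ↪ Fin m)
    (ζ : M) : Prop where
  mem_atlas : φ ∈ IsManifold.maximalAtlas (𝓒 m) ∞ M
  mem_source : ζ ∈ φ.source
  mem_range_of_zero : ∀ i, (φ ζ).1 i = 0 → i ∈ range e
  mem_fixedPoints_iff : ∀ x ∈ φ.source,
    (x ∈ MulAction.fixedPoints (MulAction.stabilizer G ζ) M ↔
      ∀ i ∉ range e, (φ x).1 i = (φ ζ).1 i)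

/-- The fixed vectors of all linear charts at points with the same stabilizer have the same
dimension. -/
theorem exists_finrank_isotropyFixed (n) [ChartedSpace (EuclideanSpace ℝ (Fin n)) G]
    [LieGroup (𝓡 n) ∞ G] [ContMDiffSMul (𝓡 n) (𝓒 m) ∞ G M] (hM : IsManifoldWithCorners m M)
    (hbif : IsBoundaryIntersectionFree m G M) (hiso : HasUniqueIsotropyType G M) (ζ : M) :
    ∃ d : ℕ, ∀ ζ' : M, MulAction.stabilizer G ζ' = MulAction.stabilizer G ζ →
      ∀ φ ∈ IsManifold.maximalAtlas (𝓒 m) ∞ M, IsLinearChart G φ ζ' →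
        Module.finrank ℝ (isotropyFixed G φ ζ') = d := by
  have key : ∀ ζ' : M, ∀ φ ∈ IsManifold.maximalAtlas (𝓒 m) ∞ M, IsLinearChart G φ ζ' →
      Module.finrank ℝ (isotropyFixed G φ ζ') + n =
        m + Module.finrank ℝ (orbitFixed n G φ ζ') := by
    intro ζ' φ hφ hlin
    obtain ⟨P, c, θ, hs⟩ := exists_isSliceSystem n hφ hlin
    exact finrank_isotropyFixed_add hφ hlin.1 hs.proj hs.equivariant
      fun w hw => hs.mem_isotropyFixed_of_proj_eq_zero hiso hw
  obtain ⟨φ₀, hφ₀, hlin₀⟩ := exists_isLinearChart (G := G) n hM hbif ζ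
  refine ⟨Module.finrank ℝ (isotropyFixed G φ₀ ζ), fun ζ' hst φ hφ hlin => ?_⟩
  have h1 := key ζ φ₀ hφ₀ hlin₀
  have h2 := key ζ' φ hφ hlin
  rw [orbitFixed_eq_of_stabilizer_eq hφ hlin.1 hφ₀ hlin₀.1 hst] at h2
  omega

/-- In a linear chart a point is fixed by the stabilizer exactly when its displacement from `ζ` is a
fixed vector. The straightening retains all coordinates vanishing at `ζ`, which is what makes the
fixed set transversal to the faces. -/
theorem exists_isFixedChart {d : ℕ} (n) [ChartedSpace (EuclideanSpace ℝ (Fin n)) G]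
    [LieGroup (𝓡 n) ∞ G] [ContMDiffSMul (𝓡 n) (𝓒 m) ∞ G M] (hM : IsManifoldWithCorners m M)
    (hbif : IsBoundaryIntersectionFree m G M) (ζ : M)
    (hd : ∀ φ ∈ IsManifold.maximalAtlas (𝓒 m) ∞ M, IsLinearChart G φ ζ →
        Module.finrank ℝ (isotropyFixed G φ ζ) = d) :
    ∃ (φ : OpenPartialHomeomorph M (EuclideanQuadrant m)) (e : Fin d ↪ Fin m),
      IsFixedChart G φ e ζ := by
  obtain ⟨φ, hφ, hlin⟩ := exists_isLinearChart (G := G) n hM hbif ζ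
  have hζ := hlin.1
  obtain ⟨e, B, hZe, hBe, hBX⟩ := exists_coordinate_straightening
    (isotropyFixed G φ ζ) {i | (φ ζ).1 i = 0}
    (fun v => exists_mem_isotropyFixed n hM hbif hφ hζ v) (hd φ hφ hlin)
  obtain ⟨φ₂, hφ₂, hζ₂, hφ₂s, hφ₂v⟩ := exists_affine_recoordinate hφ hζ B
    (fun i hi v => hBe v i (hZe hi))
  have hp₂ : (φ₂ ζ).1 = (φ ζ).1 := by rw [hφ₂v ζ hζ₂, sub_self, map_zero, add_zero]
  refine ⟨φ₂, e, hφ₂, hζ₂, fun i hi => hZe (by rwa [hp₂] at hi), fun x hx => ?_⟩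
  have h1 : (∀ i ∉ range e, (φ₂ x).1 i = (φ₂ ζ).1 i) ↔ (φ x).1 - (φ ζ).1 ∈ isotropyFixed G φ ζ := by
    refine Iff.trans (forall₂_congr fun i _ => ?_) (hBX _).symm
    rw [hp₂, hφ₂v x hx, PiLp.add_apply, add_eq_left]
  rw [h1]
  have h2 : ∀ k ∈ MulAction.stabilizer G ζ, (k • x = x ↔
      isotropyRep φ ζ k ((φ x).1 - (φ ζ).1) = (φ x).1 - (φ ζ).1) := by
    intro k hk
    obtain ⟨h3, h4⟩ := hlin.2 k hk x (hφ₂s hx)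
    rw [← φ.injOn.eq_iff h3 (hφ₂s hx), ← Subtype.coe_inj, h4, eq_sub_iff_add_eq']
  exact ⟨fun hx k hk => (h2 k hk).1 (hx ⟨k, hk⟩), fun hx k => (h2 k k.2).2 (hx k k.2)⟩

end CoordinateSlice

/-! ### Coordinate projections and inclusions of quadrants. -/

section CoordinateMaps

set_option linter.unusedSectionVars false

variable {m q : ℕ} {EX HX X : Type*} [NormedAddCommGroup EX] [NormedSpace ℝ EX] [TopologicalSpace HX]
  {J : ModelWithCorners ℝ EX HX} [TopologicalSpace X] [ChartedSpace HX X]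

theorem contMDiffOn_quadrant_of_val {f : X → EuclideanQuadrant m} {s : Set X}
    (h : ContMDiffOn J 𝓘(ℝ, 𝔼 m) ∞ (fun x => (f x).1) s) : ContMDiffOn J (𝓒 m) ∞ f s := by
  refine ((𝓒 m).contMDiffOn_symm.comp h fun x _ => val_mem_range_quadrant (f x)).congr
    fun x _ => ?_
  exact (symm_val_quadrant (f x)).symm

/-- The coordinates of a point of a quadrant in the range of `e`. -/
noncomputable def quadProj (e : Fin q ↪ Fin m) (y : EuclideanQuadrant m) : EuclideanQuadrant q :=
  ⟨WithLp.toLp 2 fun j => y.1 (e j), fun j => y.2 (e j)⟩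

/-- The point of a quadrant with the given coordinates in the range of `e` and the other coordinates
equal to those of `p`. -/
noncomputable def quadIncl (e : Fin q ↪ Fin m) (p : EuclideanQuadrant m) (y : EuclideanQuadrant q) :
    EuclideanQuadrant m :=
  ⟨WithLp.toLp 2 (Function.extend e (fun j => y.1 j) fun i => p.1 i), fun i => by
    classical
    change 0 ≤ Function.extend e (fun j => y.1 j) (fun i => p.1 i) i
    by_cases hi : ∃ j, e j = i
    · obtain ⟨j, rfl⟩ := hi
      rw [e.injective.extend_apply]
      exact y.2 j
    · rw [Function.extend_apply' _ _ _ hi]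
      exact p.2 i⟩

theorem quadProj_apply (e : Fin q ↪ Fin m) (y : EuclideanQuadrant m) (j : Fin q) :
    (quadProj e y).1 j = y.1 (e j) := rfl

theorem quadIncl_apply (e : Fin q ↪ Fin m) (p : EuclideanQuadrant m) (y : EuclideanQuadrant q)
    (j : Fin q) : (quadIncl e p y).1 (e j) = y.1 j :=
  e.injective.extend_apply _ _ _

theorem quadIncl_apply_of_notMem (e : Fin q ↪ Fin m) (p : EuclideanQuadrant m)
    (y : EuclideanQuadrant q) {i : Fin m} (hi : i ∉ range e) : (quadIncl e p y).1 i = p.1 i :=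
  Function.extend_apply' _ _ _ hi

theorem quadrant_ext {y z : EuclideanQuadrant m} (h : ∀ i, y.1 i = z.1 i) : y = z :=
  Subtype.ext (PiLp.ext h)

theorem quadProj_quadIncl (e : Fin q ↪ Fin m) (p : EuclideanQuadrant m) (y : EuclideanQuadrant q) :
    quadProj e (quadIncl e p y) = y :=
  quadrant_ext fun j => quadIncl_apply e p y j

theorem quadIncl_quadProj {e : Fin q ↪ Fin m} {p y : EuclideanQuadrant m}
    (h : ∀ i ∉ range e, y.1 i = p.1 i) : quadIncl e p (quadProj e y) = y := by
  refine quadrant_ext fun i => ?_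
  by_cases hi : i ∈ range e
  · obtain ⟨j, rfl⟩ := hi
    rw [quadIncl_apply, quadProj_apply]
  · rw [quadIncl_apply_of_notMem _ _ _ hi, h i hi]

theorem contMDiff_quadProj (e : Fin q ↪ Fin m) : ContMDiff (𝓒 m) (𝓒 q) ∞ (quadProj e) := by
  rw [← contMDiffOn_univ]
  refine contMDiffOn_quadrant_of_val (ContMDiff.contMDiffOn ?_)
  have h : ContDiff ℝ ∞ (fun y : 𝔼 m => (WithLp.toLp 2 fun j => y (e j) : 𝔼 q)) := by
    rw [contDiff_euclidean]
    intro j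
    exact (EuclideanSpace.proj (𝕜 := ℝ) (e j)).contDiff
  exact h.contMDiff.comp (𝓒 m).contMDiff

theorem contMDiff_quadIncl (e : Fin q ↪ Fin m) (p : EuclideanQuadrant m) :
    ContMDiff (𝓒 q) (𝓒 m) ∞ (quadIncl e p) := by
  rw [← contMDiffOn_univ]
  refine contMDiffOn_quadrant_of_val (ContMDiff.contMDiffOn ?_)
  have h : ContDiff ℝ ∞ (fun y : 𝔼 q =>
      (WithLp.toLp 2 (Function.extend e (fun j => y j) fun i => p.1 i) : 𝔼 m)) := by
    rw [contDiff_euclidean]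
    intro i
    by_cases hi : ∃ j, e j = i
    · obtain ⟨j, rfl⟩ := hi
      have : (fun y : 𝔼 q => (WithLp.toLp 2 (Function.extend e (fun j => y j) fun i => p.1 i) :
          𝔼 m) (e j)) = fun y : 𝔼 q => y j := by
        ext y
        exact e.injective.extend_apply _ _ _
      rw [this]
      exact (EuclideanSpace.proj (𝕜 := ℝ) j).contDiff
    · have : (fun y : 𝔼 q => (WithLp.toLp 2 (Function.extend e (fun j => y j) fun i => p.1 i) :
          𝔼 m) i) = fun _ => p.1 i := by
        ext y
        exact Function.extend_apply' _ _ _ hi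
      rw [this]
      exact contDiff_const
  exact h.contMDiff.comp (𝓒 q).contMDiff

end CoordinateMaps

/-! ### Manifold structures from families of charts. -/

section BuildManifold

variable {E H Y : Type*} [NormedAddCommGroup E] [NormedSpace ℝ E] [TopologicalSpace H]
  {I : ModelWithCorners ℝ E H} [TopologicalSpace Y]

/-- A charted space structure from a choice of charts at all points. -/
theorem exists_chartedSpace {Q : OpenPartialHomeomorph Y H → Prop}
    (h : ∀ y : Y, ∃ e : OpenPartialHomeomorph Y H, y ∈ e.source ∧ Q e) :
    ∃ cs : ChartedSpace H Y, ∀ e ∈ cs.atlas, Q e := by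
  choose e he hQ using h
  refine ⟨{ atlas := range e
            chartAt := e
            mem_chart_source := he
            chart_mem_atlas := fun y => ⟨y, rfl⟩ }, ?_⟩
  rintro _ ⟨y, rfl⟩
  exact hQ y

/-- Only one direction is assumed for each ordered pair; exchanging the charts gives the inverse, so
each transition map lies in the smooth groupoid of the model. -/
theorem isManifold_of_contMDiffOn_transition [ChartedSpace H Y]
    (h : ∀ e ∈ atlas H Y, ∀ e' ∈ atlas H Y,
      ContMDiffOn I I ∞ (e.symm.trans e') (e.symm.trans e').source) : IsManifold I ∞ Y := by
  have key : ∀ e ∈ atlas H Y, ∀ e' ∈ atlas H Y, e.symm.trans e' ∈ contDiffGroupoid ∞ I := by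
    intro e he e' he'
    have h1 : e.symm.trans e' ∈ IsManifold.maximalAtlas I ∞ H := by
      refine OpenPartialHomeomorph.mem_maximalAtlas_of_contMDiffOn _ (h e he e' he') ?_
      have := h e' he' e he
      rw [← OpenPartialHomeomorph.symm_source]
      rwa [OpenPartialHomeomorph.trans_symm_eq_symm_trans_symm, OpenPartialHomeomorph.symm_symm]
    have h2 := (h1 (OpenPartialHomeomorph.refl H) rfl).2
    rwa [OpenPartialHomeomorph.refl_symm, OpenPartialHomeomorph.refl_trans] at h2
  exact { compatible := fun {e e'} he he' => key e he e' he' }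

end BuildManifold

/-! ### A criterion for smooth quotient maps. -/

section SmoothQuotient

set_option linter.unusedSectionVars false

variable {E H E' H' X Y : Type*}
    [NormedAddCommGroup E] [NormedSpace ℝ E] [TopologicalSpace H] {I : ModelWithCorners ℝ E H}
    [NormedAddCommGroup E'] [NormedSpace ℝ E'] [TopologicalSpace H'] {J : ModelWithCorners ℝ E' H'}
    [TopologicalSpace X] [ChartedSpace H X] [TopologicalSpace Y] [ChartedSpace H' Y]
    {π : X → Y}

/-- A surjective smooth map with local sections is a quotient map. -/
theorem isSmoothQuotientMap_of_section (hs : Function.Surjective π) (hπ : ContMDiff I J ∞ π)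
    (h : ∀ x : X, ∃ (U : Set Y) (s : Y → X), IsOpen U ∧ π x ∈ U ∧
      ContMDiffOn J I ∞ s U ∧ s (π x) = x ∧ ∀ y ∈ U, π (s y) = y) :
    IsSmoothQuotientMap I J π := by
  -- A continuous local section through each point forces images of neighbourhoods to be
  -- neighbourhoods.
  have hopen : IsOpenMap π := by
    rw [isOpenMap_iff_nhds_le]
    intro x
    obtain ⟨U, s, hU, hx, hsm, hsx, hπs⟩ := h x
    have hc : Tendsto s (𝓝 (π x)) (𝓝 x) := by
      have := hsm.continuousOn.continuousAt (hU.mem_nhds hx)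
      rwa [ContinuousAt, hsx] at this
    calc 𝓝 (π x) = map (π ∘ s) (𝓝 (π x)) := by
          have : π ∘ s =ᶠ[𝓝 (π x)] id := by
            filter_upwards [hU.mem_nhds hx] with y hy using hπs y hy
          rw [map_congr this, map_id]
      _ = map π (map s (𝓝 (π x))) := map_map.symm
      _ ≤ map π (𝓝 x) := map_mono hc
  exact ⟨hopen.isQuotientMap hπ.continuous hs, hπ, h⟩

end SmoothQuotient

/-! ### Topology of the orbit space. -/

section QuotientTopology

set_option linter.unusedSectionVars false

variable {G M : Type*} [TopologicalSpace G] [Group G] [IsTopologicalGroup G] [CompactSpace G]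
  [TopologicalSpace M] [T2Space M] [MulAction G M] [ContinuousSMul G M]

/-- The orbit relation is the projection along the compact group of a closed set, hence closed, and
the quotient map is open. -/
theorem t2Space_orbitQuotient : T2Space (MulAction.orbitRel.Quotient G M) := by
  rw [t2_iff_isClosed_diagonal]
  have h1 : IsOpenQuotientMap (Prod.map (orbitMk G : M → _) (orbitMk G : M → _)) :=
    MulAction.isOpenQuotientMap_quotientMk.prodMap MulAction.isOpenQuotientMap_quotientMk
  rw [← h1.isQuotientMap.isClosed_preimage]
  have h2 : IsClosed {z : G × (M × M) | z.1 • z.2.2 = z.2.1} :=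
    isClosed_eq (by fun_prop) (by fun_prop)
  have h3 := isClosedMap_snd_of_compactSpace _ h2
  convert h3 using 1
  ext ⟨x, y⟩
  constructor
  · intro h
    have h4 : (MulAction.orbitRel G M).r x y := Quotient.exact h
    obtain ⟨g, hg⟩ := h4
    exact ⟨(g, (x, y)), hg, rfl⟩
  · rintro ⟨⟨g, x', y'⟩, hg, h⟩
    obtain ⟨rfl, rfl⟩ := Prod.ext_iff.1 h
    exact Quotient.sound ⟨g, hg⟩

theorem secondCountable_orbitQuotient [SecondCountableTopology M] :
    SecondCountableTopology (MulAction.orbitRel.Quotient G M) :=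
  MulAction.isOpenQuotientMap_quotientMk.isQuotientMap.secondCountableTopology
    MulAction.isOpenQuotientMap_quotientMk.isOpenMap

theorem orbitMk_eq_iff {x y : M} : orbitMk G x = orbitMk G y ↔ ∃ g : G, g • y = x :=
  ⟨fun h => Quotient.exact h, fun ⟨g, hg⟩ => Quotient.sound ⟨g, hg⟩⟩

theorem orbitMk_smul (g : G) (x : M) : orbitMk G (g • x) = orbitMk G x :=
  orbitMk_eq_iff.2 ⟨g, rfl⟩

end QuotientTopology

/-! ### Charts of the orbit space from slices. -/

section OrbitChart

set_option linter.unusedSectionVars false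

/-- A chart of the orbit space, given by some of the coordinates of a chart `φ` of `M` on a
slice through `ζ`, together with the inclusion `s` of the slice. -/
structure IsOrbitChart {m q : ℕ} (G : Type*) [Group G] {M : Type*} [TopologicalSpace M]
    [ChartedSpace (EuclideanQuadrant m) M] [IsManifold (𝓒 m) ∞ M] [MulAction G M]
    (φ : OpenPartialHomeomorph M (EuclideanQuadrant m)) (e : Fin q ↪ Fin m) (ζ : M)
    (χ : OpenPartialHomeomorph (MulAction.orbitRel.Quotient G M) (EuclideanQuadrant q))
    (s : EuclideanQuadrant q → M) : Prop where
  mem_atlas : φ ∈ IsManifold.maximalAtlas (𝓒 m) ∞ M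
  mem_range_of_zero : ∀ i, (φ ζ).1 i = 0 → i ∈ range e
  contMDiffOn_comp : ContMDiffOn (𝓒 m) (𝓒 q) ∞ (fun x : M => χ (orbitMk G x))
    (orbitMk G ⁻¹' χ.source)
  contMDiffOn_section : ContMDiffOn (𝓒 q) (𝓒 m) ∞ s χ.target
  orbitMk_section : ∀ y ∈ χ.target, orbitMk G (s y) = χ.symm y
  stabilizer_section : ∀ y ∈ χ.target, MulAction.stabilizer G (s y) = MulAction.stabilizer G ζ
  section_mem_source : ∀ y ∈ χ.target, s y ∈ φ.source
  chart_section : ∀ y ∈ χ.target, φ (s y) = quadIncl e (φ ζ) y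
  mem_source : orbitMk G ζ ∈ χ.source
  section_base : s (χ (orbitMk G ζ)) = ζ

variable {n m q : ℕ} {G : Type*} [TopologicalSpace G] [ChartedSpace (EuclideanSpace ℝ (Fin n)) G]
  [Group G] [LieGroup (𝓡 n) ∞ G] [IsTopologicalGroup G] [CompactSpace G]
  {M : Type*} [TopologicalSpace M] [T2Space M] [ChartedSpace (EuclideanQuadrant m) M]
  [IsManifold (𝓒 m) ∞ M] [MulAction G M] [ContMDiffSMul (𝓡 n) (𝓒 m) ∞ G M]
  [ContinuousSMul G M] {φ : OpenPartialHomeomorph M (EuclideanQuadrant m)} {ζ : M}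

/-- The slice meets each nearby orbit once, so its free coordinates parametrize the orbits;
invariance of `sl` along orbits makes the coordinates well defined. -/
theorem IsSlice.exists_isOrbitChart {e : Fin q ↪ Fin m} {N : Set M} {σ : M → G} {sl : M → M}
    (h : IsSlice n φ e ζ N σ sl) : ∃ χ s, IsOrbitChart G φ e ζ χ s := by
  classical
  have hπ : IsOpenQuotientMap (orbitMk G : M → MulAction.orbitRel.Quotient G M) :=
    MulAction.isOpenQuotientMap_quotientMk
  have : Nonempty M := ⟨ζ⟩
  -- An arbitrary representative in `N` is chosen; `slice_smul` makes the value independent of it.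
  let f : MulAction.orbitRel.Quotient G M → EuclideanQuadrant q :=
    fun y => quadProj e (φ (sl (Function.invFunOn (orbitMk G) N y)))
  have hf : ∀ x ∈ N, f (orbitMk G x) = quadProj e (φ (sl x)) := by
    intro x hx
    have h1 : ∃ a ∈ N, orbitMk G a = orbitMk G x := ⟨x, hx, rfl⟩
    have h2 := Function.invFunOn_mem h1
    obtain ⟨g, hg⟩ := orbitMk_eq_iff.1 (Function.invFunOn_eq h1)
    change quadProj e (φ (sl (Function.invFunOn (orbitMk G) N (orbitMk G x)))) = _
    rw [← hg] at h2 ⊢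
    rw [h.slice_smul x hx g h2]
  let s : EuclideanQuadrant q → M := fun y => φ.symm (quadIncl e (φ ζ) y)
  have hfc : ∀ x ∈ N, quadIncl e (φ ζ) (f (orbitMk G x)) = φ (sl x) := by
    intro x hx
    rw [hf x hx, quadIncl_quadProj (h.coord_slice x hx)]
  have hsf : ∀ x ∈ N, s (f (orbitMk G x)) = sl x := by
    intro x hx
    change φ.symm (quadIncl e (φ ζ) (f (orbitMk G x))) = _
    rw [hfc x hx, φ.left_inv (h.subset_source (h.mapsTo x hx))]
  have hfs : ∀ y, quadIncl e (φ ζ) y ∈ φ.target → s y ∈ N → f (orbitMk G (s y)) = y := by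
    intro y hy hyN
    have h1 : φ (s y) = quadIncl e (φ ζ) y := φ.right_inv hy
    rw [hf _ hyN, h.slice_eq_self _ hyN fun i hi => by
      rw [h1, quadIncl_apply_of_notMem _ _ _ hi], h1, quadProj_quadIncl]
  have hsm : ContMDiffOn (𝓒 m) (𝓒 q) ∞ (fun x => quadProj e (φ (sl x))) N :=
    (contMDiff_quadProj e).comp_contMDiffOn <| (contMDiffOn_of_mem_maximalAtlas h.mem_atlas).comp
      h.contMDiffOn_slice fun x hx => h.subset_source (h.mapsTo x hx)
  let χ : OpenPartialHomeomorph (MulAction.orbitRel.Quotient G M) (EuclideanQuadrant q) :=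
    { toFun := f
      invFun := fun y => orbitMk G (s y)
      source := orbitMk G '' N
      target := quadIncl e (φ ζ) ⁻¹' (φ.target ∩ φ.symm ⁻¹' N)
      map_source' := by
        rintro _ ⟨x, hx, rfl⟩
        change quadIncl e (φ ζ) (f (orbitMk G x)) ∈ φ.target ∩ φ.symm ⁻¹' N
        have h1 := h.subset_source (h.mapsTo x hx)
        refine ⟨?_, ?_⟩
        · rw [hfc x hx]
          exact φ.map_source h1
        · rw [hfc x hx, mem_preimage, φ.left_inv h1]
          exact h.mapsTo x hx
      map_target' := fun y hy => ⟨s y, hy.2, rfl⟩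
      left_inv' := by
        rintro _ ⟨x, hx, rfl⟩
        rw [hsf x hx]
        exact orbitMk_eq_iff.2 ⟨(σ x)⁻¹, by rw [inv_smul_eq_iff, h.smul_slice x hx]⟩
      right_inv' := fun y hy => hfs y hy.1 hy.2
      open_source := hπ.isOpenMap _ h.isOpen
      open_target := (φ.symm.isOpen_inter_preimage h.isOpen).preimage
        (contMDiff_quadIncl e (φ ζ)).continuous
      continuousOn_toFun := by
        rintro _ ⟨x, hx, rfl⟩
        refine ContinuousAt.continuousWithinAt ?_
        rw [← hπ.continuousAt_comp_iff]
        refine (hsm.continuousOn.continuousAt (h.isOpen.mem_nhds hx)).congr ?_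
        filter_upwards [h.isOpen.mem_nhds hx] with z hz using (hf z hz).symm
      continuousOn_invFun := hπ.continuous.comp_continuousOn <|
        φ.continuousOn_symm.comp (contMDiff_quadIncl e (φ ζ)).continuous.continuousOn
          fun y hy => hy.1 }
  refine ⟨χ, s, h.mem_atlas, h.mem_range_of_zero, ?_, ?_, fun y _ => rfl, ?_,
    fun y hy => φ.map_target hy.1, fun y hy => φ.right_inv hy.1, ⟨ζ, h.mem, rfl⟩, ?_⟩
  -- A point over the chart domain need not lie in `N`, but a translate does, and the chart is
  -- constant on orbits.
  · rintro x ⟨x', hx', hxx'⟩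
    obtain ⟨g, rfl⟩ := orbitMk_eq_iff.1 hxx'
    refine ContMDiffAt.contMDiffWithinAt ?_
    have h1 : ContMDiffAt (𝓒 m) (𝓒 m) ∞ (fun z : M => g • z) x :=
      (ContMDiffSMul.contMDiff_const_smul (I := 𝓡 n) g).contMDiffAt
    have h2 : ContMDiffAt (𝓒 m) (𝓒 q) ∞ (fun x => quadProj e (φ (sl x))) (g • x) :=
      hsm.contMDiffAt (h.isOpen.mem_nhds hx')
    refine (ContMDiffAt.comp x h2 h1).congr_of_eventuallyEq ?_
    filter_upwards [h1.continuousAt.preimage_mem_nhds (h.isOpen.mem_nhds hx')] with z hz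
    change f (orbitMk G z) = quadProj e (φ (sl (g • z)))
    rw [← hf _ hz, orbitMk_smul]
  · exact (contMDiffOn_symm_of_mem_maximalAtlas h.mem_atlas).comp
      (contMDiff_quadIncl e (φ ζ)).contMDiffOn fun y hy => hy.1
  · intro y hy
    rw [← h.stabilizer_slice (s y) hy.2, h.slice_eq_self _ hy.2 fun i hi => by
      rw [show φ (s y) = quadIncl e (φ ζ) y from φ.right_inv hy.1,
        quadIncl_apply_of_notMem _ _ _ hi]]
  · change s (f (orbitMk G ζ)) = ζ
    rw [hsf ζ h.mem, h.slice_self]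

end OrbitChart

/-! ### The smooth structure of the orbit space. -/

section OrbitManifold

set_option linter.unusedSectionVars false

variable {n m q : ℕ} {G : Type*} [TopologicalSpace G] [ChartedSpace (EuclideanSpace ℝ (Fin n)) G]
  [Group G] [LieGroup (𝓡 n) ∞ G] [IsTopologicalGroup G] [CompactSpace G]
  {M : Type*} [TopologicalSpace M] [T2Space M] [ChartedSpace (EuclideanQuadrant m) M]
  [IsManifold (𝓒 m) ∞ M] [MulAction G M] [ContMDiffSMul (𝓡 n) (𝓒 m) ∞ G M]
  [ContinuousSMul G M] {φ φ' : OpenPartialHomeomorph M (EuclideanQuadrant m)} {ζ ζ' : M}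
  {e e' : Fin q ↪ Fin m}
  {χ χ' : OpenPartialHomeomorph (MulAction.orbitRel.Quotient G M) (EuclideanQuadrant q)}
  {s s' : EuclideanQuadrant q → M}

/-- A transition map is the second chart, smooth as a function on `M`, composed with the slice
inclusion of the first. -/
theorem IsOrbitChart.contMDiffOn_trans (h : IsOrbitChart G φ e ζ χ s)
    (h' : IsOrbitChart G φ' e' ζ' χ' s') :
    ContMDiffOn (𝓒 q) (𝓒 q) ∞ (χ.symm.trans χ') (χ.symm.trans χ').source := by
  have h1 : (χ.symm.trans χ').source = χ.target ∩ χ.symm ⁻¹' χ'.source := by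
    rw [OpenPartialHomeomorph.trans_source, OpenPartialHomeomorph.symm_source]
  rw [h1]
  refine (h'.contMDiffOn_comp.comp (h.contMDiffOn_section.mono inter_subset_left)
    fun y hy => ?_).congr fun y hy => ?_
  · change orbitMk G (s y) ∈ χ'.source
    rw [h.orbitMk_section y hy.1]
    exact hy.2
  · change χ' (χ.symm y) = χ' (orbitMk G (s y))
    rw [h.orbitMk_section y hy.1]

variable (m q G M) in
/-- All charts of the orbit space are given by slices. -/
def IsOrbitAtlas [ChartedSpace (EuclideanQuadrant q) (MulAction.orbitRel.Quotient G M)] : Prop :=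
  ∀ χ ∈ atlas (EuclideanQuadrant q) (MulAction.orbitRel.Quotient G M),
    ∃ (φ : OpenPartialHomeomorph M (EuclideanQuadrant m)) (e : Fin q ↪ Fin m) (ζ : M)
      (s : EuclideanQuadrant q → M), IsOrbitChart G φ e ζ χ s

variable [ChartedSpace (EuclideanQuadrant q) (MulAction.orbitRel.Quotient G M)]

theorem IsOrbitAtlas.isManifold (hA : IsOrbitAtlas m q G M) :
    IsManifold (𝓒 q) ∞ (MulAction.orbitRel.Quotient G M) := by
  refine isManifold_of_contMDiffOn_transition fun χ hχ χ' hχ' => ?_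
  obtain ⟨φ, e, ζ, s, h⟩ := hA χ hχ
  obtain ⟨φ', e', ζ', s', h'⟩ := hA χ' hχ'
  exact h.contMDiffOn_trans h'

theorem IsOrbitAtlas.contMDiff (hA : IsOrbitAtlas m q G M) :
    ContMDiff (𝓒 m) (𝓒 q) ∞ (orbitMk G : M → MulAction.orbitRel.Quotient G M) := by
  have := hA.isManifold
  intro x
  obtain ⟨φ, e, ζ, s, h⟩ := hA (chartAt _ (orbitMk G x)) (chart_mem_atlas _ _)
  have hc : Continuous (orbitMk G : M → MulAction.orbitRel.Quotient G M) :=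
    MulAction.isOpenQuotientMap_quotientMk.continuous
  have ho : IsOpen (orbitMk G ⁻¹' (chartAt (EuclideanQuadrant q) (orbitMk G x)).source : Set M) :=
    (chartAt (EuclideanQuadrant q) (orbitMk G x)).open_source.preimage hc
  have h1 := (contMDiffOn_chart_symm (I := 𝓒 q) (n := ∞) (x := orbitMk G x)).comp
    h.contMDiffOn_comp fun z hz => (chartAt (EuclideanQuadrant q) (orbitMk G x)).map_source hz
  refine (h1.contMDiffAt (ho.mem_nhds (mem_chart_source _ _))).congr_of_eventuallyEq ?_
  filter_upwards [ho.mem_nhds (mem_chart_source _ _)] with z hz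
  exact ((chartAt (EuclideanQuadrant q) (orbitMk G x)).left_inv hz).symm

/-- The atlas contains one chosen chart per point, possibly built from another slice; this admits
the chart centred at any given `ζ`. -/
theorem IsOrbitChart.mem_maximalAtlas (hA : IsOrbitAtlas m q G M) (h : IsOrbitChart G φ e ζ χ s) :
    χ ∈ IsManifold.maximalAtlas (𝓒 q) ∞ (MulAction.orbitRel.Quotient G M) := by
  have := hA.isManifold
  refine OpenPartialHomeomorph.mem_maximalAtlas_of_contMDiffOn _ ?_ ?_
  · intro y hy
    obtain ⟨φ', e', ζ', s', h'⟩ := hA (chartAt _ y) (chart_mem_atlas _ _)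
    refine ContMDiffAt.contMDiffWithinAt ?_
    have hy' := mem_chart_source (EuclideanQuadrant q) y
    have ho : IsOpen (χ.source ∩ (chartAt (EuclideanQuadrant q) y).source) :=
      χ.open_source.inter (chartAt (EuclideanQuadrant q) y).open_source
    have h1 := (h'.contMDiffOn_trans h).comp
      ((contMDiffOn_chart (I := 𝓒 q) (n := ∞) (x := y)).mono
        (inter_subset_right (s := χ.source))) fun z hz => by
          rw [mem_preimage, OpenPartialHomeomorph.trans_source]
          refine ⟨(chartAt (EuclideanQuadrant q) y).map_source hz.2, ?_⟩
          rw [mem_preimage, (chartAt (EuclideanQuadrant q) y).left_inv hz.2]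
          exact hz.1
    refine (h1.contMDiffAt (ho.mem_nhds ⟨hy, hy'⟩)).congr_of_eventuallyEq ?_
    filter_upwards [ho.mem_nhds ⟨hy, hy'⟩] with z hz
    change χ z = χ ((chartAt (EuclideanQuadrant q) y).symm (chartAt (EuclideanQuadrant q) y z))
    rw [(chartAt (EuclideanQuadrant q) y).left_inv hz.2]
  · exact (hA.contMDiff.comp_contMDiffOn h.contMDiffOn_section).congr
      fun y hy => (h.orbitMk_section y hy).symm

/-- Through every point there is a section into the points with the same isotropy group. -/
theorem IsOrbitChart.exists_section (hA : IsOrbitAtlas m q G M) (h : IsOrbitChart G φ e ζ χ s) :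
    ContMDiffOn (𝓒 q) (𝓒 m) ∞ (s ∘ χ) χ.source ∧ s (χ (orbitMk G ζ)) = ζ ∧
      (∀ y ∈ χ.source, orbitMk G (s (χ y)) = y) ∧
      ∀ y ∈ χ.source, MulAction.stabilizer G (s (χ y)) = MulAction.stabilizer G ζ := by
  have := hA.isManifold
  refine ⟨h.contMDiffOn_section.comp
    (contMDiffOn_of_mem_maximalAtlas (h.mem_maximalAtlas hA)) fun y hy => χ.map_source hy,
    h.section_base, fun y hy => ?_, fun y hy => h.stabilizer_section _ (χ.map_source hy)⟩
  rw [h.orbitMk_section _ (χ.map_source hy), χ.left_inv hy]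

end OrbitManifold

/-! ### Boundary hypersurfaces of the orbit space. -/

section OrbitBoundary

set_option linter.unusedSectionVars false

/-- The coordinates outside `e` are frozen at the nonzero values of `p`, so the inclusion preserves
boundary depth. -/
theorem existsUnique_quadIncl {m q : ℕ} {e : Fin q ↪ Fin m} {p : EuclideanQuadrant m}
    (hp : ∀ i, p.1 i = 0 → i ∈ range e) (y : EuclideanQuadrant q) :
    (∃! i, (quadIncl e p y).1 i = 0) ↔ ∃! j, y.1 j = 0 := by
  have h1 : ∀ i, (quadIncl e p y).1 i = 0 → ∃ j, e j = i ∧ y.1 j = 0 := by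
    intro i hi
    by_cases hie : i ∈ range e
    · obtain ⟨j, rfl⟩ := hie
      exact ⟨j, rfl, by rwa [quadIncl_apply] at hi⟩
    · rw [quadIncl_apply_of_notMem _ _ _ hie] at hi
      exact absurd (hp i hi) hie
  constructor
  · rintro ⟨i, hi, hiu⟩
    obtain ⟨j, rfl, hj⟩ := h1 i hi
    exact ⟨j, hj, fun k hk => e.injective (hiu _ ((quadIncl_apply _ _ _ _).trans hk))⟩
  · rintro ⟨j, hj, hju⟩
    refine ⟨e j, (quadIncl_apply _ _ _ _).trans hj, fun i hi => ?_⟩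
    obtain ⟨k, rfl, hk⟩ := h1 i hi
    rw [hju k hk]

/-- The components of the smooth boundary part are relatively open. -/
theorem eventually_mem_connectedComponentIn {m : ℕ} {M : Type*} [TopologicalSpace M]
    [ChartedSpace (EuclideanQuadrant m) M] [IsManifold (𝓒 m) ∞ M] {x : M}
    (hx : x ∈ smoothBoundaryPart m M) : ∀ᶠ z in 𝓝 x, z ∈ smoothBoundaryPart m M →
      z ∈ connectedComponentIn (smoothBoundaryPart m M) x := by
  obtain ⟨φ, hφ, hxφ⟩ : ∃ φ ∈ IsManifold.maximalAtlas (𝓒 m) ∞ M, x ∈ φ.source :=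
    ⟨_, IsManifold.chart_mem_maximalAtlas x, mem_chart_source _ x⟩
  obtain ⟨ε, hε⟩ := exists_isCornerBox hxφ univ_mem
  have hu := (mem_smoothBoundaryPart_iff hφ hxφ).1 hx
  obtain ⟨i, hi, hui⟩ := hu
  filter_upwards [(isOpen_box φ (φ x).1 ε).mem_nhds ⟨hxφ, Metric.mem_ball_self hε.pos⟩]
    with z hz hzs
  have hzu := (mem_smoothBoundaryPart_iff hφ hz.1).1 hzs
  have hzi : (φ z).1 i = 0 := by
    obtain ⟨j, hj, -⟩ := hzu
    have : (φ x).1 j = 0 := by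
      by_contra h
      exact (hε.coord _ hz.2 j h).ne' hj
    rwa [← hui j this]
  refine (hε.isPreconnected_boxFace i).subset_connectedComponentIn ?_ (hε.boxFace_subset hφ i)
    (mem_boxFace_of_existsUnique hz.1 hz.2 hzi hzu)
  exact mem_boxFace_of_existsUnique hxφ (Metric.mem_ball_self hε.pos) hi ⟨i, hi, hui⟩

variable {n m q : ℕ} {G : Type*} [TopologicalSpace G] [ChartedSpace (EuclideanSpace ℝ (Fin n)) G]
  [Group G] [LieGroup (𝓡 n) ∞ G] [IsTopologicalGroup G] [CompactSpace G]
  {M : Type*} [TopologicalSpace M] [T2Space M] [ChartedSpace (EuclideanQuadrant m) M]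
  [IsManifold (𝓒 m) ∞ M] [MulAction G M] [ContMDiffSMul (𝓡 n) (𝓒 m) ∞ G M]
  [ContinuousSMul G M] {φ : OpenPartialHomeomorph M (EuclideanQuadrant m)} {ζ : M}
  {e : Fin q ↪ Fin m}
  {χ : OpenPartialHomeomorph (MulAction.orbitRel.Quotient G M) (EuclideanQuadrant q)}
  {s : EuclideanQuadrant q → M}

theorem image_smul_connectedComponentIn (n) [ChartedSpace (EuclideanSpace ℝ (Fin n)) G]
    [LieGroup (𝓡 n) ∞ G] [ContMDiffSMul (𝓡 n) (𝓒 m) ∞ G M] (g : G) {x : M}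
    (hx : x ∈ smoothBoundaryPart m M) :
    (fun y : M => g • y) '' connectedComponentIn (smoothBoundaryPart m M) x =
      connectedComponentIn (smoothBoundaryPart m M) (g • x) := by
  have h1 : Homeomorph.smul g '' smoothBoundaryPart m M = smoothBoundaryPart m M := by
    ext y
    constructor
    · rintro ⟨z, hz, rfl⟩
      exact (smul_mem_smoothBoundaryPart_iff n g).2 hz
    · intro hy
      exact ⟨g⁻¹ • y, (smul_mem_smoothBoundaryPart_iff n g⁻¹).2 hy, smul_inv_smul g y⟩
  have h2 := (Homeomorph.smul g : M ≃ₜ M).image_connectedComponentIn hx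
  rw [h1] at h2
  exact h2

theorem image_smul_closure (g : G) (S : Set M) :
    (fun y : M => g • y) '' closure S = closure ((fun y : M => g • y) '' S) :=
  (Homeomorph.smul g : M ≃ₜ M).image_closure S

theorem IsOrbitChart.orbitMk_mem_smoothBoundaryPart_iff (n)
    [ChartedSpace (EuclideanSpace ℝ (Fin n)) G] [LieGroup (𝓡 n) ∞ G]
    [ContMDiffSMul (𝓡 n) (𝓒 m) ∞ G M]
    [ChartedSpace (EuclideanQuadrant q) (MulAction.orbitRel.Quotient G M)]
    (hA : IsOrbitAtlas m q G M) (h : IsOrbitChart G φ e ζ χ s) {x : M}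
    (hx : orbitMk G x ∈ χ.source) :
    orbitMk G x ∈ smoothBoundaryPart q (MulAction.orbitRel.Quotient G M) ↔
      x ∈ smoothBoundaryPart m M := by
  have := hA.isManifold
  have ht := χ.map_source hx
  have h0 : orbitMk G (s (χ (orbitMk G x))) = orbitMk G x := by
    rw [h.orbitMk_section _ ht, χ.left_inv hx]
  obtain ⟨g, hg⟩ := orbitMk_eq_iff.1 h0
  rw [← smul_mem_smoothBoundaryPart_iff n g (x := x), hg,
    mem_smoothBoundaryPart_iff (h.mem_maximalAtlas hA) hx,
    mem_smoothBoundaryPart_iff h.mem_atlas (h.section_mem_source _ ht), h.chart_section _ ht]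
  exact (existsUnique_quadIncl h.mem_range_of_zero _).symm

theorem IsOrbitAtlas.orbitMk_mem_smoothBoundaryPart_iff (n)
    [ChartedSpace (EuclideanSpace ℝ (Fin n)) G] [LieGroup (𝓡 n) ∞ G]
    [ContMDiffSMul (𝓡 n) (𝓒 m) ∞ G M]
    [ChartedSpace (EuclideanQuadrant q) (MulAction.orbitRel.Quotient G M)]
    (hA : IsOrbitAtlas m q G M) {x : M} :
    orbitMk G x ∈ smoothBoundaryPart q (MulAction.orbitRel.Quotient G M) ↔
      x ∈ smoothBoundaryPart m M := by
  obtain ⟨φ, e, ζ, s, h⟩ := hA (chartAt _ (orbitMk G x)) (chart_mem_atlas _ _)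
  exact h.orbitMk_mem_smoothBoundaryPart_iff n hA (mem_chart_source _ _)

/-- Components of the smooth boundary part of the orbit space are images of components of the
smooth boundary part. -/
theorem IsOrbitAtlas.exists_of_mem_connectedComponentIn (n)
    [ChartedSpace (EuclideanSpace ℝ (Fin n)) G] [LieGroup (𝓡 n) ∞ G]
    [ContMDiffSMul (𝓡 n) (𝓒 m) ∞ G M]
    [ChartedSpace (EuclideanQuadrant q) (MulAction.orbitRel.Quotient G M)]
    (hA : IsOrbitAtlas m q G M) {x y : M}
    (hy : orbitMk G y ∈ connectedComponentIn
      (smoothBoundaryPart q (MulAction.orbitRel.Quotient G M)) (orbitMk G x)) :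
    ∃ g : G, g • y ∈ connectedComponentIn (smoothBoundaryPart m M) x := by
  have hx : orbitMk G x ∈ smoothBoundaryPart q (MulAction.orbitRel.Quotient G M) := by
    by_contra h
    rw [connectedComponentIn_eq_empty h] at hy
    exact hy
  have hopen : IsOpenMap (orbitMk G : M → MulAction.orbitRel.Quotient G M) :=
    MulAction.isOpenQuotientMap_quotientMk.isOpenMap
  have hsb : ∀ {x : M}, _ := fun {x} => hA.orbitMk_mem_smoothBoundaryPart_iff n (x := x)
  -- Having representatives in a common component upstairs is symmetric and transitive up to
  -- translation, and it holds locally, so it holds throughout a connected set.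
  let R : MulAction.orbitRel.Quotient G M → MulAction.orbitRel.Quotient G M → Prop :=
    fun a b => ∃ x z : M, orbitMk G x = a ∧ orbitMk G z = b ∧
      z ∈ connectedComponentIn (smoothBoundaryPart m M) x
  have key : R (orbitMk G x) (orbitMk G y) := by
    refine isPreconnected_connectedComponentIn.induction₂ R ?_ ?_ ?_
      (mem_connectedComponentIn hx) hy
    · rintro a ha
      obtain ⟨x', rfl⟩ : ∃ x', orbitMk G x' = a := Quotient.exists_rep a
      have hx' := hsb.1 (connectedComponentIn_subset _ _ ha)
      have h1 := hopen.image_mem_nhds (eventually_mem_connectedComponentIn hx')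
      filter_upwards [nhdsWithin_le_nhds h1, self_mem_nhdsWithin]
      rintro _ ⟨z, hz, rfl⟩ hb
      exact ⟨x', z, rfl, rfl, hz (hsb.1 (connectedComponentIn_subset _ _ hb))⟩
    · rintro a b c - - - ⟨x₁, z₁, rfl, rfl, h1⟩ ⟨x₂, z₂, h2, rfl, h3⟩
      obtain ⟨g, rfl⟩ := orbitMk_eq_iff.1 h2.symm
      refine ⟨x₁, g • z₂, rfl, orbitMk_smul _ _, ?_⟩
      rw [connectedComponentIn_eq h1, ← image_smul_connectedComponentIn n g
        (connectedComponentIn_nonempty_iff.1 ⟨_, h3⟩)]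
      exact ⟨z₂, h3, rfl⟩
    · rintro a b - - ⟨x₁, z₁, rfl, rfl, h1⟩
      refine ⟨z₁, x₁, rfl, rfl, ?_⟩
      rw [← connectedComponentIn_eq h1]
      exact mem_connectedComponentIn (connectedComponentIn_nonempty_iff.1 ⟨_, h1⟩)
  obtain ⟨x₁, z₁, h1, h2, h3⟩ := key
  obtain ⟨g, rfl⟩ := orbitMk_eq_iff.1 h1
  obtain ⟨k, rfl⟩ := orbitMk_eq_iff.1 h2
  rw [← image_smul_connectedComponentIn n g (hsb.1 hx)] at h3
  obtain ⟨z, hz, hzk⟩ := h3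
  refine ⟨g⁻¹ * k, ?_⟩
  rw [mul_smul, ← hzk]
  change g⁻¹ • g • z ∈ _
  rwa [inv_smul_smul]

/-- If two faces of the chart met the same component downstairs, the hypersurfaces above them would
be translates of each other, both passing through `ζ`. Boundary intersection freeness makes them
equal, and near `ζ` one hypersurface is one coordinate hyperplane. -/
theorem IsOrbitChart.noSelfIntersectionAt (n)
    [ChartedSpace (EuclideanSpace ℝ (Fin n)) G] [LieGroup (𝓡 n) ∞ G]
    [ContMDiffSMul (𝓡 n) (𝓒 m) ∞ G M] (hM : IsManifoldWithCorners m M)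
    (hbif : IsBoundaryIntersectionFree m G M)
    [ChartedSpace (EuclideanQuadrant q) (MulAction.orbitRel.Quotient G M)]
    (hA : IsOrbitAtlas m q G M) (h : IsOrbitChart G φ e ζ χ s) :
    NoSelfIntersectionAt χ (orbitMk G ζ) := by
  have := hA.isManifold
  have htζ := χ.map_source h.mem_source
  have hζ : ζ ∈ φ.source := h.section_base ▸ h.section_mem_source _ htζ
  obtain ⟨U, hU, hζU, -, hU0, hU1, -⟩ := (noSelfIntersectionAt_of_embedded hM.embedded h.mem_atlas
    hζ).exists_local_structure h.mem_atlas hζ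
  have hopen := (h.contMDiffOn_section.continuousOn.comp χ.continuousOn
    fun y hy => χ.map_source hy).isOpen_inter_preimage χ.open_source hU
  refine ⟨_, hopen.mem_nhds ⟨h.mem_source, ?_⟩, ?_⟩
  · change s (χ (orbitMk G ζ)) ∈ U
    rwa [h.section_base]
  rintro y ⟨hy, hyU⟩ y' ⟨hy', hyU'⟩ j j' hj hj' hyy'
  change s (χ y) ∈ U at hyU
  change s (χ y') ∈ U at hyU'
  have ht := χ.map_source hy
  have ht' := χ.map_source hy'
  have hsy : orbitMk G (s (χ y)) = y := by rw [h.orbitMk_section _ ht, χ.left_inv hy]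
  have hsy' : orbitMk G (s (χ y')) = y' := by rw [h.orbitMk_section _ ht', χ.left_inv hy']
  have hz : (φ (s (χ y))).1 (e j) = 0 := by rw [h.chart_section _ ht, quadIncl_apply, hj]
  have hz' : (φ (s (χ y'))).1 (e j') = 0 := by rw [h.chart_section _ ht', quadIncl_apply, hj']
  have hb : s (χ y) ∈ smoothBoundaryPart m M := by
    rw [← hA.orbitMk_mem_smoothBoundaryPart_iff n, hsy]
    exact connectedComponentIn_nonempty_iff.1 ⟨_, hyy'⟩
  have hb' : s (χ y') ∈ smoothBoundaryPart m M := by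
    rw [← hA.orbitMk_mem_smoothBoundaryPart_iff n, hsy']
    exact connectedComponentIn_subset _ _ hyy'
  rw [← hsy, ← hsy'] at hyy'
  obtain ⟨g, hg⟩ := hA.exists_of_mem_connectedComponentIn n hyy'
  have hS : (fun y : M => g • y) '' closure (connectedComponentIn (smoothBoundaryPart m M)
      (s (χ y'))) = closure (connectedComponentIn (smoothBoundaryPart m M) (s (χ y))) := by
    rw [image_smul_closure, image_smul_connectedComponentIn n g hb', connectedComponentIn_eq hg]
  have hζ1 := (hU1 _ hyU hb _ hz ζ hζU).2 (hU0 _ hyU _ hz)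
  have hζ2 := (hU1 _ hyU' hb' _ hz' ζ hζU).2 (hU0 _ hyU' _ hz')
  -- The hypersurface of `y'` and its translate by `g`, which is that of `y`, share the point `ζ`.
  have hS' := image_smul_eq_of_nonempty_inter hbif ⟨_, hb', rfl⟩ (g := g) hζ2 (hS ▸ hζ1)
  rw [hS'] at hS
  have h1 : (φ (s (χ y'))).1 (e j) = 0 := by
    refine (hU1 _ hyU hb _ hz _ hyU').1 ?_
    rw [← hS]
    exact subset_closure (mem_connectedComponentIn hb')
  exact e.injective (((mem_smoothBoundaryPart_iff h.mem_atlas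
    (h.section_mem_source _ ht')).1 hb').unique h1 hz')

variable (m q G) in
/-- There is a chart of the orbit space given by a slice through `ζ`. -/
def HasOrbitChart (ζ : M) : Prop :=
  ∃ (φ : OpenPartialHomeomorph M (EuclideanQuadrant m)) (e : Fin q ↪ Fin m)
    (χ : OpenPartialHomeomorph (MulAction.orbitRel.Quotient G M) (EuclideanQuadrant q))
    (s : EuclideanQuadrant q → M), IsOrbitChart G φ e ζ χ s

theorem IsOrbitAtlas.isManifoldWithCorners (n)
    [ChartedSpace (EuclideanSpace ℝ (Fin n)) G] [LieGroup (𝓡 n) ∞ G]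
    [ContMDiffSMul (𝓡 n) (𝓒 m) ∞ G M] (hM : IsManifoldWithCorners m M)
    (hbif : IsBoundaryIntersectionFree m G M)
    [ChartedSpace (EuclideanQuadrant q) (MulAction.orbitRel.Quotient G M)]
    (hA : IsOrbitAtlas m q G M) (hc : ∀ ζ : M, HasOrbitChart m q G ζ) :
    IsManifoldWithCorners q (MulAction.orbitRel.Quotient G M) where
  t2Space := t2Space_orbitQuotient
  secondCountable := by
    have := hM.secondCountable
    exact secondCountable_orbitQuotient
  isManifold := hA.isManifold
  embedded := by
    have := hA.isManifold
    refine embedded_of_noSelfIntersectionAt fun p => ?_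
    obtain ⟨ζ, rfl⟩ : ∃ ζ, orbitMk G ζ = p := Quotient.exists_rep p
    obtain ⟨φ, e, χ, s, h⟩ := hc ζ
    exact ⟨χ, h.mem_maximalAtlas hA, h.mem_source, h.noSelfIntersectionAt n hM hbif hA⟩

theorem IsOrbitAtlas.isSmoothQuotientMap
    [ChartedSpace (EuclideanQuadrant q) (MulAction.orbitRel.Quotient G M)]
    (hA : IsOrbitAtlas m q G M) (hc : ∀ ζ : M, HasOrbitChart m q G ζ) :
    IsSmoothQuotientMap (𝓒 m) (𝓒 q) (orbitMk G : M → MulAction.orbitRel.Quotient G M) := by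
  refine isSmoothQuotientMap_of_section Quotient.exists_rep hA.contMDiff fun x => ?_
  obtain ⟨φ, e, χ, s, h⟩ := hc x
  obtain ⟨h1, h2, h3, -⟩ := h.exists_section hA
  exact ⟨χ.source, s ∘ χ, χ.open_source, h.mem_source, h1, h2, h3⟩

/-- The dimension `q` is the common codimension of the orbits. The last clause records this so that
slices of the same dimension remain available for the fixed point set. -/
theorem exists_isOrbitAtlas (n)
    [ChartedSpace (EuclideanSpace ℝ (Fin n)) G] [LieGroup (𝓡 n) ∞ G]
    [ContMDiffSMul (𝓡 n) (𝓒 m) ∞ G M] (hM : IsManifoldWithCorners m M)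
    (hbif : IsBoundaryIntersectionFree m G M) (hiso : HasUniqueIsotropyType G M) :
    ∃ (q : ℕ) (_ : ChartedSpace (EuclideanQuadrant q) (MulAction.orbitRel.Quotient G M)),
      IsOrbitAtlas m q G M ∧ (∀ ζ : M, HasOrbitChart m q G ζ) ∧
      ∀ ζ : M, ∀ φ ∈ IsManifold.maximalAtlas (𝓒 m) ∞ M, ζ ∈ φ.source →
        Module.finrank ℝ (orbitTangent n G φ ζ) + q = m := by
  obtain ⟨q, hq⟩ : ∃ q, ∀ ζ : M, ∀ φ ∈ IsManifold.maximalAtlas (𝓒 m) ∞ M, ζ ∈ φ.source →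
      Module.finrank ℝ (orbitTangent n G φ ζ) + q = m := by
    rcases isEmpty_or_nonempty M with hE | ⟨⟨ζ₀⟩⟩
    -- For empty `M` any value serves.
    · exact ⟨0, fun ζ => hE.elim ζ⟩
    · refine ⟨m - Module.finrank ℝ (orbitTangent n G (chartAt (EuclideanQuadrant m) ζ₀) ζ₀),
        fun ζ φ hφ hζ => ?_⟩
      rw [finrank_orbitTangent_eq hiso (IsManifold.chart_mem_maximalAtlas ζ₀)
        (mem_chart_source _ ζ₀) hφ hζ]
      have := Submodule.finrank_le (orbitTangent n G (chartAt (EuclideanQuadrant m) ζ₀) ζ₀)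
      rw [finrank_euclideanSpace_fin] at this
      omega
  have hc : ∀ ζ : M, HasOrbitChart m q G ζ := by
    intro ζ
    obtain ⟨φ, e, N, σ, sl, h⟩ := exists_isSlice n hM hbif hiso ζ (hq ζ)
    obtain ⟨χ, s, hχ⟩ := h.exists_isOrbitChart
    exact ⟨φ, e, χ, s, hχ⟩
  obtain ⟨cs, hcs⟩ := exists_chartedSpace (Y := MulAction.orbitRel.Quotient G M)
    (Q := fun χ => ∃ (φ : OpenPartialHomeomorph M (EuclideanQuadrant m)) (e : Fin q ↪ Fin m)
      (ζ : M) (s : EuclideanQuadrant q → M), IsOrbitChart G φ e ζ χ s) (by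
        intro y
        obtain ⟨ζ, rfl⟩ : ∃ ζ, orbitMk G ζ = y := Quotient.exists_rep y
        obtain ⟨φ, e, χ, s, h⟩ := hc ζ
        exact ⟨χ, h.mem_source, φ, e, ζ, s, h⟩)
  exact ⟨q, cs, hcs, hc, hq⟩

end OrbitBoundary

/-! ### Submanifolds given by fixing coordinates. -/

section SubmanifoldCharts

set_option linter.unusedSectionVars false

/-- A chart `φ` of `M` around `ζ` in which `X` is given by fixing the coordinates outside the range
of `e`, together with the chart `ψ` of `X` given by the other coordinates. -/
structure IsSubmanifoldChart {m d : ℕ} {M : Type*} [TopologicalSpace M]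
    [ChartedSpace (EuclideanQuadrant m) M] [IsManifold (𝓒 m) ∞ M] (X : Set M)
    (φ : OpenPartialHomeomorph M (EuclideanQuadrant m)) (e : Fin d ↪ Fin m) (ζ : M)
    (ψ : OpenPartialHomeomorph X (EuclideanQuadrant d)) : Prop where
  mem_atlas : φ ∈ IsManifold.maximalAtlas (𝓒 m) ∞ M
  mem_source : ζ ∈ φ.source
  mem_range_of_zero : ∀ i, (φ ζ).1 i = 0 → i ∈ range e
  mem_iff : ∀ x ∈ φ.source, (x ∈ X ↔ ∀ i ∉ range e, (φ x).1 i = (φ ζ).1 i)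
  source_iff : ∀ x : X, x ∈ ψ.source ↔ (x : M) ∈ φ.source
  apply_eq : ∀ x : X, ψ x = quadProj e (φ x)
  target_subset : ∀ y ∈ ψ.target, quadIncl e (φ ζ) y ∈ φ.target
  symm_eq : ∀ y ∈ ψ.target, (ψ.symm y : M) = φ.symm (quadIncl e (φ ζ) y)

variable {m d : ℕ} {M : Type*} [TopologicalSpace M]
    [ChartedSpace (EuclideanQuadrant m) M] [IsManifold (𝓒 m) ∞ M] {X : Set M}
    {φ φ' : OpenPartialHomeomorph M (EuclideanQuadrant m)} {e e' : Fin d ↪ Fin m} {ζ ζ' : M}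
    {ψ ψ' : OpenPartialHomeomorph X (EuclideanQuadrant d)}

theorem exists_isSubmanifoldChart (hφ : φ ∈ IsManifold.maximalAtlas (𝓒 m) ∞ M)
    (hζ : ζ ∈ φ.source) (h0 : ∀ i, (φ ζ).1 i = 0 → i ∈ range e)
    (hX : ∀ x ∈ φ.source, (x ∈ X ↔ ∀ i ∉ range e, (φ x).1 i = (φ ζ).1 i)) :
    ∃ ψ : OpenPartialHomeomorph X (EuclideanQuadrant d), IsSubmanifoldChart X φ e ζ ψ := by
  classical
  have hζX : ζ ∈ X := (hX ζ hζ).2 fun _ _ => rfl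
  have hmem : ∀ y, quadIncl e (φ ζ) y ∈ φ.target → φ.symm (quadIncl e (φ ζ) y) ∈ X := by
    intro y hy
    rw [hX _ (φ.map_target hy), φ.right_inv hy]
    exact fun i hi => quadIncl_apply_of_notMem _ _ _ hi
  -- Outside the chart target the inverse takes the irrelevant value `ζ`.
  let inv : EuclideanQuadrant d → X := fun y =>
    if h : φ.symm (quadIncl e (φ ζ) y) ∈ X then ⟨_, h⟩ else ⟨ζ, hζX⟩
  have hinv : ∀ y, quadIncl e (φ ζ) y ∈ φ.target →
      (inv y : M) = φ.symm (quadIncl e (φ ζ) y) := by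
    intro y hy
    change ((if h : φ.symm (quadIncl e (φ ζ) y) ∈ X then ⟨_, h⟩ else ⟨ζ, hζX⟩ : X) : M) = _
    rw [dif_pos (hmem y hy)]
  have hpi : ∀ x : X, (x : M) ∈ φ.source → quadIncl e (φ ζ) (quadProj e (φ x)) = φ x :=
    fun x hx => quadIncl_quadProj ((hX _ hx).1 x.2)
  let ψ : OpenPartialHomeomorph X (EuclideanQuadrant d) :=
    { toFun := fun x => quadProj e (φ x)
      invFun := inv
      source := (↑) ⁻¹' φ.source
      target := quadIncl e (φ ζ) ⁻¹' φ.target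
      map_source' := by
        intro x hx
        change quadIncl e (φ ζ) (quadProj e (φ x)) ∈ φ.target
        rw [hpi x hx]
        exact φ.map_source hx
      map_target' := by
        intro y hy
        change (inv y : M) ∈ φ.source
        rw [hinv y hy]
        exact φ.map_target hy
      left_inv' := by
        intro x hx
        refine Subtype.ext ?_
        have h1 := hpi x hx
        rw [hinv _ (by rw [h1]; exact φ.map_source hx), h1, φ.left_inv hx]
      right_inv' := by
        intro y hy
        rw [hinv y hy, φ.right_inv hy, quadProj_quadIncl]
      open_source := φ.open_source.preimage continuous_subtype_val
      open_target := φ.open_target.preimage (contMDiff_quadIncl e (φ ζ)).continuous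
      continuousOn_toFun := (contMDiff_quadProj e).continuous.comp_continuousOn <|
        φ.continuousOn.comp continuous_subtype_val.continuousOn fun x hx => hx
      continuousOn_invFun := by
        rw [Topology.IsInducing.subtypeVal.continuousOn_iff]
        exact (φ.continuousOn_symm.comp (contMDiff_quadIncl e (φ ζ)).continuous.continuousOn
          fun y hy => hy).congr fun y hy => hinv y hy }
  exact ⟨ψ, hφ, hζ, h0, hX, fun x => Iff.rfl, fun x => rfl, fun y hy => hy, hinv⟩

theorem IsSubmanifoldChart.quadIncl_apply (h : IsSubmanifoldChart X φ e ζ ψ) {x : X}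
    (hx : (x : M) ∈ φ.source) : quadIncl e (φ ζ) (ψ x) = φ x := by
  rw [h.apply_eq, quadIncl_quadProj ((h.mem_iff _ hx).1 x.2)]

theorem IsSubmanifoldChart.contMDiffOn_coe_symm (h : IsSubmanifoldChart X φ e ζ ψ) :
    ContMDiffOn (𝓒 d) (𝓒 m) ∞ (fun y => (ψ.symm y : M)) ψ.target :=
  ((contMDiffOn_symm_of_mem_maximalAtlas h.mem_atlas).comp
    (contMDiff_quadIncl e (φ ζ)).contMDiffOn h.target_subset).congr h.symm_eq

theorem IsSubmanifoldChart.contMDiffOn_trans (h : IsSubmanifoldChart X φ e ζ ψ)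
    (h' : IsSubmanifoldChart X φ' e' ζ' ψ') :
    ContMDiffOn (𝓒 d) (𝓒 d) ∞ (ψ.symm.trans ψ') (ψ.symm.trans ψ').source := by
  have h1 : (ψ.symm.trans ψ').source = ψ.target ∩ ψ.symm ⁻¹' ψ'.source := by
    rw [OpenPartialHomeomorph.trans_source, OpenPartialHomeomorph.symm_source]
  rw [h1]
  refine ((contMDiff_quadProj e').comp_contMDiffOn
    ((contMDiffOn_of_mem_maximalAtlas h'.mem_atlas).comp
      (h.contMDiffOn_coe_symm.mono inter_subset_left) fun y hy => ?_)).congr fun y hy => ?_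
  · exact (h'.source_iff _).1 hy.2
  · exact h'.apply_eq _

variable (m d X) in
/-- All charts of `X` are given by coordinates of charts of `M`. -/
def IsSubmanifoldAtlas [ChartedSpace (EuclideanQuadrant d) X] : Prop :=
  ∀ ψ ∈ atlas (EuclideanQuadrant d) X,
    ∃ (φ : OpenPartialHomeomorph M (EuclideanQuadrant m)) (e : Fin d ↪ Fin m) (ζ : M),
      IsSubmanifoldChart X φ e ζ ψ

theorem exists_isSubmanifoldAtlas (hX : ∀ ζ ∈ X,
    ∃ (φ : OpenPartialHomeomorph M (EuclideanQuadrant m)) (e : Fin d ↪ Fin m)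
      (ψ : OpenPartialHomeomorph X (EuclideanQuadrant d)), IsSubmanifoldChart X φ e ζ ψ) :
    ∃ _ : ChartedSpace (EuclideanQuadrant d) X, IsSubmanifoldAtlas m d X :=
  exists_chartedSpace (Q := fun ψ =>
    ∃ (φ : OpenPartialHomeomorph M (EuclideanQuadrant m)) (e : Fin d ↪ Fin m) (ζ : M),
      IsSubmanifoldChart X φ e ζ ψ) fun ζ => by
    obtain ⟨φ, e, ψ, h⟩ := hX ζ ζ.2
    exact ⟨ψ, (h.source_iff ζ).2 h.mem_source, φ, e, ζ, h⟩

variable [ChartedSpace (EuclideanQuadrant d) X]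

theorem IsSubmanifoldAtlas.isManifold (hA : IsSubmanifoldAtlas m d X) : IsManifold (𝓒 d) ∞ X := by
  refine isManifold_of_contMDiffOn_transition fun ψ hψ ψ' hψ' => ?_
  obtain ⟨φ, e, ζ, h⟩ := hA ψ hψ
  obtain ⟨φ', e', ζ', h'⟩ := hA ψ' hψ'
  exact h.contMDiffOn_trans h'

theorem IsSubmanifoldAtlas.contMDiff_coe (hA : IsSubmanifoldAtlas m d X) :
    ContMDiff (𝓒 d) (𝓒 m) ∞ ((↑) : X → M) := by
  have := hA.isManifold
  intro x
  obtain ⟨φ, e, ζ, h⟩ := hA (chartAt _ x) (chart_mem_atlas _ _)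
  have ho := (chartAt (EuclideanQuadrant d) x).open_source.mem_nhds (mem_chart_source _ x)
  have h1 := h.contMDiffOn_coe_symm.comp (contMDiffOn_chart (I := 𝓒 d) (n := ∞) (x := x))
    fun z hz => (chartAt (EuclideanQuadrant d) x).map_source hz
  refine (h1.contMDiffAt ho).congr_of_eventuallyEq ?_
  filter_upwards [ho] with z hz
  exact congrArg Subtype.val ((chartAt (EuclideanQuadrant d) x).left_inv hz).symm

section CodRestrict

variable {EZ HZ Z : Type*} [NormedAddCommGroup EZ] [NormedSpace ℝ EZ] [TopologicalSpace HZ]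
  {J : ModelWithCorners ℝ EZ HZ} [TopologicalSpace Z] [ChartedSpace HZ Z]

/-- A map into `X` is smooth if it is smooth as a map into `M`. -/
theorem IsSubmanifoldAtlas.contMDiffOn_of_coe (hA : IsSubmanifoldAtlas m d X) {f : Z → X}
    {s : Set Z} (hf : ContMDiffOn J (𝓒 m) ∞ (fun z => (f z : M)) s) :
    ContMDiffOn J (𝓒 d) ∞ f s := by
  have := hA.isManifold
  intro z hz
  obtain ⟨φ, e, ζ, h⟩ := hA (chartAt _ (f z)) (chart_mem_atlas _ _)
  have hzs : (f z : M) ∈ φ.source := (h.source_iff _).1 (mem_chart_source _ _)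
  have h1 : ContMDiffWithinAt J (𝓒 d) ∞ (fun w => chartAt (EuclideanQuadrant d) (f z) (f w)) s z := by
    have h2 : ContMDiffAt (𝓒 m) (𝓒 d) ∞ (fun x => quadProj e (φ x)) (f z : M) :=
      (contMDiff_quadProj e).contMDiffAt.comp _
        ((contMDiffOn_of_mem_maximalAtlas h.mem_atlas).contMDiffAt (φ.open_source.mem_nhds hzs))
    refine (ContMDiffAt.comp_contMDiffWithinAt z h2 (hf z hz)).congr (fun w _ => ?_) ?_
    · exact h.apply_eq _
    · exact h.apply_eq _
  have h3 : ContMDiffAt (𝓒 d) (𝓒 d) ∞ (chartAt (EuclideanQuadrant d) (f z)).symm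
      (chartAt (EuclideanQuadrant d) (f z) (f z)) :=
    (contMDiffOn_chart_symm (I := 𝓒 d) (n := ∞) (x := f z)).contMDiffAt
      ((chartAt (EuclideanQuadrant d) (f z)).open_target.mem_nhds (mem_chart_target _ _))
  refine (ContMDiffAt.comp_contMDiffWithinAt z h3 h1).congr_of_eventuallyEq ?_ ?_
  · filter_upwards [(hf z hz).continuousWithinAt (φ.open_source.mem_nhds hzs)] with w hw
    exact ((chartAt (EuclideanQuadrant d) (f z)).left_inv ((h.source_iff _).2 hw)).symm
  · exact ((chartAt (EuclideanQuadrant d) (f z)).left_inv (mem_chart_source _ _)).symm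

end CodRestrict

theorem IsSubmanifoldChart.mem_maximalAtlas (hA : IsSubmanifoldAtlas m d X)
    (h : IsSubmanifoldChart X φ e ζ ψ) : ψ ∈ IsManifold.maximalAtlas (𝓒 d) ∞ X := by
  have := hA.isManifold
  refine OpenPartialHomeomorph.mem_maximalAtlas_of_contMDiffOn _ ?_
    (hA.contMDiffOn_of_coe h.contMDiffOn_coe_symm)
  exact ((contMDiff_quadProj e).comp_contMDiffOn
    ((contMDiffOn_of_mem_maximalAtlas h.mem_atlas).comp hA.contMDiff_coe.contMDiffOn
      fun x hx => (h.source_iff x).1 hx)).congr fun x _ => h.apply_eq x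

theorem IsSubmanifoldAtlas.coe_mem_smoothBoundaryPart (hA : IsSubmanifoldAtlas m d X) {x : X}
    (hx : x ∈ smoothBoundaryPart d X) : (x : M) ∈ smoothBoundaryPart m M := by
  obtain ⟨φ, e, ζ, h⟩ := hA (chartAt _ x) (chart_mem_atlas _ _)
  have hxs : (x : M) ∈ φ.source := (h.source_iff _).1 (mem_chart_source _ _)
  rw [mem_smoothBoundaryPart_iff h.mem_atlas hxs, ← h.quadIncl_apply hxs,
    existsUnique_quadIncl h.mem_range_of_zero]
  exact hx

/-- The inclusion carries the smooth boundary part of `X` into that of `M`, so a connected piece of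
the one lies in a component of the other. -/
theorem IsSubmanifoldChart.noSelfIntersectionAt (hM : IsManifoldWithCorners m M)
    (hA : IsSubmanifoldAtlas m d X) {x : X} (h : IsSubmanifoldChart X φ e x ψ) :
    NoSelfIntersectionAt ψ x := by
  obtain ⟨U, hU, hns⟩ := noSelfIntersectionAt_of_embedded hM.embedded h.mem_atlas h.mem_source
  refine ⟨_, continuous_subtype_val.continuousAt.preimage_mem_nhds hU,
    fun y hy z hz i j hi hj hyz => e.injective (hns y hy z hz _ _ ?_ ?_ ?_)⟩
  · rwa [h.apply_eq] at hi
  · rwa [h.apply_eq] at hj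
  · have hyb : y ∈ smoothBoundaryPart d X := connectedComponentIn_nonempty_iff.1 ⟨_, hyz⟩
    refine connectedComponentIn_mono (y : M) ?_
      (continuous_subtype_val.continuousOn.image_connectedComponentIn_subset hyb ⟨z, hyz, rfl⟩)
    rintro _ ⟨w, hw, rfl⟩
    exact hA.coe_mem_smoothBoundaryPart hw

theorem IsSubmanifoldAtlas.isManifoldWithCorners (hM : IsManifoldWithCorners m M)
    (hA : IsSubmanifoldAtlas m d X) (hX : ∀ ζ ∈ X,
    ∃ (φ : OpenPartialHomeomorph M (EuclideanQuadrant m)) (e : Fin d ↪ Fin m)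
      (ψ : OpenPartialHomeomorph X (EuclideanQuadrant d)), IsSubmanifoldChart X φ e ζ ψ) :
    IsManifoldWithCorners d X where
  t2Space := by
    have := hM.t2Space
    infer_instance
  secondCountable := by
    have := hM.secondCountable
    infer_instance
  isManifold := hA.isManifold
  embedded := by
    have := hA.isManifold
    refine embedded_of_noSelfIntersectionAt fun x => ?_
    obtain ⟨φ, e, ψ, h⟩ := hX x x.2
    exact ⟨ψ, h.mem_maximalAtlas hA, (h.source_iff x).2 h.mem_source,
      h.noSelfIntersectionAt hM hA⟩

/-- Increasing all free coordinates at once is a path in `X`. It leaves the boundary immediately,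
because every coordinate vanishing at `ζ` is free. -/
theorem IsSubmanifoldChart.not_connectedComponentIn_subset_boundary
    (h : IsSubmanifoldChart X φ e ζ ψ) :
    ¬ connectedComponentIn X ζ ⊆ (𝓒 m).boundary M := by
  classical
  obtain ⟨ε, hε⟩ := exists_isCornerBox h.mem_source univ_mem
  let v : 𝔼 m := WithLp.toLp 2 fun i => if i ∈ range e then 1 else 0
  have hv : ∀ i, v i = if i ∈ range e then 1 else 0 := fun i => rfl
  have hc : Continuous fun t : ℝ => (φ ζ).1 + t • v := by fun_prop
  obtain ⟨δ, hδ, hδb⟩ : ∃ δ : ℝ, 0 < δ ∧ ∀ t ∈ Icc 0 δ, (φ ζ).1 + t • v ∈ Metric.ball (φ ζ).1 ε := by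
    have h1 : ∀ᶠ t : ℝ in 𝓝 0, (φ ζ).1 + t • v ∈ Metric.ball (φ ζ).1 ε :=
      hc.continuousAt.preimage_mem_nhds (Metric.isOpen_ball.mem_nhds (by
        rw [zero_smul, add_zero]
        exact Metric.mem_ball_self hε.pos))
    obtain ⟨r, hr, h2⟩ := Metric.eventually_nhds_iff.1 h1
    refine ⟨r / 2, by positivity, fun t ht => h2 ?_⟩
    rw [Real.dist_0_eq_abs, abs_of_nonneg ht.1]
    linarith [ht.2]
  have hr : ∀ t : ℝ, 0 ≤ t → (φ ζ).1 + t • v ∈ range (𝓒 m) := by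
    intro t ht
    rw [mem_range_quadrant]
    intro i
    rw [PiLp.add_apply, PiLp.smul_apply, hv, smul_eq_mul]
    have := (φ ζ).2 i
    split_ifs <;> linarith
  have ht : ∀ t ∈ Icc 0 δ, (𝓒 m).symm ((φ ζ).1 + t • v) ∈ φ.target := fun t ht =>
    hε.target _ (hr t ht.1) (hδb t ht)
  let γ : ℝ → M := fun t => φ.symm ((𝓒 m).symm ((φ ζ).1 + t • v))
  have hγ : ∀ t ∈ Icc 0 δ, γ t ∈ φ.source ∧ (φ (γ t)).1 = (φ ζ).1 + t • v := fun t h' =>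
    ⟨φ.map_target (ht t h'), val_chart_symm (hr t h'.1) (ht t h')⟩
  have h0 : γ 0 = ζ := by
    change φ.symm ((𝓒 m).symm ((φ ζ).1 + (0 : ℝ) • v)) = ζ
    rw [zero_smul, add_zero, chart_symm_val h.mem_source]
  have hpre : IsPreconnected (γ '' Icc 0 δ) :=
    isPreconnected_Icc.image _ (continuousOn_chart_symm.comp hc.continuousOn ht)
  have hsub : γ '' Icc 0 δ ⊆ X := by
    rintro _ ⟨t, h', rfl⟩
    obtain ⟨h1, h2⟩ := hγ t h'
    rw [h.mem_iff _ h1]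
    intro i hi
    rw [h2, PiLp.add_apply, PiLp.smul_apply, hv, if_neg hi, smul_zero, add_zero]
  intro hcon
  have hδI : δ ∈ Icc 0 δ := ⟨hδ.le, le_rfl⟩
  obtain ⟨h1, h2⟩ := hγ δ hδI
  have h3 := hcon (hpre.subset_connectedComponentIn ⟨0, ⟨le_rfl, hδ.le⟩, h0⟩ hsub ⟨δ, hδI, rfl⟩)
  obtain ⟨i, hi⟩ := (mem_boundary_iff_chart h.mem_atlas h1).1 h3
  rw [h2, PiLp.add_apply, PiLp.smul_apply, hv, smul_eq_mul] at hi
  have h4 := (φ ζ).2 i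
  split_ifs at hi with hie
  · linarith
  · rw [mul_zero, add_zero] at hi
    exact hie (h.mem_range_of_zero i hi)

theorem IsSubmanifoldAtlas.isInteriorPSubmanifold (hA : IsSubmanifoldAtlas m d X)
    (hX : ∀ ζ ∈ X,
    ∃ (φ : OpenPartialHomeomorph M (EuclideanQuadrant m)) (e : Fin d ↪ Fin m)
      (ψ : OpenPartialHomeomorph X (EuclideanQuadrant d)), IsSubmanifoldChart X φ e ζ ψ) :
    IsInteriorPSubmanifold m d X where
  adapted p := by
    obtain ⟨φ, e, ψ, h⟩ := hX p p.2
    refine ⟨φ, h.mem_atlas, ψ, h.mem_maximalAtlas hA, e, h.mem_source, h.source_iff,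
      fun x _ j => ?_, h.mem_iff⟩
    rw [h.apply_eq, quadProj_apply]
  interior p hp := by
    obtain ⟨φ, e, ψ, h⟩ := hX p hp
    exact h.not_connectedComponentIn_subset_boundary

end SubmanifoldCharts

/-! ### Transport of structure along homeomorphisms and quotients. -/

section Transport

/-- The pullback of a charted space structure under a homeomorphism. -/
noncomputable abbrev Homeomorph.pullbackChartedSpace (H : Type*) {Y Z : Type*} [TopologicalSpace H]
    [TopologicalSpace Y] [TopologicalSpace Z] [ChartedSpace H Z] (h : Y ≃ₜ Z) :
    ChartedSpace H Y where
  atlas := (fun χ => h.toOpenPartialHomeomorph.trans χ) '' atlas H Z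
  chartAt y := h.toOpenPartialHomeomorph.trans (chartAt H (h y))
  mem_chart_source y := by
    rw [OpenPartialHomeomorph.trans_source]
    exact ⟨mem_univ _, mem_chart_source H (h y)⟩
  chart_mem_atlas y := ⟨_, chart_mem_atlas H (h y), rfl⟩

section

variable {E H Y Z : Type*} [NormedAddCommGroup E] [NormedSpace ℝ E] [TopologicalSpace H]
  {J : ModelWithCorners ℝ E H} [TopologicalSpace Y] [TopologicalSpace Z] [ChartedSpace H Z]

/-- The pulled back chart already contains `h`, so in charts `h` reads as the identity; it is
therefore a diffeomorphism for the transported structure. -/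
theorem Homeomorph.eventuallyEq_extChartAt_pullback (h : Y ≃ₜ Z) (y : Y) :
    letI := h.pullbackChartedSpace H
    (extChartAt J (h y) ∘ h ∘ (extChartAt J y).symm) =ᶠ[𝓝[range J] (extChartAt J y y)] id := by
  let _ := h.pullbackChartedSpace H
  filter_upwards [extChartAt_target_mem_nhdsWithin (I := J) (h y)] with z hz
  change extChartAt J (h y) (h (h.symm ((extChartAt J (h y)).symm z))) = z
  rw [h.apply_symm_apply, (extChartAt J (h y)).right_inv hz]

theorem Homeomorph.contMDiff_pullback (h : Y ≃ₜ Z) :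
    letI := h.pullbackChartedSpace H
    ContMDiff J J ∞ h := by
  let _ := h.pullbackChartedSpace H
  intro y
  rw [contMDiffAt_iff]
  have h1 := h.eventuallyEq_extChartAt_pullback (J := J) y
  refine ⟨h.continuous.continuousAt, contDiffWithinAt_id.congr_of_eventuallyEq h1 ?_⟩
  exact h1.eq_of_nhdsWithin ⟨_, rfl⟩

theorem Homeomorph.contMDiff_pullback_symm (h : Y ≃ₜ Z) :
    letI := h.pullbackChartedSpace H
    ContMDiff J J ∞ h.symm := by
  let _ := h.pullbackChartedSpace H
  intro z
  obtain ⟨y, rfl⟩ := h.surjective z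
  rw [contMDiffAt_iff, h.symm_apply_apply]
  have h1 : (extChartAt J y ∘ h.symm ∘ (extChartAt J (h y)).symm)
      =ᶠ[𝓝[range J] (extChartAt J (h y) (h y))] id := by
    filter_upwards [extChartAt_target_mem_nhdsWithin (I := J) (h y)] with z hz
    change extChartAt J (h y) (h (h.symm ((extChartAt J (h y)).symm z))) = z
    rw [h.apply_symm_apply, (extChartAt J (h y)).right_inv hz]
  refine ⟨h.symm.continuous.continuousAt, contDiffWithinAt_id.congr_of_eventuallyEq h1 ?_⟩
  exact h1.eq_of_nhdsWithin ⟨_, rfl⟩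

theorem Homeomorph.isManifold_pullback [IsManifold J ∞ Z] (h : Y ≃ₜ Z) :
    letI := h.pullbackChartedSpace H
    IsManifold J ∞ Y := by
  let _ := h.pullbackChartedSpace H
  refine isManifold_of_contMDiffOn_transition ?_
  rintro _ ⟨χ, hχ, rfl⟩ _ ⟨χ', hχ', rfl⟩
  have h1 : ContMDiffOn J J ∞ (χ.symm.trans χ') (χ.symm.trans χ').source :=
    contMDiffOn_of_mem_contDiffGroupoid
      (HasGroupoid.compatible (G := contDiffGroupoid ∞ J) hχ hχ')
  have h2 : ((h.toOpenPartialHomeomorph.trans χ).symm.trans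
      (h.toOpenPartialHomeomorph.trans χ')).source ⊆ (χ.symm.trans χ').source := by
    intro z hz
    rw [OpenPartialHomeomorph.trans_source] at hz ⊢
    refine ⟨?_, ?_⟩
    · have := hz.1
      rw [OpenPartialHomeomorph.symm_source, OpenPartialHomeomorph.trans_target] at this
      exact this.1
    · have := hz.2
      rw [mem_preimage, OpenPartialHomeomorph.trans_source] at this
      have h3 : h (h.symm (χ.symm z)) ∈ χ'.source := this.2
      rwa [h.apply_symm_apply] at h3
  refine (h1.mono h2).congr fun z _ => ?_
  change χ' (h (h.symm (χ.symm z))) = χ' (χ.symm z)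
  rw [h.apply_symm_apply]

end

theorem Homeomorph.isManifoldWithCorners_pullback {k : ℕ} {Y Z : Type*} [TopologicalSpace Y]
    [TopologicalSpace Z] [ChartedSpace (EuclideanQuadrant k) Z] (hZ : IsManifoldWithCorners k Z)
    (h : Y ≃ₜ Z) :
    letI := h.pullbackChartedSpace (EuclideanQuadrant k)
    IsManifoldWithCorners k Y := by
  let _ := h.pullbackChartedSpace (EuclideanQuadrant k)
  have := hZ.t2Space
  have := hZ.secondCountable
  have := hZ.isManifold
  refine ⟨h.symm.t2Space, h.secondCountableTopology, h.isManifold_pullback, ?_⟩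
  rintro _ ⟨x, hx, rfl⟩ p hp
  have hsb : h '' smoothBoundaryPart k Y = smoothBoundaryPart k Z := by
    ext z
    constructor
    · rintro ⟨y, hy, rfl⟩
      exact hy
    · intro hz
      refine ⟨h.symm z, ?_, h.apply_symm_apply z⟩
      change h (h.symm z) ∈ smoothBoundaryPart k Z
      rwa [h.apply_symm_apply]
  have hS : h '' closure (connectedComponentIn (smoothBoundaryPart k Y) x) =
      closure (connectedComponentIn (smoothBoundaryPart k Z) (h x)) := by
    rw [h.image_closure, h.image_connectedComponentIn hx, hsb]
  have hmem : ∀ y, y ∈ closure (connectedComponentIn (smoothBoundaryPart k Y) x) ↔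
      h y ∈ closure (connectedComponentIn (smoothBoundaryPart k Z) (h x)) := by
    intro y
    rw [← hS, h.injective.mem_set_image]
  obtain ⟨U, f, hU, hpU, hf, hpos, hzero, hd⟩ :=
    hZ.embedded _ ⟨h x, hx, rfl⟩ (h p) ((hmem p).1 hp)
  have hfh : ContMDiffOn (𝓒 k) 𝓘(ℝ, ℝ) ∞ (f ∘ h) (h ⁻¹' U) :=
    hf.comp h.contMDiff_pullback.contMDiffOn fun y hy => hy
  refine ⟨h ⁻¹' U, f ∘ h, hU.preimage h.continuous, hpU, hfh, fun y hy => hpos _ hy,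
    fun y hy => (hmem y).trans (hzero _ hy), fun h0 => hd ?_⟩
  have h1 : MDifferentiableAt (𝓒 k) 𝓘(ℝ, ℝ) (f ∘ h) (h.symm (h p)) := by
    rw [h.symm_apply_apply]
    exact (hfh.contMDiffAt ((hU.preimage h.continuous).mem_nhds hpU)).mdifferentiableAt (by simp)
  have h2 : MDifferentiableAt (𝓒 k) (𝓒 k) h.symm (h p) :=
    h.contMDiff_pullback_symm.contMDiffAt.mdifferentiableAt (by simp)
  have h3 := mfderiv_comp (h p) h1 h2
  have h4 : (f ∘ h) ∘ h.symm = f := by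
    ext z
    simp
  rw [h4, h.symm_apply_apply, h0] at h3
  rw [h3]
  ext v
  rfl

/-- A quotient with the same fibres as a smooth quotient is a smooth quotient. -/
theorem exists_chartedSpace_of_isSmoothQuotientMap {k : ℕ} {E H X Y Z : Type*}
    [NormedAddCommGroup E] [NormedSpace ℝ E] [TopologicalSpace H] {I : ModelWithCorners ℝ E H}
    [TopologicalSpace X] [ChartedSpace H X] [TopologicalSpace Y] [TopologicalSpace Z]
    [ChartedSpace (EuclideanQuadrant k) Z] (hZ : IsManifoldWithCorners k Z) {π : X → Y} {p : X → Z}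
    (hπ : Topology.IsQuotientMap π) (hp : IsSmoothQuotientMap I (𝓒 k) p)
    (h : ∀ x y, π x = π y ↔ p x = p y) :
    ∃ _ : ChartedSpace (EuclideanQuadrant k) Y, IsManifoldWithCorners k Y ∧
      IsSmoothQuotientMap I (𝓒 k) π ∧
      ∃ Φ : Diffeomorph (𝓒 k) (𝓒 k) Y Z ∞, ∀ x, Φ (π x) = p x := by
  have hps := hp.isQuotientMap.surjective
  let f : Y → Z := fun y => p (Function.surjInv hπ.surjective y)
  let g : Z → Y := fun z => π (Function.surjInv hps z)
  have hf : ∀ x, f (π x) = p x := fun x => (h _ _).1 (Function.surjInv_eq hπ.surjective (π x))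
  have hg : ∀ x, g (p x) = π x := fun x => (h _ _).2 (Function.surjInv_eq hps (p x))
  -- Equal fibres give mutually inverse bijections, and each is continuous because the map it
  -- factors through is a topological quotient map.
  let F : Y ≃ₜ Z :=
    { toFun := f
      invFun := g
      left_inv := by
        intro y
        obtain ⟨x, rfl⟩ := hπ.surjective y
        rw [hf, hg]
      right_inv := by
        intro z
        obtain ⟨x, rfl⟩ := hps z
        rw [hg, hf]
      continuous_toFun := hπ.continuous_iff.2 (by
        rw [show f ∘ π = p from funext hf]
        exact hp.contMDiff.continuous)
      continuous_invFun := hp.isQuotientMap.continuous_iff.2 (by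
        rw [show g ∘ p = π from funext hg]
        exact hπ.continuous) }
  let _ := F.pullbackChartedSpace (EuclideanQuadrant k)
  have hF : ContMDiff (𝓒 k) (𝓒 k) ∞ F := F.contMDiff_pullback
  have hF' : ContMDiff (𝓒 k) (𝓒 k) ∞ F.symm := F.contMDiff_pullback_symm
  refine ⟨F.pullbackChartedSpace (EuclideanQuadrant k), F.isManifoldWithCorners_pullback hZ,
    ⟨hπ, ?_, fun x => ?_⟩, ⟨F.toEquiv, hF, hF'⟩, hf⟩
  · have : π = F.symm ∘ p := (funext hg).symm
    rw [this]
    exact hF'.comp hp.contMDiff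
  · obtain ⟨U, s, hU, hx, hs, hsx, hps⟩ := hp.exists_section x
    refine ⟨F ⁻¹' U, s ∘ F, hU.preimage F.continuous, ?_, hs.comp hF.contMDiffOn fun y hy => hy,
      ?_, fun y hy => ?_⟩
    · change f (π x) ∈ U
      rwa [hf]
    · change s (f (π x)) = x
      rw [hf, hsx]
    · rw [Function.comp_apply, ← hg, hps _ hy]
      exact F.symm_apply_apply y

end Transport

/-! ### The fixed point set of an isotropy group. -/

section FixedPoints

set_option linter.unusedSectionVars false

variable {n m q d : ℕ} {G : Type*} [TopologicalSpace G] [ChartedSpace (EuclideanSpace ℝ (Fin n)) G]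
  [Group G] [LieGroup (𝓡 n) ∞ G] [IsTopologicalGroup G] [CompactSpace G]
  {M : Type*} [TopologicalSpace M] [T2Space M] [ChartedSpace (EuclideanQuadrant m) M]
  [IsManifold (𝓒 m) ∞ M] [MulAction G M] [ContMDiffSMul (𝓡 n) (𝓒 m) ∞ G M]
  [ContinuousSMul G M] {ζ₀ : M}

theorem smul_mem_fixedPoints_stabilizer {K : Subgroup G} {x : M}
    (h : MulAction.stabilizer G x = K) : x ∈ MulAction.fixedPoints K M :=
  fun k => h.symm ▸ k.2

/-- Points of the same orbit with the same isotropy group are related by the normalizer. -/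
theorem mem_normalizer_of_stabilizer_eq {K : Subgroup G} {x y : M}
    (hx : MulAction.stabilizer G x = K) (hy : MulAction.stabilizer G y = K) {g : G}
    (hg : g • x = y) : g ∈ Subgroup.normalizer (K : Set G) := by
  rw [Subgroup.mem_normalizer_iff]
  intro k
  rw [← hx, MulAction.mem_stabilizer_iff, hx, ← hy, ← hg, MulAction.mem_stabilizer_iff]
  rw [mul_smul, mul_smul, inv_smul_smul, smul_left_cancel_iff]

/-- Every isotropy group is conjugate to the given one, so every orbit meets its fixed point set. -/
theorem exists_smul_mem_fixedPoints (hiso : HasUniqueIsotropyType G M) (ζ₀ z : M) :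
    ∃ (g : G) (x : M), x ∈ MulAction.fixedPoints (MulAction.stabilizer G ζ₀) M ∧ g • x = z := by
  obtain ⟨g, hg⟩ := hiso z ζ₀
  refine ⟨g⁻¹, g • z, smul_mem_fixedPoints_stabilizer ?_, inv_smul_smul g z⟩
  rw [MulAction.stabilizer_smul_eq_stabilizer_map_conj, hg]

theorem exists_isSubmanifoldChart_fixedPoints (n) [ChartedSpace (EuclideanSpace ℝ (Fin n)) G]
    [LieGroup (𝓡 n) ∞ G] [ContMDiffSMul (𝓡 n) (𝓒 m) ∞ G M] (hM : IsManifoldWithCorners m M)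
    (hbif : IsBoundaryIntersectionFree m G M) (hiso : HasUniqueIsotropyType G M) (ζ₀ : M) :
    ∃ d : ℕ, ∀ ζ ∈ MulAction.fixedPoints (MulAction.stabilizer G ζ₀) M,
      ∃ (φ : OpenPartialHomeomorph M (EuclideanQuadrant m)) (e : Fin d ↪ Fin m)
        (ψ : OpenPartialHomeomorph (MulAction.fixedPoints (MulAction.stabilizer G ζ₀) M)
          (EuclideanQuadrant d)),
        IsSubmanifoldChart (MulAction.fixedPoints (MulAction.stabilizer G ζ₀) M) φ e ζ ψ := by
  obtain ⟨d, hd⟩ := exists_finrank_isotropyFixed n hM hbif hiso ζ₀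
  refine ⟨d, fun ζ hζ => ?_⟩
  have hst := stabilizer_eq_of_mem_fixedPoints hiso hζ
  obtain ⟨φ, e, h⟩ := exists_isFixedChart n hM hbif ζ (hd ζ hst)
  obtain ⟨ψ, hψ⟩ := exists_isSubmanifoldChart
    (X := MulAction.fixedPoints (MulAction.stabilizer G ζ₀) M) h.mem_atlas h.mem_source
    h.mem_range_of_zero (by
      have := h.mem_fixedPoints_iff
      rwa [hst] at this)
  exact ⟨φ, e, ψ, hψ⟩

variable [ChartedSpace (EuclideanQuadrant d)
    (MulAction.fixedPoints (MulAction.stabilizer G ζ₀) M)]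

/-- The slice at `x₀` consists of points with the same stabilizer as `x₀`, so it lies in the fixed
set, and the decomposition `x = σ(x) sl(x)` is a smooth local section. Translation by `g₀` brings
the section through `(g₀, x₀)`. -/
theorem isSmoothQuotientMap_smul_fixedPoints (hM : IsManifoldWithCorners m M)
    (hbif : IsBoundaryIntersectionFree m G M) (hiso : HasUniqueIsotropyType G M)
    (hA : IsSubmanifoldAtlas m d (MulAction.fixedPoints (MulAction.stabilizer G ζ₀) M))
    (hq : ∀ ζ : M, ∀ φ ∈ IsManifold.maximalAtlas (𝓒 m) ∞ M, ζ ∈ φ.source →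
      Module.finrank ℝ (orbitTangent n G φ ζ) + q = m) :
    IsSmoothQuotientMap ((𝓡 n).prod (𝓒 d)) (𝓒 m)
      (fun a : G × MulAction.fixedPoints (MulAction.stabilizer G ζ₀) M => a.1 • (a.2 : M)) := by
  classical
  refine isSmoothQuotientMap_of_section ?_ ?_ ?_
  · intro z
    obtain ⟨g, x, hx, hz⟩ := exists_smul_mem_fixedPoints hiso ζ₀ z
    exact ⟨(g, ⟨x, hx⟩), hz⟩
  · exact contMDiff_fst.smul (hA.contMDiff_coe.comp contMDiff_snd)
  · rintro ⟨g₀, x₀⟩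
    obtain ⟨φ, e, N, σ, sl, h⟩ := exists_isSlice n hM hbif hiso (x₀ : M) (hq x₀)
    have hst := stabilizer_eq_of_mem_fixedPoints hiso x₀.2
    have hslK : ∀ x ∈ N, sl x ∈ MulAction.fixedPoints (MulAction.stabilizer G ζ₀) M := fun x hx =>
      smul_mem_fixedPoints_stabilizer ((h.stabilizer_slice x hx).trans hst)
    let r : M → MulAction.fixedPoints (MulAction.stabilizer G ζ₀) M := fun x =>
      if hx : sl x ∈ MulAction.fixedPoints (MulAction.stabilizer G ζ₀) M then ⟨_, hx⟩ else x₀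
    have hr : ∀ x ∈ N, (r x : M) = sl x := by
      intro x hx
      exact congrArg Subtype.val (dif_pos (hslK x hx))
    have hrs : ContMDiffOn (𝓒 m) (𝓒 d) ∞ r N :=
      hA.contMDiffOn_of_coe (h.contMDiffOn_slice.congr hr)
    have hg : ContMDiff (𝓒 m) (𝓒 m) ∞ (fun z : M => g₀⁻¹ • z) :=
      ContMDiffSMul.contMDiff_const_smul (I := 𝓡 n) g₀⁻¹
    have hpair : ContMDiffOn (𝓒 m) ((𝓡 n).prod (𝓒 d)) ∞ (fun z => (g₀ * σ z, r z)) N :=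
      (contMDiffOn_const.mul h.contMDiffOn_translate).prodMk hrs
    refine ⟨(fun z : M => g₀⁻¹ • z) ⁻¹' N, fun z => (g₀ * σ (g₀⁻¹ • z), r (g₀⁻¹ • z)),
      h.isOpen.preimage hg.continuous, ?_, hpair.comp hg.contMDiffOn fun z hz => hz, ?_, ?_⟩
    · change g₀⁻¹ • g₀ • (x₀ : M) ∈ N
      rw [inv_smul_smul]
      exact h.mem
    · change (g₀ * σ (g₀⁻¹ • g₀ • (x₀ : M)), r (g₀⁻¹ • g₀ • (x₀ : M))) = (g₀, x₀)
      rw [inv_smul_smul, h.translate_self, mul_one]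
      exact Prod.ext rfl (Subtype.ext ((hr _ h.mem).trans h.slice_self))
    · intro z hz
      change (g₀ * σ (g₀⁻¹ • z)) • (r (g₀⁻¹ • z) : M) = z
      rw [hr _ hz, mul_smul, h.smul_slice _ hz, smul_inv_smul]

/-- The local sections of the orbit projection through a point of the fixed set take values in
points with the same stabilizer, hence in the fixed set. -/
theorem isSmoothQuotientMap_orbitMk_fixedPoints (hiso : HasUniqueIsotropyType G M)
    (hA : IsSubmanifoldAtlas m d (MulAction.fixedPoints (MulAction.stabilizer G ζ₀) M))
    [ChartedSpace (EuclideanQuadrant q) (MulAction.orbitRel.Quotient G M)]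
    (hB : IsOrbitAtlas m q G M) (hc : ∀ ζ : M, HasOrbitChart m q G ζ) :
    IsSmoothQuotientMap (𝓒 d) (𝓒 q)
      (fun x : MulAction.fixedPoints (MulAction.stabilizer G ζ₀) M => orbitMk G (x : M)) := by
  classical
  refine isSmoothQuotientMap_of_section ?_ (hB.contMDiff.comp hA.contMDiff_coe) ?_
  · intro y
    obtain ⟨z, rfl⟩ : ∃ z, orbitMk G z = y := Quotient.exists_rep y
    obtain ⟨g, x, hx, rfl⟩ := exists_smul_mem_fixedPoints hiso ζ₀ z
    exact ⟨⟨x, hx⟩, (orbitMk_smul g x).symm⟩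
  · intro x₀
    obtain ⟨φ, e, χ, s, h⟩ := hc x₀
    obtain ⟨h1, h2, h3, h4⟩ := h.exists_section hB
    have hst := stabilizer_eq_of_mem_fixedPoints hiso x₀.2
    let r : MulAction.orbitRel.Quotient G M →
        MulAction.fixedPoints (MulAction.stabilizer G ζ₀) M := fun y =>
      if hx : s (χ y) ∈ MulAction.fixedPoints (MulAction.stabilizer G ζ₀) M then ⟨_, hx⟩ else x₀
    have hr : ∀ y ∈ χ.source, (r y : M) = s (χ y) := by
      intro y hy
      exact congrArg Subtype.val (dif_pos (smul_mem_fixedPoints_stabilizer ((h4 y hy).trans hst)))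
    refine ⟨χ.source, r, χ.open_source, h.mem_source, hA.contMDiffOn_of_coe (h1.congr hr),
      Subtype.ext ((hr _ h.mem_source).trans h2), fun y hy => ?_⟩
    rw [hr y hy, h3 y hy]

/-- If `a.1 x = b.1 y` for fixed points `x, y` of the isotropy group, then `b.1⁻¹ a.1` carries `x`
to `y`; both have the same stabilizer, so it normalizes that group and is the required element. -/
theorem twistedProduct_mk_eq_iff (hiso : HasUniqueIsotropyType G M)
    (a b : G × MulAction.fixedPoints (MulAction.stabilizer G ζ₀) M) :
    TwistedProduct.mk (Subgroup.normalizer (MulAction.stabilizer G ζ₀ : Set G))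
      (MulAction.fixedPoints (MulAction.stabilizer G ζ₀) M) a =
    TwistedProduct.mk (Subgroup.normalizer (MulAction.stabilizer G ζ₀ : Set G))
      (MulAction.fixedPoints (MulAction.stabilizer G ζ₀) M) b ↔
    a.1 • (a.2 : M) = b.1 • (b.2 : M) := by
  constructor
  · intro h
    obtain ⟨k, rfl⟩ : (twistedSetoid _ _).r a b := Quotient.exact h
    change a.1 • (a.2 : M) = (a.1 * (k : G)⁻¹) • (k : G) • (a.2 : M)
    rw [mul_smul, inv_smul_smul]
  · intro h
    have h1 : (b.1⁻¹ * a.1) • (a.2 : M) = b.2 := by rw [mul_smul, h, inv_smul_smul]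
    have h2 := mem_normalizer_of_stabilizer_eq (stabilizer_eq_of_mem_fixedPoints hiso a.2.2)
      (stabilizer_eq_of_mem_fixedPoints hiso b.2.2) h1
    refine Quotient.sound ⟨⟨_, h2⟩, Prod.ext ?_ (Subtype.ext h1.symm)⟩
    change b.1 = a.1 * (b.1⁻¹ * a.1)⁻¹
    group

theorem orbitMk_normalizer_eq_iff (hiso : HasUniqueIsotropyType G M)
    (x y : MulAction.fixedPoints (MulAction.stabilizer G ζ₀) M) :
    orbitMk (Subgroup.normalizer (MulAction.stabilizer G ζ₀ : Set G)) x =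
      orbitMk (Subgroup.normalizer (MulAction.stabilizer G ζ₀ : Set G)) y ↔
    orbitMk G (x : M) = orbitMk G (y : M) := by
  constructor
  · intro h
    obtain ⟨k, rfl⟩ : (MulAction.orbitRel _ _).r x y := Quotient.exact h
    exact orbitMk_smul (k : G) (y : M)
  · intro h
    obtain ⟨g, hg⟩ := orbitMk_eq_iff.1 h
    have h2 := mem_normalizer_of_stabilizer_eq (stabilizer_eq_of_mem_fixedPoints hiso y.2)
      (stabilizer_eq_of_mem_fixedPoints hiso x.2) hg
    exact Quotient.sound ⟨⟨g, h2⟩, Subtype.ext hg⟩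

theorem orbitRel_weylGroup {G M : Type*} [Group G] [MulAction G M] (K : Subgroup G) :
    MulAction.orbitRel (WeylGroup K) (MulAction.fixedPoints K M) =
      MulAction.orbitRel (Subgroup.normalizer (K : Set G)) (MulAction.fixedPoints K M) := by
  ext x y
  rw [MulAction.orbitRel_apply, MulAction.orbitRel_apply]
  constructor
  · rintro ⟨w, rfl⟩
    obtain ⟨k, rfl⟩ := QuotientGroup.mk_surjective w
    exact ⟨k, rfl⟩
  · rintro ⟨k, rfl⟩
    exact ⟨(k : WeylGroup K), rfl⟩

end FixedPoints

end

/-! ### Assembly of the theorem. -/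

theorem mainTheorem5 {n m : ℕ}
    {G : Type*} [TopologicalSpace G] [ChartedSpace (EuclideanSpace ℝ (Fin n)) G] [Group G]
    [LieGroup (𝓡 n) ∞ G] [CompactSpace G] [T2Space G]
    {M : Type*} [TopologicalSpace M] [ChartedSpace (EuclideanQuadrant m) M]
    (hM : IsManifoldWithCorners m M)
    [MulAction G M] [ContMDiffSMul (𝓡 n) (modelWithCornersEuclideanQuadrant m) ∞ G M]
    (hbif : IsBoundaryIntersectionFree m G M)
    (hiso : HasUniqueIsotropyType G M) :
    -- the orbit space is a smooth manifold with corners, independently of the choice of `K` below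
    ∃ (q : ℕ) (_ : ChartedSpace (EuclideanQuadrant q) (MulAction.orbitRel.Quotient G M)),
      IsManifoldWithCorners q (MulAction.orbitRel.Quotient G M) ∧
      IsSmoothQuotientMap (modelWithCornersEuclideanQuadrant m)
        (modelWithCornersEuclideanQuadrant q) (orbitMk G : M → MulAction.orbitRel.Quotient G M) ∧
      ∀ K : Subgroup G, (∃ x : M, K = MulAction.stabilizer G x) →
        -- the fixed point set of `K` is an interior p-submanifold
        ∃ (d : ℕ) (_ : ChartedSpace (EuclideanQuadrant d) (MulAction.fixedPoints K M)),
          IsManifoldWithCorners d (MulAction.fixedPoints K M) ∧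
          IsInteriorPSubmanifold m d (MulAction.fixedPoints K M) ∧
          -- the twisted product is smooth and equivariantly diffeomorphic to `M`
          (∃ _ : ChartedSpace (EuclideanQuadrant m)
              (TwistedProduct (Subgroup.normalizer (K : Set G)) (MulAction.fixedPoints K M)),
            IsManifoldWithCorners m
              (TwistedProduct (Subgroup.normalizer (K : Set G)) (MulAction.fixedPoints K M)) ∧
            IsSmoothQuotientMap ((𝓡 n).prod (modelWithCornersEuclideanQuadrant d))
              (modelWithCornersEuclideanQuadrant m)
              (TwistedProduct.mk (Subgroup.normalizer (K : Set G)) (MulAction.fixedPoints K M)) ∧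
            ∃ Φ : Diffeomorph (modelWithCornersEuclideanQuadrant m)
                (modelWithCornersEuclideanQuadrant m)
                (TwistedProduct (Subgroup.normalizer (K : Set G)) (MulAction.fixedPoints K M))
                M ∞,
              (∀ (g : G) (z : TwistedProduct (Subgroup.normalizer (K : Set G))
                (MulAction.fixedPoints K M)), Φ (g • z) = g • Φ z) ∧
              ∀ (g : G) (x : MulAction.fixedPoints K M),
                Φ (TwistedProduct.mk (Subgroup.normalizer (K : Set G))
                  (MulAction.fixedPoints K M) (g, x)) = g • (x : M)) ∧
          -- the orbits of `N(K)/K` and of `N(K)` coincide, their space is smooth, and the inclusion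
          -- of the fixed point set induces a diffeomorphism onto the orbit space of `M`
          MulAction.orbitRel (WeylGroup K) (MulAction.fixedPoints K M) =
            MulAction.orbitRel (Subgroup.normalizer (K : Set G)) (MulAction.fixedPoints K M) ∧
          ∃ _ : ChartedSpace (EuclideanQuadrant q)
              (MulAction.orbitRel.Quotient (Subgroup.normalizer (K : Set G))
                (MulAction.fixedPoints K M)),
            IsManifoldWithCorners q
              (MulAction.orbitRel.Quotient (Subgroup.normalizer (K : Set G))
                (MulAction.fixedPoints K M)) ∧
            IsSmoothQuotientMap (modelWithCornersEuclideanQuadrant d)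
              (modelWithCornersEuclideanQuadrant q)
              (orbitMk (Subgroup.normalizer (K : Set G)) :
                MulAction.fixedPoints K M → MulAction.orbitRel.Quotient
                  (Subgroup.normalizer (K : Set G)) (MulAction.fixedPoints K M)) ∧
            ∃ Ψ : Diffeomorph (modelWithCornersEuclideanQuadrant q)
                (modelWithCornersEuclideanQuadrant q)
                (MulAction.orbitRel.Quotient (Subgroup.normalizer (K : Set G))
                  (MulAction.fixedPoints K M))
                (MulAction.orbitRel.Quotient G M) ∞,
              ∀ x : MulAction.fixedPoints K M,
                Ψ (orbitMk (Subgroup.normalizer (K : Set G)) x) = orbitMk G (x : M) := by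
  have := hM.t2Space
  have := hM.isManifold
  have : IsTopologicalGroup G := topologicalGroup_of_lieGroup (𝓡 n) ∞
  have : ContinuousSMul G M :=
    ⟨(contMDiff_smul (I := 𝓡 n) (I' := modelWithCornersEuclideanQuadrant m)
      (n := ∞)).continuous⟩
  obtain ⟨q, csQ, hB, hc, hq⟩ := exists_isOrbitAtlas n hM hbif hiso
  have hQ := hB.isManifoldWithCorners n hM hbif hc
  refine ⟨q, csQ, hQ, hB.isSmoothQuotientMap hc, ?_⟩
  rintro _ ⟨ζ₀, rfl⟩
  obtain ⟨d, hd⟩ := exists_isSubmanifoldChart_fixedPoints n hM hbif hiso ζ₀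
  obtain ⟨csX, hA⟩ := exists_isSubmanifoldAtlas hd
  refine ⟨d, csX, hA.isManifoldWithCorners hM hd, hA.isInteriorPSubmanifold hd, ?_,
    orbitRel_weylGroup _, ?_⟩
  -- `M` itself serves as the model quotient of `G × M^K`: the map `(g, x) ↦ g x` is a smooth
  -- quotient map with the same fibres as the projection to the twisted product.
  · obtain ⟨cs, h1, h2, Φ, hΦ⟩ := exists_chartedSpace_of_isSmoothQuotientMap hM
      (π := TwistedProduct.mk (Subgroup.normalizer (MulAction.stabilizer G ζ₀ : Set G))
        (MulAction.fixedPoints (MulAction.stabilizer G ζ₀) M)) isQuotientMap_quot_mk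
      (isSmoothQuotientMap_smul_fixedPoints hM hbif hiso hA hq) (twistedProduct_mk_eq_iff hiso)
    refine ⟨cs, h1, h2, Φ, ?_, fun g x => hΦ (g, x)⟩
    rintro g ⟨a⟩
    exact (hΦ (g * a.1, a.2)).trans ((mul_smul g a.1 _).trans (congrArg (g • ·) (hΦ a).symm))
  -- Here the model quotient is the orbit space of `M`, which already has its structure; the fibres
  -- over it in the fixed set are the orbits of the normalizer.
  · obtain ⟨cs, h1, h2, Ψ, hΨ⟩ := exists_chartedSpace_of_isSmoothQuotientMap hQ
      (π := (orbitMk (Subgroup.normalizer (MulAction.stabilizer G ζ₀ : Set G)) :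
        MulAction.fixedPoints (MulAction.stabilizer G ζ₀) M → _)) isQuotientMap_quot_mk
      (isSmoothQuotientMap_orbitMk_fixedPoints hiso hA hB hc) (orbitMk_normalizer_eq_iff hiso)
    exact ⟨cs, h1, h2, Ψ, hΨ⟩
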